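/- Let $A$ be a simple unital C*-algebra, let $T_A$ be its (weak* compact, convex, possibly empty) set of tracial states, and let $\mathrm{Aff}(T_A)$ be the space of real-valued affine continuous functions on $T_A$. Let $\mathrm{App}(A)$ be the group of approximately inner automorphisms of $A$, i.e. the closure of the group of inner automorphisms $\mathrm{Ad}\,u$ ($u\in U(A)$) in $\mathrm{Aut}(A)$ for the topology of pointwise norm convergence. Let $D:K_0(A)\to \mathrm{Aff}(T_A)$ be the dimension map $D([p])(\tau)=\tau(p)$; traces are extended to matrices by $\tau((a_{ij}))=\sum_i\tau(a_{ii})$. An orderextension for $(K_1(A),K_0(A))$ is a pair $(E,R)$ of an exact sequence of abelian groups $0\to K_0(A)\xrightarrow{\iota}E\xrightarrow{q}K_1(A)\to 0$ and a homomorphism $R:E\to\mathrm{Aff}(T_A)$ with $R\circ\iota=D$. Two orderextensions $(E,R)$, $(E',R')$ are isomorphic if there is a group isomorphism $\varphi:E\to E'$ with $\varphi\circ\iota=\iota'$, $q'\circ\varphi=q$ and $R=R'\circ\varphi$. The sum of $(E,R)$ and $(E',R')$ is $E''=\{(x,y)\in E\oplus E' : q(x)=q'(y)\}/\{(\iota(a),-\iota'(a))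 : a\in K_0(A)\}$ with $\iota''(a)=[(\iota(a),0)]$, $q''([(x,y)])=q(x)$ and $R''([(x,y)])=R(x)+R'(y)$. With this addition the isomorphism classes of orderextensions form an abelian group $\mathrm{OExt}(K_1(A),K_0(A))$. For $\alpha\in\mathrm{App}(A)$ let $M_\alpha=\{x\in C([0,1],A) : \alpha(x(0))=x(1)\}$ be the mapping torus. Let $q_*:K_1(M_\alpha)\to K_1(A)$ be induced by $x\mapsto x(0)$, and let $\iota_*:K_0(A)\to K_1(M_\alpha)$ be the homomorphism sending the class of a projection $p\in M_n(A)$ to the class of the unitary $t\mapsto e^{2\pi i t}p+1-p$. Then: (a) For every $\alpha\in\mathrm{App}(A)$ there is exactly one group homomorphism $R_\alpha:K_1(M_\alpha)\to\mathrm{Aff}(T_A)$ (the rotation map) such that, for all $n$, all piecewise $C^1$ unitaries $u\in M_n(M_\alpha)$ and all $\tau\in T_A$, $$R_\alpha([u])(\tau)=\frac{1}{2\pi i}\int_0^1\tau(\dot u(t)u(t)^*)\,dt .$$ (b) For every $\alpha\in\mathrm{App}(A)$ the sequence $0\to K_0(A)\xrightarrow{\iota_*}K_1(M_\alpha)\xrightarrow{q_*}K_1(A)\to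 0$ is exact and $R_\alpha\circ\iota_*=D$, so that $(K_1(M_\alpha),R_\alpha)$ is an orderextension; and the map $$\tilde\eta_0:\mathrm{App}(A)\to\mathrm{OExt}(K_1(A),K_0(A)),\qquad \alpha\mapsto[(K_1(M_\alpha),R_\alpha)],$$ is a group homomorphism. -/

import Mathlib

section OrderExtensions

universe u w

variable {G₁ G₀ : Type u} {V : Type w} [AddCommGroup G₁] [AddCommGroup G₀] [AddCommGroup V]

/-- The sequence `0 → G₀ → E → G₁ → 0` with maps `ι`, `q` is exact and `R : E → V` satisfies
`R ∘ ι = D`. -/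
structure IsOrderExt (D : G₀ →+ V) {E : Type u} [AddCommGroup E]
    (ι : G₀ →+ E) (q : E →+ G₁) (R : E →+ V) : Prop where
  injective : Function.Injective ι
  exact : ∀ x : E, q x = 0 ↔ ∃ a, ι a = x
  surjective : Function.Surjective q
  comp : ∀ a, R (ι a) = D a

/-- An orderextension `(E, R)` for `(G₁, G₀)` relative to the map `D : G₀ → V`. -/
structure OrderExt (G₁ : Type u) {G₀ : Type u} {V : Type w} [AddCommGroup G₁] [AddCommGroup G₀]
    [AddCommGroup V] (D : G₀ →+ V) where
  E : Type u
  [grp : AddCommGroup E]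
  ι : G₀ →+ E
  q : E →+ G₁
  R : E →+ V
  isOrderExt : IsOrderExt D ι q R

attribute [instance] OrderExt.grp

namespace OrderExt

variable {D : G₀ →+ V}

/-- Isomorphism of orderextensions. -/
def Iso (X Y : OrderExt G₁ D) : Prop :=
  ∃ φ : X.E ≃+ Y.E, (∀ x, X.R x = Y.R (φ x)) ∧ (∀ a, φ (X.ι a) = Y.ι a) ∧
    ∀ x, Y.q (φ x) = X.q x

theorem Iso.refl (X : OrderExt G₁ D) : Iso X X :=
  ⟨AddEquiv.refl _, fun _ => rfl, fun _ => rfl, fun _ => rfl⟩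

theorem Iso.symm {X Y : OrderExt G₁ D} : Iso X Y → Iso Y X := by
  rintro ⟨φ, h1, h2, h3⟩
  refine ⟨φ.symm, fun y => ?_, fun a => ?_, fun y => ?_⟩
  · rw [h1, φ.apply_symm_apply]
  · rw [← h2, φ.symm_apply_apply]
  · rw [← h3, φ.apply_symm_apply]

theorem Iso.trans {X Y Z : OrderExt G₁ D} : Iso X Y → Iso Y Z → Iso X Z := by
  rintro ⟨φ, h1, h2, h3⟩ ⟨ψ, k1, k2, k3⟩
  exact ⟨φ.trans ψ, fun x => by simp [h1, k1], fun a => by simp [h2, k2],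
    fun x => by simp [h3, k3]⟩

theorem q_ι (X : OrderExt G₁ D) (a : G₀) : X.q (X.ι a) = 0 :=
  (X.isOrderExt.exact _).2 ⟨a, rfl⟩

theorem R_ι (X : OrderExt G₁ D) (a : G₀) : X.R (X.ι a) = D a := X.isOrderExt.comp a

/-- A homomorphism compatible with all the structure is an isomorphism (short five lemma). -/
theorem iso_of_hom {X Y : OrderExt G₁ D} (φ : X.E →+ Y.E) (h1 : ∀ x, X.R x = Y.R (φ x))
    (h2 : ∀ a, φ (X.ι a) = Y.ι a) (h3 : ∀ x, Y.q (φ x) = X.q x) : Iso X Y := by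
  have hinj : Function.Injective φ := by
    rw [injective_iff_map_eq_zero]
    intro x hx
    have hq : X.q x = 0 := by rw [← h3, hx, map_zero]
    obtain ⟨a, rfl⟩ := (X.isOrderExt.exact x).1 hq
    rw [h2] at hx
    have : a = 0 := Y.isOrderExt.injective (by rw [hx, map_zero])
    rw [this, map_zero]
  have hsurj : Function.Surjective φ := by
    intro y
    obtain ⟨x, hx⟩ := X.isOrderExt.surjective (Y.q y)
    have : Y.q (y - φ x) = 0 := by rw [map_sub, h3, hx, sub_self]
    obtain ⟨a, ha⟩ := (Y.isOrderExt.exact _).1 this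
    exact ⟨X.ι a + x, by rw [map_add, h2, ha]; abel⟩
  exact ⟨AddEquiv.ofBijective φ ⟨hinj, hsurj⟩, h1, h2, h3⟩

/-- To give an isomorphism it is enough to give a common cover. -/
theorem iso_of_cover {X Y : OrderExt G₁ D} {T : Type u} [AddCommGroup T] (f : T →+ X.E)
    (g : T →+ Y.E) (hf : Function.Surjective f) (hker : ∀ t, f t = 0 → g t = 0)
    (h1 : ∀ t, X.R (f t) = Y.R (g t)) (h2 : ∀ a, ∃ t, f t = X.ι a ∧ g t = Y.ι a)
    (h3 : ∀ t, Y.q (g t) = X.q (f t)) : Iso X Y := by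
  have key : ∀ t, f.liftOfSurjective hf ⟨g, fun t ht => hker t ht⟩ (f t) = g t := fun t =>
    AddMonoidHom.liftOfRightInverse_comp_apply f _ _ ⟨g, _⟩ t
  refine iso_of_hom (f.liftOfSurjective hf ⟨g, fun t ht => hker t ht⟩) ?_ ?_ ?_
  · intro x
    obtain ⟨t, rfl⟩ := hf x
    rw [key, h1]
  · intro a
    obtain ⟨t, ht, ht'⟩ := h2 a
    rw [← ht, key, ht']
  · intro x
    obtain ⟨t, rfl⟩ := hf x
    rw [key, h3]

section Add

variable (X Y : OrderExt G₁ D)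

/-- `{(x, y) ∈ E ⊕ E' | q x = q' y}`. -/
def pullback : AddSubgroup (X.E × Y.E) where
  carrier := {z | X.q z.1 = Y.q z.2}
  zero_mem' := by simp
  add_mem' := by
    intro a b ha hb
    simp only [Set.mem_ofPred_eq, Prod.fst_add, Prod.snd_add, map_add] at *
    rw [ha, hb]
  neg_mem' := by
    intro a ha
    simp only [Set.mem_ofPred_eq, Prod.fst_neg, Prod.snd_neg, map_neg] at *
    rw [ha]

theorem mem_pullback {x : X.E} {y : Y.E} : (x, y) ∈ pullback X Y ↔ X.q x = Y.q y := Iff.rfl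

theorem antidiag_mem (a : G₀) : (X.ι a, -Y.ι a) ∈ pullback X Y := by
  rw [mem_pullback, map_neg, q_ι, q_ι, neg_zero]

theorem inl_mem (a : G₀) : (X.ι a, (0 : Y.E)) ∈ pullback X Y := by
  rw [mem_pullback, q_ι, map_zero]

/-- The homomorphism `a ↦ (ι a, -ι' a)`. -/
def antidiag : G₀ →+ pullback X Y where
  toFun a := ⟨(X.ι a, -Y.ι a), antidiag_mem X Y a⟩
  map_zero' := Subtype.ext (Prod.ext (map_zero X.ι) (by simp))
  map_add' a b := Subtype.ext (Prod.ext (map_add X.ι a b) (by simp [add_comm]))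

/-- `{(x, y) ∈ E ⊕ E' | q x = q' y} / {(ι a, -ι' a) | a ∈ G₀}`. -/
abbrev SumCarrier : Type u := pullback X Y ⧸ (antidiag X Y).range

/-- The class of `(x, y)`. -/
def pairHom : pullback X Y →+ SumCarrier X Y := QuotientAddGroup.mk' _

theorem pairHom_surjective : Function.Surjective (pairHom X Y) :=
  QuotientAddGroup.mk'_surjective _

theorem pairHom_eq_zero {z : pullback X Y} :
    pairHom X Y z = 0 ↔ ∃ a, X.ι a = z.1.1 ∧ -Y.ι a = z.1.2 := by
  rw [pairHom, QuotientAddGroup.mk'_apply, QuotientAddGroup.eq_zero_iff]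
  constructor
  · rintro ⟨a, rfl⟩
    exact ⟨a, rfl, rfl⟩
  · rintro ⟨a, h1, h2⟩
    exact ⟨a, Subtype.ext (Prod.ext h1 h2)⟩

/-- The inclusion `a ↦ [(ι a, 0)]`. -/
def sumι : G₀ →+ SumCarrier X Y :=
  (pairHom X Y).comp
    { toFun := fun a => ⟨(X.ι a, 0), inl_mem _ _ a⟩
      map_zero' := Subtype.ext (Prod.ext (map_zero X.ι) rfl)
      map_add' := fun a b => Subtype.ext (Prod.ext (map_add X.ι a b) (add_zero 0).symm) }

/-- The quotient map `[(x, y)] ↦ q x`. -/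
def sumq : SumCarrier X Y →+ G₁ :=
  QuotientAddGroup.lift _
    { toFun := fun z : pullback X Y => X.q z.1.1
      map_zero' := by simp
      map_add' := fun a b => by simp }
    (by rintro _ ⟨a, rfl⟩; exact q_ι X a)

/-- The map `[(x, y)] ↦ R x + R' y`. -/
def sumR : SumCarrier X Y →+ V :=
  QuotientAddGroup.lift _
    { toFun := fun z : pullback X Y => X.R z.1.1 + Y.R z.1.2
      map_zero' := by simp
      map_add' := fun a b => by simp; abel }
    (by
      rintro _ ⟨a, rfl⟩
      change X.R (X.ι a) + Y.R (-Y.ι a) = 0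
      rw [map_neg, R_ι, R_ι, add_neg_cancel])

theorem sumι_apply (a : G₀) :
    sumι X Y a = pairHom X Y ⟨(X.ι a, 0), inl_mem _ _ a⟩ := rfl

theorem sumq_pairHom (z : pullback X Y) : sumq X Y (pairHom X Y z) = X.q z.1.1 := rfl

theorem sumR_pairHom (z : pullback X Y) :
    sumR X Y (pairHom X Y z) = X.R z.1.1 + Y.R z.1.2 := rfl

theorem sum_isOrderExt : IsOrderExt D (sumι X Y) (sumq X Y) (sumR X Y) where
  injective := by
    rw [injective_iff_map_eq_zero]
    intro a ha
    rw [sumι_apply, pairHom_eq_zero] at ha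
    obtain ⟨b, h1, h2⟩ := ha
    have hb : b = 0 := Y.isOrderExt.injective (by simpa using h2)
    subst hb
    exact X.isOrderExt.injective (by simpa using h1.symm)
  exact := by
    intro x
    obtain ⟨z, rfl⟩ := pairHom_surjective X Y x
    rw [sumq_pairHom]
    constructor
    · intro h
      have h' : Y.q z.1.2 = 0 := by rw [← h]; exact z.2.symm
      obtain ⟨a, ha⟩ := (X.isOrderExt.exact _).1 h
      obtain ⟨b, hb⟩ := (Y.isOrderExt.exact _).1 h'
      refine ⟨a + b, ?_⟩
      rw [sumι_apply, ← sub_eq_zero, ← map_sub, pairHom_eq_zero]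
      exact ⟨b, by simp [← ha], by simp [← hb]⟩
    · rintro ⟨a, ha⟩
      rw [← sumq_pairHom, ← ha, sumι_apply, sumq_pairHom, q_ι]
  surjective := by
    intro g
    obtain ⟨x, hx⟩ := X.isOrderExt.surjective g
    obtain ⟨y, hy⟩ := Y.isOrderExt.surjective g
    exact ⟨pairHom X Y ⟨(x, y), hx.trans hy.symm⟩, hx⟩
  comp := by
    intro a
    rw [sumι_apply, sumR_pairHom]
    simp [R_ι]

/-- The sum `(E'', R'')` of two orderextensions. -/
abbrev sum : OrderExt G₁ D where
  E := SumCarrier X Y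
  ι := sumι X Y
  q := sumq X Y
  R := sumR X Y
  isOrderExt := sum_isOrderExt X Y

end Add

/-- The trivial orderextension `G₀ ⊕ G₁` with `R₀ (a, b) = D a`. -/
abbrev triv (D : G₀ →+ V) : OrderExt G₁ D where
  E := G₀ × G₁
  ι := AddMonoidHom.inl G₀ G₁
  q := AddMonoidHom.snd G₀ G₁
  R := D.comp (AddMonoidHom.fst G₀ G₁)
  isOrderExt :=
    { injective := fun a b h => congrArg Prod.fst h
      exact := fun x => ⟨fun h => ⟨x.1, Prod.ext rfl h.symm⟩, by rintro ⟨a, rfl⟩; rfl⟩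
      surjective := fun g => ⟨(0, g), rfl⟩
      comp := fun _ => rfl }

/-- The inverse orderextension `(E, -R)` with inclusion `-ι`. -/
abbrev opp (X : OrderExt G₁ D) : OrderExt G₁ D where
  E := X.E
  ι := -X.ι
  q := X.q
  R := -X.R
  isOrderExt :=
    { injective := fun a b h => X.isOrderExt.injective (neg_injective h)
      exact := fun x => (X.isOrderExt.exact x).trans
        ⟨fun ⟨a, h⟩ => ⟨-a, by simp [h]⟩, fun ⟨a, h⟩ => ⟨-a, by simpa using h⟩⟩
      surjective := X.isOrderExt.surjective
      comp := fun a => by simp [R_ι] }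

theorem sum_congr {X X' Y Y' : OrderExt G₁ D} (hX : Iso X X') (hY : Iso Y Y') :
    Iso (sum X Y) (sum X' Y') := by
  obtain ⟨φ, h1, h2, h3⟩ := hX
  obtain ⟨ψ, k1, k2, k3⟩ := hY
  let g : pullback X Y →+ pullback X' Y' :=
    { toFun := fun z => ⟨(φ z.1.1, ψ z.1.2), by
        rw [mem_pullback, h3, k3]; exact z.2⟩
      map_zero' := Subtype.ext (Prod.ext (map_zero φ) (map_zero ψ))
      map_add' := fun a b => Subtype.ext (Prod.ext (map_add φ _ _) (map_add ψ _ _)) }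
  refine iso_of_cover (X := sum X Y) (Y := sum X' Y') (pairHom X Y) ((pairHom X' Y').comp g)
    (pairHom_surjective X Y) ?_ ?_ ?_ ?_
  · intro t ht
    obtain ⟨a, ha, hb⟩ := (pairHom_eq_zero X Y).1 ht
    refine (pairHom_eq_zero X' Y').2 ⟨a, ?_, ?_⟩
    · rw [← h2, ha]; rfl
    · rw [← k2, ← map_neg, hb]; rfl
  · intro t
    change X.R t.1.1 + Y.R t.1.2 = X'.R (φ t.1.1) + Y'.R (ψ t.1.2)
    rw [h1, k1]
  · intro a
    refine ⟨⟨(X.ι a, 0), inl_mem _ _ a⟩, rfl, ?_⟩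
    exact congrArg (pairHom X' Y') (Subtype.ext (Prod.ext (h2 a) (map_zero ψ)))
  · intro t
    exact h3 t.1.1

theorem opp_congr {X Y : OrderExt G₁ D} (h : Iso X Y) : Iso (opp X) (opp Y) := by
  obtain ⟨φ, h1, h2, h3⟩ := h
  refine ⟨φ, fun x => ?_, fun a => ?_, h3⟩
  · change -X.R x = -Y.R (φ x)
    rw [h1]
  · change φ (-X.ι a) = -Y.ι a
    rw [map_neg, h2]

theorem sum_comm (X Y : OrderExt G₁ D) : Iso (sum X Y) (sum Y X) := by
  let g : pullback X Y →+ pullback Y X :=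
    { toFun := fun z => ⟨(z.1.2, z.1.1), z.2.symm⟩
      map_zero' := rfl
      map_add' := fun a b => rfl }
  refine iso_of_cover (X := sum X Y) (Y := sum Y X) (pairHom X Y) ((pairHom Y X).comp g)
    (pairHom_surjective X Y) ?_ ?_ ?_ ?_
  · intro t ht
    obtain ⟨a, ha, hb⟩ := (pairHom_eq_zero X Y).1 ht
    refine (pairHom_eq_zero Y X).2 ⟨-a, ?_, ?_⟩
    · rw [map_neg, hb]; rfl
    · rw [map_neg, neg_neg, ha]; rfl
  · intro t
    exact add_comm _ _
  · intro a
    refine ⟨⟨(X.ι a, 0), inl_mem _ _ a⟩, rfl, ?_⟩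
    change pairHom Y X _ = pairHom Y X _
    rw [← sub_eq_zero, ← map_sub, pairHom_eq_zero]
    exact ⟨-a, by simp [g], by simp [g]⟩
  · intro t
    exact t.2.symm

theorem triv_sum (X : OrderExt G₁ D) : Iso (sum (triv D) X) X := by
  let g : pullback (triv D) X →+ X.E :=
    { toFun := fun z => X.ι z.1.1.1 + z.1.2
      map_zero' := by
        change X.ι 0 + 0 = 0
        simp
      map_add' := fun a b => by
        change X.ι (a.1.1.1 + b.1.1.1) + (a.1.2 + b.1.2) = _
        rw [map_add]; abel }
  refine iso_of_cover (X := sum (triv D) X) (Y := X) (pairHom _ _) g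
    (pairHom_surjective _ _) ?_ ?_ ?_ ?_
  · intro t ht
    obtain ⟨a, ha, hb⟩ := (pairHom_eq_zero _ _).1 ht
    change X.ι t.1.1.1 + t.1.2 = 0
    rw [← ha, ← hb]
    exact add_neg_cancel (X.ι a)
  · intro t
    change D t.1.1.1 + X.R t.1.2 = X.R (X.ι t.1.1.1 + t.1.2)
    rw [map_add, R_ι]
  · intro a
    refine ⟨⟨((a, 0), 0), (map_zero X.q).symm⟩, rfl, ?_⟩
    change X.ι a + 0 = X.ι a
    rw [add_zero]
  · intro t
    change X.q (X.ι t.1.1.1 + t.1.2) = (triv D).q t.1.1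
    rw [map_add, q_ι, zero_add]
    exact t.2.symm

theorem opp_sum (X : OrderExt G₁ D) : Iso (sum (opp X) X) (triv D) := by
  refine Iso.symm ?_
  -- the diagonal gives the splitting
  let f : G₀ × X.E →+ G₀ × G₁ := (AddMonoidHom.id G₀).prodMap X.q
  let g : G₀ × X.E →+ pullback (opp X) X :=
    { toFun := fun z => ⟨(z.2 - X.ι z.1, z.2), by
        change X.q (z.2 - X.ι z.1) = X.q z.2
        rw [map_sub, q_ι, sub_zero]⟩
      map_zero' := by
        apply Subtype.ext
        change ((0 : X.E) - X.ι 0, (0 : X.E)) = (0, 0)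
        rw [map_zero, sub_zero]
      map_add' := fun a b => by
        apply Subtype.ext
        change (a.2 + b.2 - X.ι (a.1 + b.1), a.2 + b.2) =
          (a.2 - X.ι a.1 + (b.2 - X.ι b.1), a.2 + b.2)
        rw [map_add]
        congr 1
        abel }
  refine iso_of_cover (X := triv D) (Y := sum (opp X) X) f ((pairHom _ _).comp g) ?_ ?_ ?_ ?_ ?_
  · rintro ⟨a, b⟩
    obtain ⟨x, hx⟩ := X.isOrderExt.surjective b
    exact ⟨(a, x), Prod.ext rfl hx⟩
  · rintro ⟨a, x⟩ h
    have h1 : a = 0 := congrArg Prod.fst h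
    have h2 : X.q x = 0 := congrArg Prod.snd h
    obtain ⟨b, rfl⟩ := (X.isOrderExt.exact _).1 h2
    subst h1
    refine (pairHom_eq_zero _ _).2 ⟨-b, ?_, ?_⟩
    · change -X.ι (-b) = X.ι b - X.ι 0
      simp
    · change -X.ι (-b) = X.ι b
      simp
  · rintro ⟨a, x⟩
    change D a = -X.R (x - X.ι a) + X.R x
    rw [map_sub, R_ι]; abel
  · intro a
    refine ⟨(a, 0), ?_, ?_⟩
    · change (a, X.q 0) = (a, 0)
      rw [map_zero]
    · change pairHom _ _ _ = pairHom _ _ _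
      congr 1
      apply Subtype.ext
      change ((0 : X.E) - X.ι a, (0 : X.E)) = (-X.ι a, 0)
      rw [zero_sub]
  · rintro ⟨a, x⟩
    change X.q (x - X.ι a) = X.q x
    rw [map_sub, q_ι, sub_zero]

/-- `{(x, y, z) | q x = q' y, q' y = q'' z}`. -/
def triple (X Y Z : OrderExt G₁ D) : AddSubgroup (X.E × Y.E × Z.E) where
  carrier := {z | X.q z.1 = Y.q z.2.1 ∧ Y.q z.2.1 = Z.q z.2.2}
  zero_mem' := by simp
  add_mem' := by
    intro a b ha hb
    simp only [Set.mem_ofPred_eq, Prod.fst_add, Prod.snd_add, map_add] at *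
    rw [ha.1, hb.1, ha.2, hb.2]
    exact ⟨rfl, rfl⟩
  neg_mem' := by
    intro a ha
    simp only [Set.mem_ofPred_eq, Prod.fst_neg, Prod.snd_neg, map_neg] at *
    rw [ha.1, ha.2]
    exact ⟨rfl, rfl⟩

theorem sum_assoc (X Y Z : OrderExt G₁ D) :
    Iso (sum (sum X Y) Z) (sum X (sum Y Z)) := by
  let f₁ : triple X Y Z →+ pullback X Y :=
    { toFun := fun t => ⟨(t.1.1, t.1.2.1), t.2.1⟩
      map_zero' := rfl
      map_add' := fun _ _ => rfl }
  let f : triple X Y Z →+ pullback (sum X Y) Z :=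
    { toFun := fun t => ⟨(pairHom X Y (f₁ t), t.1.2.2), t.2.1.trans t.2.2⟩
      map_zero' := rfl
      map_add' := fun _ _ => rfl }
  let g₁ : triple X Y Z →+ pullback Y Z :=
    { toFun := fun t => ⟨(t.1.2.1, t.1.2.2), t.2.2⟩
      map_zero' := rfl
      map_add' := fun _ _ => rfl }
  let g : triple X Y Z →+ pullback X (sum Y Z) :=
    { toFun := fun t => ⟨(t.1.1, pairHom Y Z (g₁ t)), t.2.1⟩
      map_zero' := rfl
      map_add' := fun _ _ => rfl }
  refine iso_of_cover (X := sum (sum X Y) Z) (Y := sum X (sum Y Z)) ((pairHom _ _).comp f)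
    ((pairHom _ _).comp g) ?_ ?_ ?_ ?_ ?_
  · intro s
    obtain ⟨⟨⟨s, z⟩, hs⟩, rfl⟩ := pairHom_surjective _ _ s
    obtain ⟨⟨⟨x, y⟩, hxy⟩, rfl⟩ := pairHom_surjective X Y s
    exact ⟨⟨(x, y, z), hxy, hxy.symm.trans hs⟩, rfl⟩
  · rintro ⟨⟨x, y, z⟩, hxy, hyz⟩ h
    obtain ⟨a, ha, hb⟩ := (pairHom_eq_zero _ _).1 h
    have ha' : pairHom X Y (f₁ ⟨(x, y, z), hxy, hyz⟩ -
        ⟨(X.ι a, 0), inl_mem _ _ a⟩) = 0 := by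
      rw [map_sub, sub_eq_zero]; exact ha.symm
    obtain ⟨b, h1, h2⟩ := (pairHom_eq_zero _ _).1 ha'
    change X.ι b = x - X.ι a at h1
    change -Y.ι b = y - 0 at h2
    change -Z.ι a = z at hb
    refine (pairHom_eq_zero _ _).2 ⟨a + b, ?_, ?_⟩
    · change X.ι (a + b) = x
      rw [map_add, h1]; abel
    · change -pairHom Y Z ⟨(Y.ι (a + b), 0), _⟩ = pairHom Y Z ⟨(y, z), _⟩
      rw [← sub_eq_zero, ← map_neg, ← map_sub, pairHom_eq_zero]
      refine ⟨-a, ?_, ?_⟩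
      · change Y.ι (-a) = -Y.ι (a + b) - y
        rw [sub_zero] at h2
        rw [← h2, map_add, map_neg]; abel
      · change -Z.ι (-a) = -0 - z
        rw [← hb, map_neg]; abel
  · rintro ⟨⟨x, y, z⟩, hxy, hyz⟩
    change X.R x + Y.R y + Z.R z = X.R x + (Y.R y + Z.R z)
    abel
  · intro a
    refine ⟨⟨(X.ι a, 0, 0), ?_, ?_⟩, rfl, rfl⟩
    · change X.q (X.ι a) = Y.q 0
      rw [q_ι, map_zero]
    · change Y.q 0 = Z.q 0
      rw [map_zero, map_zero]
  · intro t
    rfl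

instance setoid (G₁ : Type u) [AddCommGroup G₁] (D : G₀ →+ V) : Setoid (OrderExt G₁ D) where
  r := Iso
  iseqv := ⟨Iso.refl, Iso.symm, Iso.trans⟩

end OrderExt

/-- The group `OExt(G₁, G₀)` of isomorphism classes of orderextensions (relative to `D`). -/
def OExt (G₁ : Type u) [AddCommGroup G₁] (D : G₀ →+ V) : Type (max (u + 1) w) :=
  Quotient (OrderExt.setoid G₁ D)

namespace OExt

variable {D : G₀ →+ V}

/-- The class `[(E, R)]`. -/
def mk (X : OrderExt G₁ D) : OExt G₁ D := Quotient.mk _ X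

instance : Add (OExt G₁ D) :=
  ⟨Quotient.map₂ OrderExt.sum fun _ _ h _ _ k => OrderExt.sum_congr h k⟩

instance : Zero (OExt G₁ D) := ⟨mk (OrderExt.triv D)⟩

instance : Neg (OExt G₁ D) := ⟨Quotient.map OrderExt.opp fun _ _ h => OrderExt.opp_congr h⟩

instance : AddCommGroup (OExt G₁ D) where
  add_assoc := by
    rintro ⟨X⟩ ⟨Y⟩ ⟨Z⟩
    exact Quotient.sound (OrderExt.sum_assoc X Y Z)
  zero_add := by
    rintro ⟨X⟩
    exact Quotient.sound (OrderExt.triv_sum X)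
  add_zero := by
    rintro ⟨X⟩
    exact Quotient.sound ((OrderExt.sum_comm X _).trans (OrderExt.triv_sum X))
  add_comm := by
    rintro ⟨X⟩ ⟨Y⟩
    exact Quotient.sound (OrderExt.sum_comm X Y)
  neg_add_cancel := by
    rintro ⟨X⟩
    exact Quotient.sound (OrderExt.opp_sum X)
  nsmul := nsmulRec
  zsmul := zsmulRec

end OExt

end OrderExtensions

open scoped Matrix

section KOne

set_option linter.unusedSectionVars false

universe u

/-! ### Enlarging matrices -/

section Corner

variable {ι κ μ : Type*} [Fintype ι] [Fintype κ] [Fintype μ] [DecidableEq ι] [DecidableEq κ]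
  [DecidableEq μ] {B : Type u} [Ring B] [StarRing B]

/-- The `0`-`1` matrix of an injection of index sets. -/
def injMat (B : Type u) [Ring B] (f : ι ↪ κ) : Matrix κ ι B :=
  Matrix.of fun k i => if k = f i then 1 else 0

theorem injMat_apply (f : ι ↪ κ) (k : κ) (i : ι) :
    injMat B f k i = if k = f i then 1 else 0 := rfl

theorem conjTranspose_injMat_apply (f : ι ↪ κ) (k : κ) (i : ι) :
    (injMat B f)ᴴ i k = if k = f i then 1 else 0 := by
  rw [Matrix.conjTranspose_apply, injMat_apply]
  split_ifs <;> simp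

theorem injMat_conjTranspose_mul (f : ι ↪ κ) : (injMat B f)ᴴ * injMat B f = 1 := by
  ext i j
  rw [Matrix.mul_apply]
  simp [-Matrix.conjTranspose_apply, conjTranspose_injMat_apply, injMat_apply, Matrix.one_apply,
    eq_comm]

theorem injMat_conjTranspose_mul_of_disjoint (f : ι ↪ κ) (g : μ ↪ κ) (h : ∀ i j, f i ≠ g j) :
    (injMat B f)ᴴ * injMat B g = 0 := by
  ext i j
  rw [Matrix.mul_apply]
  simp [-Matrix.conjTranspose_apply, conjTranspose_injMat_apply, injMat_apply, (h i j).symm]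

theorem injMat_mul (f : ι ↪ κ) (g : κ ↪ μ) :
    injMat B g * injMat B f = injMat B (f.trans g) := by
  ext i j
  rw [Matrix.mul_apply]
  simp [injMat_apply]

/-- The corner embedding `x ↦ x ⊕ 0` along an injection of index sets. -/
def corner (f : ι ↪ κ) (x : Matrix ι ι B) : Matrix κ κ B :=
  injMat B f * x * (injMat B f)ᴴ

/-- The entries of `x ⊕ 0`. -/
theorem corner_apply_apply (f : ι ↪ κ) (x : Matrix ι ι B) (i j : ι) :
    corner f x (f i) (f j) = x i j := by
  simp [-Matrix.conjTranspose_apply, corner, Matrix.mul_apply, conjTranspose_injMat_apply, injMat_apply]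

theorem corner_apply_of_left (f : ι ↪ κ) (x : Matrix ι ι B) (k l : κ) (h : ∀ i, k ≠ f i) :
    corner f x k l = 0 := by
  simp [corner, Matrix.mul_apply, injMat_apply, h]

theorem corner_apply_of_right (f : ι ↪ κ) (x : Matrix ι ι B) (k l : κ) (h : ∀ i, l ≠ f i) :
    corner f x k l = 0 := by
  simp [-Matrix.conjTranspose_apply, corner, Matrix.mul_apply, conjTranspose_injMat_apply, h]

theorem corner_mul (f : ι ↪ κ) (x y : Matrix ι ι B) :
    corner f x * corner f y = corner f (x * y) := by
  simp only [corner]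
  calc injMat B f * x * (injMat B f)ᴴ * (injMat B f * y * (injMat B f)ᴴ)
      = injMat B f * x * ((injMat B f)ᴴ * injMat B f) * y * (injMat B f)ᴴ := by
        simp only [Matrix.mul_assoc]
    _ = _ := by rw [injMat_conjTranspose_mul, Matrix.mul_one]; simp only [Matrix.mul_assoc]

theorem corner_mul_of_disjoint (f : ι ↪ κ) (g : μ ↪ κ) (h : ∀ i j, f i ≠ g j)
    (x : Matrix ι ι B) (y : Matrix μ μ B) : corner f x * corner g y = 0 := by
  simp only [corner]
  calc injMat B f * x * (injMat B f)ᴴ * (injMat B g * y * (injMat B g)ᴴ)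
      = injMat B f * x * ((injMat B f)ᴴ * injMat B g) * y * (injMat B g)ᴴ := by
        simp only [Matrix.mul_assoc]
    _ = _ := by rw [injMat_conjTranspose_mul_of_disjoint f g h]; simp

theorem corner_add (f : ι ↪ κ) (x y : Matrix ι ι B) :
    corner f (x + y) = corner f x + corner f y := by
  simp [corner, Matrix.mul_add, Matrix.add_mul]

theorem corner_zero (f : ι ↪ κ) : corner f (0 : Matrix ι ι B) = 0 := by
  simp [corner]

theorem corner_star (f : ι ↪ κ) (x : Matrix ι ι B) :
    star (corner f x) = corner f (star x) := by
  simp [corner, Matrix.star_eq_conjTranspose, Matrix.mul_assoc]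

theorem corner_trans (f : ι ↪ κ) (g : κ ↪ μ) (x : Matrix ι ι B) :
    corner g (corner f x) = corner (f.trans g) x := by
  simp only [corner, ← injMat_mul, Matrix.conjTranspose_mul, Matrix.mul_assoc]

theorem injMat_refl : injMat B (Function.Embedding.refl ι) = 1 := by
  ext i j
  simp [injMat_apply, Matrix.one_apply]

theorem corner_refl (x : Matrix ι ι B) : corner (Function.Embedding.refl ι) x = x := by
  simp [corner, injMat_refl]

theorem corner_sub (f : ι ↪ κ) (x y : Matrix ι ι B) :
    corner f (x - y) = corner f x - corner f y := by
  simp [corner, Matrix.mul_sub, Matrix.sub_mul]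

/-- `u ↦ u ⊕ 1` along an injection of index sets, as a map of matrices. -/
def stabMat (f : ι ↪ κ) (u : Matrix ι ι B) : Matrix κ κ B := 1 + corner f (u - 1)

theorem stabMat_one (f : ι ↪ κ) : stabMat f (1 : Matrix ι ι B) = 1 := by
  simp [stabMat, corner_zero]

theorem stabMat_mul (f : ι ↪ κ) (u v : Matrix ι ι B) :
    stabMat f (u * v) = stabMat f u * stabMat f v := by
  simp only [stabMat]
  have h : u * v - 1 = (u - 1) + (v - 1) + (u - 1) * (v - 1) := by noncomm_ring
  rw [h, corner_add, corner_add, ← corner_mul]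
  noncomm_ring

theorem stabMat_star (f : ι ↪ κ) (u : Matrix ι ι B) :
    star (stabMat f u) = stabMat f (star u) := by
  simp [stabMat, corner_star]

theorem stabMat_trans (f : ι ↪ κ) (g : κ ↪ μ) (u : Matrix ι ι B) :
    stabMat g (stabMat f u) = stabMat (f.trans g) u := by
  simp [stabMat, corner_trans]

theorem stabMat_refl (u : Matrix ι ι B) : stabMat (Function.Embedding.refl ι) u = u := by
  simp [stabMat, corner_refl]

/-- `u ↦ u ⊕ 1` as a homomorphism of unitary groups. -/
def stab (f : ι ↪ κ) : unitary (Matrix ι ι B) →* unitary (Matrix κ κ B) where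
  toFun u := ⟨stabMat f u.1, by
    rw [Unitary.mem_iff, stabMat_star, ← stabMat_mul, ← stabMat_mul]
    rw [(Unitary.mem_iff.1 u.2).1, (Unitary.mem_iff.1 u.2).2, stabMat_one]
    exact ⟨rfl, rfl⟩⟩
  map_one' := Subtype.ext (stabMat_one f)
  map_mul' u v := Subtype.ext (stabMat_mul f u.1 v.1)

theorem stab_coe (f : ι ↪ κ) (u : unitary (Matrix ι ι B)) :
    (stab f u : Matrix κ κ B) = 1 + corner f ((u : Matrix ι ι B) - 1) := rfl

theorem stab_trans (f : ι ↪ κ) (g : κ ↪ μ) (u : unitary (Matrix ι ι B)) :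
    stab g (stab f u) = stab (f.trans g) u := Subtype.ext (stabMat_trans f g u.1)

theorem stab_refl (u : unitary (Matrix ι ι B)) : stab (Function.Embedding.refl ι) u = u :=
  Subtype.ext (stabMat_refl u.1)

theorem stab_comm_of_disjoint (f : ι ↪ κ) (g : μ ↪ κ) (h : ∀ i j, f i ≠ g j)
    (u : unitary (Matrix ι ι B)) (v : unitary (Matrix μ μ B)) :
    stab f u * stab g v = stab g v * stab f u := by
  apply Subtype.ext
  change (stab f u : Matrix κ κ B) * (stab g v : Matrix κ κ B) =
    (stab g v : Matrix κ κ B) * (stab f u : Matrix κ κ B)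
  rw [stab_coe, stab_coe]
  simp only [mul_add, add_mul, corner_mul_of_disjoint f g h,
    corner_mul_of_disjoint g f (fun i j => (h j i).symm), mul_one, one_mul, add_zero]
  abel

end Corner

/-! ### The group `K₁` -/

section Def

variable (B : Type u) [Ring B] [StarRing B] [TopologicalSpace B] [IsTopologicalRing B]
  [ContinuousStar B]

/-- The unitary group `U_n(B)` of `M_n(B)`, with the topology of entrywise convergence (for a
C*-algebra `B` this is the norm topology of `M_n(B)`). -/
abbrev UMat (n : ℕ) : Type u := unitary (Matrix (Fin n) (Fin n) B)

variable {B} in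
theorem continuous_stab {n m : ℕ} (f : Fin n ↪ Fin m) :
    Continuous (stab f : UMat B n →* UMat B m) := by
  refine Continuous.subtype_mk ?_ _
  unfold stabMat corner
  fun_prop

/-- `π₀(U_n(B))`: the quotient of `U_n(B)` by the path component of `1`. -/
abbrev UMatPi0 (n : ℕ) : Type u := UMat B n ⧸ Subgroup.pathComponentOne (UMat B n)

variable {B} in
/-- A continuous homomorphism induces a homomorphism of groups of path components. -/
def pi0Map {G H : Type*} [Group G] [TopologicalSpace G] [IsTopologicalGroup G] [Group H]
    [TopologicalSpace H] [IsTopologicalGroup H] (φ : G →* H) (hφ : Continuous φ) :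
    G ⧸ Subgroup.pathComponentOne G →* H ⧸ Subgroup.pathComponentOne H :=
  QuotientGroup.map _ _ φ (by
    intro x hx
    have hx' : Joined 1 x := hx
    have h := hx'.map hφ
    rw [map_one] at h
    exact h)

/-- The connecting map `π₀(U_n(B)) → π₀(U_m(B))` induced by `u ↦ u ⊕ 1`. -/
def UMatPi0.trans (n m : ℕ) (h : n ≤ m) : UMatPi0 B n →* UMatPi0 B m :=
  pi0Map (stab (Fin.castLEEmb h)) (continuous_stab _)

instance : DirectedSystem (UMatPi0 B) (fun n m h => UMatPi0.trans B n m h) where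
  map_self := by
    rintro n ⟨x⟩
    exact congrArg (QuotientGroup.mk) (stab_refl x)
  map_map := by
    rintro k j i hij hjk ⟨x⟩
    exact congrArg (QuotientGroup.mk) (stab_trans _ _ x)

/-- The multiplicative form of `K₁(B)`: the direct limit of the groups `π₀(U_n(B))` under
`u ↦ u ⊕ 1`. -/
abbrev KOneMul : Type u := DirectLimit (UMatPi0 B) (fun n m h => UMatPi0.trans B n m h)

/-- `K₁(B) = lim π₀(U_n(B))`, written additively. -/
def K1 : Type u := Additive (KOneMul B)

noncomputable instance : AddGroup (K1 B) := inferInstanceAs (AddGroup (Additive (KOneMul B)))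

variable {B}

/-- The class `[u] ∈ K₁(B)` of a unitary `u ∈ M_n(B)`. -/
def K1.mk {n : ℕ} (u : UMat B n) : K1 B :=
  Additive.ofMul (⟦⟨n, QuotientGroup.mk u⟩⟧ : KOneMul B)

theorem K1.mk_mul {n : ℕ} (u v : UMat B n) : K1.mk (u * v) = K1.mk u + K1.mk v :=
  congrArg Additive.ofMul (DirectLimit.mul_def (f := fun n m h => UMatPi0.trans B n m h) n
    (QuotientGroup.mk u : UMatPi0 B n) (QuotientGroup.mk v : UMatPi0 B n)).symm

theorem K1.mk_one {n : ℕ} : K1.mk (1 : UMat B n) = 0 :=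
  congrArg Additive.ofMul
    (DirectLimit.one_def (f := fun n m h => UMatPi0.trans B n m h) n).symm

theorem K1.mk_eq_of_joined {n : ℕ} {u v : UMat B n} (h : Joined u v) : K1.mk u = K1.mk v := by
  have h' : (QuotientGroup.mk u : UMatPi0 B n) = QuotientGroup.mk v := by
    rw [QuotientGroup.eq]
    have h2 := h.map (f := fun x => u⁻¹ * x) (by fun_prop)
    have h3 : Joined 1 (u⁻¹ * v) := by simpa using h2
    exact h3
  rw [K1.mk, K1.mk, h']

theorem K1.mk_stab_castLE {n m : ℕ} (h : n ≤ m) (u : UMat B n) :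
    K1.mk (stab (Fin.castLEEmb h) u) = K1.mk u := by
  refine congrArg Additive.ofMul (Quotient.sound ?_)
  refine ⟨m, le_rfl, h, ?_⟩
  exact congrArg (QuotientGroup.mk) (stab_refl _)

theorem K1.ind {p : K1 B → Prop} (h : ∀ (n : ℕ) (u : UMat B n), p (K1.mk u)) (x : K1 B) : p x := by
  obtain ⟨⟨n, ⟨u⟩⟩⟩ := x
  exact h n u

/-- Two classes `[u]`, `[v]` agree iff `u ⊕ 1` and `v ⊕ 1` are homotopic in some `U_k(B)`. -/
theorem K1.mk_eq_iff {n m : ℕ} (u : UMat B n) (v : UMat B m) :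
    K1.mk u = K1.mk v ↔ ∃ (k : ℕ) (hn : n ≤ k) (hm : m ≤ k),
      Joined (stab (Fin.castLEEmb hn) u) (stab (Fin.castLEEmb hm) v) := by
  constructor
  · intro h
    obtain ⟨k, hn, hm, hk⟩ := Quotient.exact (Additive.ofMul.injective h)
    refine ⟨k, hn, hm, ?_⟩
    have h2 := QuotientGroup.eq.1 hk
    have h3 : Joined 1 ((stab (Fin.castLEEmb hn) u)⁻¹ * stab (Fin.castLEEmb hm) v) := h2
    have := h3.map (f := fun x => stab (Fin.castLEEmb hn) u * x) (by fun_prop)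
    simpa using this
  · rintro ⟨k, hn, hm, h⟩
    rw [← K1.mk_stab_castLE hn u, ← K1.mk_stab_castLE hm v]
    exact K1.mk_eq_of_joined h

end Def

section Comm

variable {B : Type u} [Ring B] [StarRing B] [TopologicalSpace B] [IsTopologicalRing B]
  [ContinuousStar B] [Algebra ℂ B] [StarModule ℂ B] [ContinuousSMul ℂ B]

/-- The path `(1 + w)/2 + e^{iπs} (1 - w)/2` from `1` to the selfadjoint unitary `w`. -/
noncomputable def symmPath {k : ℕ} (w : Matrix (Fin k) (Fin k) B) (s : ℝ) :
    Matrix (Fin k) (Fin k) B :=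
  (1 / 2 : ℂ) • (1 + w) + (Complex.exp (Real.pi * s * Complex.I) / 2) • (1 - w)

theorem symmPath_zero {k : ℕ} (w : Matrix (Fin k) (Fin k) B) : symmPath w 0 = 1 := by
  simp only [symmPath, Complex.ofReal_zero, mul_zero, zero_mul, Complex.exp_zero]
  module

theorem symmPath_one {k : ℕ} (w : Matrix (Fin k) (Fin k) B) : symmPath w 1 = w := by
  simp only [symmPath, Complex.ofReal_one, mul_one, Complex.exp_pi_mul_I]
  module

theorem continuous_symmPath {k : ℕ} (w : Matrix (Fin k) (Fin k) B) : Continuous (symmPath w) := by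
  unfold symmPath
  fun_prop

theorem symmPath_mem {k : ℕ} {w : Matrix (Fin k) (Fin k) B} (h1 : star w = w) (h2 : w * w = 1)
    (s : ℝ) : symmPath w s ∈ unitary (Matrix (Fin k) (Fin k) B) := by
  have e1 : star (Complex.exp (Real.pi * s * Complex.I)) =
      Complex.exp (-(Real.pi * s * Complex.I)) := by
    rw [Complex.star_def, ← Complex.exp_conj]
    simp
  have e2 : Complex.exp (-(Real.pi * s * Complex.I)) * Complex.exp (Real.pi * s * Complex.I) = 1 := by
    rw [← Complex.exp_add]; simp
  have e3 : star (symmPath w s) = (1 / 2 : ℂ) • (1 + w) +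
      (Complex.exp (-(Real.pi * s * Complex.I)) / 2) • (1 - w) := by
    simp only [symmPath, star_add, star_smul, star_sub, star_one, h1, star_div₀, e1]
    simp
  have f1 : (1 + w) * (1 + w) = (2 : ℂ) • (1 + w) := by
    simp only [mul_add, add_mul, h2, mul_one, one_mul]; module
  have f2 : (1 - w) * (1 - w) = (2 : ℂ) • (1 - w) := by
    simp only [mul_sub, sub_mul, h2, mul_one, one_mul]; module
  have f3 : (1 + w) * (1 - w) = 0 := by
    simp only [mul_sub, add_mul, h2, mul_one, one_mul]; abel
  have f4 : (1 - w) * (1 + w) = 0 := by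
    simp only [mul_add, sub_mul, h2, mul_one, one_mul]; abel
  have key : ∀ c d : ℂ, c * d = 1 →
      ((1 / 2 : ℂ) • (1 + w) + (c / 2) • (1 - w)) * ((1 / 2 : ℂ) • (1 + w) + (d / 2) • (1 - w)) =
        1 := by
    intro c d hcd
    rw [mul_add, add_mul, add_mul, smul_mul_smul_comm, smul_mul_smul_comm, smul_mul_smul_comm,
      smul_mul_smul_comm, f1, f2, f3, f4, smul_zero, smul_zero, add_zero, zero_add, smul_smul,
      smul_smul]
    have : c / 2 * (d / 2) * 2 = 1 / 2 := by linear_combination (1 / 2 : ℂ) * hcd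
    rw [this]
    module
  rw [Unitary.mem_iff, e3]
  exact ⟨key _ _ e2, key _ _ (by rw [mul_comm]; exact e2)⟩

/-- The selfadjoint unitary exchanging the ranges of the partial isometry `v` (with `v² = 0`). -/
def swapSymm {k : ℕ} (v : Matrix (Fin k) (Fin k) B) : Matrix (Fin k) (Fin k) B :=
  v + star v + (1 - star v * v - v * star v)

section Swap

variable {k : ℕ} {v : Matrix (Fin k) (Fin k) B}

theorem star_swap_aux (h1 : v * star v * v = v) : star v * v * star v = star v := by
  have := congrArg star h1
  simpa [mul_assoc] using this

theorem star_swap_sq (h2 : v * v = 0) : star v * star v = 0 := by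
  have := congrArg star h2
  simpa using this

theorem swapSymm_star : star (swapSymm v) = swapSymm v := by
  simp only [swapSymm, star_add, star_sub, star_mul, star_star, star_one]
  abel

theorem swapSymm_mul_star (h1 : v * star v * v = v) (h2 : v * v = 0) :
    swapSymm v * (star v * v) = v := by
  have h3 := star_swap_sq h2
  simp only [swapSymm, add_mul, sub_mul, one_mul]
  have a1 : v * (star v * v) = v := by rw [← mul_assoc, h1]
  have a2 : star v * (star v * v) = 0 := by rw [← mul_assoc, h3, zero_mul]
  have a3 : star v * v * (star v * v) = star v * v := by rw [mul_assoc, a1]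
  have a4 : v * star v * (star v * v) = 0 := by rw [mul_assoc, a2, mul_zero]
  rw [a1, a2, a3, a4]
  abel

theorem swapSymm_conj (h1 : v * star v * v = v) (h2 : v * v = 0) :
    swapSymm v * (star v * v) * swapSymm v = v * star v := by
  have h4 := star_swap_aux h1
  rw [swapSymm_mul_star h1 h2]
  simp only [swapSymm, mul_add, mul_sub, mul_one]
  have a1 : v * (star v * v) = v := by rw [← mul_assoc, h1]
  have a2 : v * (v * star v) = 0 := by rw [← mul_assoc, h2, zero_mul]
  rw [h2, a1, a2]
  abel

theorem swapSymm_sq (h1 : v * star v * v = v) (h2 : v * v = 0) :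
    swapSymm v * swapSymm v = 1 := by
  have h3 := star_swap_sq h2
  have h4 := star_swap_aux h1
  have a1 : v * (star v * v) = v := by rw [← mul_assoc, h1]
  have a2 : star v * (star v * v) = 0 := by rw [← mul_assoc, h3, zero_mul]
  have a5 : star v * (v * star v) = star v := by rw [← mul_assoc, h4]
  have a6 : v * (v * star v) = 0 := by rw [← mul_assoc, h2, zero_mul]
  simp only [swapSymm, mul_add, mul_sub, add_mul, sub_mul, one_mul, mul_one, mul_assoc, h2, h3,
    a1, a2, a5, a6, mul_zero]
  abel

end Swap

theorem joined_conj_of_symm {k : ℕ} (w : Matrix (Fin k) (Fin k) B) (h1 : star w = w)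
    (h2 : w * w = 1) (u u' : UMat B k)
    (h : w * (u : Matrix (Fin k) (Fin k) B) * w = (u' : Matrix (Fin k) (Fin k) B)) :
    Joined u u' := by
  let W : ℝ → UMat B k := fun s => ⟨symmPath w s, symmPath_mem h1 h2 s⟩
  have hW : Continuous W := (continuous_symmPath w).subtype_mk _
  have hj : Joined (0 : ℝ) 1 := PathConnectedSpace.joined 0 1
  have := hj.map (f := fun s => W s * u * (W s)⁻¹) (by fun_prop)
  have e0 : W 0 = 1 := Subtype.ext (symmPath_zero w)
  have e1 : (W 1 : Matrix (Fin k) (Fin k) B) = w := symmPath_one w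
  have e2 : W 1 * u * (W 1)⁻¹ = u' := by
    apply Subtype.ext
    change (W 1 : Matrix (Fin k) (Fin k) B) * (u : Matrix (Fin k) (Fin k) B) *
      star (W 1 : Matrix (Fin k) (Fin k) B) = _
    rw [e1, h1, h]
  simp only [e0, e2] at this
  simpa using this

/-- Embeddings of `M_n` into complementary corners of `M_k` give homotopic unitaries. -/
theorem joined_stab_of_disjoint {n k : ℕ} (f g : Fin n ↪ Fin k) (hfg : ∀ i j, f i ≠ g j)
    (u : UMat B n) : Joined (stab f u) (stab g u) := by
  have d1 : (injMat B f)ᴴ * injMat B g = 0 := injMat_conjTranspose_mul_of_disjoint f g hfg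
  have d2 : (injMat B f)ᴴ * injMat B f = 1 := injMat_conjTranspose_mul f
  have d3 : (injMat B g)ᴴ * injMat B g = 1 := injMat_conjTranspose_mul g
  set v : Matrix (Fin k) (Fin k) B := injMat B g * (injMat B f)ᴴ with hv
  have hsv : star v = injMat B f * (injMat B g)ᴴ := by
    rw [hv, Matrix.star_eq_conjTranspose, Matrix.conjTranspose_mul,
      Matrix.conjTranspose_conjTranspose]
  have h1 : v * star v * v = v := by
    rw [hsv, hv]
    calc _ = injMat B g * ((injMat B f)ᴴ * injMat B f) * ((injMat B g)ᴴ * injMat B g) *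
          (injMat B f)ᴴ := by simp only [Matrix.mul_assoc]
      _ = _ := by rw [d2, d3, Matrix.mul_one, Matrix.mul_one]
  have h2 : v * v = 0 := by
    rw [hv]
    calc _ = injMat B g * ((injMat B f)ᴴ * injMat B g) * (injMat B f)ᴴ := by
          simp only [Matrix.mul_assoc]
      _ = _ := by rw [d1]; simp
  have hw := swapSymm_sq h1 h2
  have hs := swapSymm_star (v := v)
  have c1 : swapSymm v * injMat B f = injMat B g := by
    have e : (star v * v) * injMat B f = injMat B f := by
      rw [hsv, hv]
      calc _ = injMat B f * ((injMat B g)ᴴ * injMat B g) * ((injMat B f)ᴴ * injMat B f) := by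
            simp only [Matrix.mul_assoc]
        _ = _ := by rw [d2, d3, Matrix.mul_one, Matrix.mul_one]
    rw [← e, ← Matrix.mul_assoc, swapSymm_mul_star h1 h2, hv, Matrix.mul_assoc, d2,
      Matrix.mul_one]
  have c2 : (injMat B f)ᴴ * swapSymm v = (injMat B g)ᴴ := by
    have := congrArg Matrix.conjTranspose c1
    rw [Matrix.conjTranspose_mul] at this
    rw [← this, ← Matrix.star_eq_conjTranspose (swapSymm v), hs]
  refine joined_conj_of_symm (swapSymm v) hs hw _ _ ?_
  rw [stab_coe, stab_coe, mul_add, mul_one, add_mul, hw]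
  congr 1
  rw [corner, corner]
  calc swapSymm v * (injMat B f * ((u : Matrix (Fin n) (Fin n) B) - 1) * (injMat B f)ᴴ) *
        swapSymm v
      = (swapSymm v * injMat B f) * ((u : Matrix (Fin n) (Fin n) B) - 1) *
        ((injMat B f)ᴴ * swapSymm v) := by simp only [Matrix.mul_assoc]
    _ = _ := by rw [c1, c2]

theorem K1.mk_stab {n k : ℕ} (f : Fin n ↪ Fin k) (u : UMat B n) : K1.mk (stab f u) = K1.mk u := by
  have hk : k ≤ k + n := Nat.le_add_right k n
  have hn : n ≤ k := by simpa using Fintype.card_le_of_embedding f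
  rw [← K1.mk_stab_castLE hk (stab f u), ← K1.mk_stab_castLE (hn.trans hk) u, stab_trans]
  have hd : ∀ f' : Fin n ↪ Fin (k + n), (∀ i, (f' i : ℕ) < k) →
      K1.mk (stab f' u) = K1.mk (stab (Fin.natAddEmb k) u) := by
    intro f' hf'
    refine K1.mk_eq_of_joined (joined_stab_of_disjoint _ _ ?_ u)
    intro i j h
    have h1 := congrArg Fin.val h
    have h2 := hf' i
    simp only [Fin.natAddEmb_apply, Fin.val_natAdd] at h1
    omega
  rw [hd (f.trans (Fin.castLEEmb hk)) (fun i => (f i).2),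
    hd (Fin.castLEEmb (hn.trans hk)) (fun i => i.2.trans_le hn)]

theorem K1.mk_comm {n m : ℕ} (u : UMat B n) (v : UMat B m) :
    K1.mk u + K1.mk v = K1.mk v + K1.mk u := by
  rw [← K1.mk_stab (Fin.castAddEmb m) u, ← K1.mk_stab (Fin.natAddEmb n) v, ← K1.mk_mul,
    ← K1.mk_mul, stab_comm_of_disjoint]
  intro i j h
  have h1 := congrArg Fin.val h
  have := i.2
  simp only [Fin.natAddEmb_apply, Fin.val_natAdd, Fin.castAddEmb_apply, Fin.val_castAdd] at h1
  omega

noncomputable instance : AddCommGroup (K1 B) :=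
  { (inferInstance : AddGroup (K1 B)) with
    add_comm := fun x y => by
      induction x using K1.ind with
      | h n u =>
        induction y using K1.ind with
        | h m v => exact K1.mk_comm u v }

end Comm

section Map

variable {B C : Type u} [Ring B] [StarRing B] [TopologicalSpace B] [IsTopologicalRing B]
  [ContinuousStar B] [Algebra ℂ B] [StarModule ℂ B] [ContinuousSMul ℂ B]
  [Ring C] [StarRing C] [TopologicalSpace C] [IsTopologicalRing C]
  [ContinuousStar C] [Algebra ℂ C] [StarModule ℂ C] [ContinuousSMul ℂ C]

/-- The homomorphism `U_n(B) → U_n(C)` obtained by applying a unital *-homomorphism entrywise. -/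
def UMat.map (φ : B →⋆ₐ[ℂ] C) (n : ℕ) : UMat B n →* UMat C n where
  toFun u := ⟨(u : Matrix (Fin n) (Fin n) B).map φ, by
    have hs : star ((u : Matrix (Fin n) (Fin n) B).map φ) =
        (star (u : Matrix (Fin n) (Fin n) B)).map φ := by
      ext i j
      simp [Matrix.star_apply, map_star]
    rw [Unitary.mem_iff, hs, ← Matrix.map_mul, ← Matrix.map_mul, (Unitary.mem_iff.1 u.2).1,
      (Unitary.mem_iff.1 u.2).2, Matrix.map_one _ (map_zero φ) (map_one φ)]
    exact ⟨rfl, rfl⟩⟩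
  map_one' := Subtype.ext (Matrix.map_one _ (map_zero φ) (map_one φ))
  map_mul' u v := Subtype.ext (Matrix.map_mul (f := φ))

theorem UMat.continuous_map (φ : B →⋆ₐ[ℂ] C) (hφ : Continuous φ) (n : ℕ) :
    Continuous (UMat.map φ n) := by
  refine Continuous.subtype_mk ?_ _
  exact Continuous.matrix_map continuous_subtype_val hφ

theorem UMat.map_stab (φ : B →⋆ₐ[ℂ] C) {n m : ℕ} (f : Fin n ↪ Fin m) (u : UMat B n) :
    UMat.map φ m (stab f u) = stab f (UMat.map φ n u) := by
  apply Subtype.ext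
  change (stab f u : Matrix (Fin m) (Fin m) B).map φ = 
    1 + corner f ((u : Matrix (Fin n) (Fin n) B).map φ - 1)
  have hi : (injMat B f).map φ = injMat C f := by
    ext i j
    simp only [Matrix.map_apply, injMat_apply]
    split_ifs <;> simp
  have hi' : ((injMat B f)ᴴ).map φ = (injMat C f)ᴴ := by
    ext i j
    simp only [Matrix.map_apply, conjTranspose_injMat_apply]
    split_ifs <;> simp
  rw [stab_coe, Matrix.map_add _ (map_add φ), Matrix.map_one _ (map_zero φ) (map_one φ), corner,
    Matrix.map_mul, Matrix.map_mul, hi, hi', Matrix.map_sub _ (map_sub φ),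
    Matrix.map_one _ (map_zero φ) (map_one φ), corner]

/-- The homomorphism `φ_* : K₁(B) → K₁(C)`, `[u] ↦ [φ(u)]`. -/
noncomputable def K1.map (φ : B →⋆ₐ[ℂ] C) (hφ : Continuous φ) : K1 B →+ K1 C :=
  MonoidHom.toAdditive
    { toFun := DirectLimit.map _ _ (fun n => pi0Map (UMat.map φ n) (UMat.continuous_map φ hφ n))
        (by
          rintro n m h ⟨u⟩
          exact congrArg QuotientGroup.mk (UMat.map_stab φ (Fin.castLEEmb h) u).symm)
      map_one' := by
        rw [DirectLimit.one_def 0, DirectLimit.map_def, map_one, ← DirectLimit.one_def]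
      map_mul' := by
        refine DirectLimit.induction₂ _ fun n u v => ?_
        rw [DirectLimit.mul_def, DirectLimit.map_def, DirectLimit.map_def, DirectLimit.map_def,
          map_mul, DirectLimit.mul_def] }

theorem K1.map_mk (φ : B →⋆ₐ[ℂ] C) (hφ : Continuous φ) {n : ℕ} (u : UMat B n) :
    K1.map φ hφ (K1.mk u) = K1.mk (UMat.map φ n u) := rfl

end Map

end KOne

section KZero

universe u

variable {A : Type u} [CStarAlgebra A]

/-- Murray–von Neumann equivalence of two square matrices `p`, `q` of possibly different sizes:
`p = v* v` and `q = v v*` for some rectangular matrix `v` over `A`. -/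
def MvN {ι κ : Type*} [Fintype ι] [Fintype κ] (p : Matrix ι ι A) (q : Matrix κ κ A) : Prop :=
  ∃ v : Matrix κ ι A, vᴴ * v = p ∧ v * vᴴ = q

theorem MvN.symm {ι κ : Type*} [Fintype ι] [Fintype κ] {p : Matrix ι ι A} {q : Matrix κ κ A} :
    MvN p q → MvN q p := by
  rintro ⟨v, h1, h2⟩
  exact ⟨vᴴ, by rw [Matrix.conjTranspose_conjTranspose, h2],
    by rw [Matrix.conjTranspose_conjTranspose, h1]⟩

theorem MvN.trans {ι κ μ : Type*} [Fintype ι] [Fintype κ] [Fintype μ] {p : Matrix ι ι A}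
    {q : Matrix κ κ A} {r : Matrix μ μ A} (hp : p * p = p) (hr : r * r = r) :
    MvN p q → MvN q r → MvN p r := by
  rintro ⟨v, h1, h2⟩ ⟨w, h3, h4⟩
  refine ⟨w * v, ?_, ?_⟩
  · rw [Matrix.conjTranspose_mul]
    calc vᴴ * wᴴ * (w * v) = vᴴ * (wᴴ * w) * v := by simp only [Matrix.mul_assoc]
      _ = (vᴴ * v) * (vᴴ * v) := by rw [h3, ← h2]; simp only [Matrix.mul_assoc]
      _ = p := by rw [h1, hp]
  · rw [Matrix.conjTranspose_mul]
    calc w * v * (vᴴ * wᴴ) = w * (v * vᴴ) * wᴴ := by simp only [Matrix.mul_assoc]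
      _ = (w * wᴴ) * (w * wᴴ) := by rw [h2, ← h3]; simp only [Matrix.mul_assoc]
      _ = r := by rw [h4, hr]

theorem MvN.reindex {ι κ : Type*} [Fintype ι] [Fintype κ] {p : Matrix ι ι A}
    (hp : p * p = p) (hs : pᴴ = p) (e : κ ≃ ι) : MvN p (p.submatrix e e) := by
  refine ⟨p.submatrix e id, ?_, ?_⟩
  · rw [Matrix.conjTranspose_submatrix, hs]
    exact (Matrix.submatrix_mul_equiv p p id e id).trans (by rw [hp]; rfl)
  · rw [Matrix.conjTranspose_submatrix, hs]
    exact (Matrix.submatrix_mul_equiv p p e (Equiv.refl _) e).trans (by rw [hp])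

/-- The direct sum `p ⊕ q` of matrices. -/
def dsum {n m : ℕ} (p : Matrix (Fin n) (Fin n) A) (q : Matrix (Fin m) (Fin m) A) :
    Matrix (Fin (n + m)) (Fin (n + m)) A :=
  (Matrix.fromBlocks p 0 0 q).submatrix finSumFinEquiv.symm finSumFinEquiv.symm

theorem MvN.fromBlocks {ι κ ι' κ' : Type*} [Fintype ι] [Fintype κ] [Fintype ι'] [Fintype κ']
    {p : Matrix ι ι A} {q : Matrix κ κ A} {p' : Matrix ι' ι' A} {q' : Matrix κ' κ' A} :
    MvN p p' → MvN q q' → MvN (Matrix.fromBlocks p 0 0 q) (Matrix.fromBlocks p' 0 0 q') := by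
  rintro ⟨v, h1, h2⟩ ⟨w, h3, h4⟩
  refine ⟨Matrix.fromBlocks v 0 0 w, ?_, ?_⟩ <;>
    simp [Matrix.fromBlocks_conjTranspose, Matrix.fromBlocks_multiply, h1, h2, h3, h4]

theorem MvN.fromBlocks_comm {ι κ : Type*} [Fintype ι] [Fintype κ] {p : Matrix ι ι A}
    {q : Matrix κ κ A} (hp : p * p = p) (hp' : pᴴ = p) (hq : q * q = q) (hq' : qᴴ = q) :
    MvN (Matrix.fromBlocks p 0 0 q) (Matrix.fromBlocks q 0 0 p) := by
  refine ⟨Matrix.fromBlocks 0 q p 0, ?_, ?_⟩ <;>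
    simp [Matrix.fromBlocks_conjTranspose, Matrix.fromBlocks_multiply, hp, hp', hq, hq']

variable (A) in
/-- The projections in `M_∞(A) = ⋃ M_n(A)`. -/
structure Proj : Type u where
  n : ℕ
  p : Matrix (Fin n) (Fin n) A
  isProj : IsStarProjection p

theorem Proj.mul_self (p : Proj A) : p.p * p.p = p.p := p.isProj.isIdempotentElem
theorem Proj.star_self (p : Proj A) : p.pᴴ = p.p := p.isProj.isSelfAdjoint

theorem isStarProjection_iff_matrix {ι : Type*} [Fintype ι] (p : Matrix ι ι A) :
    IsStarProjection p ↔ p * p = p ∧ pᴴ = p :=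
  ⟨fun h => ⟨h.isIdempotentElem, h.isSelfAdjoint⟩, fun h => ⟨h.1, h.2⟩⟩

theorem fromBlocks_proj {ι κ : Type*} [Fintype ι] [Fintype κ] {p : Matrix ι ι A}
    {q : Matrix κ κ A} (hp : IsStarProjection p) (hq : IsStarProjection q) :
    IsStarProjection (Matrix.fromBlocks p 0 0 q) := by
  rw [isStarProjection_iff_matrix] at *
  simp [Matrix.fromBlocks_conjTranspose, Matrix.fromBlocks_multiply, hp, hq]

theorem submatrix_proj {ι κ : Type*} [Fintype ι] [Fintype κ] {p : Matrix ι ι A} (e : κ ≃ ι)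
    (hp : IsStarProjection p) : IsStarProjection (p.submatrix e e) := by
  rw [isStarProjection_iff_matrix] at *
  rw [Matrix.submatrix_mul_equiv, Matrix.conjTranspose_submatrix, hp.1, hp.2]
  exact ⟨rfl, rfl⟩

/-- The direct sum of projections. -/
def Proj.add (p q : Proj A) : Proj A :=
  ⟨p.n + q.n, dsum p.p q.p, submatrix_proj _ (fromBlocks_proj p.isProj q.isProj)⟩

theorem MvN.submatrix_iff {ι κ ι' κ' : Type*} [Fintype ι] [Fintype κ] [Fintype ι'] [Fintype κ']
    {p : Matrix ι ι A} {q : Matrix κ κ A} (hp : IsStarProjection p) (hq : IsStarProjection q)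
    (e : ι' ≃ ι) (f : κ' ≃ κ) (h : MvN p q) : MvN (p.submatrix e e) (q.submatrix f f) := by
  have hp' := (isStarProjection_iff_matrix _).1 hp
  have hq' := (isStarProjection_iff_matrix _).1 hq
  have hpe := (isStarProjection_iff_matrix _).1 (submatrix_proj e hp)
  have hqf := (isStarProjection_iff_matrix _).1 (submatrix_proj f hq)
  exact ((MvN.reindex hp'.1 hp'.2 e).symm.trans hpe.1 hq'.1 h).trans hpe.1 hqf.1
    (MvN.reindex hq'.1 hq'.2 f)

variable (A) in
instance Proj.setoid : Setoid (Proj A) where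
  r p q := MvN p.p q.p
  iseqv :=
    { refl := fun p => ⟨p.p, by rw [p.star_self, p.mul_self], by rw [p.star_self, p.mul_self]⟩
      symm := MvN.symm
      trans := fun {p _ r} => MvN.trans p.mul_self r.mul_self }

variable (A) in
/-- The semigroup `V(A)` of Murray–von Neumann classes of projections in matrix algebras
over `A`. -/
def ProjClass : Type u := Quotient (Proj.setoid A)

instance : Add (ProjClass A) :=
  ⟨Quotient.map₂ Proj.add fun p p' h q q' k =>
    MvN.submatrix_iff (fromBlocks_proj p.isProj q.isProj) (fromBlocks_proj p'.isProj q'.isProj)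
      _ _ (MvN.fromBlocks h k)⟩

instance : Zero (ProjClass A) :=
  ⟨Quotient.mk _ ⟨0, 0, (isStarProjection_iff_matrix _).2 ⟨by simp, by simp⟩⟩⟩

instance : AddCommMonoid (ProjClass A) where
  add_assoc := by
    rintro ⟨p⟩ ⟨q⟩ ⟨r⟩
    refine Quotient.sound ?_
    change MvN (dsum (dsum p.p q.p) r.p) (dsum p.p (dsum q.p r.p))
    have e1 : dsum (dsum p.p q.p) r.p =
        (Matrix.fromBlocks p.p 0 0 (Matrix.fromBlocks q.p 0 0 r.p)).submatrix
          ((finSumFinEquiv.symm.trans (Equiv.sumCongr finSumFinEquiv.symm (Equiv.refl _))).trans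
            (Equiv.sumAssoc _ _ _))
          ((finSumFinEquiv.symm.trans (Equiv.sumCongr finSumFinEquiv.symm (Equiv.refl _))).trans
            (Equiv.sumAssoc _ _ _)) := by
      ext i j
      obtain ⟨i, rfl⟩ := finSumFinEquiv.surjective i
      obtain ⟨j, rfl⟩ := finSumFinEquiv.surjective j
      rcases i with i | i <;> rcases j with j | j
      · obtain ⟨i, rfl⟩ := finSumFinEquiv.surjective i
        obtain ⟨j, rfl⟩ := finSumFinEquiv.surjective j
        rcases i with i | i <;> rcases j with j | j <;> simp [dsum]
      · obtain ⟨i, rfl⟩ := finSumFinEquiv.surjective i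
        rcases i with i | i <;> simp [dsum]
      · obtain ⟨j, rfl⟩ := finSumFinEquiv.surjective j
        rcases j with j | j <;> simp [dsum]
      · simp [dsum]
    have e2 : dsum p.p (dsum q.p r.p) =
        (Matrix.fromBlocks p.p 0 0 (Matrix.fromBlocks q.p 0 0 r.p)).submatrix
          (finSumFinEquiv.symm.trans (Equiv.sumCongr (Equiv.refl _) finSumFinEquiv.symm))
          (finSumFinEquiv.symm.trans (Equiv.sumCongr (Equiv.refl _) finSumFinEquiv.symm)) := by
      ext i j
      obtain ⟨i, rfl⟩ := finSumFinEquiv.surjective i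
      obtain ⟨j, rfl⟩ := finSumFinEquiv.surjective j
      rcases i with i | i <;> rcases j with j | j <;> simp [dsum]
    rw [e1, e2]
    have hP := fromBlocks_proj p.isProj (fromBlocks_proj q.isProj r.isProj)
    have hP' := (isStarProjection_iff_matrix _).1 hP
    exact MvN.submatrix_iff hP hP _ _
      ⟨_, by rw [hP'.2, hP'.1], by rw [hP'.2, hP'.1]⟩
  zero_add := by
    rintro ⟨p⟩
    refine Quotient.sound ?_
    change MvN (dsum 0 p.p) p.p
    have e1 : dsum (0 : Matrix (Fin 0) (Fin 0) A) p.p =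
        p.p.submatrix (finSumFinEquiv.symm.trans (Equiv.emptySum (Fin 0) (Fin p.n)))
          (finSumFinEquiv.symm.trans (Equiv.emptySum (Fin 0) (Fin p.n))) := by
      ext i j
      obtain ⟨i, rfl⟩ := finSumFinEquiv.surjective i
      obtain ⟨j, rfl⟩ := finSumFinEquiv.surjective j
      rcases i with i | i
      · exact i.elim0
      rcases j with j | j
      · exact j.elim0
      simp only [dsum, Matrix.submatrix_apply, Equiv.symm_apply_apply, Equiv.trans_apply]
      rfl
    rw [e1]
    exact (MvN.reindex p.mul_self p.star_self _).symm
  add_zero := by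
    rintro ⟨p⟩
    refine Quotient.sound ?_
    change MvN (dsum p.p 0) p.p
    have e1 : dsum p.p (0 : Matrix (Fin 0) (Fin 0) A) =
        p.p.submatrix (finSumFinEquiv.symm.trans (Equiv.sumEmpty (Fin p.n) (Fin 0)))
          (finSumFinEquiv.symm.trans (Equiv.sumEmpty (Fin p.n) (Fin 0))) := by
      ext i j
      obtain ⟨i, rfl⟩ := finSumFinEquiv.surjective i
      obtain ⟨j, rfl⟩ := finSumFinEquiv.surjective j
      rcases i with i | i
      · rcases j with j | j
        · simp [dsum]
        · exact j.elim0
      · exact i.elim0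
    rw [e1]
    exact (MvN.reindex p.mul_self p.star_self _).symm
  add_comm := by
    rintro ⟨p⟩ ⟨q⟩
    refine Quotient.sound ?_
    exact MvN.submatrix_iff (fromBlocks_proj p.isProj q.isProj)
      (fromBlocks_proj q.isProj p.isProj) _ _
      (MvN.fromBlocks_comm p.mul_self p.star_self q.mul_self q.star_self)
  nsmul := nsmulRec

variable (A) in
/-- `K₀(A)` for a unital C*-algebra `A`: the Grothendieck group of `V(A)`. -/
abbrev K0 : Type u := Algebra.GrothendieckAddGroup (ProjClass A)

/-- The class `[p] ∈ V(A)`. -/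
def ProjClass.mk (p : Proj A) : ProjClass A := Quotient.mk _ p

/-- The class `[p] ∈ K₀(A)` of a projection `p`. -/
noncomputable def K0.mk (p : Proj A) : K0 A := Algebra.GrothendieckAddGroup.of (ProjClass.mk p)

theorem ProjClass.mk_add (p q : Proj A) :
    ProjClass.mk (p.add q) = ProjClass.mk p + ProjClass.mk q := rfl

end KZero

section Traces

universe u

open scoped ComplexOrder

variable (A : Type u) [CStarAlgebra A]

/-- The set of tracial states of `A`, in the weak* dual. -/
def tracialStates : Set (WeakDual ℂ A) :=
  {τ | τ 1 = 1 ∧ (∀ a, 0 ≤ τ (star a * a)) ∧ ∀ a b, τ (a * b) = τ (b * a)}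

/-- The tracial state space `T_A`, with the weak* topology. -/
abbrev TracialState : Type u := tracialStates A

/-- The real affine continuous functions on `T_A`. -/
noncomputable def AffT : Submodule ℝ C(TracialState A, ℝ) where
  carrier := {f | ∀ (σ τ ρ : TracialState A) (s : ℝ), 0 ≤ s → s ≤ 1 →
    (ρ : WeakDual ℂ A) = (s : ℂ) • (σ : WeakDual ℂ A) + ((1 - s : ℝ) : ℂ) • (τ : WeakDual ℂ A) →
    f ρ = s * f σ + (1 - s) * f τ}
  zero_mem' := by
    intro σ τ ρ s _ _ _
    simp
  add_mem' := by
    intro f g hf hg σ τ ρ s h0 h1 h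
    rw [ContinuousMap.add_apply, ContinuousMap.add_apply, ContinuousMap.add_apply,
      hf σ τ ρ s h0 h1 h, hg σ τ ρ s h0 h1 h]
    ring
  smul_mem' := by
    intro c f hf σ τ ρ s h0 h1 h
    rw [ContinuousMap.smul_apply, ContinuousMap.smul_apply, ContinuousMap.smul_apply,
      hf σ τ ρ s h0 h1 h]
    simp only [smul_eq_mul]
    ring

variable {A}

/-- The function `τ ↦ Re τ(a)` on `T_A`. -/
noncomputable def evalAff (a : A) : AffT A :=
  ⟨⟨fun τ => ((τ : WeakDual ℂ A) a).re,
    Complex.continuous_re.comp ((WeakDual.eval_continuous a).comp continuous_subtype_val)⟩, by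
    intro σ τ ρ s _ _ h
    change ((ρ : WeakDual ℂ A) a).re = s * ((σ : WeakDual ℂ A) a).re +
      (1 - s) * ((τ : WeakDual ℂ A) a).re
    rw [h]
    change ((s : ℂ) * ((σ : WeakDual ℂ A) a) + ((1 - s : ℝ) : ℂ) * ((τ : WeakDual ℂ A) a)).re = _
    simp [Complex.add_re, Complex.mul_re]⟩

theorem evalAff_apply (a : A) (τ : TracialState A) :
    (evalAff a : C(TracialState A, ℝ)) τ = ((τ : WeakDual ℂ A) a).re := rfl

theorem TracialState.trace_comm (τ : TracialState A) {ι κ : Type*} [Fintype ι] [Fintype κ]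
    (v : Matrix ι κ A) (w : Matrix κ ι A) :
    (τ : WeakDual ℂ A) (v * w).trace = (τ : WeakDual ℂ A) (w * v).trace := by
  simp only [Matrix.trace, Matrix.diag, Matrix.mul_apply, map_sum]
  rw [Finset.sum_comm]
  refine Finset.sum_congr rfl fun i _ => Finset.sum_congr rfl fun j _ => ?_
  exact τ.2.2.2 _ _

theorem dsum_trace {n m : ℕ} (p : Matrix (Fin n) (Fin n) A) (q : Matrix (Fin m) (Fin m) A) :
    (dsum p q).trace = p.trace + q.trace := by
  rw [dsum, Matrix.trace, ← finSumFinEquiv.sum_comp]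
  simp [Matrix.trace]

variable (A) in
/-- The dimension map `D : K₀(A) → Aff(T_A)`, `D([p])(τ) = τ(p)`; the trace `τ` is extended to
`M_n(A)` by `τ((a_ij)) = ∑ τ(a_ii)`, and its values on projections are real. -/
noncomputable def dimensionMap : K0 A →+ AffT A :=
  Algebra.GrothendieckAddGroup.lift
    { toFun := Quotient.lift (fun p : Proj A => evalAff p.p.trace) (by
        rintro p q ⟨v, h1, h2⟩
        apply Subtype.ext
        ext τ
        rw [evalAff_apply, evalAff_apply, ← h1, ← h2, TracialState.trace_comm])
      map_zero' := by
        apply Subtype.ext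
        ext τ
        change ((τ : WeakDual ℂ A) (Matrix.trace 0)).re = 0
        simp
      map_add' := by
        rintro ⟨p⟩ ⟨q⟩
        apply Subtype.ext
        ext τ
        change ((τ : WeakDual ℂ A) (dsum p.p q.p).trace).re =
          ((τ : WeakDual ℂ A) p.p.trace).re + ((τ : WeakDual ℂ A) q.p.trace).re
        rw [dsum_trace, map_add, Complex.add_re] }

theorem dimensionMap_mk (p : Proj A) (τ : TracialState A) :
    (dimensionMap A (K0.mk p) : C(TracialState A, ℝ)) τ =
      ((τ : WeakDual ℂ A) p.p.trace).re := by
  rw [dimensionMap, K0.mk]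
  have h : ∀ (f : ProjClass A →+ AffT A) (x : ProjClass A),
      Algebra.GrothendieckAddGroup.lift f (Algebra.GrothendieckAddGroup.of x) = f x := fun f x =>
    DFunLike.congr_fun (Algebra.GrothendieckAddGroup.lift.symm_apply_apply f) x
  rw [h]
  rfl

end Traces

section Torus

universe u

variable {A : Type u} [CStarAlgebra A]

variable (A) in
/-- The group of approximately inner automorphisms of `A`: the closure of the inner automorphisms
`Ad u` in the group of *-automorphisms for the topology of pointwise norm convergence. -/
def approxInn : Subgroup (A ≃⋆ₐ[ℂ] A) where
  carrier := {α | ∀ (F : Finset A) (ε : ℝ), 0 < ε → ∃ u : unitary A, ∀ a ∈ F,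
    ‖α a - (u : A) * a * star (u : A)‖ < ε}
  one_mem' := by
    intro F ε hε
    exact ⟨1, fun a _ => by simpa using hε⟩
  mul_mem' := by
    classical
    intro α β hα hβ F ε hε
    obtain ⟨v, hv⟩ := hβ F (ε / 2) (half_pos hε)
    obtain ⟨u, hu⟩ := hα (F.image fun a => (v : A) * a * star (v : A)) (ε / 2) (half_pos hε)
    refine ⟨u * v, fun a ha => ?_⟩
    have h1 := hu _ (Finset.mem_image_of_mem _ ha)
    have h2 : ‖α (β a - (v : A) * a * star (v : A))‖ < ε / 2 := by
      rw [NonUnitalStarAlgHom.norm_map α α.injective]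
      exact hv a ha
    have h3 : (α * β) a - ((u * v : unitary A) : A) * a * star ((u * v : unitary A) : A) =
        α (β a - (v : A) * a * star (v : A)) +
        (α ((v : A) * a * star (v : A)) -
          (u : A) * ((v : A) * a * star (v : A)) * star (u : A)) := by
      rw [map_sub, sub_add_sub_cancel]
      congr 1
      simp [mul_assoc]
    rw [h3]
    calc _ ≤ _ := norm_add_le _ _
      _ < ε / 2 + ε / 2 := add_lt_add h2 h1
      _ = ε := add_halves ε
  inv_mem' := by
    classical
    intro α hα F ε hε
    obtain ⟨u, hu⟩ := hα (F.image fun a => α⁻¹ a) ε hε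
    refine ⟨star u, fun a ha => ?_⟩
    have h1 := hu _ (Finset.mem_image_of_mem _ ha)
    have h2 : α (α⁻¹ a) = a := α.apply_symm_apply a
    rw [h2] at h1
    have h3 : α⁻¹ a - ((star u : unitary A) : A) * a * star ((star u : unitary A) : A) =
        -((star u : unitary A) * (a - (u : A) * (α⁻¹ a) * star (u : A)) * (u : unitary A)) := by
      have e1 : star (u : A) * u = 1 := (Unitary.mem_iff.1 u.2).1
      rw [Unitary.coe_star, star_star, mul_sub, sub_mul, neg_sub]
      congr 1
      calc α⁻¹ a = (star (u : A) * u) * α⁻¹ a * (star (u : A) * u) := by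
            rw [e1, one_mul, mul_one]
        _ = _ := by simp only [mul_assoc]
    rw [h3, norm_neg, CStarRing.norm_mul_coe_unitary, CStarRing.norm_coe_unitary_mul]
    exact h1

variable (α : A ≃⋆ₐ[ℂ] A)

/-- The mapping torus `M_α = {x ∈ C([0,1], A) | α(x(0)) = x(1)}`. -/
def mappingTorus : StarSubalgebra ℂ C(unitInterval, A) where
  carrier := {x | α (x 0) = x 1}
  mul_mem' := by
    intro x y hx hy
    change α (x 0 * y 0) = x 1 * y 1
    rw [map_mul]
    exact congrArg₂ _ hx hy
  add_mem' := by
    intro x y hx hy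
    change α (x 0 + y 0) = x 1 + y 1
    rw [map_add]
    exact congrArg₂ _ hx hy
  algebraMap_mem' := by
    intro c
    change α (algebraMap ℂ A c) = algebraMap ℂ A c
    exact AlgHomClass.commutes α c
  star_mem' := by
    intro x hx
    change α (star (x 0)) = star (x 1)
    rw [map_star]
    exact congrArg _ hx

theorem mem_mappingTorus {x : C(unitInterval, A)} : x ∈ mappingTorus α ↔ α (x 0) = x 1 := Iff.rfl

/-- The mapping torus `M_α` as a type, with its *-algebra structure and its norm topology. -/
def MappingTorus : Type u := mappingTorus α

noncomputable instance : Ring (MappingTorus α) := inferInstanceAs (Ring (mappingTorus α))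

noncomputable instance : StarRing (MappingTorus α) :=
  inferInstanceAs (StarRing (mappingTorus α))

noncomputable instance : Algebra ℂ (MappingTorus α) :=
  inferInstanceAs (Algebra ℂ (mappingTorus α))

instance : StarModule ℂ (MappingTorus α) := inferInstanceAs (StarModule ℂ (mappingTorus α))

instance : TopologicalSpace (MappingTorus α) :=
  inferInstanceAs (TopologicalSpace (mappingTorus α))

/-- The function on `[0,1]` underlying an element of the mapping torus. -/
def MappingTorus.toFun (x : MappingTorus α) : C(unitInterval, A) := Subtype.val x

theorem MappingTorus.toFun_injective :
    Function.Injective (MappingTorus.toFun α) := Subtype.val_injective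

theorem MappingTorus.continuous_toFun : Continuous (MappingTorus.toFun α) :=
  continuous_subtype_val

theorem MappingTorus.continuous_iff {X : Type*} [TopologicalSpace X] {f : X → MappingTorus α} :
    Continuous f ↔ Continuous fun x => MappingTorus.toFun α (f x) :=
  continuous_induced_rng

instance : IsTopologicalRing (MappingTorus α) where
  continuous_add := by
    rw [MappingTorus.continuous_iff]
    exact ((MappingTorus.continuous_toFun α).comp continuous_fst).add
      ((MappingTorus.continuous_toFun α).comp continuous_snd)
  continuous_mul := by
    rw [MappingTorus.continuous_iff]
    exact ((MappingTorus.continuous_toFun α).comp continuous_fst).mul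
      ((MappingTorus.continuous_toFun α).comp continuous_snd)
  continuous_neg := by
    rw [MappingTorus.continuous_iff]
    exact (MappingTorus.continuous_toFun α).neg

instance : ContinuousStar (MappingTorus α) where
  continuous_star := by
    rw [MappingTorus.continuous_iff]
    exact (MappingTorus.continuous_toFun α).star

instance : ContinuousSMul ℂ (MappingTorus α) where
  continuous_smul := by
    rw [MappingTorus.continuous_iff]
    exact continuous_fst.smul ((MappingTorus.continuous_toFun α).comp continuous_snd)

/-- The evaluation `x ↦ x(t)` on the mapping torus. -/
def torusEval (t : unitInterval) : MappingTorus α →⋆ₐ[ℂ] A where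
  toFun x := MappingTorus.toFun α x t
  map_one' := rfl
  map_mul' _ _ := rfl
  map_zero' := rfl
  map_add' _ _ := rfl
  commutes' _ := rfl
  map_star' _ := rfl

theorem continuous_torusEval (t : unitInterval) : Continuous (torusEval α t) :=
  (continuous_eval_const t).comp (MappingTorus.continuous_toFun α)

/-- The homomorphism `q_* : K₁(M_α) → K₁(A)` induced by `q(x) = x(0)`. -/
noncomputable def torusQ : K1 (MappingTorus α) →+ K1 A :=
  K1.map (torusEval α 0) (continuous_torusEval α 0)

/-- The function `t ↦ e^{2πit} - 1` on `[0,1]`, with values in the scalars of `A`. -/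
noncomputable def loopFun (A : Type u) [CStarAlgebra A] : C(unitInterval, A) :=
  ⟨fun t => algebraMap ℂ A (Complex.exp (2 * Real.pi * Complex.I * (t : ℝ)) - 1), by fun_prop⟩

theorem loopFun_zero : loopFun A 0 = 0 := by
  simp [loopFun]

theorem loopFun_one : loopFun A 1 = 0 := by
  simp [loopFun, Complex.exp_two_pi_mul_I]

/-- The element `t ↦ (e^{2πit} - 1) a` of the mapping torus. -/
noncomputable def loopElt (a : A) : MappingTorus α :=
  ⟨loopFun A * ContinuousMap.const _ a, by
    rw [mem_mappingTorus, ContinuousMap.mul_apply, ContinuousMap.mul_apply, loopFun_zero,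
      loopFun_one, zero_mul, zero_mul, map_zero]⟩

theorem torusEval_loopElt (t : unitInterval) (a : A) :
    torusEval α t (loopElt α a) = (Complex.exp (2 * Real.pi * Complex.I * (t : ℝ)) - 1) • a := by
  rw [Algebra.smul_def]
  rfl

theorem continuous_loopElt : Continuous (loopElt α) := by
  rw [MappingTorus.continuous_iff]
  exact continuous_const.mul ContinuousMap.continuous_const'

theorem torus_matrix_ext {n : ℕ} {X Y : Matrix (Fin n) (Fin n) (MappingTorus α)}
    (h : ∀ t, X.map (torusEval α t) = Y.map (torusEval α t)) : X = Y := by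
  ext i j
  apply MappingTorus.toFun_injective α
  ext t
  exact congrFun (congrFun (h t) i) j

/-- The matrix `t ↦ e^{2πit} p + 1 - p` over the mapping torus. -/
noncomputable def loopMat {n : ℕ} (p : Matrix (Fin n) (Fin n) A) :
    Matrix (Fin n) (Fin n) (MappingTorus α) :=
  1 + p.map (loopElt α)

/-- The value of `loopMat` at `t` is `e^{2πit} p + 1 - p`. -/
theorem loopMat_eval {n : ℕ} (p : Matrix (Fin n) (Fin n) A) (t : unitInterval) :
    (loopMat α p).map (torusEval α t) =
      Complex.exp (2 * Real.pi * Complex.I * (t : ℝ)) • p + 1 - p := by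
  have h : (p.map (loopElt α)).map (torusEval α t) =
      (Complex.exp (2 * Real.pi * Complex.I * (t : ℝ)) - 1) • p := by
    ext i j
    exact torusEval_loopElt α t (p i j)
  rw [loopMat, Matrix.map_add _ (map_add _), Matrix.map_one _ (map_zero _) (map_one _), h,
    sub_smul, one_smul]
  abel

theorem map_star_matrix {B C : Type u} [Ring B] [StarRing B] [Algebra ℂ B] [Ring C] [StarRing C]
    [Algebra ℂ C] (φ : B →⋆ₐ[ℂ] C) {n m : ℕ} (X : Matrix (Fin n) (Fin m) B) :
    (Xᴴ).map φ = (X.map φ)ᴴ := by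
  ext i j
  exact map_star φ (X j i)

theorem corner_map {B C : Type u} [Ring B] [StarRing B] [Algebra ℂ B] [Ring C] [StarRing C]
    [Algebra ℂ C] (φ : B →⋆ₐ[ℂ] C) {n m : ℕ} (f : Fin n ↪ Fin m)
    (X : Matrix (Fin n) (Fin n) B) : (corner f X).map φ = corner f (X.map φ) := by
  have hi : (injMat B f).map φ = injMat C f := by
    ext i j
    simp only [Matrix.map_apply, injMat_apply]
    split_ifs <;> simp
  rw [corner, Matrix.map_mul, Matrix.map_mul, map_star_matrix, hi, corner]

theorem corner_smul {n m : ℕ} (f : Fin n ↪ Fin m) (c : ℂ) (X : Matrix (Fin n) (Fin n) A) :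
    corner f (c • X) = c • corner f X := by
  rw [corner, corner, Matrix.mul_smul, Matrix.smul_mul]

/-- The unitary `t ↦ e^{2πit} p + 1 - p` for a projection `p ∈ M_n(A)`. -/
noncomputable def loopU {n : ℕ} (p : Matrix (Fin n) (Fin n) A) (hp : IsStarProjection p) :
    UMat (MappingTorus α) n :=
  ⟨loopMat α p, by
    obtain ⟨h1, h2⟩ := (isStarProjection_iff_matrix p).1 hp
    have key : ∀ c d : ℂ, c * d = 1 → (c • p + 1 - p) * (d • p + 1 - p) = 1 := by
      intro c d hcd
      have hdc : d * c = 1 := by rw [mul_comm, hcd]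
      simp only [mul_add, mul_sub, add_mul, sub_mul, smul_mul_assoc,
        mul_smul_comm, h1, hdc, mul_one, one_mul, smul_add, smul_sub, smul_smul, one_smul]
      abel
    have hz : ∀ t : unitInterval, star (Complex.exp (2 * Real.pi * Complex.I * (t : ℝ))) *
        Complex.exp (2 * Real.pi * Complex.I * (t : ℝ)) = 1 := by
      intro t
      rw [Complex.star_def, ← Complex.exp_conj, ← Complex.exp_add]
      simp [Complex.conj_ofNat]
    have hs : ∀ t : unitInterval, (star (loopMat α p)).map (torusEval α t) =
        star (Complex.exp (2 * Real.pi * Complex.I * (t : ℝ))) • p + 1 - p := by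
      intro t
      rw [Matrix.star_eq_conjTranspose, map_star_matrix, loopMat_eval, Matrix.conjTranspose_sub,
        Matrix.conjTranspose_add, Matrix.conjTranspose_smul, Matrix.conjTranspose_one, h2]
    rw [Unitary.mem_iff]
    constructor <;> refine torus_matrix_ext α fun t => ?_
    · rw [Matrix.map_mul, hs, loopMat_eval, key _ _ (hz t),
        Matrix.map_one _ (map_zero _) (map_one _)]
    · rw [Matrix.map_mul, hs, loopMat_eval, key _ _ (by rw [mul_comm]; exact hz t),
        Matrix.map_one _ (map_zero _) (map_one _)]⟩

theorem loopU_coe {n : ℕ} (p : Matrix (Fin n) (Fin n) A) (hp : IsStarProjection p) :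
    (loopU α p hp : Matrix (Fin n) (Fin n) (MappingTorus α)) = loopMat α p := rfl

theorem corner_proj {n m : ℕ} (f : Fin n ↪ Fin m) {p : Matrix (Fin n) (Fin n) A}
    (hp : IsStarProjection p) : IsStarProjection (corner f p) := by
  rw [isStarProjection_iff_matrix] at *
  refine ⟨by rw [corner_mul, hp.1], ?_⟩
  have := corner_star f p
  rw [Matrix.star_eq_conjTranspose, Matrix.star_eq_conjTranspose, hp.2] at this
  exact this

theorem stab_loopU {n m : ℕ} (f : Fin n ↪ Fin m) (p : Matrix (Fin n) (Fin n) A)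
    (hp : IsStarProjection p) :
    stab f (loopU α p hp) = loopU α (corner f p) (corner_proj f hp) := by
  apply Subtype.ext
  refine torus_matrix_ext α fun t => ?_
  change (stab f (loopU α p hp) : Matrix (Fin m) (Fin m) (MappingTorus α)).map _ =
    (loopMat α (corner f p)).map _
  rw [stab_coe, loopU_coe, Matrix.map_add _ (map_add _), corner_map, Matrix.map_sub _ (map_sub _),
    Matrix.map_one _ (map_zero _) (map_one _), Matrix.map_one _ (map_zero _) (map_one _),
    loopMat_eval, loopMat_eval, corner_sub, corner_sub, corner_add, corner_smul]
  abel

theorem joined_loopU {k : ℕ} {p q : Matrix (Fin k) (Fin k) A} (hp : IsStarProjection p)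
    (hq : IsStarProjection q) (hpq : p * q = 0) (h : MvN p q) :
    Joined (loopU α p hp) (loopU α q hq) := by
  obtain ⟨p1, p2⟩ := (isStarProjection_iff_matrix p).1 hp
  obtain ⟨q1, q2⟩ := (isStarProjection_iff_matrix q).1 hq
  obtain ⟨v, h1, h2⟩ := h
  rw [← Matrix.star_eq_conjTranspose] at h1 h2 p2 q2
  -- replace `v` by the partial isometry `q v p`
  set w : Matrix (Fin k) (Fin k) A := q * v * p with hw
  have hsw : star w = p * star v * q := by
    rw [hw, star_mul, star_mul, p2, q2, mul_assoc]
  have e1 : star w * w = p := by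
    rw [hsw, hw]
    calc p * star v * q * (q * v * p) = p * star v * (q * q) * v * p := by simp only [mul_assoc]
      _ = p * (star v * v) * (star v * v) * p := by rw [q1, ← h2]; simp only [mul_assoc]
      _ = p := by rw [h1]; simp only [p1]
  have e2 : w * star w = q := by
    rw [hsw, hw]
    calc q * v * p * (p * star v * q) = q * v * (p * p) * star v * q := by simp only [mul_assoc]
      _ = q * (v * star v) * (v * star v) * q := by rw [p1, ← h1]; simp only [mul_assoc]
      _ = q := by rw [h2]; simp only [q1]
  have e3 : w * star w * w = w := by
    rw [e2, hw, mul_assoc q v p, ← mul_assoc q q, q1]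
  have e4 : w * w = 0 := by
    rw [hw]
    calc q * v * p * (q * v * p) = q * v * (p * q) * v * p := by simp only [mul_assoc]
      _ = 0 := by rw [hpq]; simp
  have hc := swapSymm_conj e3 e4
  rw [e1, e2] at hc
  have hmem := symmPath_mem (swapSymm_star (v := w)) (swapSymm_sq e3 e4)
  let S : ℝ → Matrix (Fin k) (Fin k) A := symmPath (swapSymm w)
  have hS : Continuous S := continuous_symmPath _
  have hproj : ∀ s, IsStarProjection (S s * p * star (S s)) := by
    intro s
    have u1 : star (S s) * S s = 1 := (Unitary.mem_iff.1 (hmem s)).1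
    rw [isStarProjection_iff_matrix, ← Matrix.star_eq_conjTranspose]
    constructor
    · calc S s * p * star (S s) * (S s * p * star (S s))
          = S s * p * (star (S s) * S s) * p * star (S s) := by simp only [mul_assoc]
        _ = S s * (p * p) * star (S s) := by rw [u1]; simp only [mul_assoc, mul_one]
        _ = _ := by rw [p1]
    · rw [star_mul, star_mul, star_star, p2, mul_assoc]
  have hcont : Continuous fun s => loopU α (S s * p * star (S s)) (hproj s) := by
    refine Continuous.subtype_mk ?_ _
    unfold loopMat
    refine continuous_const.add ?_
    exact Continuous.matrix_map (by fun_prop) (continuous_loopElt α)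
  have hj := (PathConnectedSpace.joined (0 : ℝ) 1).map hcont
  have s0 : S 0 * p * star (S 0) = p := by
    simp [S, symmPath_zero]
  have s1 : S 1 * p * star (S 1) = q := by
    simp only [S, symmPath_one, swapSymm_star, hc]
  simpa only [s0, s1] using hj

theorem K1.mk_loopU_eq {n m : ℕ} {p : Matrix (Fin n) (Fin n) A} {q : Matrix (Fin m) (Fin m) A}
    (hp : IsStarProjection p) (hq : IsStarProjection q) (h : MvN p q) :
    K1.mk (loopU α p hp) = K1.mk (loopU α q hq) := by
  rw [← K1.mk_stab (Fin.castAddEmb m) (loopU α p hp), ← K1.mk_stab (Fin.natAddEmb n)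
    (loopU α q hq), stab_loopU, stab_loopU]
  refine K1.mk_eq_of_joined (joined_loopU α _ _ (corner_mul_of_disjoint _ _ ?_ _ _) ?_)
  · intro i j h
    have h1 := congrArg Fin.val h
    have := i.2
    simp only [Fin.natAddEmb_apply, Fin.val_natAdd, Fin.castAddEmb_apply, Fin.val_castAdd] at h1
    omega
  · obtain ⟨v, h1, h2⟩ := h
    set f : Fin n ↪ Fin (n + m) := Fin.castAddEmb m
    set g : Fin m ↪ Fin (n + m) := Fin.natAddEmb n
    refine ⟨injMat A g * v * (injMat A f)ᴴ, ?_, ?_⟩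
    · rw [Matrix.conjTranspose_mul, Matrix.conjTranspose_mul, Matrix.conjTranspose_conjTranspose,
        corner]
      calc _ = injMat A f * (vᴴ * ((injMat A g)ᴴ * injMat A g) * v) * (injMat A f)ᴴ := by
            simp only [Matrix.mul_assoc]
        _ = _ := by rw [injMat_conjTranspose_mul, Matrix.mul_one, h1]
    · rw [Matrix.conjTranspose_mul, Matrix.conjTranspose_mul, Matrix.conjTranspose_conjTranspose,
        corner]
      calc _ = injMat A g * (v * ((injMat A f)ᴴ * injMat A f) * vᴴ) * (injMat A g)ᴴ := by
            simp only [Matrix.mul_assoc]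
        _ = _ := by rw [injMat_conjTranspose_mul, Matrix.mul_one, h2]

theorem dsum_eq_corner {n m : ℕ} (p : Matrix (Fin n) (Fin n) A) (q : Matrix (Fin m) (Fin m) A) :
    dsum p q = corner (Fin.castAddEmb m) p + corner (Fin.natAddEmb n) q := by
  have d1 : ∀ (i : Fin n) (j : Fin m), Fin.castAddEmb m i ≠ Fin.natAddEmb n j := by
    intro i j h
    have h1 := congrArg Fin.val h
    have := i.2
    simp only [Fin.natAddEmb_apply, Fin.val_natAdd, Fin.castAddEmb_apply, Fin.val_castAdd] at h1
    omega
  ext i j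
  obtain ⟨i, rfl⟩ := finSumFinEquiv.surjective i
  obtain ⟨j, rfl⟩ := finSumFinEquiv.surjective j
  rw [Matrix.add_apply]
  rcases i with i | i <;> rcases j with j | j
  · have a1 := corner_apply_apply (Fin.castAddEmb m) p i j
    have a2 := corner_apply_of_left (Fin.natAddEmb n) q (Fin.castAddEmb m i) (Fin.castAddEmb m j)
      (d1 i)
    simp only [Fin.castAddEmb_apply] at a1 a2
    simp [dsum, a1, a2]
  · have a1 := corner_apply_of_right (Fin.castAddEmb m) p (Fin.castAddEmb m i)
      (Fin.natAddEmb n j) (fun k => (d1 k j).symm)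
    have a2 := corner_apply_of_left (Fin.natAddEmb n) q (Fin.castAddEmb m i) (Fin.natAddEmb n j)
      (d1 i)
    simp only [Fin.castAddEmb_apply, Fin.natAddEmb_apply] at a1 a2
    simp [dsum, a1, a2]
  · have a1 := corner_apply_of_left (Fin.castAddEmb m) p (Fin.natAddEmb n i)
      (Fin.castAddEmb m j) (fun k => (d1 k i).symm)
    have a2 := corner_apply_of_right (Fin.natAddEmb n) q (Fin.natAddEmb n i) (Fin.castAddEmb m j)
      (d1 j)
    simp only [Fin.castAddEmb_apply, Fin.natAddEmb_apply] at a1 a2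
    simp [dsum, a1, a2]
  · have a1 := corner_apply_of_left (Fin.castAddEmb m) p (Fin.natAddEmb n i)
      (Fin.natAddEmb n j) (fun k => (d1 k i).symm)
    have a2 := corner_apply_apply (Fin.natAddEmb n) q i j
    simp only [Fin.natAddEmb_apply] at a1 a2
    simp [dsum, a1, a2]

theorem K1.mk_loopU_dsum (p q : Proj A) :
    K1.mk (loopU α (p.add q).p (p.add q).isProj) =
      K1.mk (loopU α p.p p.isProj) + K1.mk (loopU α q.p q.isProj) := by
  have d1 : ∀ (i : Fin p.n) (j : Fin q.n), Fin.castAddEmb q.n i ≠ Fin.natAddEmb p.n j := by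
    intro i j h
    have h1 := congrArg Fin.val h
    have := i.2
    simp only [Fin.natAddEmb_apply, Fin.val_natAdd, Fin.castAddEmb_apply, Fin.val_castAdd] at h1
    omega
  rw [← K1.mk_stab (Fin.castAddEmb q.n) (loopU α p.p p.isProj),
    ← K1.mk_stab (Fin.natAddEmb p.n) (loopU α q.p q.isProj), ← K1.mk_mul, stab_loopU, stab_loopU]
  congr 1
  apply Subtype.ext
  refine torus_matrix_ext α fun t => ?_
  change (loopMat α (dsum p.p q.p)).map _ =
    (loopMat α (corner (Fin.castAddEmb q.n) p.p) * loopMat α (corner (Fin.natAddEmb p.n) q.p)).map _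
  have hz := corner_mul_of_disjoint _ _ d1 p.p q.p
  rw [Matrix.map_mul, loopMat_eval, loopMat_eval, loopMat_eval, dsum_eq_corner]
  simp only [mul_add, mul_sub, add_mul, sub_mul, smul_mul_assoc,
    mul_smul_comm, hz, mul_one, one_mul, smul_add, smul_zero]
  abel_nf

/-- The homomorphism `ι_* : K₀(A) → K₁(M_α)`, `[p] ↦ [t ↦ e^{2πit} p + 1 - p]`. -/
noncomputable def torusι : K0 A →+ K1 (MappingTorus α) :=
  Algebra.GrothendieckAddGroup.lift
    { toFun := Quotient.lift (fun p : Proj A => K1.mk (loopU α p.p p.isProj))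
        (fun p q h => K1.mk_loopU_eq α p.isProj q.isProj h)
      map_zero' := by
        change K1.mk (loopU α (0 : Matrix (Fin 0) (Fin 0) A) _) = 0
        rw [← K1.mk_one (n := 0)]
        congr 1
        exact Subtype.ext (Subsingleton.elim _ _)
      map_add' := by
        rintro ⟨p⟩ ⟨q⟩
        exact K1.mk_loopU_dsum α p q }

theorem torusι_mk (p : Proj A) : torusι α (K0.mk p) = K1.mk (loopU α p.p p.isProj) := by
  rw [torusι, K0.mk]
  have h : ∀ (f : ProjClass A →+ K1 (MappingTorus α)) (x : ProjClass A),
      Algebra.GrothendieckAddGroup.lift f (Algebra.GrothendieckAddGroup.of x) = f x := fun f x =>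
    DFunLike.congr_fun (Algebra.GrothendieckAddGroup.lift.symm_apply_apply f) x
  rw [h]
  rfl

/-- A unitary in `M_n(M_α)` as a matrix-valued function of a real variable (extended to be
constant outside `[0,1]`). -/
noncomputable def torusPath {n : ℕ} (u : UMat (MappingTorus α) n) (t : ℝ) :
    Matrix (Fin n) (Fin n) A :=
  (u : Matrix (Fin n) (Fin n) (MappingTorus α)).map
    (torusEval α (Set.projIcc (0 : ℝ) 1 zero_le_one t))

/-- `f` is piecewise `C¹` on `[0,1]`: there is a finite set `S` such that `f` is `C¹` on every
closed subinterval whose interior does not meet `S`. -/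
def IsPiecewiseC1 (f : ℝ → A) : Prop :=
  ∃ S : Finset ℝ, ∀ a b : ℝ, 0 ≤ a → a < b → b ≤ 1 → (∀ s ∈ S, s ∉ Set.Ioo a b) →
    ContDiffOn ℝ 1 f (Set.Icc a b)

/-- The number `τ(u) = (1 / 2πi) ∫₀¹ τ(u̇(t) u(t)*) dt` for a piecewise `C¹` unitary `u`, where
`τ` is extended to matrices by `τ((a_ij)) = ∑ τ(a_ii)`. -/
noncomputable def rotationNumber {n : ℕ} (u : UMat (MappingTorus α) n) (τ : TracialState A) : ℂ :=
  1 / (2 * Real.pi * Complex.I) * ∫ t in (0 : ℝ)..1, (τ : WeakDual ℂ A)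
    (Matrix.trace ((Matrix.of fun i j => deriv (fun s => torusPath α u s i j) t) *
      star (torusPath α u t)))

/-- `R` is the rotation map of `α`: `R([u])(τ) = τ(u)` for all piecewise `C¹` unitaries `u` in
matrix algebras over `M_α`. -/
def IsRotationMap (R : K1 (MappingTorus α) →+ AffT A) : Prop :=
  ∀ (n : ℕ) (u : UMat (MappingTorus α) n),
    (∀ i j, IsPiecewiseC1 fun t => torusPath α u t i j) →
    ∀ τ : TracialState A,
      (((R (K1.mk u) : C(TracialState A, ℝ)) τ : ℝ) : ℂ) = rotationNumber α u τ

/-- The orderextension `(K₁(M_α), R)` with the maps `ι_*` and `q_*`. -/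
noncomputable def torusOrderExt (R : K1 (MappingTorus α) →+ AffT A)
    (h : IsOrderExt (dimensionMap A) (torusι α) (torusQ α) R) :
    OrderExt (K1 A) (dimensionMap A) where
  E := K1 (MappingTorus α)
  ι := torusι α
  q := torusQ α
  R := R
  isOrderExt := h

end Torus

/-!
For a unitary `u` over the mapping torus `M_α`, a path of unitaries with `α(u(0)) = u(1)`, the
rotation map integrates the logarithmic derivative. For a fine partition this integral is the sum
of `τ(log(u(t_k)* u(t_{k+1})))`, which makes sense for all continuous `u`. Traces of logarithms are
additive near `1` (`trace_log_mul`), so that the sum does not depend on the partition, is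
multiplicative in `u`, and, when `τ` is invariant under `α`, vanishes for `u` near `1`. It
therefore depends on the homotopy class of `u` only (`rotSum_eq_of_joined`), and defines the
rotation map (`exists_isRotationMap`). Every unitary is homotopic to a smooth one, the unitary part
of a polynomial approximation (`exists_joined_piecewiseC1`), which gives uniqueness.

Exactness for `α = 1` is Bott periodicity. Surjectivity (`exists_torusι_add_const`): an invertible
loop is approximated by a polynomial in `z` and `z⁻¹`, linearized at the price of larger matrices,
and the linear pencil `1 + (z - 1) a` is deformed to one with an idempotent coefficient: in a
commutative Banach algebra containing `a`, the function `a ^ N / ((1 - a) ^ N + a ^ N)` is nearly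
idempotent for suitable `N` (`exists_idempotent_pencil`). Injectivity (`torusι_one_injective`) is
deduced from surjectivity over another algebra: a homotopy between the loops `z p + 1 - p` and
`z q + 1 - q` is a single loop of unitaries over the algebra `D` of paths in `M_k(A)` that begin in
the span of `p`, `1 - p` and end in the span of `q`, `1 - q`. Its class is the Bott class of a
difference of projections over `D`, whose ranks at the four characters of `D` given by the end
points are computed by the rotation map of `D` (`exists_proj_paths`). Moving from one end of the
path to the other yields `[p] = [q]`.

Approximately inner automorphisms do not move a loop `c` of unitaries up to homotopy
(`isStablyNull_aut_mul_inv`): on the compact image of `c` the automorphism is close to conjugation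
by a unitary `w`, and `w ⊕ w⁻¹` is homotopic to `1`. Hence a loop represents zero in `K₁(M_α)` if
and only if it is contractible in some `U_k(A)` (`isStablyNull_of_mk_eq_zero`,
`IsStablyNull.mk_eq_zero`), a condition without `α`, and exactness for `α` follows from exactness
for `1`.

The extension for `αβ` is compared with the sum of those for `α` and `β` through the group of
triples `([v], [u], [w])` in which the path `w` over `M_{αβ}` is `u` followed by `α(v)`
(`gluedTriples`). It maps onto both extensions, and the kernel of the map to the sum is mapped to
zero because gluing respects homotopies (`IsGlued.mk_eq_zero`); the rotation maps agree because
they are additive under gluing (`IsRotationMap.apply_isGlued`).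
-/

universe u

/-! ### C*-algebra norms on matrices and on mapping tori -/

section MatrixCStar

variable {ι : Type*} [Fintype ι] [DecidableEq ι] {A : Type u} [CStarAlgebra A]

/-- The C*-algebra norm on `M_ι(A)`: a normed ring whose ring structure and topology are the
usual ones of matrices (the topology is that of entrywise convergence). -/
noncomputable abbrev Matrix.cstarNormedRing : NormedRing (Matrix ι ι A) :=
  letI := CStarAlgebra.spectralOrder A
  letI := CStarAlgebra.spectralOrderedRing A
  { (inferInstance : Ring (Matrix ι ι A)) with
    norm := fun M => ‖CStarMatrix.ofMatrix M‖
    dist := fun M N => dist (CStarMatrix.ofMatrix M) (CStarMatrix.ofMatrix N)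
    dist_self := fun M => dist_self (CStarMatrix.ofMatrix M)
    dist_comm := fun M N => dist_comm (CStarMatrix.ofMatrix M) (CStarMatrix.ofMatrix N)
    dist_triangle := fun M N P => dist_triangle (CStarMatrix.ofMatrix M) (CStarMatrix.ofMatrix N)
      (CStarMatrix.ofMatrix P)
    toUniformSpace := (inferInstance : UniformSpace (Matrix ι ι A))
    uniformity_dist := (inferInstance : PseudoMetricSpace (CStarMatrix ι ι A)).uniformity_dist
    toBornology := (inferInstance : Bornology (CStarMatrix ι ι A))
    cobounded_sets := (inferInstance : PseudoMetricSpace (CStarMatrix ι ι A)).cobounded_sets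
    eq_of_dist_eq_zero := fun {M N} h => eq_of_dist_eq_zero (γ := CStarMatrix ι ι A) h
    dist_eq := fun M N => NormedRing.dist_eq (α := CStarMatrix ι ι A) M N
    norm_mul_le := fun M N => norm_mul_le (α := CStarMatrix ι ι A) M N }

attribute [local instance] Matrix.cstarNormedRing in
/-- The C*-algebra `M_ι(A)`. -/
noncomputable abbrev Matrix.cstarAlgebra : CStarAlgebra (Matrix ι ι A) :=
  letI := CStarAlgebra.spectralOrder A
  letI := CStarAlgebra.spectralOrderedRing A
  { Matrix.cstarNormedRing, (inferInstance : StarRing (Matrix ι ι A)),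
    (inferInstance : Algebra ℂ (Matrix ι ι A)) with
    norm_smul_le := fun r M => norm_smul_le (β := CStarMatrix ι ι A) r M
    norm_mul_self_le := fun M => CStarRing.norm_mul_self_le (E := CStarMatrix ι ι A) M
    star_smul := fun r M => star_smul r M
    complete := (inferInstance : CompleteSpace (CStarMatrix ι ι A)).complete }

end MatrixCStar

section TorusCStar

variable {A : Type u} [CStarAlgebra A] (α : A ≃⋆ₐ[ℂ] A)

theorem isClosed_mappingTorus : IsClosed (mappingTorus α : Set C(unitInterval, A)) := by
  have hα : Continuous α := (NonUnitalStarAlgHom.isometry α α.injective).continuous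
  exact isClosed_eq (hα.comp (continuous_eval_const 0))
    (continuous_eval_const 1)

/-- The mapping torus as a C*-algebra, with the supremum norm. -/
noncomputable abbrev MappingTorus.cstarAlgebra : CStarAlgebra (MappingTorus α) :=
  haveI : IsClosed (mappingTorus α : Set C(unitInterval, A)) := isClosed_mappingTorus α
  inferInstanceAs (CStarAlgebra (mappingTorus α))

end TorusCStar

/-! ### Unitary parts of invertible elements -/

section Polar

variable {E : Type*} [CStarAlgebra E]

/-- The inverse square root of a positive invertible element. -/
noncomputable def invSqrt (h : E) : E := cfc (fun t : ℝ => (Real.sqrt t)⁻¹) h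

theorem spectrum_star_mul_self_pos {x : E} (hx : IsUnit x) :
    spectrum ℝ (star x * x) ⊆ Set.Ioi 0 := by
  intro t ht
  refine lt_of_le_of_ne (spectrum_star_mul_self_nonneg t ht) ?_
  rintro rfl
  exact spectrum.zero_notMem ℝ (hx.star.mul hx) ht

theorem continuousOn_inv_sqrt : ContinuousOn (fun t : ℝ => (Real.sqrt t)⁻¹) (Set.Ioi 0) :=
  Real.continuous_sqrt.continuousOn.inv₀ fun _ ht => (Real.sqrt_pos.2 ht).ne'

theorem isSelfAdjoint_invSqrt (h : E) : IsSelfAdjoint (invSqrt h) := cfc_predicate _ _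

theorem Commute.invSqrt {h p : E} (hp : Commute h p) : Commute (invSqrt h) p :=
  hp.cfc_real _

theorem invSqrt_mul_mul {x : E} (hx : IsUnit x) :
    invSqrt (star x * x) * (star x * x) * invSqrt (star x * x) = 1 := by
  have hs := spectrum_star_mul_self_pos hx
  have hc : ContinuousOn (fun t : ℝ => (Real.sqrt t)⁻¹) (spectrum ℝ (star x * x)) :=
    continuousOn_inv_sqrt.mono hs
  have e1 : invSqrt (star x * x) * (star x * x) =
      cfc (fun t : ℝ => (Real.sqrt t)⁻¹ * t) (star x * x) := by
    rw [cfc_mul (fun t : ℝ => (Real.sqrt t)⁻¹) (fun t => t) _ hc, cfc_id' ℝ (star x * x)]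
    rfl
  rw [e1, invSqrt, ← cfc_mul (fun t : ℝ => (Real.sqrt t)⁻¹ * t) (fun t : ℝ => (Real.sqrt t)⁻¹) _
    (hc.mul continuousOn_id) hc, ← cfc_one ℝ (star x * x)]
  refine cfc_congr fun t ht => ?_
  have h0 : 0 < t := hs ht
  have h1 : Real.sqrt t * Real.sqrt t = t := Real.mul_self_sqrt h0.le
  have h2 : Real.sqrt t ≠ 0 := (Real.sqrt_pos.2 h0).ne'
  simp only [Pi.one_apply]
  field_simp
  exact (Real.sq_sqrt h0.le).symm

/-- The unitary part `x |x|⁻¹` of an invertible element. -/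
noncomputable def polar (x : E) : E := x * invSqrt (star x * x)

theorem polar_mem {x : E} (hx : IsUnit x) : polar x ∈ unitary E := by
  have h1 : star (polar x) * polar x = 1 := by
    rw [polar, star_mul, (isSelfAdjoint_invSqrt _).star_eq, ← mul_assoc, mul_assoc _ (star x) x,
      invSqrt_mul_mul hx]
  have h2 : IsUnit (invSqrt (star x * x)) := by
    have hs := spectrum_star_mul_self_pos hx
    refine (isUnit_cfc_iff _ _ (continuousOn_inv_sqrt.mono hs)).2 fun t ht => ?_
    exact inv_ne_zero (Real.sqrt_pos.2 (hs ht)).ne'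
  have h3 : IsUnit (polar x) := hx.mul h2
  obtain ⟨u, hu⟩ := h3
  rw [Unitary.mem_iff]
  refine ⟨h1, ?_⟩
  rw [← hu] at h1 ⊢
  rw [Units.eq_inv_of_mul_eq_one_right h1]
  simp

theorem polar_of_mem {x : E} (hx : x ∈ unitary E) : polar x = x := by
  rw [polar, (Unitary.mem_iff.1 hx).1, invSqrt, cfc_apply_one]
  simp

theorem continuousOn_polar : ContinuousOn (polar : E → E) {x | IsUnit x} := by
  refine continuousOn_id.mul ?_
  rw [continuousOn_iff_continuous_domRestrict]
  refine Continuous.cfc_of_mem_nhdsSet (s := Set.Ioi 0) _ ?_ (by fun_prop)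
    (fun x => IsSelfAdjoint.star_mul_self _) continuousOn_inv_sqrt
  exact isOpen_Ioi.mem_nhdsSet.2 (Set.iUnion_subset fun x => spectrum_star_mul_self_pos x.2)

/-- The unitary part of an invertible element, as an element of the unitary group. -/
noncomputable def polarU (x : E) (hx : IsUnit x) : unitary E := ⟨polar x, polar_mem hx⟩

theorem joinedIn_polar {x : E} (hx : IsUnit x) : JoinedIn {y : E | IsUnit y} x (polar x) := by
  have hs := spectrum_star_mul_self_pos hx
  refine JoinedIn.ofLine (f := fun s : ℝ => x * ((1 - s) • (1 : E) + s • invSqrt (star x * x)))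
    (by fun_prop) (by simp) (by simp [polar]) ?_
  rintro _ ⟨s, hs01, rfl⟩
  refine hx.mul ?_
  have hc : ContinuousOn (fun t : ℝ => (Real.sqrt t)⁻¹) (spectrum ℝ (star x * x)) :=
    continuousOn_inv_sqrt.mono hs
  have e : (1 - s) • (1 : E) + s • invSqrt (star x * x) =
      cfc (fun t : ℝ => (1 - s) + s * (Real.sqrt t)⁻¹) (star x * x) := by
    rw [cfc_const_add (1 - s) (fun t : ℝ => s * (Real.sqrt t)⁻¹) _ (continuousOn_const.mul hc),
      cfc_const_mul s (fun t : ℝ => (Real.sqrt t)⁻¹) _ hc,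
      Algebra.algebraMap_eq_smul_one]
    rfl
  rw [e]
  refine (isUnit_cfc_iff _ _ (continuousOn_const.add (continuousOn_const.mul hc))).2
    fun t ht => ?_
  have h0 : 0 < (Real.sqrt t)⁻¹ := inv_pos.2 (Real.sqrt_pos.2 (hs ht))
  have h1 := hs01.1
  have h2 := hs01.2
  rcases h1.eq_or_lt with rfl | h1
  · simp
  · have := mul_pos h1 h0
    have : 0 < 1 - s + s * (Real.sqrt t)⁻¹ := by linarith
    exact this.ne'

/-- Unitaries which are connected through invertible elements are connected through unitaries. -/
theorem joined_of_joinedIn_units {u v : unitary E}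
    (h : JoinedIn {y : E | IsUnit y} (u : E) (v : E)) : Joined u v := by
  have hc : Continuous fun x : {y : E | IsUnit y} => polarU x.1 x.2 :=
    Continuous.subtype_mk (continuousOn_iff_continuous_domRestrict.1 continuousOn_polar) _
  have hj := h.joined_subtype.map hc
  have e : ∀ (w : unitary E) (hw : IsUnit (w : E)), polarU (w : E) hw = w := fun w hw =>
    Subtype.ext (polar_of_mem w.2)
  simpa only [e] using hj

theorem JoinedIn.units_mul {E : Type*} [Monoid E] [TopologicalSpace E] [ContinuousMul E]
    {x x' y y' : E} (h : JoinedIn {y : E | IsUnit y} x x')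
    (k : JoinedIn {y : E | IsUnit y} y y') : JoinedIn {y : E | IsUnit y} (x * y) (x' * y') :=
  (h.mul k).mono (by rintro _ ⟨a, ha, b, hb, rfl⟩; exact IsUnit.mul ha hb)

end Polar

section MatrixPolar

variable {ι : Type*} [Fintype ι] [DecidableEq ι] {B : Type u} [CStarAlgebra B]

theorem Matrix.exists_joinedIn_unitary {F : Matrix ι ι B} (hF : IsUnit F) :
    ∃ u : unitary (Matrix ι ι B), JoinedIn {y : Matrix ι ι B | IsUnit y} F u :=
  letI : CStarAlgebra (Matrix ι ι B) := Matrix.cstarAlgebra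
  ⟨polarU F hF, joinedIn_polar hF⟩

theorem Matrix.joined_of_joinedIn_units {u v : unitary (Matrix ι ι B)}
    (h : JoinedIn {y : Matrix ι ι B | IsUnit y} (u : Matrix ι ι B) (v : Matrix ι ι B)) :
    Joined u v :=
  letI : CStarAlgebra (Matrix ι ι B) := Matrix.cstarAlgebra
  _root_.joined_of_joinedIn_units (E := Matrix ι ι B) h

attribute [local instance] Matrix.cstarAlgebra in
theorem UMat.joined_of_norm_sub_lt {n : ℕ} {u v : UMat B n}
    (h : ‖(v - u : Matrix (Fin n) (Fin n) B)‖ < 2) : Joined u v :=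
  Unitary.joined u v h

end MatrixPolar

/-! ### Classes of invertible matrices in `K₁` -/

section Kap

theorem isUnit_stabMat {ι κ : Type*} [Fintype ι] [Fintype κ] [DecidableEq ι] [DecidableEq κ]
    {B : Type*} [Ring B] [StarRing B] (f : ι ↪ κ)
    {F : Matrix ι ι B} (hF : IsUnit F) : IsUnit (stabMat f F) := by
  obtain ⟨⟨F, G, h1, h2⟩, rfl⟩ := hF
  exact ⟨⟨stabMat f F, stabMat f G, by rw [← stabMat_mul, h1, stabMat_one],
    by rw [← stabMat_mul, h2, stabMat_one]⟩, rfl⟩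

variable {ι κ : Type*} [Fintype ι] [Fintype κ] [DecidableEq ι] [DecidableEq κ]
  {B : Type u} [CStarAlgebra B]

omit [Fintype κ] in
theorem continuous_stabMat (f : ι ↪ κ) :
    Continuous (stabMat f : Matrix ι ι B → Matrix κ κ B) := by
  unfold stabMat corner
  fun_prop

theorem JoinedIn.stabMat (f : ι ↪ κ) {F G : Matrix ι ι B}
    (h : JoinedIn {y : Matrix ι ι B | IsUnit y} F G) :
    JoinedIn {y : Matrix κ κ B | IsUnit y} (stabMat f F) (stabMat f G) :=
  (h.map (continuous_stabMat f)).mono (by rintro _ ⟨a, ha, rfl⟩; exact isUnit_stabMat f ha)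

/-- The class in `K₁(B)` of a unitary matrix with arbitrary finite index set. -/
noncomputable def K1.mkU (u : unitary (Matrix ι ι B)) : K1 B :=
  K1.mk (stab (Fintype.equivFin ι).toEmbedding u)

theorem K1.mkU_eq {k : ℕ} (f : ι ↪ Fin k) (u : unitary (Matrix ι ι B)) :
    K1.mkU u = K1.mk (stab f u) := by
  have hf : f = (Fintype.equivFin ι).toEmbedding.trans
      ((Fintype.equivFin ι).symm.toEmbedding.trans f) := by
    ext i
    simp
  rw [hf, ← stab_trans, K1.mk_stab]
  rfl

theorem K1.mkU_fin {n : ℕ} (u : UMat B n) : K1.mkU u = K1.mk u := by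
  rw [K1.mkU_eq (Function.Embedding.refl _), stab_refl]

theorem K1.mkU_stab (f : ι ↪ κ) (u : unitary (Matrix ι ι B)) :
    K1.mkU (stab f u) = K1.mkU u := by
  rw [K1.mkU_eq (f.trans (Fintype.equivFin κ).toEmbedding) u, ← stab_trans, K1.mkU]

theorem K1.mkU_mul (u v : unitary (Matrix ι ι B)) :
    K1.mkU (u * v) = K1.mkU u + K1.mkU v := by
  rw [K1.mkU, map_mul, K1.mk_mul]; rfl

theorem K1.mkU_eq_of_joinedIn {u v : unitary (Matrix ι ι B)}
    (h : JoinedIn {y : Matrix ι ι B | IsUnit y} (u : Matrix ι ι B) v) : K1.mkU u = K1.mkU v :=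
  K1.mk_eq_of_joined (Matrix.joined_of_joinedIn_units
    (u := stab (Fintype.equivFin ι).toEmbedding u)
    (v := stab (Fintype.equivFin ι).toEmbedding v) (h.stabMat _))

open Classical in
/-- The class in `K₁(B)` of an invertible matrix, which is the class of its unitary part. It is
`0` on matrices which are not invertible. -/
noncomputable def K1.cls (F : Matrix ι ι B) : K1 B :=
  if h : IsUnit F then K1.mkU (Matrix.exists_joinedIn_unitary h).choose else 0

theorem K1.cls_eq {F : Matrix ι ι B} {u : unitary (Matrix ι ι B)}
    (h : JoinedIn {y : Matrix ι ι B | IsUnit y} F u) : K1.cls F = K1.mkU u := by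
  have hF : IsUnit F := h.source_mem
  rw [K1.cls, dif_pos hF]
  exact K1.mkU_eq_of_joinedIn ((Matrix.exists_joinedIn_unitary hF).choose_spec.symm.trans h)

theorem K1.cls_unitary (u : unitary (Matrix ι ι B)) :
    K1.cls (u : Matrix ι ι B) = K1.mkU u :=
  K1.cls_eq (JoinedIn.refl ⟨Unitary.toUnits u, rfl⟩)

theorem K1.cls_congr {F G : Matrix ι ι B} (h : JoinedIn {y : Matrix ι ι B | IsUnit y} F G) :
    K1.cls F = K1.cls G := by
  obtain ⟨u, hu⟩ := Matrix.exists_joinedIn_unitary (F := G) h.target_mem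
  rw [K1.cls_eq (h.trans hu), K1.cls_eq hu]

theorem K1.cls_mul {F G : Matrix ι ι B} (hF : IsUnit F) (hG : IsUnit G) :
    K1.cls (F * G) = K1.cls F + K1.cls G := by
  obtain ⟨u, hu⟩ := Matrix.exists_joinedIn_unitary hF
  obtain ⟨v, hv⟩ := Matrix.exists_joinedIn_unitary hG
  rw [K1.cls_eq hu, K1.cls_eq hv, ← K1.mkU_mul]
  exact K1.cls_eq (hu.units_mul hv)

theorem K1.cls_stabMat (f : ι ↪ κ) {F : Matrix ι ι B} (hF : IsUnit F) :
    K1.cls (stabMat f F) = K1.cls F := by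
  obtain ⟨u, hu⟩ := Matrix.exists_joinedIn_unitary hF
  rw [K1.cls_eq hu, ← K1.mkU_stab f]
  exact K1.cls_eq (hu.stabMat f)

theorem K1.cls_one : K1.cls (1 : Matrix ι ι B) = 0 := by
  have := K1.cls_mul (F := (1 : Matrix ι ι B)) (G := 1) isUnit_one isUnit_one
  rw [mul_one] at this
  simpa using this

end Kap

/-! ### Deforming linear pencils to idempotents -/

section Pencil

/-- Averaging over the `N`-th roots of unity, for odd `N`. -/
theorem pow_add_pow_mul_sum_roots {R : Type*} [CommRing R] [Algebra ℂ R] {N : ℕ} (hN : Odd N)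
    {ω : ℂ} (hω : IsPrimitiveRoot ω N) (a c : R) (g : ℕ → R)
    (hg : ∀ j < N, (c + ω ^ j • a) * g j = 1) :
    (c ^ N + a ^ N) * ∑ j ∈ Finset.range N, (ω ^ j • a) * g j = (N : ℂ) • a ^ N := by
  have hN0 : 0 < N := hN.pos
  have key : ∀ j ∈ Finset.range N, (c ^ N + a ^ N) * ((ω ^ j • a) * g j) =
      ∑ i ∈ Finset.range N, (ω ^ (i + 1)) ^ j • ((-1) ^ i * a ^ (i + 1) * c ^ (N - 1 - i)) := by
    intro j hj
    have h1 := geom_sum₂_mul (-(ω ^ j • a)) c N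
    have h2 : (-(ω ^ j • a)) ^ N = -(a ^ N) := by
      rw [hN.neg_pow, smul_pow, ← pow_mul, mul_comm j N, pow_mul, hω.pow_eq_one, one_pow, one_smul]
    rw [h2] at h1
    have h3 := hg j (Finset.mem_range.1 hj)
    have h4 : (c ^ N + a ^ N) * g j =
        ∑ i ∈ Finset.range N, (-(ω ^ j • a)) ^ i * c ^ (N - 1 - i) := by
      linear_combination (g j) * h1 +
        (∑ i ∈ Finset.range N, (-(ω ^ j • a)) ^ i * c ^ (N - 1 - i)) * h3
    calc (c ^ N + a ^ N) * ((ω ^ j • a) * g j) = (ω ^ j • a) * ((c ^ N + a ^ N) * g j) := by ring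
      _ = _ := by
        rw [h4, Finset.mul_sum]
        refine Finset.sum_congr rfl fun i _ => ?_
        rw [neg_pow, smul_pow, ← pow_mul, ← pow_mul, mul_smul_comm, smul_mul_assoc, smul_mul_assoc,
          mul_smul_comm, smul_smul, ← pow_add]
        have e1 : j + j * i = (i + 1) * j := by ring
        rw [e1]
        congr 1
        ring
  rw [Finset.mul_sum, Finset.sum_congr rfl key, Finset.sum_comm]
  have hz : ∀ i ∈ Finset.range N, i ≠ N - 1 →
      ∑ j ∈ Finset.range N, (ω ^ (i + 1)) ^ j • ((-1) ^ i * a ^ (i + 1) * c ^ (N - 1 - i)) =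
        0 := by
    intro i hi hne
    have hi' := Finset.mem_range.1 hi
    rw [← Finset.sum_smul]
    have h1 : ω ^ (i + 1) ≠ 1 := hω.pow_ne_one_of_pos_of_lt (by omega) (by omega)
    have h2 := mul_geom_sum (ω ^ (i + 1)) N
    rw [← pow_mul, mul_comm (i + 1) N, pow_mul, hω.pow_eq_one, one_pow, sub_self] at h2
    rw [(mul_eq_zero.1 h2).resolve_left (sub_ne_zero.2 h1), zero_smul]
  rw [Finset.sum_eq_single_of_mem (N - 1) (Finset.mem_range.2 (by omega)) hz]
  have e1 : N - 1 + 1 = N := by omega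
  have e2 : Even (N - 1) := by
    obtain ⟨k, hk⟩ := hN
    exact ⟨k, by omega⟩
  simp only [e1, hω.pow_eq_one, one_pow, one_smul, e2.neg_one_pow, Nat.sub_self, pow_zero, mul_one,
    one_mul, Finset.sum_const, Finset.card_range]
  rw [← Nat.cast_smul_eq_nsmul ℂ]

/-- Iterating `x ↦ 3x² - 2x³` turns an approximate idempotent into an idempotent. -/
theorem exists_isIdempotentElem_near {R : Type*} [NormedCommRing R] [CompleteSpace R] (x : R)
    (hx : ‖x - x * x‖ ≤ 1 / 16) :
    ∃ e : R, e * e = e ∧ ‖e - x‖ ≤ 2 * (‖x - x * x‖ * ‖2 * x - 1‖) := by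
  let X : ℕ → R := fun k => (fun x => 3 * x ^ 2 - 2 * x ^ 3)^[k] x
  have hX0 : X 0 = x := rfl
  have hX : ∀ k, X (k + 1) = 3 * X k ^ 2 - 2 * X k ^ 3 := fun k =>
    Function.iterate_succ_apply' _ _ _
  set y : R := x - x * x
  set b : R := 2 * x - 1
  have hyk : ∀ k, ‖X k - X k * X k‖ ≤ ‖y‖ * (1 / 4) ^ k := by
    intro k
    induction k with
    | zero => simp [hX0, y]
    | succ k ih =>
      set w := X k - X k * X k with hw
      have e : X (k + 1) - X (k + 1) * X (k + 1) = w * w + w * w + w * w + (w * w * w + w * w * w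
          + w * w * w + w * w * w) := by rw [hX, hw]; ring
      have hw1 : ‖w‖ ≤ 1 / 16 := by
        refine ih.trans ?_
        have : (1 / 4 : ℝ) ^ k ≤ 1 := pow_le_one₀ (by norm_num) (by norm_num)
        nlinarith [norm_nonneg y]
      have h2 : ‖w * w‖ ≤ ‖w‖ * (1 / 16) := (norm_mul_le _ _).trans (by gcongr)
      have h3 : ‖w * w * w‖ ≤ ‖w‖ * (1 / 16) * (1 / 16) :=
        (norm_mul_le _ _).trans (by gcongr)
      have h4 : ‖X (k + 1) - X (k + 1) * X (k + 1)‖ ≤ ‖w‖ * (1 / 4) := by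
        rw [e]
        calc _ ≤ ‖w * w‖ + ‖w * w‖ + ‖w * w‖ + (‖w * w * w‖ + ‖w * w * w‖ + ‖w * w * w‖
            + ‖w * w * w‖) := by
              refine (norm_add_le _ _).trans (add_le_add ?_ ?_)
              · exact norm_add₃_le
              · exact (norm_add_le _ _).trans (add_le_add norm_add₃_le le_rfl)
          _ ≤ _ := by nlinarith [norm_nonneg w]
      calc _ ≤ ‖w‖ * (1 / 4) := h4
        _ ≤ ‖y‖ * (1 / 4) ^ k * (1 / 4) := by gcongr
        _ = _ := by ring
  have hbk : ∀ k, ‖2 * X k - 1‖ ≤ ‖b‖ * 2 ^ k := by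
    intro k
    induction k with
    | zero => simp [hX0, b]
    | succ k ih =>
      set w := X k - X k * X k with hw
      set v := 2 * X k - 1 with hv
      have e : 2 * X (k + 1) - 1 = v + (w * v + w * v) := by rw [hX, hv, hw]; ring
      have hw1 : ‖w‖ ≤ 1 / 16 := by
        refine (hyk k).trans ?_
        have : (1 / 4 : ℝ) ^ k ≤ 1 := pow_le_one₀ (by norm_num) (by norm_num)
        nlinarith [norm_nonneg y]
      have h2 : ‖w * v‖ ≤ 1 / 16 * ‖v‖ := (norm_mul_le _ _).trans (by gcongr)
      calc _ ≤ ‖v‖ + (‖w * v‖ + ‖w * v‖) := by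
            rw [e]
            exact (norm_add_le _ _).trans (add_le_add le_rfl (norm_add_le _ _))
        _ ≤ 2 * ‖v‖ := by nlinarith [norm_nonneg v]
        _ ≤ 2 * (‖b‖ * 2 ^ k) := by gcongr
        _ = _ := by ring
  have hd : ∀ k, dist (X k) (X (k + 1)) ≤ (‖y‖ * ‖b‖) * (1 / 2) ^ k := by
    intro k
    have e : X (k + 1) - X k = (X k - X k * X k) * (2 * X k - 1) := by rw [hX]; ring
    rw [dist_comm, dist_eq_norm, e]
    calc _ ≤ (‖y‖ * (1 / 4) ^ k) * (‖b‖ * 2 ^ k) :=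
          (norm_mul_le _ _).trans (mul_le_mul (hyk k) (hbk k) (norm_nonneg _) (by positivity))
      _ = (‖y‖ * ‖b‖) * ((1 / 4) * 2) ^ k := by rw [mul_pow]; ring
      _ = _ := by norm_num
  obtain ⟨e, he⟩ := cauchySeq_tendsto_of_complete
    (cauchySeq_of_le_geometric (1 / 2) _ (by norm_num) hd)
  refine ⟨e, ?_, ?_⟩
  · have h1 : Filter.Tendsto (fun k => X k - X k * X k) Filter.atTop (nhds (e - e * e)) :=
      he.sub (he.mul he)
    have h2 : Filter.Tendsto (fun k => X k - X k * X k) Filter.atTop (nhds 0) := by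
      refine squeeze_zero_norm hyk ?_
      have := (tendsto_pow_atTop_nhds_zero_of_lt_one (r := (1 / 4 : ℝ)) (by norm_num)
        (by norm_num)).const_mul ‖y‖
      simpa using this
    exact (sub_eq_zero.1 (tendsto_nhds_unique h1 h2)).symm
  · have := dist_le_of_le_geometric_of_tendsto₀ (1 / 2) _ (by norm_num) hd he
    rw [dist_comm, dist_eq_norm, hX0] at this
    refine this.trans (le_of_eq ?_)
    ring

section Comm

variable {R : Type*} [NormedCommRing R] [NormedAlgebra ℂ R] [CompleteSpace R]

/-- By Gelfand theory: at a character, `c ^ N + a ^ N = 0` forces `|c| = |a|`. -/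
theorem isUnit_pow_add_pow {a c : R} (h : ∀ z : ℂ, ‖z‖ = 1 → IsUnit (c + z • a)) {N : ℕ}
    (hN : 0 < N) : IsUnit (c ^ N + a ^ N) := by
  by_contra hu
  obtain ⟨φ, hφ⟩ := WeakDual.CharacterSpace.exists_apply_eq_zero hu
  rw [map_add, map_pow, map_pow] at hφ
  have h1 : ‖φ c‖ = ‖φ a‖ := by
    have h2 : ‖φ c‖ ^ N = ‖φ a‖ ^ N := by
      rw [← norm_pow, ← norm_pow, eq_neg_of_add_eq_zero_left hφ, norm_neg]
    exact (pow_left_inj₀ (norm_nonneg _) (norm_nonneg _) hN.ne').1 h2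
  obtain ⟨z, hz, hz0⟩ : ∃ z : ℂ, ‖z‖ = 1 ∧ φ c + z * φ a = 0 := by
    by_cases ha : φ a = 0
    · refine ⟨1, by simp, ?_⟩
      rw [ha, norm_zero, norm_eq_zero] at h1
      rw [ha, h1]; simp
    · refine ⟨-(φ c / φ a), ?_, by field_simp; ring⟩
      rw [norm_neg, norm_div, h1, div_self (norm_ne_zero_iff.2 ha)]
  have := (h z hz).map φ
  rw [map_add, map_smul, smul_eq_mul, hz0] at this
  exact not_isUnit_zero this

omit [CompleteSpace R] in
theorem smul_mul_inverse_mean {a c : R} {N : ℕ} (hN : Odd N) (g : ℂ → R) {r : ℂ}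
    (h : ∀ z : ℂ, ‖z‖ = ‖r‖ → (c + z • a) * g z = 1) :
    (c ^ N + r ^ N • a ^ N) * ((N : ℂ)⁻¹ • ∑ j ∈ Finset.range N,
        ((Complex.exp (2 * Real.pi * Complex.I / N) ^ j * r) • a) *
          g (Complex.exp (2 * Real.pi * Complex.I / N) ^ j * r)) = r ^ N • a ^ N := by
  have hω := Complex.isPrimitiveRoot_exp N hN.pos.ne'
  have h1 := pow_add_pow_mul_sum_roots hN hω (r • a) c
    (fun j => g (Complex.exp (2 * Real.pi * Complex.I / N) ^ j * r)) (fun j _ => by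
      rw [smul_smul]
      refine h _ ?_
      rw [norm_mul, norm_pow, hω.norm'_eq_one hN.pos.ne', one_pow, one_mul])
  rw [mul_smul_comm]
  simp only [smul_pow, smul_smul] at h1 ⊢
  rw [h1, smul_smul, inv_mul_cancel_left₀ (Nat.cast_ne_zero.2 hN.pos.ne')]

omit [CompleteSpace R] in
theorem norm_mean_le {N : ℕ} (hN : 0 < N) (F : ℕ → R) {C : ℝ} (h : ∀ j, ‖F j‖ ≤ C) :
    ‖(N : ℂ)⁻¹ • ∑ j ∈ Finset.range N, F j‖ ≤ C := by
  have h1 : ‖∑ j ∈ Finset.range N, F j‖ ≤ N * C := by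
    refine (norm_sum_le_of_le _ fun j _ => h j).trans (le_of_eq ?_)
    simp
  rw [norm_smul, norm_inv, Complex.norm_natCast]
  have h2 : (0 : ℝ) < N := Nat.cast_pos.2 hN
  rw [inv_mul_le_iff₀ h2]
  exact h1

/-- If the pencil `c + z a` is invertible on the unit circle and `a + c = 1`, then
`a ^ N / (c ^ N + a ^ N)` is nearly idempotent for suitable large `N`. It is the mean of the
values of `z a (c + z a)⁻¹` over the `N`-th roots of unity; the corresponding means `G₋`, `G₊` over
circles of radii `1 - s < 1 + s` are close to it and satisfy
`(r₊ ^ N - r₋ ^ N) G₋ (1 - G₊) = r₋ ^ N (G₊ - G₋)`. -/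
theorem exists_approx_idempotent {a c : R} (h : ∀ z : ℂ, ‖z‖ = 1 → IsUnit (c + z • a)) :
    ∃ C : ℝ, ∀ η : ℝ, 0 < η → ∃ N : ℕ, 0 < N ∧ ∃ G : R,
      (c ^ N + a ^ N) * G = a ^ N ∧ ‖G‖ ≤ C ∧ ‖G - G * G‖ ≤ η := by
  have hcont : Continuous fun z : ℂ => c + z • a := by fun_prop
  have hopen : IsOpen {z : ℂ | IsUnit (c + z • a)} := Units.isOpen.preimage hcont
  obtain ⟨δ, hδ, hsub⟩ := (isCompact_sphere (0 : ℂ) 1).exists_cthickening_subset_open hopen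
    (fun z hz => h z (mem_sphere_zero_iff_norm.1 hz))
  set K := Metric.cthickening δ (Metric.sphere (0 : ℂ) 1)
  have hK : IsCompact K := (isCompact_sphere (0 : ℂ) 1).cthickening
  set g : ℂ → R := fun z => Ring.inverse (c + z • a)
  have hg : ∀ z ∈ K, (c + z • a) * g z = 1 := fun z hz => Ring.mul_inverse_cancel _ (hsub hz)
  have hgc : ContinuousOn (fun z => (z • a) * g z) K := by
    refine ContinuousOn.mul (by fun_prop) ?_
    intro z hz
    obtain ⟨u, hu⟩ := hsub hz
    have := NormedRing.inverse_continuousAt u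
    rw [hu] at this
    exact (this.comp (f := fun z : ℂ => c + z • a) hcont.continuousAt).continuousWithinAt
  obtain ⟨C, hC⟩ := hK.exists_bound_of_continuousOn hgc
  have huc := Metric.uniformContinuousOn_iff_le.1 (hK.uniformContinuousOn_of_continuous hgc)
  refine ⟨C, fun η hη => ?_⟩
  have hC0 : 0 ≤ C := (norm_nonneg _).trans
    (hC 1 (Metric.self_subset_cthickening _ (by simp)))
  set D : ℝ := 2 + ‖(1 : R)‖ + 2 * C
  have hD : 0 < D := by positivity
  obtain ⟨ε, hε, hε'⟩ := huc (η / D) (div_pos hη hD)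
  set s : ℝ := min (min δ ε) 1 / 2
  have hs : 0 < s := by positivity
  have hsδ : s ≤ δ := by
    have : min (min δ ε) 1 ≤ δ := (min_le_left _ _).trans (min_le_left _ _)
    have := hs.le
    simp only [s] at *
    linarith
  have hsε : s ≤ ε := by
    have : min (min δ ε) 1 ≤ ε := (min_le_left _ _).trans (min_le_right _ _)
    have := hs.le
    simp only [s] at *
    linarith
  have hs1 : s ≤ 1 / 2 := by
    have : min (min δ ε) 1 ≤ 1 := min_le_right _ _
    simp only [s]
    linarith
  obtain ⟨n, hn⟩ := pow_unbounded_of_one_lt (2 : ℝ) (show 1 < 1 + s by linarith)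
  set N := 2 * n + 1 with hNdef
  have hN : Odd N := ⟨n, rfl⟩
  have hN0 : 0 < N := hN.pos
  have hN2 : 2 ≤ (1 + s) ^ N :=
    hn.le.trans (pow_le_pow_right₀ (by linarith) (by omega))
  set ω := Complex.exp (2 * Real.pi * Complex.I / N) with hω
  have hωn : ∀ j : ℕ, ‖ω ^ j‖ = 1 := fun j => by
    rw [norm_pow, (Complex.isPrimitiveRoot_exp N hN0.ne').norm'_eq_one hN0.ne', one_pow]
  -- circles of radius `r` close to `1`
  have hmem : ∀ (r : ℝ), |r - 1| ≤ s → ∀ z : ℂ, ‖z‖ = 1 → z * r ∈ K ∧ dist (z * r) (z * 1) ≤ s := by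
    intro r hr z hz
    have hd : dist (z * r) (z * 1) ≤ s := by
      rw [dist_eq_norm, ← mul_sub, norm_mul, hz, one_mul]
      have : ((r : ℂ) - 1) = ((r - 1 : ℝ) : ℂ) := by push_cast; rfl
      rw [this, Complex.norm_real]
      exact hr
    refine ⟨Metric.mem_cthickening_of_dist_le _ z _ _ (by simpa using hz) ?_, hd⟩
    rw [mul_one] at hd
    exact hd.trans hsδ
  set G : ℝ → R := fun r => (N : ℂ)⁻¹ • ∑ j ∈ Finset.range N, ((ω ^ j * r) • a) * g (ω ^ j * r)
    with hG
  have hGeq : ∀ r : ℝ, |r - 1| ≤ s → (c ^ N + (r : ℂ) ^ N • a ^ N) * G r = (r : ℂ) ^ N • a ^ N := by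
    intro r hr
    refine smul_mul_inverse_mean hN g fun z hz => hg z ?_
    have hr0 : (0 : ℝ) < r := by linarith [(abs_le.1 hr).1]
    have hrc : (r : ℂ) ≠ 0 := Complex.ofReal_ne_zero.2 hr0.ne'
    have := (hmem r hr (z / r) (by rw [norm_div, hz, div_self (norm_ne_zero_iff.2 hrc)])).1
    rwa [div_mul_cancel₀ _ hrc] at this
  have hunit : ∀ r : ℝ, |r - 1| ≤ s → IsUnit (c ^ N + (r : ℂ) ^ N • a ^ N) := by
    intro r hr
    rw [← smul_pow]
    refine isUnit_pow_add_pow (fun z hz => ?_) hN0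
    rw [smul_smul]
    exact hsub (hmem r hr z hz).1
  have hGC : ∀ r : ℝ, |r - 1| ≤ s → ‖G r‖ ≤ C := fun r hr =>
    norm_mean_le hN0 _ fun j => hC _ (hmem r hr _ (hωn j)).1
  have hGd : ∀ r : ℝ, |r - 1| ≤ s → ‖G r - G 1‖ ≤ η / D := by
    intro r hr
    simp only [hG]
    rw [← smul_sub, ← Finset.sum_sub_distrib]
    refine norm_mean_le hN0 _ fun j => ?_
    rw [← dist_eq_norm]
    have h1 := hmem r hr _ (hωn j)
    have h2 := hmem 1 (by simpa using hs.le) _ (hωn j)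
    refine hε' _ h1.1 _ h2.1 ?_
    rw [Complex.ofReal_one]
    exact h1.2.trans hsε
  have a1 : |(1 - s) - 1| ≤ s := by rw [abs_le]; constructor <;> linarith
  have a2 : |(1 + s) - 1| ≤ s := by rw [abs_le]; constructor <;> linarith
  have a3 : |(1 : ℝ) - 1| ≤ s := by simpa using hs.le
  set ρ : ℝ := (1 - s) ^ N with hρ
  set ρ' : ℝ := (1 + s) ^ N with hρ'
  have hρ1 : ρ ≤ 1 := pow_le_one₀ (by linarith) (by linarith)
  have hρ0 : 0 ≤ ρ := pow_nonneg (by linarith) _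
  have key : ((ρ' - ρ : ℝ) : ℂ) • (G (1 - s) * (1 - G (1 + s))) =
      (ρ : ℂ) • (G (1 + s) - G (1 - s)) := by
    refine ((hunit _ a1).mul (hunit _ a2)).mul_left_cancel ?_
    have e1 := hGeq _ a1
    have e2 := hGeq _ a2
    rw [← Complex.ofReal_pow, ← hρ] at e1
    rw [← Complex.ofReal_pow, ← hρ'] at e2
    rw [← Complex.ofReal_pow, ← Complex.ofReal_pow, ← hρ, ← hρ']
    simp only [Algebra.smul_def] at e1 e2 ⊢
    rw [Complex.ofReal_sub, map_sub]
    set P := G (1 - s)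
    set Q := G (1 + s)
    set A := algebraMap ℂ R ρ
    set B := algebraMap ℂ R ρ'
    have e3 : (c ^ N + B * a ^ N) * (1 - Q) = c ^ N := by linear_combination -e2
    linear_combination ((B - A) * ((c ^ N + B * a ^ N) * (1 - Q)) + A * (c ^ N + B * a ^ N)) * e1 +
      ((B - A) * A * a ^ N) * e3 - A * (c ^ N + A * a ^ N) * e2
  have hsmall : ‖G (1 - s) * (1 - G (1 + s))‖ ≤ 2 * (η / D) := by
    have h1 := congrArg norm key
    rw [norm_smul, norm_smul, Complex.norm_real, Complex.norm_real, Real.norm_of_nonneg hρ0,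
      Real.norm_of_nonneg (by linarith)] at h1
    have h2 : ‖G (1 + s) - G (1 - s)‖ ≤ 2 * (η / D) := by
      have : G (1 + s) - G (1 - s) = (G (1 + s) - G 1) - (G (1 - s) - G 1) := by abel
      rw [this, two_mul]
      exact (norm_sub_le _ _).trans (add_le_add (hGd _ a2) (hGd _ a1))
    have h3 := norm_nonneg (G (1 - s) * (1 - G (1 + s)))
    have h4 := norm_nonneg (G (1 + s) - G (1 - s))
    nlinarith
  refine ⟨N, hN0, G 1, by simpa using hGeq 1 a3, hGC 1 a3, ?_⟩
  have e : G 1 - G 1 * G 1 = G (1 - s) * (1 - G (1 + s)) + (-(G (1 - s) - G 1)) * (1 - G 1) +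
      G (1 - s) * (G (1 + s) - G 1) := by ring
  have hη' : 0 ≤ η / D := (div_pos hη hD).le
  have b1 : ‖1 - G 1‖ ≤ ‖(1 : R)‖ + C := (norm_sub_le _ _).trans (add_le_add le_rfl (hGC 1 a3))
  calc ‖G 1 - G 1 * G 1‖ ≤ 2 * (η / D) + (η / D) * (‖(1 : R)‖ + C) + C * (η / D) := by
        rw [e]
        refine norm_add₃_le.trans (add_le_add (add_le_add hsmall ?_) ?_)
        · refine (norm_mul_le _ _).trans (mul_le_mul ?_ b1 (norm_nonneg _) hη')
          rw [norm_neg]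
          exact hGd _ a1
        · exact (norm_mul_le _ _).trans (mul_le_mul (hGC _ a1) (hGd _ a2) (norm_nonneg _) hC0)
    _ = D * (η / D) := by simp only [D]; ring
    _ = η := mul_div_cancel₀ _ hD.ne'

/-- An invertible pencil `1 + (z - 1) a` on the unit circle can be deformed to one for which the
coefficient is idempotent. Characters `φ` see whether `Re φ(a)` is larger or smaller than `1/2`,
and the idempotent is `1` or `0` accordingly. -/
theorem exists_idempotent_pencil_comm {a : R}
    (h : ∀ z : ℂ, ‖z‖ = 1 → IsUnit (1 + (z - 1) • a)) :
    ∃ e : R, e * e = e ∧ ∀ s : ℝ, 0 ≤ s → s ≤ 1 → ∀ z : ℂ, ‖z‖ = 1 →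
      IsUnit (1 + (z - 1) • (((1 - s : ℝ) : ℂ) • a + (s : ℂ) • e)) := by
  set c : R := 1 - a with hc
  have h' : ∀ z : ℂ, ‖z‖ = 1 → IsUnit (c + z • a) := by
    intro z hz
    have : c + z • a = 1 + (z - 1) • a := by rw [hc, sub_smul, one_smul]; abel
    rw [this]
    exact h z hz
  obtain ⟨C, hC⟩ := exists_approx_idempotent h'
  set M : ℝ := 2 * ((2 * max C 0 + ‖(1 : R)‖) * (‖(1 : R)‖ + 1)) + 1 with hM
  have hM0 : 0 < M := by positivity
  set η : ℝ := min (1 / 16) (1 / (4 * M))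
  have hη : 0 < η := by positivity
  obtain ⟨N, hN, G, hG, hGC, hGη⟩ := hC η hη
  obtain ⟨e, he, hed⟩ := exists_isIdempotentElem_near G (hGη.trans (min_le_left _ _))
  have hclose : ‖e - G‖ * ‖(1 : R)‖ < 1 / 2 := by
    have h1 : ‖2 * G - 1‖ ≤ 2 * max C 0 + ‖(1 : R)‖ := by
      refine (norm_sub_le _ _).trans (add_le_add ?_ le_rfl)
      have : ‖2 * G‖ ≤ ‖G‖ + ‖G‖ := by rw [two_mul]; exact norm_add_le _ _
      have := le_max_left C 0
      linarith
    have h2 : ‖e - G‖ ≤ 2 * (η * (2 * max C 0 + ‖(1 : R)‖)) :=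
      hed.trans (by gcongr)
    have h3 : η * M ≤ 1 / 4 := by
      have : η ≤ 1 / (4 * M) := min_le_right _ _
      calc η * M ≤ 1 / (4 * M) * M := by gcongr
        _ = 1 / 4 := by field_simp
    have h4 : 0 ≤ ‖(1 : R)‖ := norm_nonneg _
    have h5 : 0 ≤ max C 0 := le_max_right _ _
    calc ‖e - G‖ * ‖(1 : R)‖ ≤ 2 * (η * (2 * max C 0 + ‖(1 : R)‖)) * ‖(1 : R)‖ := by gcongr
      _ ≤ η * M := by
        rw [hM]
        have : 0 ≤ η * (2 * max C 0 + ‖(1 : R)‖) := by positivity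
        nlinarith
      _ < 1 / 2 := by linarith
  refine ⟨e, he, fun s hs0 hs1 z hz => ?_⟩
  by_contra hu
  obtain ⟨φ, hφ⟩ := WeakDual.CharacterSpace.exists_apply_eq_zero hu
  have hφn : ‖φ e - φ G‖ < 1 / 2 := by
    rw [← map_sub]
    exact (AlgHom.norm_apply_le_self_mul_norm_one φ (e - G)).trans_lt hclose
  have hφe : φ e = 0 ∨ φ e = 1 := by
    have := congrArg φ he
    rw [map_mul] at this
    have : φ e * (φ e - 1) = 0 := by rw [mul_sub, this]; ring
    rcases mul_eq_zero.1 this with h | h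
    · exact Or.inl h
    · exact Or.inr (sub_eq_zero.1 h)
  have hφG : (φ c ^ N + φ a ^ N) * φ G = φ a ^ N := by
    have := congrArg φ hG
    simpa using this
  have hφc : φ c = 1 - φ a := by rw [hc, map_sub, map_one]
  have hnorm : ∀ w : ℂ, ‖1 - w‖ ^ 2 = ‖w‖ ^ 2 + (1 - 2 * w.re) := by
    intro w
    rw [← Complex.normSq_eq_norm_sq, ← Complex.normSq_eq_norm_sq, Complex.normSq_apply,
      Complex.normSq_apply]
    simp
    ring
  -- the pencil at `φ` degenerates, so that `λ = (1 - s) φ(a) + s φ(e)` has real part `1/2`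
  simp only [map_add, map_smul, map_one, smul_eq_mul] at hφ
  set w : ℂ := ((1 - s : ℝ) : ℂ) * φ a + (s : ℂ) * φ e with hw
  have hw1 : ‖1 - w‖ = ‖w‖ := by
    have : 1 - w = -(z * w) := by linear_combination hφ
    rw [this, norm_neg, norm_mul, hz, one_mul]
  have hw2 : w.re = 1 / 2 := by
    have := hnorm w
    rw [hw1] at this
    linarith
  have hwre : w.re = (1 - s) * (φ a).re + s * (φ e).re := by
    rw [hw]; simp
  have hne : ‖φ c‖ ≠ ‖φ a‖ := by
    intro heq
    have hre : ∃ z : ℂ, ‖z‖ = 1 ∧ φ c + z * φ a = 0 := by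
      by_cases ha : φ a = 0
      · refine ⟨1, by simp, ?_⟩
        rw [ha, norm_zero, norm_eq_zero] at heq
        rw [ha, heq]; simp
      · refine ⟨-(φ c / φ a), ?_, by field_simp; ring⟩
        rw [norm_neg, norm_div, heq, div_self (norm_ne_zero_iff.2 ha)]
    obtain ⟨z, hz, hz0⟩ := hre
    have := (h' z hz).map φ
    rw [map_add, map_smul, smul_eq_mul, hz0] at this
    exact not_isUnit_zero this
  have hre := hnorm (φ a)
  rw [← hφc] at hre
  rcases hφe with h0 | h1
  · -- here `|φ(G)| < 1/2`, so that `|φ(c)| > |φ(a)|`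
    have hlt : ‖φ a‖ < ‖φ c‖ := by
      refine lt_of_not_ge fun hle => ?_
      have hap : 0 < ‖φ a‖ := by
        refine lt_of_le_of_ne (norm_nonneg _) fun h0 => hne ?_
        rw [← h0] at hle ⊢
        exact le_antisymm hle (norm_nonneg _)
      have h2 : ‖φ c ^ N + φ a ^ N‖ ≤ 2 * ‖φ a‖ ^ N := by
        refine (norm_add_le _ _).trans ?_
        rw [norm_pow, norm_pow, two_mul]
        gcongr
      have h3 := congrArg norm hφG
      rw [norm_mul, norm_pow] at h3
      rw [h0, zero_sub, norm_neg] at hφn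
      have h4 : 0 < ‖φ a‖ ^ N := pow_pos hap _
      have h5 := mul_le_mul_of_nonneg_right h2 (norm_nonneg (φ G))
      have h6 := norm_nonneg (φ G)
      nlinarith
    rw [h0, Complex.zero_re] at hwre
    have h2 : ‖φ a‖ ^ 2 < ‖φ c‖ ^ 2 := pow_lt_pow_left₀ hlt (norm_nonneg _) two_ne_zero
    have h3 : (φ a).re < 1 / 2 := by linarith
    have h4 : s = 0 := by nlinarith [mul_nonneg (sub_nonneg.2 hs1) (sub_nonneg.2 h3.le)]
    rw [h4] at hwre
    linarith
  · have hlt : ‖φ c‖ < ‖φ a‖ := by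
      refine lt_of_not_ge fun hle => ?_
      have hap : 0 < ‖φ c‖ := by
        refine lt_of_le_of_ne (norm_nonneg _) fun h0 => hne ?_
        rw [← h0] at hle ⊢
        exact (le_antisymm hle (norm_nonneg _)).symm
      have h2 : ‖φ c ^ N + φ a ^ N‖ ≤ 2 * ‖φ c‖ ^ N := by
        refine (norm_add_le _ _).trans ?_
        rw [norm_pow, norm_pow, two_mul]
        gcongr
      have h3 : (φ c ^ N + φ a ^ N) * (1 - φ G) = φ c ^ N := by linear_combination -hφG
      have h3 := congrArg norm h3
      rw [norm_mul, norm_pow] at h3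
      rw [h1] at hφn
      have h4 : 0 < ‖φ c‖ ^ N := pow_pos hap _
      have h5 := mul_le_mul_of_nonneg_right h2 (norm_nonneg (1 - φ G))
      have h6 := norm_nonneg (1 - φ G)
      nlinarith
    rw [h1, Complex.one_re] at hwre
    have h2 : ‖φ c‖ ^ 2 < ‖φ a‖ ^ 2 := pow_lt_pow_left₀ hlt (norm_nonneg _) two_ne_zero
    have h3 : 1 / 2 < (φ a).re := by linarith
    have h4 : s = 0 := by nlinarith [mul_nonneg (sub_nonneg.2 hs1) (sub_nonneg.2 h3.le)]
    rw [h4] at hwre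
    linarith

end Comm

section Noncomm

variable {R : Type*} [NormedRing R] [NormedAlgebra ℂ R] [CompleteSpace R]

/-- The noncommutative case, by restriction to the double commutant of `a`. -/
theorem exists_idempotent_pencil {a : R}
    (h : ∀ z : ℂ, ‖z‖ = 1 → IsUnit (1 + (z - 1) • a)) :
    ∃ e : R, e * e = e ∧ ∀ s : ℝ, 0 ≤ s → s ≤ 1 → ∀ z : ℂ, ‖z‖ = 1 →
      IsUnit (1 + (z - 1) • (((1 - s : ℝ) : ℂ) • a + (s : ℂ) • e)) := by
  let S : Subalgebra ℂ R :=
    Subalgebra.centralizer ℂ (Subalgebra.centralizer ℂ ({a} : Set R) : Set R)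
  have haS : a ∈ S := by
    rw [Subalgebra.mem_centralizer_iff]
    intro g hg
    exact ((Subalgebra.mem_centralizer_iff ℂ).1 hg a rfl).symm
  have hSa : ∀ x ∈ S, x ∈ Subalgebra.centralizer ℂ ({a} : Set R) := by
    intro x hx
    rw [Subalgebra.mem_centralizer_iff]
    rintro g rfl
    refine (Subalgebra.mem_centralizer_iff ℂ).1 hx g ?_
    change g ∈ Subalgebra.centralizer ℂ ({g} : Set R)
    rw [Subalgebra.mem_centralizer_iff]
    rintro _ rfl
    rfl
  have hcomm : ∀ x y : S, x * y = y * x := fun x y =>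
    Subtype.ext ((Subalgebra.mem_centralizer_iff ℂ).1 y.2 x.1 (hSa x.1 x.2))
  have hclosed : IsClosed (S : Set R) := Set.isClosed_centralizer _
  let _ : NormedCommRing S := { (inferInstance : NormedRing S) with mul_comm := hcomm }
  have : CompleteSpace S := hclosed.completeSpace_coe
  have hunit : ∀ x : S, IsUnit (x : R) → IsUnit x := by
    rintro x ⟨u, hu⟩
    have hmem : (↑u⁻¹ : R) ∈ S := by
      rw [Subalgebra.mem_centralizer_iff]
      intro g hg
      have h1 : Commute g (u : R) := by
        rw [hu]
        exact (Subalgebra.mem_centralizer_iff ℂ).1 x.2 g hg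
      exact (h1.units_inv_right).eq
    exact ⟨⟨x, ⟨_, hmem⟩, Subtype.ext (by simp [← hu]), Subtype.ext (by simp [← hu])⟩, rfl⟩
  obtain ⟨e, he, hes⟩ := exists_idempotent_pencil_comm (R := S) (a := ⟨a, haS⟩)
    (fun z hz => hunit _ (h z hz))
  exact ⟨e, congrArg Subtype.val he, fun s h0 h1 z hz => (hes s h0 h1 z hz).map S.val⟩

end Noncomm

/-- Every idempotent `e` of a C*-algebra has the same range as a projection, namely
`e e* (1 + (e - e*)(e* - e))⁻¹`. -/
theorem exists_isStarProjection_of_idempotent {E : Type*} [CStarAlgebra E] {e : E}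
    (he : e * e = e) : ∃ p : E, IsStarProjection p ∧ e * p = p ∧ p * e = e := by
  have he' : star e * star e = star e := by rw [← star_mul, he]
  set z : E := 1 + star (star e - e) * (star e - e) with hz
  have hze : z = 1 - e - star e + e * star e + star e * e := by
    rw [hz, star_sub, star_star, sub_mul, mul_sub, mul_sub, he, he']
    abel
  have hzu : IsUnit z := by
    have h1 : (-1 : ℝ) ∉ spectrum ℝ (star (star e - e) * (star e - e)) := fun h => by
      have := spectrum_star_mul_self_nonneg _ h
      linarith
    rw [spectrum.notMem_iff] at h1
    have h2 : z = -(algebraMap ℝ E (-1) - star (star e - e) * (star e - e)) := by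
      rw [hz, map_neg, map_one]; abel
    rw [h2]
    exact h1.neg
  have c1 : z * e = e * star e * e := by
    rw [hze]
    simp only [add_mul, sub_mul, one_mul, mul_assoc, he]
    abel
  have c2 : e * z = e * star e * e := by
    rw [hze]
    simp only [mul_add, mul_sub, mul_one, ← mul_assoc, he]
    abel
  have hzs : star z = z := by
    rw [hz]; simp
  have c3 : star e * z = z * star e := by
    have := congrArg star (c1.trans c2.symm)
    simpa [hzs] using this
  obtain ⟨u, hu⟩ := hzu
  have k1 : Commute (u : E) e := by rw [hu]; exact c1.trans c2.symm
  have k2 : Commute (u : E) (star e) := by rw [hu]; exact c3.symm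
  have k1' := k1.units_inv_left
  have k2' := k2.units_inv_left
  have hus : star (↑u⁻¹ : E) = ↑u⁻¹ := by
    have h1 : star (u : E) * star (↑u⁻¹ : E) = 1 := by rw [← star_mul]; simp
    rw [hu, hzs, ← hu] at h1
    exact (left_inv_eq_right_inv (Units.inv_mul u) h1).symm
  have c4 : e * star e * e = u * e := by rw [hu, c1]
  refine ⟨e * star e * ↑u⁻¹, ?_, ?_, ?_⟩
  · refine ⟨?_, ?_⟩
    · change e * star e * ↑u⁻¹ * (e * star e * ↑u⁻¹) = _
      calc e * star e * ↑u⁻¹ * (e * star e * ↑u⁻¹)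
          = e * star e * (↑u⁻¹ * e) * star e * ↑u⁻¹ := by simp only [mul_assoc]
        _ = (e * star e * e) * (↑u⁻¹ * star e) * ↑u⁻¹ := by rw [k1'.eq]; simp only [mul_assoc]
        _ = (e * (↑u⁻¹ * (u : E))) * star e * ↑u⁻¹ := by
            rw [c4, k2'.eq, k1.eq]
            have : (u : E) * (star e * ↑u⁻¹) = ↑u⁻¹ * (u : E) * star e := by
              rw [← k2'.eq, Units.inv_mul, one_mul, Units.mul_inv_cancel_left]
            rw [mul_assoc e, this]; simp only [mul_assoc]
        _ = _ := by rw [Units.inv_mul, mul_one]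
    · change star (e * star e * ↑u⁻¹) = _
      rw [star_mul, hus, star_mul, star_star, ← mul_assoc, k1'.eq, mul_assoc, k2'.eq, ← mul_assoc]
  · rw [← mul_assoc, ← mul_assoc, he]
  · rw [mul_assoc, k1'.eq, ← mul_assoc, c4, k1.eq, mul_assoc, Units.mul_inv, mul_one]

end Pencil

/-! ### Approximation by trigonometric polynomials -/

section Trig

variable {V : Type*} [NormedAddCommGroup V] [NormedSpace ℂ V]

/-- The trigonometric polynomial `t ↦ ∑ e^{2πikt} a_k` with coefficients in `V`. -/
noncomputable def trig (a : ℤ →₀ V) (t : ℝ) : V :=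
  a.sum fun k v => Complex.exp (2 * Real.pi * Complex.I * k * t) • v

theorem trig_add (a b : ℤ →₀ V) (t : ℝ) : trig (a + b) t = trig a t + trig b t :=
  Finsupp.sum_add_index' (fun _ => smul_zero _) (fun _ => smul_add _)

theorem trig_finset_sum {σ : Type*} (s : Finset σ) (a : σ → ℤ →₀ V) (t : ℝ) :
    trig (∑ i ∈ s, a i) t = ∑ i ∈ s, trig (a i) t := by
  classical
  induction s using Finset.induction_on with
  | empty => simp [trig]
  | insert i s hi ih => rw [Finset.sum_insert hi, Finset.sum_insert hi, trig_add, ih]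

theorem exists_trig_smul (a : ℤ →₀ ℂ) (v : V) : ∃ b : ℤ →₀ V, ∀ t, trig b t = trig a t • v := by
  refine ⟨a.mapRange (fun c => c • v) (zero_smul _ _), fun t => ?_⟩
  rw [trig, Finsupp.sum_mapRange_index (fun _ => smul_zero _), trig, Finsupp.sum, Finsupp.sum,
    Finset.sum_smul]
  simp only [smul_smul, smul_eq_mul]

/-- Multiplying by a power of `e^{2πit}` removes the terms of negative degree. -/
theorem exists_polynomial_trig (a : ℤ →₀ V) : ∃ (m d : ℕ) (b : ℕ → V), ∀ t : ℝ,
    Complex.exp (2 * Real.pi * Complex.I * t) ^ m • trig a t =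
      ∑ k ∈ Finset.range d, Complex.exp (2 * Real.pi * Complex.I * t) ^ k • b k := by
  classical
  let m : ℕ := a.support.sup Int.natAbs
  have hm : ∀ k ∈ a.support, k.natAbs ≤ m := fun k hk => Finset.le_sup (f := Int.natAbs) hk
  refine ⟨m, 2 * m + 1, fun k => a (k - m), fun t => ?_⟩
  rw [trig, Finsupp.sum, Finset.smul_sum]
  symm
  have hinj : Set.InjOn (fun k : ℕ => (k : ℤ) - m) (Finset.range (2 * m + 1)) := by
    intro x _ y _ h
    simpa using h
  have hexp : ∀ k : ℕ, Complex.exp (2 * Real.pi * Complex.I * t) ^ k =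
      Complex.exp (2 * Real.pi * Complex.I * t) ^ m *
        Complex.exp (2 * Real.pi * Complex.I * ((k : ℤ) - m : ℤ) * t) := by
    intro k
    rw [← Complex.exp_nat_mul, ← Complex.exp_nat_mul, ← Complex.exp_add]
    congr 1
    push_cast
    ring
  have h1 : ∑ k ∈ Finset.range (2 * m + 1), Complex.exp (2 * Real.pi * Complex.I * t) ^ k •
      a ((k : ℤ) - m) = ∑ k ∈ (Finset.range (2 * m + 1)).image (fun k : ℕ => (k : ℤ) - m),
        Complex.exp (2 * Real.pi * Complex.I * t) ^ m •
          Complex.exp (2 * Real.pi * Complex.I * k * t) • a k := by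
    rw [Finset.sum_image hinj]
    refine Finset.sum_congr rfl fun k _ => ?_
    rw [hexp, smul_smul]
  rw [h1]
  symm
  refine Finset.sum_subset ?_ ?_
  · intro k hk
    have := hm k hk
    exact Finset.mem_image.2 ⟨(k + m).toNat, Finset.mem_range.2 (by omega), by omega⟩
  · intro k _ hk
    rw [Finsupp.notMem_support_iff.1 hk, smul_zero, smul_zero]

theorem exists_trig_near_scalar (φ : ℝ → ℂ) (hφ : ContinuousOn φ (Set.Icc 0 1)) (h01 : φ 0 = φ 1)
    {ε : ℝ} (hε : 0 < ε) :
    ∃ a : ℤ →₀ ℂ, ∀ t : ℝ, 0 ≤ t → t ≤ 1 → ‖φ t - trig a t‖ < ε := by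
  have : Fact ((0 : ℝ) < 1) := ⟨one_pos⟩
  have hc := AddCircle.liftIco_continuous (p := (1 : ℝ)) (a := 0) (f := φ) (by rw [zero_add, h01])
    (by rwa [zero_add])
  set Φ : C(AddCircle (1 : ℝ), ℂ) := ⟨_, hc⟩
  have hmem : Φ ∈ (Submodule.span ℂ (Set.range (fourier (T := 1)))).topologicalClosure := by
    rw [span_fourier_closure_eq_top]; trivial
  obtain ⟨g, hg, hgd⟩ := Metric.mem_closure_iff.1 hmem ε hε
  obtain ⟨a, ha⟩ := (Finsupp.mem_span_range_iff_exists_finsupp).1 hg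
  have key : ∀ t : ℝ, 0 ≤ t → t < 1 → ‖φ t - trig a t‖ < ε := by
    intro t h0 h1
    have e1 : Φ (t : AddCircle (1 : ℝ)) = φ t :=
      AddCircle.liftIco_zero_coe_apply ⟨h0, h1⟩
    have e2 : g (t : AddCircle (1 : ℝ)) = trig a t := by
      rw [← ha, trig, Finsupp.sum, Finsupp.sum, ContinuousMap.coe_sum, Finset.sum_apply]
      refine Finset.sum_congr rfl fun k _ => ?_
      rw [ContinuousMap.smul_apply, fourier_coe_apply, Complex.ofReal_one, div_one, smul_eq_mul,
        smul_eq_mul, mul_comm]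
    rw [← e1, ← e2, ← dist_eq_norm]
    exact (ContinuousMap.dist_apply_le_dist _).trans_lt hgd
  refine ⟨a, fun t h0 h1 => ?_⟩
  rcases h1.lt_or_eq with h1 | rfl
  · exact key t h0 h1
  · have e : trig a 1 = trig a 0 := by
      unfold trig
      refine Finsupp.sum_congr fun k _ => ?_
      congr 1
      rw [Complex.ofReal_one, Complex.ofReal_zero, mul_one, mul_zero, Complex.exp_zero,
        mul_comm _ (k : ℂ), Complex.exp_int_mul_two_pi_mul_I]
    rw [← h01, e]
    exact key 0 le_rfl one_pos

/-- Trigonometric polynomials with values in `V` are dense in the continuous `1`-periodic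
functions: the first and the last term of a Bernstein approximation combine to a periodic
function, and the other terms vanish at both ends. -/
theorem exists_trig_near (f : C(unitInterval, V)) (h01 : f 0 = f 1) {ε : ℝ} (hε : 0 < ε) :
    ∃ a : ℤ →₀ V, ∀ t : unitInterval, ‖f t - trig a t‖ < ε := by
  obtain ⟨n, hn1, hn⟩ := (((Metric.tendsto_nhds.1 (bernsteinApproximation_uniform f)) (ε / 2)
    (half_pos hε)).and (Filter.eventually_gt_atTop 0)).exists
  -- the coefficients with the value at `1` moved to `0`
  let β : Fin (n + 1) → ℝ → ℂ := fun k t =>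
    if k = Fin.last n then 0 else if k = 0 then (((1 - t) ^ n + t ^ n : ℝ) : ℂ) else
      ((n.choose k * t ^ (k : ℕ) * (1 - t) ^ (n - k : ℕ) : ℝ) : ℂ)
  have hβc : ∀ k, ContinuousOn (β k) (Set.Icc 0 1) := by
    intro k
    refine Continuous.continuousOn ?_
    simp only [β]
    split_ifs <;> fun_prop
  have hβ01 : ∀ k, β k 0 = β k 1 := by
    intro k
    simp only [β]
    split_ifs with h1 h2
    · rfl
    · simp [hn.ne']
    · have h3 : (k : ℕ) ≠ 0 := fun h => h2 (Fin.ext h)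
      have h4 : n - (k : ℕ) ≠ 0 := by
        have h5 : (k : ℕ) ≠ n := fun h => h1 (Fin.ext h)
        have := k.2
        omega
      simp [h3, h4]
  set M : ℝ := ∑ k : Fin (n + 1), ‖f (bernstein.z k)‖ + 1
  have hM : 0 < M := by positivity
  choose a ha using fun k => exists_trig_near_scalar (β k) (hβc k) (hβ01 k)
    (ε := ε / (2 * M)) (by positivity)
  choose b hb using fun k => exists_trig_smul (a k) (f (bernstein.z k))
  refine ⟨∑ k, b k, fun t => ?_⟩
  rw [trig_finset_sum]
  simp only [hb]
  have hsum : bernsteinApproximation n f t = ∑ k : Fin (n + 1), β k t • f (bernstein.z k) := by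
    have hz0 : bernstein.z (0 : Fin (n + 1)) = 0 := by
      ext; simp [bernstein.z]
    have hz1 : bernstein.z (Fin.last n) = 1 := by
      ext; simp [bernstein.z, hn.ne']
    rw [bernsteinApproximation.apply]
    obtain ⟨n, rfl⟩ : ∃ m, n = m + 1 := ⟨n - 1, by omega⟩
    have e1 : β (Fin.castSucc 0) t = (((1 - t : ℝ) ^ (n + 1) + (t : ℝ) ^ (n + 1) : ℝ) : ℂ) := by
      have h : (Fin.castSucc 0 : Fin (n + 2)) ≠ Fin.last (n + 1) := (Fin.castSucc_lt_last _).ne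
      simp only [β]
      rw [if_neg h]
      simp
    have e2 : β (Fin.last (n + 1)) t = 0 := by simp [β]
    have e3 : ∀ k : Fin n, β (Fin.succ k).castSucc t =
        ((bernstein (n + 1) ((Fin.succ k).castSucc : Fin (n + 2)) t : ℝ) : ℂ) := by
      intro k
      simp only [β]
      rw [if_neg (Fin.castSucc_lt_last _).ne, if_neg, bernstein_apply]
      intro h
      have := congrArg Fin.val h
      simp at this
    have h0 : (Fin.castSucc 0 : Fin (n + 2)) = 0 := rfl
    conv_lhs => rw [Fin.sum_univ_castSucc, Fin.sum_univ_succ, hz1, h0, hz0, ← h01]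
    conv_rhs => rw [Fin.sum_univ_castSucc, Fin.sum_univ_succ, e1, e2, hz1, h0, hz0, ← h01]
    simp only [e3, Complex.coe_smul, bernstein_apply]
    simp
    module
  calc ‖f t - ∑ k, trig (a k) t • f (bernstein.z k)‖
      = ‖(f t - bernsteinApproximation n f t) +
        ∑ k, (β k t - trig (a k) t) • f (bernstein.z k)‖ := by
        congr 1
        rw [hsum]
        simp only [sub_smul, Finset.sum_sub_distrib]
        abel
    _ ≤ ‖f t - bernsteinApproximation n f t‖ +
        ∑ k, ε / (2 * M) * ‖f (bernstein.z k)‖ := by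
        refine (norm_add_le _ _).trans (add_le_add le_rfl ?_)
        refine norm_sum_le_of_le _ fun k _ => ?_
        rw [norm_smul]
        exact mul_le_mul_of_nonneg_right (ha k t t.2.1 t.2.2).le (norm_nonneg _)
    _ < ε / 2 + ε / (2 * M) * M := by
        refine add_lt_add_of_lt_of_le ?_ ?_
        · rw [← dist_eq_norm, dist_comm]
          exact (ContinuousMap.dist_apply_le_dist _).trans_lt hn1
        · rw [← Finset.mul_sum]
          refine mul_le_mul_of_nonneg_left ?_ (by positivity)
          simp only [M]
          linarith
    _ = ε := by field_simp; ring

end Trig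

/-! ### Block matrices -/

section StabMat

theorem stabMat_inl {ι κ B : Type*} [Fintype ι] [DecidableEq ι] [Fintype κ] [DecidableEq κ]
    [Ring B] [StarRing B] (P : Matrix ι ι B) :
    stabMat (Function.Embedding.inl (β := κ)) P = Matrix.fromBlocks P 0 0 1 := by
  have h : corner (Function.Embedding.inl (β := κ)) (P - 1) =
      Matrix.fromBlocks (P - 1) 0 0 0 := by
    ext i j
    rcases i with i | i <;> rcases j with j | j
    · exact corner_apply_apply (Function.Embedding.inl (β := κ)) (P - 1) i j
    · exact corner_apply_of_right _ _ _ _ (by simp)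
    · exact corner_apply_of_left _ _ _ _ (by simp)
    · exact corner_apply_of_right _ _ _ _ (by simp)
  rw [stabMat, h, ← Matrix.fromBlocks_one, Matrix.fromBlocks_add]
  simp

theorem stabMat_inl_add_mul {ι B : Type*} [Fintype ι] [DecidableEq ι] [Ring B] [StarRing B]
    (a : Matrix ι ι B) {q z : Matrix ι ι B} (h : q * z = z * q) :
    stabMat (Function.Embedding.inl (β := ι)) (a + z * q) =
      (1 + Matrix.fromBlocks 0 (-q) 0 0) * (Matrix.fromBlocks a q (-z) 1 *
        (1 + Matrix.fromBlocks 0 0 z 0)) := by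
  rw [stabMat_inl, ← Matrix.fromBlocks_one, Matrix.fromBlocks_add, Matrix.fromBlocks_add,
    Matrix.fromBlocks_multiply, Matrix.fromBlocks_multiply]
  simp [h]

theorem fromBlocks_upper_sq {ι κ B : Type*} [Fintype ι] [Fintype κ] [Ring B] (q : Matrix ι κ B) :
    (Matrix.fromBlocks 0 q 0 0 : Matrix (ι ⊕ κ) (ι ⊕ κ) B) * Matrix.fromBlocks 0 q 0 0 = 0 := by
  rw [Matrix.fromBlocks_multiply]; simp

theorem fromBlocks_lower_sq {ι κ B : Type*} [Fintype ι] [Fintype κ] [Ring B] (q : Matrix κ ι B) :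
    (Matrix.fromBlocks 0 0 q 0 : Matrix (ι ⊕ κ) (ι ⊕ κ) B) * Matrix.fromBlocks 0 0 q 0 = 0 := by
  rw [Matrix.fromBlocks_multiply]; simp

end StabMat

/-! ### Matrices over mapping tori -/

section TorusMatrices

variable {ι κ : Type*} [Fintype ι] [DecidableEq ι] [Fintype κ] [DecidableEq κ]
  {A : Type u} [CStarAlgebra A] (α : A ≃⋆ₐ[ℂ] A)

/-- The value at `t` of a matrix over the mapping torus, as a ring homomorphism. -/
noncomputable def torusEv (t : unitInterval) :
    Matrix ι ι (MappingTorus α) →+* Matrix ι ι A :=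
  (torusEval α t : MappingTorus α →+* A).mapMatrix

omit [Fintype ι] [DecidableEq ι] [Fintype κ] [DecidableEq κ] in
theorem torusMatrix_ext {X Y : Matrix ι κ (MappingTorus α)}
    (h : ∀ t, X.map (torusEval α t) = Y.map (torusEval α t)) : X = Y := by
  ext i j
  apply MappingTorus.toFun_injective α
  ext t
  exact congrFun (congrFun (h t) i) j

theorem torusEv_ext {X Y : Matrix ι ι (MappingTorus α)} (h : ∀ t, torusEv α t X = torusEv α t Y) :
    X = Y := torusMatrix_ext α h

theorem continuous_torusEv_apply (F : Matrix ι ι (MappingTorus α)) :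
    Continuous fun t => torusEv α t F := by
  refine continuous_pi fun i => continuous_pi fun j => ?_
  exact (MappingTorus.toFun α (F i j)).continuous

theorem torusEv_end (F : Matrix ι ι (MappingTorus α)) :
    (torusEv α 0 F).map α = torusEv α 1 F := by
  ext i j
  exact (F i j).2

theorem torusEv_smul (t : unitInterval) (c : ℂ) (F : Matrix ι ι (MappingTorus α)) :
    torusEv α t (c • F) = c • torusEv α t F := by
  ext i j
  exact map_smul (torusEval α t) c (F i j)

theorem torusEv_star (t : unitInterval) (F : Matrix ι ι (MappingTorus α)) :
    torusEv α t (star F) = star (torusEv α t F) := by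
  ext i j
  exact map_star (torusEval α t) (F j i)

/-- The matrix over the mapping torus given by a continuous matrix-valued function. -/
def torusMat (f : C(unitInterval, Matrix ι ι A)) (h : (f 0).map α = f 1) :
    Matrix ι ι (MappingTorus α) :=
  Matrix.of fun i j => ⟨⟨fun t => f t i j, by fun_prop⟩, congrFun (congrFun h i) j⟩

theorem continuous_ringInverse_matrix {X : Type*} [TopologicalSpace X] {f : X → Matrix ι ι A}
    (hf : Continuous f) (h : ∀ x, IsUnit (f x)) : Continuous fun x => Ring.inverse (f x) := by
  let _ : CStarAlgebra (Matrix ι ι A) := Matrix.cstarAlgebra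
  rw [continuous_iff_continuousAt]
  intro x
  obtain ⟨w, hw⟩ := h x
  exact (hw ▸ NormedRing.inverse_continuousAt w : ContinuousAt Ring.inverse (f x)).comp
    hf.continuousAt

/-- A matrix over the mapping torus is invertible if all its values are. -/
theorem isUnit_torus_iff (F : Matrix ι ι (MappingTorus α)) :
    IsUnit F ↔ ∀ t, IsUnit (torusEv α t F) := by
  refine ⟨fun h t => h.map (torusEv α t), fun h => ?_⟩
  have hG : Continuous fun t => Ring.inverse (torusEv α t F) :=
    continuous_ringInverse_matrix (continuous_torusEv_apply α F) h
  have h01 : (Ring.inverse (torusEv α 0 F)).map α = Ring.inverse (torusEv α 1 F) := by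
    have e : (Ring.inverse (torusEv α 0 F)).map α * torusEv α 1 F = 1 := by
      rw [← torusEv_end, ← Matrix.map_mul, Ring.inverse_mul_cancel _ (h 0),
        Matrix.map_one _ (map_zero _) (map_one _)]
    have e2 := Ring.mul_inverse_cancel _ (h 1)
    calc _ = (Ring.inverse (torusEv α 0 F)).map α *
          (torusEv α 1 F * Ring.inverse (torusEv α 1 F)) := by rw [e2, mul_one]
      _ = _ := by rw [← mul_assoc, e, one_mul]
  let G : Matrix ι ι (MappingTorus α) := torusMat α ⟨_, hG⟩ h01
  refine ⟨⟨F, G, torusEv_ext α fun t => ?_, torusEv_ext α fun t => ?_⟩, rfl⟩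
  · rw [map_mul, map_one]
    exact Ring.mul_inverse_cancel _ (h t)
  · rw [map_mul, map_one]
    exact Ring.inverse_mul_cancel _ (h t)

/-- The class in `K₁(M_α)` of an invertible matrix over the mapping torus. -/
noncomputable def torusCls (F : Matrix ι ι (MappingTorus α)) : K1 (MappingTorus α) :=
  let _ := MappingTorus.cstarAlgebra α
  K1.cls F

variable {α}

theorem torusCls_congr {F G : Matrix ι ι (MappingTorus α)}
    (h : JoinedIn {y : Matrix ι ι (MappingTorus α) | IsUnit y} F G) :
    torusCls α F = torusCls α G :=
  let _ := MappingTorus.cstarAlgebra α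
  K1.cls_congr h

theorem torusCls_mul {F G : Matrix ι ι (MappingTorus α)} (hF : IsUnit F) (hG : IsUnit G) :
    torusCls α (F * G) = torusCls α F + torusCls α G :=
  let _ := MappingTorus.cstarAlgebra α
  K1.cls_mul hF hG

theorem torusCls_stabMat (f : ι ↪ κ) {F : Matrix ι ι (MappingTorus α)} (hF : IsUnit F) :
    torusCls α (stabMat f F) = torusCls α F :=
  let _ := MappingTorus.cstarAlgebra α
  K1.cls_stabMat f hF

theorem torusCls_one : torusCls α (1 : Matrix ι ι (MappingTorus α)) = 0 :=
  let _ := MappingTorus.cstarAlgebra α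
  K1.cls_one

theorem torusCls_unitary {n : ℕ} (u : UMat (MappingTorus α) n) :
    torusCls α (u : Matrix (Fin n) (Fin n) (MappingTorus α)) = K1.mk u :=
  let _ := MappingTorus.cstarAlgebra α
  (K1.cls_unitary u).trans (K1.mkU_fin u)

theorem torusCls_congr_segment {F G : Matrix ι ι (MappingTorus α)}
    (h : ∀ t, ∀ s : ℝ, 0 ≤ s → s ≤ 1 →
      IsUnit (((1 - s : ℝ) : ℂ) • torusEv α t F + (s : ℂ) • torusEv α t G)) :
    torusCls α F = torusCls α G := by
  refine torusCls_congr (JoinedIn.ofLine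
    (f := fun s : ℝ => ((1 - s : ℝ) : ℂ) • F + (s : ℂ) • G) (by fun_prop) (by simp) (by simp) ?_)
  rintro _ ⟨s, hs, rfl⟩
  refine (isUnit_torus_iff α _).2 fun t => ?_
  rw [map_add, torusEv_smul, torusEv_smul]
  exact h t s hs.1 hs.2

theorem isUnit_one_add_of_sq {R : Type*} [Ring R] {x : R} (h : x * x = 0) : IsUnit (1 + x) :=
  ⟨⟨1 + x, 1 - x, by simp [mul_sub, add_mul, h], by simp [mul_add, sub_mul, h]⟩, rfl⟩

theorem torusCls_one_add_of_sq {N : Matrix ι ι (MappingTorus α)} (h : N * N = 0) :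
    torusCls α (1 + N) = 0 := by
  rw [← torusCls_one (α := α) (ι := ι)]
  refine torusCls_congr_segment fun t s _ _ => ?_
  have e : ((1 - s : ℝ) : ℂ) • torusEv α t (1 + N) + (s : ℂ) • torusEv α t 1 =
      1 + ((1 - s : ℝ) : ℂ) • torusEv α t N := by
    rw [map_add, map_one]
    push_cast
    module
  rw [e]
  refine isUnit_one_add_of_sq ?_
  rw [smul_mul_smul_comm, ← map_mul, h, map_zero, smul_zero]

end TorusMatrices

/-! ### Bott periodicity: surjectivity -/

section BottSurjective

open scoped Matrix

variable {ι κ : Type*} [Fintype ι] [DecidableEq ι] [Fintype κ] [DecidableEq κ]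
  {A : Type u} [CStarAlgebra A]

variable (A) in
/-- The embedding of `A` into `C(S¹, A)`, the mapping torus of the identity, as the algebra of
constant functions. -/
noncomputable def torusConst : A →⋆ₐ[ℂ] MappingTorus (1 : A ≃⋆ₐ[ℂ] A) where
  toFun a := ⟨ContinuousMap.const _ a, rfl⟩
  map_one' := rfl
  map_mul' _ _ := rfl
  map_zero' := rfl
  map_add' _ _ := rfl
  commutes' _ := rfl
  map_star' _ := rfl

variable (A) in
theorem continuous_torusConst : Continuous (torusConst A) := by
  rw [MappingTorus.continuous_iff]
  exact ContinuousMap.continuous_const'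

/-- The constant matrix-valued function `a`. -/
noncomputable def constMat (a : Matrix ι ι A) : Matrix ι ι (MappingTorus (1 : A ≃⋆ₐ[ℂ] A)) :=
  a.map (torusConst A)

theorem torusEv_constMat (t : unitInterval) (a : Matrix ι ι A) :
    torusEv 1 t (constMat a) = a := rfl

omit [Fintype ι] [DecidableEq ι] in
theorem continuous_constMat : Continuous (constMat : Matrix ι ι A → _) :=
  Continuous.matrix_map continuous_id (continuous_torusConst A)

/-- The number `e^{2πit}`. -/
noncomputable def circleExp (t : unitInterval) : ℂ :=
  Complex.exp (2 * Real.pi * Complex.I * (t : ℝ))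

theorem norm_circleExp (t : unitInterval) : ‖circleExp t‖ = 1 := by
  have : (2 * Real.pi * Complex.I * (t : ℝ) : ℂ) = ((2 * Real.pi * t : ℝ) : ℂ) * Complex.I := by
    push_cast; ring
  rw [circleExp, this, Complex.norm_exp_ofReal_mul_I]

theorem circleExp_zero : circleExp 0 = 1 := by simp [circleExp]

variable (ι A) in
/-- The scalar loop `t ↦ e^{2πit}` in `M_ι(A)`. -/
noncomputable def zMat : Matrix ι ι (MappingTorus (1 : A ≃⋆ₐ[ℂ] A)) :=
  1 + (1 : Matrix ι ι A).map (loopElt 1)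

theorem torusEv_map_loopElt (t : unitInterval) (p : Matrix ι ι A) :
    torusEv 1 t (p.map (loopElt (1 : A ≃⋆ₐ[ℂ] A))) = (circleExp t - 1) • p := by
  ext i j
  exact torusEval_loopElt (1 : A ≃⋆ₐ[ℂ] A) t (p i j)

theorem torusEv_zMat (t : unitInterval) : torusEv 1 t (zMat ι A) = circleExp t • 1 := by
  rw [zMat, map_add, map_one, torusEv_map_loopElt]
  module

theorem isUnit_circleExp_smul (t : unitInterval) : IsUnit (circleExp t • (1 : Matrix ι ι A)) := by
  have h : circleExp t ≠ 0 := by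
    intro h
    have := norm_circleExp t
    simp [h] at this
  exact (isUnit_one (M := Matrix ι ι A)).smul (Units.mk0 _ h)

theorem isUnit_zMat : IsUnit (zMat ι A) :=
  (isUnit_torus_iff _ _).2 fun t => by
    rw [torusEv_zMat]; exact isUnit_circleExp_smul t

theorem torusEv_stabMat (α : A ≃⋆ₐ[ℂ] A) (f : ι ↪ κ) (F : Matrix ι ι (MappingTorus α))
    (t : unitInterval) : torusEv α t (stabMat f F) = stabMat f (torusEv α t F) := by
  have hi : (injMat (MappingTorus α) f).map (torusEval α t) = injMat A f := by
    ext i j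
    rw [Matrix.map_apply, injMat_apply, injMat_apply]
    split_ifs <;> simp
  have hi' : ((injMat (MappingTorus α) f)ᴴ).map (torusEval α t) = (injMat A f)ᴴ := by
    ext i j
    rw [Matrix.map_apply, conjTranspose_injMat_apply, conjTranspose_injMat_apply]
    split_ifs <;> simp
  have hc : ∀ X : Matrix ι ι (MappingTorus α), torusEv α t (corner f X) =
      corner f (torusEv α t X) := by
    intro X
    change (corner f X).map (torusEval α t) = corner f (X.map (torusEval α t))
    rw [corner, Matrix.map_mul, Matrix.map_mul, hi, hi', corner]
  rw [stabMat, map_add, map_one, hc, map_sub, map_one, stabMat]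

variable (A) in
/-- The subgroup of `K₁(C(S¹, A))` generated by the classes of the loops `e^{2πit} p + 1 - p` and
the classes of the constant unitaries. -/
noncomputable def bottRange : AddSubgroup (K1 (MappingTorus (1 : A ≃⋆ₐ[ℂ] A))) :=
  (torusι 1).range ⊔ (K1.map (torusConst A) (continuous_torusConst A)).range

theorem isUnit_constMat {a : Matrix ι ι A} (ha : IsUnit a) : IsUnit (constMat a) :=
  (isUnit_torus_iff _ _).2 fun _ => ha

theorem torusCls_constMat_mem {a : Matrix ι ι A} (ha : IsUnit a) :
    torusCls 1 (constMat a) ∈ bottRange A := by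
  let f := (Fintype.equivFin ι).toEmbedding
  rw [← torusCls_stabMat f (isUnit_constMat ha)]
  have e : stabMat f (constMat a) = constMat (stabMat f a) :=
    torusEv_ext _ fun t => by
      rw [torusEv_stabMat, torusEv_constMat, torusEv_constMat]
  rw [e]
  obtain ⟨v, hv⟩ := Matrix.exists_joinedIn_unitary (isUnit_stabMat f ha)
  refine AddSubgroup.mem_sup_right ⟨K1.mk v, ?_⟩
  rw [K1.map_mk, ← torusCls_unitary]
  refine (torusCls_congr ((hv.map continuous_constMat).mono ?_)).symm
  rintro _ ⟨b, hb, rfl⟩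
  exact isUnit_constMat hb

/-- The pencil `1 + (e^{2πit} - 1) a`. -/
noncomputable def pencil (a : Matrix ι ι A) : Matrix ι ι (MappingTorus (1 : A ≃⋆ₐ[ℂ] A)) :=
  1 + a.map (loopElt 1)

theorem torusEv_pencil (a : Matrix ι ι A) (t : unitInterval) :
    torusEv 1 t (pencil a) = 1 + (circleExp t - 1) • a := by
  rw [pencil, map_add, map_one, torusEv_map_loopElt]

theorem isUnit_one_add_smul_idempotent {R : Type*} [Ring R] [Algebra ℂ R] {e : R} (he : e * e = e)
    {z : ℂ} (hz : z ≠ 0) : IsUnit (1 + (z - 1) • e) := by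
  have h : ∀ z w : ℂ, z * w = 1 → (1 + (z - 1) • e) * (1 + (w - 1) • e) = 1 := by
    intro z w hzw
    have e1 : (1 + (z - 1) • e) * (1 + (w - 1) • e) =
        1 + ((z - 1) + (w - 1) + (z - 1) * (w - 1)) • e := by
      simp only [add_mul, mul_add, smul_mul_assoc, mul_smul_comm, he, one_mul, mul_one]
      module
    have e2 : (z - 1) + (w - 1) + (z - 1) * (w - 1) = 0 := by linear_combination hzw
    rw [e1, e2, zero_smul, add_zero]
  exact ⟨⟨_, _, h z z⁻¹ (mul_inv_cancel₀ hz), h _ _ (inv_mul_cancel₀ hz)⟩, rfl⟩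

theorem circleExp_ne_zero (t : unitInterval) : circleExp t ≠ 0 := Complex.exp_ne_zero _

theorem torusCls_pencil_proj_mem {p : Matrix ι ι A} (hp : IsStarProjection p) :
    torusCls 1 (pencil p) ∈ bottRange A := by
  have hu : IsUnit (pencil p) := (isUnit_torus_iff _ _).2 fun t => by
    rw [torusEv_pencil]
    exact isUnit_one_add_smul_idempotent hp.isIdempotentElem (circleExp_ne_zero t)
  let f := (Fintype.equivFin ι).toEmbedding
  rw [← torusCls_stabMat f hu]
  have hp' : IsStarProjection (corner f p) := by
    rw [isStarProjection_iff_matrix] at *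
    refine ⟨by rw [corner_mul, hp.1], ?_⟩
    have := corner_star f p
    rw [Matrix.star_eq_conjTranspose, Matrix.star_eq_conjTranspose, hp.2] at this
    exact this
  have e : stabMat f (pencil p) = pencil (corner f p) :=
    torusEv_ext _ fun t => by
      rw [torusEv_stabMat, torusEv_pencil, torusEv_pencil, stabMat, add_sub_cancel_left, corner,
        Matrix.mul_smul, Matrix.smul_mul, corner]
  rw [e]
  refine AddSubgroup.mem_sup_left ⟨K0.mk ⟨_, corner f p, hp'⟩, ?_⟩
  rw [torusι_mk, ← torusCls_unitary]
  rfl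

/-- The pencil of `a` is homotopic to that of an idempotent, and this to that of a projection with
the same range. -/
theorem torusCls_pencil_mem {a : Matrix ι ι A}
    (h : ∀ z : ℂ, ‖z‖ = 1 → IsUnit (1 + (z - 1) • a)) : torusCls 1 (pencil a) ∈ bottRange A := by
  let _ : CStarAlgebra (Matrix ι ι A) := Matrix.cstarAlgebra
  obtain ⟨e, he, hs⟩ := exists_idempotent_pencil h
  obtain ⟨p, hp, h1, h2⟩ := exists_isStarProjection_of_idempotent he
  have key : ∀ (b c : Matrix ι ι A) (s : ℝ) (t : unitInterval),
      ((1 - s : ℝ) : ℂ) • torusEv 1 t (pencil b) + (s : ℂ) • torusEv 1 t (pencil c) =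
      1 + (circleExp t - 1) • (((1 - s : ℝ) : ℂ) • b + (s : ℂ) • c) := by
    intro b c s t
    rw [torusEv_pencil, torusEv_pencil]
    push_cast
    module
  have e1 : torusCls 1 (pencil a) = torusCls 1 (pencil e) :=
    torusCls_congr_segment fun t s h0 h1 => by
      rw [key]
      exact hs s h0 h1 _ (norm_circleExp t)
  have e2 : torusCls 1 (pencil e) = torusCls 1 (pencil p) :=
    torusCls_congr_segment fun t s _ _ => by
      rw [key]
      refine isUnit_one_add_smul_idempotent ?_ (circleExp_ne_zero t)
      simp only [add_mul, mul_add, smul_mul_assoc, mul_smul_comm, he, h1, h2,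
        hp.isIdempotentElem.eq]
      push_cast
      module
  rw [e1, e2]
  exact torusCls_pencil_proj_mem hp

/-- Every complex number of modulus one is of the form `e^{2πit}` with `0 ≤ t ≤ 1`. -/
theorem exists_circleExp_eq {z : ℂ} (hz : ‖z‖ = 1) : ∃ t, circleExp t = z := by
  have hpi := Real.pi_pos
  have hz1 : Complex.exp (Complex.arg z * Complex.I) = z := by
    have := Complex.norm_mul_exp_arg_mul_I z
    rwa [hz, Complex.ofReal_one, one_mul] at this
  have h1 := Complex.neg_pi_lt_arg z
  have h2 := Complex.arg_le_pi z
  have hpi' : (Real.pi : ℂ) ≠ 0 := Complex.ofReal_ne_zero.2 hpi.ne'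
  rcases le_or_gt 0 (Complex.arg z) with h | h
  · refine ⟨⟨Complex.arg z / (2 * Real.pi), by positivity, ?_⟩, ?_⟩
    · rw [div_le_one (by positivity)]; linarith
    · have e : (2 * Real.pi * Complex.I * ((Complex.arg z / (2 * Real.pi) : ℝ) : ℂ)) =
          Complex.arg z * Complex.I := by
        push_cast
        field_simp
      change Complex.exp (2 * Real.pi * Complex.I * ((Complex.arg z / (2 * Real.pi) : ℝ) : ℂ)) = z
      rw [e, hz1]
  · refine ⟨⟨Complex.arg z / (2 * Real.pi) + 1, ?_, ?_⟩, ?_⟩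
    · have : -1 ≤ Complex.arg z / (2 * Real.pi) := by
        rw [le_div_iff₀ (by positivity)]; linarith
      linarith
    · have : Complex.arg z / (2 * Real.pi) ≤ 0 :=
        div_nonpos_of_nonpos_of_nonneg h.le (by positivity)
      linarith
    · have e : (2 * Real.pi * Complex.I * ((Complex.arg z / (2 * Real.pi) + 1 : ℝ) : ℂ)) =
          Complex.arg z * Complex.I + 2 * Real.pi * Complex.I := by
        push_cast
        field_simp
      change Complex.exp (2 * Real.pi * Complex.I *
        ((Complex.arg z / (2 * Real.pi) + 1 : ℝ) : ℂ)) = z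
      rw [e, Complex.exp_add, hz1, Complex.exp_two_pi_mul_I, mul_one]

/-- The linear loop `b + z c` is the constant `b + c` times a pencil. -/
theorem torusCls_linear_mem {b c : Matrix ι ι A}
    (h : IsUnit (constMat b + zMat ι A * constMat c)) :
    torusCls 1 (constMat b + zMat ι A * constMat c) ∈ bottRange A := by
  have hev : ∀ t, torusEv 1 t (constMat b + zMat ι A * constMat c) = b + circleExp t • c := by
    intro t
    rw [map_add, map_mul, torusEv_zMat, torusEv_constMat, torusEv_constMat, smul_mul_assoc,
      one_mul]
  rw [isUnit_torus_iff] at h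
  simp only [hev] at h
  have h0 : IsUnit (b + c) := by
    have := h 0
    rwa [circleExp_zero, one_smul] at this
  obtain ⟨w, hw⟩ := h0
  have e1 : ∀ z : ℂ, b + z • c =
      w * (1 + (z - 1) • (((w⁻¹ : (Matrix ι ι A)ˣ) : Matrix ι ι A) * c)) := by
    intro z
    rw [mul_add, mul_smul_comm, Units.mul_inv_cancel_left, mul_one, hw]
    module
  have hp : ∀ z : ℂ, ‖z‖ = 1 →
      IsUnit (1 + (z - 1) • (((w⁻¹ : (Matrix ι ι A)ˣ) : Matrix ι ι A) * c)) := by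
    intro z hz
    obtain ⟨t, rfl⟩ := exists_circleExp_eq hz
    have := h t
    rwa [e1, Units.isUnit_units_mul] at this
  have e : constMat b + zMat ι A * constMat c =
      constMat (w : Matrix ι ι A) * pencil (((w⁻¹ : (Matrix ι ι A)ˣ) : Matrix ι ι A) * c) :=
    torusEv_ext _ fun t => by
      rw [hev, map_mul, torusEv_constMat, torusEv_pencil, e1]
  rw [e, torusCls_mul]
  · exact add_mem (torusCls_constMat_mem w.isUnit) (torusCls_pencil_mem hp)
  · exact (isUnit_torus_iff _ _).2 fun t => w.isUnit
  · refine (isUnit_torus_iff _ _).2 fun t => ?_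
    rw [torusEv_pencil]
    exact hp _ (norm_circleExp t)

/-- The polynomial loop `∑_{k<d} e^{2πikt} a_k`. -/
noncomputable def polyMat (d : ℕ) (a : ℕ → Matrix ι ι A) :
    Matrix ι ι (MappingTorus (1 : A ≃⋆ₐ[ℂ] A)) :=
  ∑ k ∈ Finset.range d, zMat ι A ^ k * constMat (a k)

theorem torusEv_polyMat (d : ℕ) (a : ℕ → Matrix ι ι A) (t : unitInterval) :
    torusEv 1 t (polyMat d a) = ∑ k ∈ Finset.range d, circleExp t ^ k • a k := by
  rw [polyMat, map_sum]
  refine Finset.sum_congr rfl fun k _ => ?_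
  rw [map_mul, map_pow, torusEv_zMat, smul_pow, one_pow, torusEv_constMat, smul_mul_assoc, one_mul]

/-- The coefficients of the polynomial loop `[[a₀, q], [-z, 1]]`, where `q = ∑ z^k a_{k+1}`. -/
def linearized (a : ℕ → Matrix ι ι A) (k : ℕ) : Matrix (ι ⊕ ι) (ι ⊕ ι) A :=
  Matrix.fromBlocks (if k = 0 then a 0 else 0) (a (k + 1)) (if k = 1 then -1 else 0)
    (if k = 0 then 1 else 0)

theorem polyMat_linearized (d : ℕ) (a : ℕ → Matrix ι ι A) :
    polyMat (d + 2) (linearized a) = Matrix.fromBlocks (constMat (a 0))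
      (polyMat (d + 2) fun k => a (k + 1)) (-zMat ι A) 1 := by
  refine torusEv_ext _ fun t => ?_
  have e1 : torusEv 1 t (Matrix.fromBlocks (constMat (a 0))
      (polyMat (d + 2) fun k => a (k + 1)) (-zMat ι A) 1) =
      Matrix.fromBlocks (a 0) (torusEv 1 t (polyMat (d + 2) fun k => a (k + 1)))
        (torusEv 1 t (-zMat ι A)) (torusEv 1 t 1) :=
    Matrix.fromBlocks_map _ _ _ _ _
  rw [e1, torusEv_polyMat, torusEv_polyMat, map_neg, torusEv_zMat, map_one]
  have e2 : ∀ m, ∑ k ∈ Finset.range m, circleExp t ^ k • linearized a k = Matrix.fromBlocks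
      (∑ k ∈ Finset.range m, circleExp t ^ k • (if k = 0 then a 0 else 0))
      (∑ k ∈ Finset.range m, circleExp t ^ k • a (k + 1))
      (∑ k ∈ Finset.range m, circleExp t ^ k • (if k = 1 then -1 else 0))
      (∑ k ∈ Finset.range m, circleExp t ^ k • (if k = 0 then 1 else 0)) := by
    intro m
    induction m with
    | zero => simp [Matrix.fromBlocks_zero]
    | succ m ihm =>
      rw [Finset.sum_range_succ, ihm]
      simp only [Finset.sum_range_succ, linearized, Matrix.fromBlocks_smul, Matrix.fromBlocks_add]
  rw [e2]
  congr 1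
  · rw [Finset.sum_eq_single 0] <;> simp +contextual
  · rw [Finset.sum_eq_single 1] <;> simp +contextual
  · rw [Finset.sum_eq_single 0] <;> simp +contextual

/-- Invertible polynomial loops: the degree is lowered, at the price of doubling the size of the
matrices, by `(a₀ + zq) ⊕ 1 ∼ [[a₀, q], [-z, 1]]`. -/
theorem torusCls_polyMat_mem (d : ℕ) : ∀ (ι : Type) [Fintype ι] [DecidableEq ι]
    (a : ℕ → Matrix ι ι A), IsUnit (polyMat (d + 2) a) →
      torusCls 1 (polyMat (d + 2) a) ∈ bottRange A := by
  induction d with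
  | zero =>
    intro ι _ _ a h
    have e : polyMat (0 + 2) a = constMat (a 0) + zMat ι A * constMat (a 1) := by
      simp [polyMat, Finset.sum_range_succ]
    rw [e] at h ⊢
    exact torusCls_linear_mem h
  | succ d ih =>
    intro ι _ _ a h
    let q := polyMat (d + 2) fun k => a (k + 1)
    let z := zMat ι A
    have hzc : ∀ X : Matrix ι ι (MappingTorus (1 : A ≃⋆ₐ[ℂ] A)), X * z = z * X := fun X =>
      torusEv_ext _ fun t => by
        rw [map_mul, map_mul, torusEv_zMat, mul_smul_comm, smul_mul_assoc, one_mul, mul_one]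
    have hP : polyMat (d + 1 + 2) a = constMat (a 0) + z * q := by
      rw [polyMat, Finset.sum_range_succ', add_comm]
      simp only [pow_zero, one_mul, q, polyMat, Finset.mul_sum, pow_succ', mul_assoc, z]
    let b := linearized a
    have hblock : polyMat (d + 2) b = Matrix.fromBlocks (constMat (a 0)) q (-z) 1 :=
      polyMat_linearized d a
    have hfac : stabMat (Function.Embedding.inl (β := ι)) (polyMat (d + 1 + 2) a) =
        (1 + Matrix.fromBlocks 0 (-q) 0 0) * (polyMat (d + 2) b *
          (1 + Matrix.fromBlocks 0 0 z 0)) := by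
      rw [hP, hblock]
      exact stabMat_inl_add_mul _ (hzc q)
    have n1 := fromBlocks_upper_sq (-q)
    have n2 := fromBlocks_lower_sq z
    have u1 := isUnit_one_add_of_sq n1
    have u2 := isUnit_one_add_of_sq n2
    have u3 : IsUnit (polyMat (d + 2) b) := by
      have h1 := isUnit_stabMat (Function.Embedding.inl (β := ι)) h
      rw [hfac] at h1
      obtain ⟨w1, hw1⟩ := u1
      obtain ⟨w2, hw2⟩ := u2
      rwa [← hw1, ← hw2, Units.isUnit_units_mul, Units.isUnit_mul_units] at h1
    rw [← torusCls_stabMat (Function.Embedding.inl (β := ι)) h, hfac,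
      torusCls_mul u1 (u3.mul u2), torusCls_mul u3 u2, torusCls_one_add_of_sq n1,
      torusCls_one_add_of_sq n2, zero_add, add_zero]
    exact ih _ b u3

theorem torusCls_zMat_pow_mem (m : ℕ) : torusCls 1 (zMat ι A ^ m) ∈ bottRange A := by
  induction m with
  | zero => rw [pow_zero, torusCls_one]; exact zero_mem _
  | succ m ih =>
    rw [pow_succ, torusCls_mul (isUnit_zMat.pow m) isUnit_zMat]
    exact add_mem ih (torusCls_pencil_proj_mem (p := 1) (.one _))

/-- An invertible loop is approximated by a trigonometric polynomial, and multiplication by a power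
of `z` makes that a polynomial. -/
theorem torusCls_mem_bottRange {ι : Type} [Fintype ι] [DecidableEq ι]
    {F : Matrix ι ι (MappingTorus (1 : A ≃⋆ₐ[ℂ] A))} (hF : IsUnit F) :
    torusCls 1 F ∈ bottRange A := by
  let _ : CStarAlgebra (Matrix ι ι A) := Matrix.cstarAlgebra
  have hF' := (isUnit_torus_iff _ _).1 hF
  let f : C(unitInterval, Matrix ι ι A) := ⟨fun t => torusEv 1 t F, continuous_torusEv_apply 1 F⟩
  have hf01 : f 0 = f 1 := torusEv_end 1 F
  have hsub : Set.range f ⊆ {x | IsUnit x} := by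
    rintro _ ⟨t, rfl⟩
    exact hF' t
  obtain ⟨δ, hδ, hδ'⟩ := (isCompact_range f.continuous).exists_thickening_subset_open
    Units.isOpen hsub
  have hnear : ∀ t y, ‖f t - y‖ < δ → IsUnit y := fun t y hy =>
    hδ' (Metric.mem_thickening_iff.2 ⟨f t, ⟨t, rfl⟩, by rwa [dist_comm, dist_eq_norm]⟩)
  obtain ⟨a, ha⟩ := exists_trig_near f hf01 hδ
  obtain ⟨m, d, b, hb⟩ := exists_polynomial_trig a
  have htc : Continuous (trig a) := by
    unfold trig Finsupp.sum
    fun_prop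
  have ht01 : trig a 0 = trig a 1 := by
    unfold trig
    refine Finsupp.sum_congr fun k _ => ?_
    congr 1
    rw [Complex.ofReal_one, Complex.ofReal_zero, mul_one, mul_zero, Complex.exp_zero,
      mul_comm _ (k : ℂ), Complex.exp_int_mul_two_pi_mul_I]
  let G : Matrix ι ι (MappingTorus (1 : A ≃⋆ₐ[ℂ] A)) :=
    torusMat 1 ⟨fun t : unitInterval => trig a t, htc.comp continuous_subtype_val⟩
      (Matrix.ext fun i j => congrFun (congrFun ht01 i) j)
  have hG : ∀ t : unitInterval, torusEv 1 t G = trig a t := fun t => rfl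
  have hGu : IsUnit G := (isUnit_torus_iff _ _).2 fun t => hnear t _ (ha t)
  have e1 : torusCls 1 F = torusCls 1 G := by
    refine torusCls_congr_segment fun t s h0 h1 => hnear t _ ?_
    rw [hG]
    change ‖f t - (((1 - s : ℝ) : ℂ) • f t + (s : ℂ) • trig a t)‖ < δ
    have e : f t - (((1 - s : ℝ) : ℂ) • f t + (s : ℂ) • trig a t) =
        (s : ℂ) • (f t - trig a t) := by
      push_cast
      module
    rw [e, norm_smul, Complex.norm_real, Real.norm_of_nonneg h0]
    exact (mul_le_of_le_one_left (norm_nonneg _) h1).trans_lt (ha t)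
  -- two vanishing coefficients are appended to reach the form of `torusCls_polyMat_mem`
  let b' : ℕ → Matrix ι ι A := fun k => if k < d then b k else 0
  have e2 : zMat ι A ^ m * G = polyMat (d + 2) b' := by
    refine torusEv_ext _ fun t => ?_
    rw [map_mul, map_pow, torusEv_zMat, smul_pow, one_pow, smul_mul_assoc, one_mul,
      torusEv_polyMat, hG]
    refine (hb t).trans ?_
    have h1 : ∑ k ∈ Finset.range d, circleExp t ^ k • b k =
        ∑ k ∈ Finset.range d, circleExp t ^ k • b' k :=
      Finset.sum_congr rfl fun k hk => by simp only [b', if_pos (Finset.mem_range.1 hk)]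
    refine h1.trans ?_
    simp [Finset.sum_range_succ, b']
  have h3 : torusCls 1 (zMat ι A ^ m * G) ∈ bottRange A := by
    have hu : IsUnit (zMat ι A ^ m * G) := (isUnit_zMat.pow m).mul hGu
    rw [e2] at hu ⊢
    exact torusCls_polyMat_mem d ι b' hu
  rw [torusCls_mul (isUnit_zMat.pow m) hGu] at h3
  rw [e1]
  exact (AddSubgroup.add_mem_cancel_left _ (torusCls_zMat_pow_mem m)).1 h3

/-- The surjectivity part of Bott periodicity. -/
theorem exists_torusι_add_const (x : K1 (MappingTorus (1 : A ≃⋆ₐ[ℂ] A))) :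
    ∃ y c, x = torusι 1 y + K1.map (torusConst A) (continuous_torusConst A) c := by
  induction x using K1.ind with
  | h n v =>
    have h : K1.mk v ∈ bottRange A := by
      rw [← torusCls_unitary]
      exact torusCls_mem_bottRange ⟨Unitary.toUnits v, rfl⟩
    obtain ⟨_, ⟨y, rfl⟩, _, ⟨c, rfl⟩, hyc⟩ := AddSubgroup.mem_sup.1 h
    exact ⟨y, c, hyc.symm⟩

end BottSurjective

/-! ### Traces of logarithms -/

section LogSeries

/-- The series `∑ (-1)^k x^(k+1) / (k+1)` of `log (1 + x)`. -/
noncomputable def logSeries {E : Type*} [Ring E] [Algebra ℂ E] [TopologicalSpace E] (x : E) : E :=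
  ∑' k : ℕ, ((-1 : ℂ) ^ k / (k + 1)) • x ^ (k + 1)

variable {E : Type*} [NormedRing E] [NormedAlgebra ℂ E] [CompleteSpace E]

theorem norm_logCoeff_le (k : ℕ) : ‖((-1 : ℂ) ^ k / (k + 1))‖ ≤ 1 := by
  have h : ‖((k : ℂ) + 1)‖ = k + 1 := by
    rw [← Nat.cast_succ, Complex.norm_natCast, Nat.cast_succ]
  rw [norm_div, norm_pow, norm_neg, norm_one, one_pow, h]
  exact div_le_one_of_le₀ (by linarith [(Nat.cast_nonneg k : (0 : ℝ) ≤ k)]) (by positivity)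

theorem summable_logSeries {x : E} (hx : ‖x‖ < 1) :
    Summable fun k : ℕ => ((-1 : ℂ) ^ k / (k + 1)) • x ^ (k + 1) := by
  refine Summable.of_norm_bounded ((summable_geometric_of_lt_one (norm_nonneg x) hx).mul_left ‖x‖)
    fun k => ?_
  rw [norm_smul, ← pow_succ']
  calc _ ≤ 1 * ‖x‖ ^ (k + 1) := mul_le_mul (norm_logCoeff_le k) (norm_pow_le' x k.succ_pos)
        (norm_nonneg _) zero_le_one
    _ = _ := one_mul _

theorem map_logSeries (φ : E →L[ℂ] ℂ) {x : E} (hx : ‖x‖ < 1) :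
    φ (logSeries x) = ∑' k : ℕ, ((-1 : ℂ) ^ k / (k + 1)) * φ (x ^ (k + 1)) := by
  rw [logSeries, φ.map_tsum (summable_logSeries hx)]
  simp

omit [CompleteSpace E] in
theorem hasFDerivAt_trace_pow (φ : E →L[ℂ] ℂ) (hφ : ∀ a b, φ (a * b) = φ (b * a)) (k : ℕ) (x : E) :
    HasFDerivAt (fun x => φ (x ^ (k + 1)))
      (((k : ℂ) + 1) • φ.comp (ContinuousLinearMap.mul ℂ E (x ^ k))) x := by
  have h := φ.hasFDerivAt.comp x (hasFDerivAt_pow' (𝕜 := ℂ) (k + 1) (x := x))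
  refine h.congr_fderiv ?_
  ext v
  have e : ∀ i ∈ Finset.range (k + 1), φ (x ^ (k - i) * (v * x ^ i)) = φ (x ^ k * v) := by
    intro i hi
    have hi' : i + (k - i) = k := by have := Finset.mem_range.1 hi; omega
    rw [← mul_assoc, hφ, ← mul_assoc, ← pow_add, hi']
  simp only [Nat.pred_succ]
  simp [map_sum, mul_assoc]
  refine (Finset.sum_congr rfl e).trans ?_
  simp

/-- The derivative of `x ↦ φ (log (1 + x))` at `x` is `v ↦ φ ((1 + x)⁻¹ v)`, if `φ` is tracial. -/
theorem hasFDerivAt_trace_logSeries (φ : E →L[ℂ] ℂ) (hφ : ∀ a b, φ (a * b) = φ (b * a)) {x : E}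
    (hx : ‖x‖ < 1) : HasFDerivAt (fun x => φ (logSeries x))
      (φ.comp (ContinuousLinearMap.mul ℂ E (∑' k : ℕ, (-x) ^ k))) x := by
  obtain ⟨r, hr, hr1⟩ := exists_between hx
  have hr0 : 0 < r := (norm_nonneg x).trans_lt hr
  let f : ℕ → E → ℂ := fun k x => ((-1 : ℂ) ^ k / (k + 1)) * φ (x ^ (k + 1))
  let f' : ℕ → E → (E →L[ℂ] ℂ) := fun k x => φ.comp (ContinuousLinearMap.mul ℂ E ((-x) ^ k))
  have hpow : ∀ (k : ℕ) (y v : E), ‖y ^ k * v‖ ≤ ‖y‖ ^ k * ‖v‖ := by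
    intro k
    induction k with
    | zero => intro y v; simp
    | succ k ih =>
      intro y v
      rw [pow_succ, mul_assoc, pow_succ, mul_assoc]
      exact (ih y _).trans (mul_le_mul_of_nonneg_left (norm_mul_le _ _) (by positivity))
  have hf : ∀ n y, y ∈ Metric.ball (0 : E) r → HasFDerivAt (f n) (f' n y) y := by
    intro n y _
    refine ((hasFDerivAt_trace_pow φ hφ n y).const_mul ((-1 : ℂ) ^ n / (n + 1))).congr_fderiv ?_
    ext v
    have hn : (n : ℂ) + 1 ≠ 0 := Nat.cast_add_one_ne_zero n
    have e1 : (-y) ^ n = ((-1 : ℂ) ^ n) • y ^ n := by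
      rw [← smul_pow, neg_one_smul]
    simp only [f', smul_apply, ContinuousLinearMap.comp_apply,
      ContinuousLinearMap.mul_apply', e1, map_smul, smul_eq_mul]
    field_simp
  have hf' : ∀ n y, y ∈ Metric.ball (0 : E) r → ‖f' n y‖ ≤ ‖φ‖ * r ^ n := by
    intro n y hy
    have hy' : ‖y‖ ≤ r := (mem_ball_zero_iff.1 hy).le
    refine ContinuousLinearMap.opNorm_le_bound _ (by positivity) fun v => ?_
    simp only [f', ContinuousLinearMap.comp_apply, ContinuousLinearMap.mul_apply']
    refine (φ.le_opNorm _).trans ?_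
    rw [mul_assoc]
    refine mul_le_mul_of_nonneg_left ((hpow n _ v).trans ?_) (norm_nonneg _)
    rw [norm_neg]
    gcongr
  have hsum : Summable fun n => ‖φ‖ * r ^ n := (summable_geometric_of_lt_one hr0.le hr1).mul_left _
  have hxr : x ∈ Metric.ball (0 : E) r := mem_ball_zero_iff.2 hr
  have h := hasFDerivAt_tsum_of_isPreconnected hsum Metric.isOpen_ball
    (convex_ball (0 : E) r).isPreconnected hf hf' (Metric.mem_ball_self hr0) (by
      simp [f]) hxr
  have heq : (fun y => ∑' n, f n y) =ᶠ[nhds x] fun y => φ (logSeries y) := by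
    filter_upwards [Metric.isOpen_ball.mem_nhds hxr] with y hy
    exact (map_logSeries φ ((mem_ball_zero_iff.1 hy).trans hr1)).symm
  refine (h.congr_of_eventuallyEq heq.symm).congr_fderiv ?_
  have hgs : Summable fun k : ℕ => (-x) ^ k :=
    summable_geometric_of_norm_lt_one (x := -x) (by rwa [norm_neg])
  have hs2 : Summable fun n => f' n x := Summable.of_norm_bounded hsum fun n => hf' n x hxr
  ext v
  rw [ContinuousLinearMap.comp_apply, ContinuousLinearMap.mul_apply',
    ← hgs.tsum_mul_right, φ.map_tsum (hgs.mul_right v)]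
  exact (ContinuousLinearMap.apply ℂ ℂ v).map_tsum hs2

/-- The derivative of `t ↦ φ (log γ(t))` is `φ (γ⁻¹ γ')`. -/
theorem hasDerivAt_trace_log (φ : E →L[ℂ] ℂ) (hφ : ∀ a b, φ (a * b) = φ (b * a)) {γ : ℝ → E}
    {t : ℝ} {γ' w : E} (hγ : HasDerivAt γ γ' t) (h1 : ‖γ t - 1‖ < 1) (hw : w * γ t = 1) :
    HasDerivAt (fun s => φ (logSeries (γ s - 1))) (φ (w * γ')) t := by
  have h := ((hasFDerivAt_trace_logSeries φ hφ h1).restrictScalars ℝ).comp_hasDerivAt t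
    (hγ.sub_const 1)
  refine h.congr_deriv ?_
  have e : ∑' k : ℕ, (-(γ t - 1)) ^ k = w := by
    have h2 := mul_neg_geom_series (-(γ t - 1)) (by rwa [norm_neg])
    rw [sub_neg_eq_add, add_sub_cancel] at h2
    calc _ = w * γ t * ∑' k : ℕ, (-(γ t - 1)) ^ k := by rw [hw, one_mul]
      _ = w := by rw [mul_assoc, h2, mul_one]
  change φ ((∑' k : ℕ, (-(γ t - 1)) ^ k) * γ') = φ (w * γ')
  rw [e]

omit [CompleteSpace E] in
theorem logSeries_zero : logSeries (0 : E) = 0 := by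
  simp [logSeries]

/-- Additivity of the trace of the logarithm: along the segment `w` from `1` to `v`, the traces of
`log (u w)` and of `log w` have the same derivative. -/
theorem trace_log_mul (φ : E →L[ℂ] ℂ) (hφ : ∀ a b, φ (a * b) = φ (b * a)) {u v : E}
    (hu : ‖u - 1‖ ≤ 1 / 4) (hv : ‖v - 1‖ ≤ 1 / 4) :
    φ (logSeries (u * v - 1)) = φ (logSeries (u - 1)) + φ (logSeries (v - 1)) := by
  let w : ℝ → E := fun t => 1 + t • (v - 1)
  have hw : ∀ t, HasDerivAt w (v - 1) t := by
    intro t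
    have := ((hasDerivAt_id t).smul_const (v - 1)).const_add 1
    simpa [w] using this
  have hinv : ∀ x : E, ‖x - 1‖ < 1 → ∃ y, y * x = 1 ∧ x * y = 1 := by
    intro x hx
    have hx' : ‖-(x - 1)‖ < 1 := by rwa [norm_neg]
    have h1 := geom_series_mul_neg _ hx'
    have h2 := mul_neg_geom_series _ hx'
    rw [sub_neg_eq_add, add_sub_cancel] at h1 h2
    exact ⟨_, h1, h2⟩
  have hwn : ∀ t ∈ Set.Icc (0 : ℝ) 1, ‖w t - 1‖ ≤ 1 / 4 := by
    intro t ht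
    simp only [w, add_sub_cancel_left, norm_smul, Real.norm_of_nonneg ht.1]
    exact (mul_le_of_le_one_left (norm_nonneg _) ht.2).trans hv
  have huwn : ∀ t ∈ Set.Icc (0 : ℝ) 1, ‖u * w t - 1‖ < 1 := by
    intro t ht
    have e : u * w t - 1 = (u - 1) * (w t - 1) + ((u - 1) + (w t - 1)) := by noncomm_ring
    rw [e]
    have h1 := norm_mul_le (u - 1) (w t - 1)
    have h2 := hwn t ht
    have h3 : ‖u - 1‖ * ‖w t - 1‖ ≤ 1 / 4 * (1 / 4) :=
      mul_le_mul hu h2 (norm_nonneg _) (by norm_num)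
    calc _ ≤ ‖(u - 1) * (w t - 1)‖ + (‖u - 1‖ + ‖w t - 1‖) :=
          (norm_add_le _ _).trans (add_le_add le_rfl (norm_add_le _ _))
      _ < 1 := by linarith
  obtain ⟨u', hu1, hu2⟩ := hinv u (hu.trans_lt (by norm_num))
  have hd : ∀ t ∈ Set.Icc (0 : ℝ) 1, HasDerivAt
      (fun s => φ (logSeries (u * w s - 1)) - φ (logSeries (w s - 1))) 0 t := by
    intro t ht
    obtain ⟨y, hy, -⟩ := hinv (w t) ((hwn t ht).trans_lt (by norm_num))
    have d1 := hasDerivAt_trace_log φ hφ ((hw t).const_mul u) (huwn t ht) (w := y * u') (by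
      rw [mul_assoc, ← mul_assoc u', hu1, one_mul, hy])
    have d2 := hasDerivAt_trace_log φ hφ (hw t) ((hwn t ht).trans_lt (by norm_num)) hy
    refine (d1.sub d2).congr_deriv ?_
    rw [mul_assoc, ← mul_assoc u', hu1, one_mul, sub_self]
  have hc := constant_of_has_deriv_right_zero (a := 0) (b := 1)
    (fun t ht => (hd t ht).continuousAt.continuousWithinAt)
    (fun t ht => (hd t ⟨ht.1, ht.2.le⟩).hasDerivWithinAt) 1 ⟨zero_le_one, le_rfl⟩
  simp only [w, one_smul, add_sub_cancel, zero_smul, add_zero, mul_one, sub_self, logSeries_zero,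
    map_zero, sub_zero] at hc
  rw [← hc]
  ring

theorem trace_log_conj (φ : E →L[ℂ] ℂ) (hφ : ∀ a b, φ (a * b) = φ (b * a)) {u g g' : E}
    (h : g * g' = 1) (h' : g' * g = 1) (h1 : ‖u - 1‖ < 1) (h2 : ‖g' * u * g - 1‖ < 1) :
    φ (logSeries (g' * u * g - 1)) = φ (logSeries (u - 1)) := by
  rw [map_logSeries φ h1, map_logSeries φ h2]
  refine tsum_congr fun k => ?_
  have e : ∀ n, (g' * u * g - 1) ^ n = g' * (u - 1) ^ n * g := by
    have e0 : g' * u * g - 1 = g' * (u - 1) * g := by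
      rw [mul_sub, sub_mul, mul_one, h']
    intro n
    rw [e0]
    induction n with
    | zero => simp [h']
    | succ n ih =>
      rw [pow_succ, ih, pow_succ]
      calc _ = g' * (u - 1) ^ n * (g * g') * (u - 1) * g := by simp only [mul_assoc]
        _ = _ := by rw [h, mul_one]; simp only [mul_assoc]
  rw [e, hφ, ← mul_assoc, h, one_mul]

end LogSeries

/-! ### Sums of logarithms along paths of unitaries -/

section LogSum

variable {E : Type*} [CStarAlgebra E]

/-- The number `φ (log (γ(s)* γ(t)))` for a path `γ` of unitaries. -/
noncomputable def logStep (φ : E →L[ℂ] ℂ) (γ : ℝ → E) (s t : ℝ) : ℂ :=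
  φ (logSeries (star (γ s) * γ t - 1))

/-- The sum of the logarithms of the increments `γ(k/N)* γ((k+1)/N)`. -/
noncomputable def logSum {E : Type*} [Ring E] [StarRing E] [Algebra ℂ E] [TopologicalSpace E]
    (N : ℕ) (γ : ℝ → E) : E :=
  ∑ k ∈ Finset.range N, logSeries (star (γ (k / N)) * γ ((k + 1) / N) - 1)

/-- The increments of `γ` over intervals of length at most `1 / N` are small. The bound `1 / 16`
leaves room for products of a few increments to stay where `trace_log_mul` applies. -/
def IsFine (N : ℕ) (γ : ℝ → E) : Prop :=
  0 < N ∧ ∀ s t : ℝ, |s - t| ≤ 1 / N → ‖γ s - γ t‖ ≤ 1 / 16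

theorem IsFine.mul {N : ℕ} {γ : ℝ → E} (h : IsFine N γ) {M : ℕ} (hM : 0 < M) :
    IsFine (N * M) γ := by
  refine ⟨Nat.mul_pos h.1 hM, fun s t hst => h.2 s t (hst.trans ?_)⟩
  have h1 : (0 : ℝ) < N := Nat.cast_pos.2 h.1
  have h2 : (1 : ℝ) ≤ M := Nat.one_le_cast.2 hM
  rw [Nat.cast_mul]
  exact one_div_le_one_div_of_le h1 (le_mul_of_one_le_right h1.le h2)

theorem exists_isFine {γ : ℝ → E} (h : UniformContinuous γ) : ∃ N, IsFine N γ := by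
  obtain ⟨δ, hδ, hd⟩ := Metric.uniformContinuous_iff.1 h (1 / 16) (by norm_num)
  obtain ⟨N, hN⟩ := exists_nat_one_div_lt hδ
  refine ⟨N + 1, N.succ_pos, fun s t hst => ?_⟩
  rw [← dist_eq_norm]
  refine (hd ?_).le
  rw [Real.dist_eq]
  exact hst.trans_lt (by exact_mod_cast hN)

variable (φ : E →L[ℂ] ℂ)

theorem map_logSum (N : ℕ) (γ : ℝ → E) :
    φ (logSum N γ) = ∑ k ∈ Finset.range N, logStep φ γ (k / N) ((k + 1) / N) :=
  map_sum φ _ _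

theorem norm_star_mul_sub_one {u v : E} (hu : u ∈ unitary E) : ‖star u * v - 1‖ = ‖u - v‖ := by
  have h : star u * v - 1 = star u * (v - u) := by
    rw [mul_sub, (Unitary.mem_iff.1 hu).1]
  rw [h, CStarRing.norm_mem_unitary_mul _ (Unitary.star_mem hu), norm_sub_rev]

variable (hφ : ∀ a b, φ (a * b) = φ (b * a)) {γ δ : ℝ → E} (hγ : ∀ t, γ t ∈ unitary E)
  (hδ : ∀ t, δ t ∈ unitary E)

include hγ in
theorem logStep_self (s : ℝ) : logStep φ γ s s = 0 := by
  rw [logStep, (Unitary.mem_iff.1 (hγ s)).1, sub_self, logSeries_zero, map_zero]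

include hφ hγ in
theorem logStep_add {s t r : ℝ} (h1 : ‖γ s - γ t‖ ≤ 1 / 4) (h2 : ‖γ t - γ r‖ ≤ 1 / 4) :
    logStep φ γ s r = logStep φ γ s t + logStep φ γ t r := by
  rw [logStep, logStep, logStep, ← trace_log_mul φ hφ]
  · congr 3
    calc _ = star (γ s) * (γ t * star (γ t)) * γ r := by
          rw [(Unitary.mem_iff.1 (hγ t)).2, mul_one]
      _ = _ := by simp only [mul_assoc]
  · rwa [norm_star_mul_sub_one (hγ s)]
  · rwa [norm_star_mul_sub_one (hγ t)]

include hφ hγ in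
/-- Refining the partition does not change the trace of the sum of the logarithms. -/
theorem map_logSum_mul {N : ℕ} (h : IsFine N γ) {M : ℕ} (hM : 0 < M) :
    φ (logSum (N * M) γ) = φ (logSum N γ) := by
  have hN0 : (0 : ℝ) < N := Nat.cast_pos.2 h.1
  have hM0 : (0 : ℝ) < M := Nat.cast_pos.2 hM
  have inner : ∀ (j m : ℕ), m ≤ M → ∑ i ∈ Finset.range m,
      logStep φ γ ((j * M + i : ℕ) / (N * M : ℕ)) (((j * M + i : ℕ) + 1) / (N * M : ℕ)) =
        logStep φ γ (j / N) ((j * M + m : ℕ) / (N * M : ℕ)) := by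
    intro j m
    induction m with
    | zero =>
      intro _
      have e : ((j * M + 0 : ℕ) : ℝ) / (N * M : ℕ) = j / N := by
        push_cast
        rw [add_zero, mul_div_mul_right _ _ hM0.ne']
      rw [e, logStep_self φ hγ, Finset.range_zero, Finset.sum_empty]
    | succ m ih =>
      intro hm
      have hm' : (m : ℝ) ≤ M := by exact_mod_cast (Nat.le_of_succ_le hm)
      have hM1 : (1 : ℝ) ≤ M := by exact_mod_cast hM
      rw [Finset.sum_range_succ, ih (Nat.le_of_succ_le hm)]
      have e : ((j * M + (m + 1) : ℕ) : ℝ) / (N * M : ℕ) =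
          ((j * M + m : ℕ) + 1) / (N * M : ℕ) := by
        push_cast; ring
      rw [e]
      refine (logStep_add φ hφ hγ ?_ ?_).symm
      · refine (h.2 _ _ ?_).trans (by norm_num)
        have e2 : (j : ℝ) / N - ((j * M + m : ℕ) : ℝ) / (N * M : ℕ) = -(m / M / N) := by
          push_cast
          field_simp
          ring
        rw [e2, abs_neg, abs_of_nonneg (by positivity)]
        exact div_le_div_of_nonneg_right (div_le_one_of_le₀ hm' hM0.le) hN0.le
      · refine (h.2 _ _ ?_).trans (by norm_num)
        have e2 : ((j * M + m : ℕ) : ℝ) / (N * M : ℕ) - ((j * M + m : ℕ) + 1) / (N * M : ℕ) =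
            -(1 / M / N) := by
          push_cast
          field_simp
          ring
        rw [e2, abs_neg, abs_of_nonneg (by positivity)]
        exact div_le_div_of_nonneg_right (div_le_one_of_le₀ hM1 hM0.le) hN0.le
  have outer : ∀ n : ℕ, ∑ k ∈ Finset.range (n * M),
      logStep φ γ (k / (N * M : ℕ)) ((k + 1) / (N * M : ℕ)) =
        ∑ j ∈ Finset.range n, logStep φ γ (j / N) ((j + 1) / N) := by
    intro n
    induction n with
    | zero => simp
    | succ n ih =>
      rw [Nat.succ_mul, Finset.sum_range_add, ih, Finset.sum_range_succ]
      congr 1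
      rw [inner n M le_rfl]
      congr 1
      push_cast
      field_simp
  rw [map_logSum, map_logSum, outer]

include hφ hγ hδ in
theorem map_logSum_mul_path {N : ℕ} (h : IsFine N γ) (k : IsFine N δ) :
    φ (logSum N fun t => γ t * δ t) = φ (logSum N γ) + φ (logSum N δ) := by
  rw [map_logSum, map_logSum, map_logSum, ← Finset.sum_add_distrib]
  refine Finset.sum_congr rfl fun j _ => ?_
  have hN0 : (0 : ℝ) < N := Nat.cast_pos.2 h.1
  have hst : |(j : ℝ) / N - (j + 1) / N| ≤ 1 / N := by
    rw [← sub_div, sub_add_cancel_left, neg_div, abs_neg, abs_of_nonneg (by positivity)]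
  set s : ℝ := j / N
  set t : ℝ := (j + 1) / N
  have h1 := h.2 s t hst
  have h2 := k.2 s t hst
  have e : star (γ s * δ s) * (γ t * δ t) =
      (star (δ s) * (star (γ s) * γ t) * δ s) * (star (δ s) * δ t) := by
    rw [star_mul]
    calc _ = star (δ s) * (star (γ s) * γ t) * δ t := by simp only [mul_assoc]
      _ = star (δ s) * (star (γ s) * γ t) * (δ s * star (δ s)) * δ t := by
          rw [(Unitary.mem_iff.1 (hδ s)).2, mul_one]
      _ = _ := by simp only [mul_assoc]
  have n1 : ‖star (γ s) * γ t - 1‖ ≤ 1 / 16 := by rwa [norm_star_mul_sub_one (hγ s)]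
  have n2 : ‖star (δ s) * (star (γ s) * γ t) * δ s - 1‖ ≤ 1 / 16 := by
    have e1 : star (δ s) * (star (γ s) * γ t) * δ s - 1 =
        star (δ s) * (star (γ s) * γ t - 1) * δ s := by
      rw [mul_sub, sub_mul, mul_one, (Unitary.mem_iff.1 (hδ s)).1]
    rw [e1, CStarRing.norm_mul_mem_unitary _ (hδ s),
      CStarRing.norm_mem_unitary_mul _ (Unitary.star_mem (hδ s))]
    exact n1
  rw [logStep, e, trace_log_mul φ hφ (n2.trans (by norm_num))
    (by rw [norm_star_mul_sub_one (hδ s)]; exact h2.trans (by norm_num)),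
    trace_log_conj φ hφ (Unitary.mem_iff.1 (hδ s)).2 (Unitary.mem_iff.1 (hδ s)).1
      (n1.trans_lt (by norm_num)) (n2.trans_lt (by norm_num))]
  rfl

include hφ hγ in
/-- For a path near `1` the sum of the logarithms telescopes. -/
theorem map_logSum_near_one {N : ℕ} (hN : 0 < N) (h1 : ∀ t, ‖γ t - 1‖ ≤ 1 / 16) :
    φ (logSum N γ) = φ (logSeries (γ 1 - 1)) - φ (logSeries (γ 0 - 1)) := by
  have hN0 : (N : ℝ) ≠ 0 := Nat.cast_ne_zero.2 hN.ne'
  have h2 : ∀ s t, logStep φ γ s t = φ (logSeries (γ t - 1)) - φ (logSeries (γ s - 1)) := by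
    intro s t
    rw [eq_sub_iff_add_eq', logStep, ← trace_log_mul φ hφ ((h1 s).trans (by norm_num)),
      ← mul_assoc, (Unitary.mem_iff.1 (hγ s)).2, one_mul]
    rw [norm_star_mul_sub_one (hγ s)]
    have := norm_sub_le_norm_sub_add_norm_sub (γ s) 1 (γ t)
    rw [norm_sub_rev 1 (γ t)] at this
    linarith [h1 s, h1 t]
  rw [map_logSum]
  have h3 := Finset.sum_range_sub (fun k : ℕ => φ (logSeries (γ (k / N) - 1))) N
  simp only [Nat.cast_zero, zero_div, div_self hN0] at h3
  rw [← h3]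
  refine Finset.sum_congr rfl fun k _ => ?_
  rw [h2, Nat.cast_succ]

include hφ in
theorem re_trace_log_eq_zero (hs : ∀ a, φ (star a) = star (φ a)) {u : E} (hu : u ∈ unitary E)
    (h1 : ‖u - 1‖ ≤ 1 / 4) : (φ (logSeries (u - 1))).re = 0 := by
  have h2 : ‖star u - 1‖ ≤ 1 / 4 := by
    rwa [← star_one E, ← star_sub, norm_star]
  have h3 := trace_log_mul φ hφ h2 h1
  rw [(Unitary.mem_iff.1 hu).1, sub_self, logSeries_zero, map_zero] at h3
  have h4 : φ (logSeries (star u - 1)) = star (φ (logSeries (u - 1))) := by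
    rw [map_logSeries φ (h2.trans_lt (by norm_num)), map_logSeries φ (h1.trans_lt (by norm_num))]
    rw [tsum_star]
    refine tsum_congr fun k => ?_
    rw [star_mul', ← hs, star_pow, star_sub, star_one]
    congr 1
    simp
  rw [h4] at h3
  have := congrArg Complex.re h3
  simp at this
  linarith

include hφ hγ in
/-- Over an interval on which `γ` varies little, the logarithm of the increment of a piecewise
differentiable path is the integral of the logarithmic derivative. -/
theorem logStep_eq_integral {a b : ℝ} (hab : a ≤ b) (hc : ContinuousOn γ (Set.Icc a b))
    (hsmall : ∀ t ∈ Set.Icc a b, ‖γ a - γ t‖ < 1) {γ' : ℝ → E}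
    (hd : ∀ t ∈ Set.Ioo a b, HasDerivAt γ (γ' t) t)
    (hi : IntervalIntegrable (fun t => φ (γ' t * star (γ t))) MeasureTheory.volume a b) :
    ∫ t in a..b, φ (γ' t * star (γ t)) = logStep φ γ a b := by
  have h1 : ∀ t ∈ Set.Icc a b, ‖star (γ a) * γ t - 1‖ < 1 := fun t ht => by
    rw [norm_star_mul_sub_one (hγ a)]
    exact hsmall t ht
  have h2 := intervalIntegral.integral_eq_sub_of_hasDerivAt_of_le hab
    (f := fun t => logStep φ γ a t) ?_ ?_ hi
  · rw [h2, logStep_self φ hγ, sub_zero]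
  · intro t ht
    have hF := (hasFDerivAt_trace_logSeries φ hφ (h1 t ht)).continuousAt
    exact ContinuousAt.comp_continuousWithinAt (f := fun t => star (γ a) * γ t - 1) hF
      ((continuousWithinAt_const.mul (hc t ht)).sub continuousWithinAt_const)
  · intro t ht
    have hw : (star (γ t) * γ a) * (star (γ a) * γ t) = 1 := by
      calc _ = star (γ t) * (γ a * star (γ a)) * γ t := by simp only [mul_assoc]
        _ = 1 := by
          rw [(Unitary.mem_iff.1 (hγ a)).2, mul_one, (Unitary.mem_iff.1 (hγ t)).1]
    refine (hasDerivAt_trace_log φ hφ ((hd t ht).const_mul (star (γ a)))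
      (h1 t ⟨ht.1.le, ht.2.le⟩) hw).congr_deriv ?_
    rw [hφ (γ' t)]
    congr 1
    calc _ = star (γ t) * (γ a * star (γ a)) * γ' t := by simp only [mul_assoc]
      _ = _ := by rw [(Unitary.mem_iff.1 (hγ a)).2, mul_one]

end LogSum

/-! ### The rotation map on `K₁` -/

section LiftK

variable {B : Type u} [Ring B] [StarRing B] [TopologicalSpace B] [IsTopologicalRing B]
  [ContinuousStar B] [Algebra ℂ B] [StarModule ℂ B] [ContinuousSMul ℂ B] {G : Type*}
  [AddCommGroup G]

/-- The universal property of `K₁`. -/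
theorem K1.exists_hom (r : ∀ n, UMat B n → G)
    (hmul : ∀ n (u v : UMat B n), r n (u * v) = r n u + r n v)
    (hstab : ∀ n m (h : n ≤ m) (u : UMat B n), r m (stab (Fin.castLEEmb h) u) = r n u)
    (hj : ∀ n (u v : UMat B n), Joined u v → r n u = r n v) :
    ∃ R : K1 B →+ G, ∀ n (u : UMat B n), R (K1.mk u) = r n u := by
  have hrep : ∀ x : K1 B, ∃ g : G, ∀ n (u : UMat B n), K1.mk u = x → r n u = g := by
    intro x
    induction x using K1.ind with
    | h n u =>
      refine ⟨r n u, fun m v hv => ?_⟩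
      obtain ⟨k, hm, hn, hjk⟩ := (K1.mk_eq_iff v u).1 hv
      rw [← hstab m k hm v, ← hstab n k hn u]
      exact hj _ _ _ hjk
  choose R hR using hrep
  refine ⟨AddMonoidHom.mk' R fun x y => ?_, fun n u => (hR _ n u rfl).symm⟩
  induction x using K1.ind with
  | h n u =>
    induction y using K1.ind with
    | h m v =>
      have hn : n ≤ max n m := le_max_left n m
      have hm : m ≤ max n m := le_max_right n m
      rw [← hR _ n u rfl, ← hR _ m v rfl, ← hstab _ _ hn u, ← hstab _ _ hm v, ← hmul]
      refine (hR _ _ _ ?_).symm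
      rw [K1.mk_mul, K1.mk_stab, K1.mk_stab]

end LiftK

section TraceFunctional

open scoped ComplexOrder

variable {A : Type u} [CStarAlgebra A] {ι κ : Type*} [Fintype ι] [Fintype κ] [DecidableEq ι]
  [DecidableEq κ]

variable (ι) in
/-- The extension `τ((a_ij)) = ∑ τ(a_ii)` of a functional to matrices. -/
noncomputable def traceCLM (τ : WeakDual ℂ A) : Matrix ι ι A →L[ℂ] ℂ where
  toFun M := τ M.trace
  map_add' M N := by rw [Matrix.trace_add, map_add]
  map_smul' c M := by rw [Matrix.trace_smul, map_smul]; rfl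
  cont := (map_continuous τ).comp (by fun_prop : Continuous fun M : Matrix ι ι A => M.trace)

omit [DecidableEq ι] in
theorem traceCLM_apply (τ : WeakDual ℂ A) (M : Matrix ι ι A) : traceCLM ι τ M = τ M.trace := rfl

omit [DecidableEq ι] in
theorem traceCLM_comm (τ : TracialState A) (M N : Matrix ι ι A) :
    traceCLM ι (τ : WeakDual ℂ A) (M * N) = traceCLM ι (τ : WeakDual ℂ A) (N * M) :=
  τ.trace_comm M N

theorem TracialState.apply_star (τ : TracialState A) (a : A) :
    (τ : WeakDual ℂ A) (star a) = star ((τ : WeakDual ℂ A) a) := by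
  have hpos : ∀ x : A, ((τ : WeakDual ℂ A) (star x * x)).im = 0 := fun x =>
    ((Complex.nonneg_iff.1 (τ.2.2.1 x)).2).symm
  have h1 := hpos (a + 1)
  have h2 := hpos (a + Complex.I • 1)
  have h3 := hpos a
  have h4 : (τ : WeakDual ℂ A) 1 = 1 := τ.2.1
  have e1 : star (a + 1) * (a + 1) = star a * a + star a + a + 1 := by
    rw [star_add, star_one]; noncomm_ring
  have e2 : star (a + Complex.I • (1 : A)) * (a + Complex.I • 1) =
      star a * a + Complex.I • star a - Complex.I • a + 1 := by
    rw [star_add, star_smul, star_one, Complex.star_def, Complex.conj_I]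
    simp only [add_mul, mul_add, smul_mul_assoc, mul_smul_comm, one_mul, mul_one]
    simp only [smul_add, neg_smul, smul_neg, smul_smul, Complex.I_mul_I, one_smul, neg_neg]
    abel
  rw [e1, map_add, map_add, map_add, h4] at h1
  rw [e2, map_add, map_sub, map_add, map_smul, map_smul, h4] at h2
  simp [h3] at h1 h2
  apply Complex.ext
  · simp; linarith
  · simp; linarith

omit [DecidableEq ι] in
theorem traceCLM_star (τ : TracialState A) (M : Matrix ι ι A) :
    traceCLM ι (τ : WeakDual ℂ A) (star M) = star (traceCLM ι (τ : WeakDual ℂ A) M) := by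
  rw [traceCLM_apply, traceCLM_apply, ← τ.apply_star, Matrix.star_eq_conjTranspose,
    Matrix.trace_conjTranspose]

theorem traceCLM_corner (τ : TracialState A) (f : ι ↪ κ) (M : Matrix ι ι A) :
    traceCLM κ (τ : WeakDual ℂ A) (corner f M) = traceCLM ι (τ : WeakDual ℂ A) M := by
  rw [traceCLM_apply, corner, τ.trace_comm, ← Matrix.mul_assoc, injMat_conjTranspose_mul,
    Matrix.one_mul, traceCLM_apply]

end TraceFunctional

section RotationSum

variable {A : Type u} [CStarAlgebra A] (α : A ≃⋆ₐ[ℂ] A) {n : ℕ}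

theorem torusPath_eq (u : UMat (MappingTorus α) n) (t : ℝ) :
    torusPath α u t = torusEv α (Set.projIcc (0 : ℝ) 1 zero_le_one t) u := rfl

theorem torusPath_mul (u v : UMat (MappingTorus α) n) (t : ℝ) :
    torusPath α (u * v) t = torusPath α u t * torusPath α v t :=
  map_mul (torusEv α _) _ _

theorem torusPath_mem (u : UMat (MappingTorus α) n) (t : ℝ) :
    torusPath α u t ∈ unitary (Matrix (Fin n) (Fin n) A) := by
  rw [Unitary.mem_iff, torusPath_eq, ← torusEv_star, ← map_mul, ← map_mul,
    (Unitary.mem_iff.1 u.2).1, (Unitary.mem_iff.1 u.2).2, map_one]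
  exact ⟨rfl, rfl⟩

theorem torusPath_one (u : UMat (MappingTorus α) n) :
    torusPath α u 1 = (torusPath α u 0).map α := by
  rw [torusPath_eq, torusPath_eq, Set.projIcc_right, Set.projIcc_left]
  exact (torusEv_end α _).symm

theorem torusPath_stab {m : ℕ} (f : Fin n ↪ Fin m) (u : UMat (MappingTorus α) n) (t : ℝ) :
    torusPath α (stab f u) t = stabMat f (torusPath α u t) :=
  torusEv_stabMat α f _ _

/-- The increments of the path of unitaries `u` over intervals of length at most `1 / N` are
small in the norm of `M_n(A)`. -/
def TorusFine (N : ℕ) (u : UMat (MappingTorus α) n) : Prop :=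
  let _ : CStarAlgebra (Matrix (Fin n) (Fin n) A) := Matrix.cstarAlgebra
  IsFine N (torusPath α u)

theorem uniformContinuous_comp_projIcc {X : Type*} [UniformSpace X] {f : unitInterval → X}
    (hf : Continuous f) : UniformContinuous fun t : ℝ => f (Set.projIcc 0 1 zero_le_one t) :=
  (CompactSpace.uniformContinuous_of_continuous hf).comp
    (LipschitzWith.projIcc (zero_le_one (α := ℝ))).uniformContinuous

theorem exists_torusFine (u : UMat (MappingTorus α) n) : ∃ N, TorusFine α N u :=
  let _ : CStarAlgebra (Matrix (Fin n) (Fin n) A) := Matrix.cstarAlgebra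
  exists_isFine (uniformContinuous_comp_projIcc (continuous_torusEv_apply α _))

variable {α} in
theorem TorusFine.mul {N M : ℕ} {u : UMat (MappingTorus α) n} (h : TorusFine α N u) (hM : 0 < M) :
    TorusFine α (N * M) u :=
  let _ : CStarAlgebra (Matrix (Fin n) (Fin n) A) := Matrix.cstarAlgebra
  IsFine.mul h hM

variable {α} in
theorem TorusFine.pos {N : ℕ} {u : UMat (MappingTorus α) n} (h : TorusFine α N u) : 0 < N := h.1

/-- The trace of the sum of the logarithms of the increments of `u`, an element of `A`. -/
noncomputable def rotSum (N : ℕ) (u : UMat (MappingTorus α) n) : A :=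
  (logSum N (torusPath α u)).trace

variable (τ : TracialState A)

theorem apply_rotSum (N : ℕ) (u : UMat (MappingTorus α) n) :
    (τ : WeakDual ℂ A) (rotSum α N u) =
      traceCLM (Fin n) (τ : WeakDual ℂ A) (logSum N (torusPath α u)) := rfl

theorem rotSum_refine {N M : ℕ} {u : UMat (MappingTorus α) n} (h : TorusFine α N u) (hM : 0 < M) :
    (τ : WeakDual ℂ A) (rotSum α (N * M) u) = (τ : WeakDual ℂ A) (rotSum α N u) :=
  let _ : CStarAlgebra (Matrix (Fin n) (Fin n) A) := Matrix.cstarAlgebra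
  map_logSum_mul (E := Matrix (Fin n) (Fin n) A) (traceCLM (Fin n) (τ : WeakDual ℂ A))
    (traceCLM_comm τ) (torusPath_mem α u) h hM

theorem rotSum_eq {N M : ℕ} {u : UMat (MappingTorus α) n} (h : TorusFine α N u)
    (k : TorusFine α M u) :
    (τ : WeakDual ℂ A) (rotSum α N u) = (τ : WeakDual ℂ A) (rotSum α M u) := by
  rw [← rotSum_refine α τ h k.pos, ← rotSum_refine α τ k h.pos, mul_comm]

theorem rotSum_mul {N : ℕ} {u v : UMat (MappingTorus α) n} (h : TorusFine α N u)
    (k : TorusFine α N v) : (τ : WeakDual ℂ A) (rotSum α N (u * v)) =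
      (τ : WeakDual ℂ A) (rotSum α N u) + (τ : WeakDual ℂ A) (rotSum α N v) := by
  let _ : CStarAlgebra (Matrix (Fin n) (Fin n) A) := Matrix.cstarAlgebra
  have := map_logSum_mul_path (E := Matrix (Fin n) (Fin n) A)
    (traceCLM (Fin n) (τ : WeakDual ℂ A)) (traceCLM_comm τ) (torusPath_mem α u)
    (torusPath_mem α v) h k
  have e : (fun t => torusPath α u t * torusPath α v t) = torusPath α (u * v) :=
    funext fun t => (torusPath_mul α u v t).symm
  rw [e] at this
  exact this

theorem re_rotSum {N : ℕ} {u : UMat (MappingTorus α) n} (h : TorusFine α N u) :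
    ((τ : WeakDual ℂ A) (rotSum α N u)).re = 0 := by
  let _ : CStarAlgebra (Matrix (Fin n) (Fin n) A) := Matrix.cstarAlgebra
  have h0 : (0 : ℝ) < N := Nat.cast_pos.2 h.pos
  rw [apply_rotSum, logSum, map_sum, Complex.re_sum]
  refine Finset.sum_eq_zero fun k _ => ?_
  refine re_trace_log_eq_zero (E := Matrix (Fin n) (Fin n) A) _ (traceCLM_comm τ)
    (traceCLM_star τ) (mul_mem (Unitary.star_mem (torusPath_mem α u _)) (torusPath_mem α u _)) ?_
  rw [norm_star_mul_sub_one (torusPath_mem α u _)]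
  refine (h.2 _ _ ?_).trans (by norm_num)
  rw [← sub_div, sub_add_cancel_left, neg_div, abs_neg, abs_of_nonneg (by positivity)]

theorem trace_logSeries_map (hα : ∀ a, (τ : WeakDual ℂ A) (α a) = (τ : WeakDual ℂ A) a)
    (x : Matrix (Fin n) (Fin n) A) :
    let _ : CStarAlgebra (Matrix (Fin n) (Fin n) A) := Matrix.cstarAlgebra
    ‖x‖ < 1 → ‖(x.map α : Matrix (Fin n) (Fin n) A)‖ < 1 →
    traceCLM (Fin n) (τ : WeakDual ℂ A) (logSeries (x.map α)) =
      traceCLM (Fin n) (τ : WeakDual ℂ A) (logSeries x) := by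
  intro _ h1 h2
  have e1 := map_logSeries (E := Matrix (Fin n) (Fin n) A)
    (traceCLM (Fin n) (τ : WeakDual ℂ A)) h1
  have e2 := map_logSeries (E := Matrix (Fin n) (Fin n) A)
    (traceCLM (Fin n) (τ : WeakDual ℂ A)) h2
  refine e2.trans (Eq.trans ?_ e1.symm)
  refine tsum_congr fun k => ?_
  congr 1
  have e3 : (x.map α) ^ (k + 1) = (x ^ (k + 1)).map α :=
    (map_pow (α : A →+* A).mapMatrix x (k + 1)).symm
  rw [e3, traceCLM_apply, traceCLM_apply, Matrix.trace, Matrix.trace, map_sum, map_sum]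
  exact Finset.sum_congr rfl fun i _ => hα _

/-- For `u` near `1` the sum telescopes to `τ(log u(1)) - τ(log u(0))`, and `u(1) = α(u(0))`. -/
theorem rotSum_near_one (hα : ∀ a, (τ : WeakDual ℂ A) (α a) = (τ : WeakDual ℂ A) a)
    {N : ℕ} (hN : 0 < N) {u : UMat (MappingTorus α) n} :
    let _ : CStarAlgebra (Matrix (Fin n) (Fin n) A) := Matrix.cstarAlgebra
    (∀ t, ‖torusPath α u t - 1‖ ≤ 1 / 16) → (τ : WeakDual ℂ A) (rotSum α N u) = 0 := by
  intro _ h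
  have h1 := map_logSum_near_one (E := Matrix (Fin n) (Fin n) A)
    (traceCLM (Fin n) (τ : WeakDual ℂ A)) (traceCLM_comm τ) (torusPath_mem α u) hN h
  refine h1.trans ?_
  have e : torusPath α u 1 - 1 = (torusPath α u 0 - 1).map α := by
    rw [torusPath_one, Matrix.map_sub _ (map_sub _), Matrix.map_one _ (map_zero _) (map_one _)]
  rw [sub_eq_zero, e]
  refine trace_logSeries_map α τ hα _ ((h 0).trans_lt (by norm_num)) ?_
  rw [← e]
  exact (h 1).trans_lt (by norm_num)

theorem eventually_near_one :
    let _ : CStarAlgebra (Matrix (Fin n) (Fin n) A) := Matrix.cstarAlgebra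
    ∀ᶠ u : UMat (MappingTorus α) n in nhds 1, ∀ t, ‖torusPath α u t - 1‖ ≤ 1 / 16 := by
  intro _
  let Φ : UMat (MappingTorus α) n → C(unitInterval, Matrix (Fin n) (Fin n) A) := fun u =>
    ⟨fun t => torusEv α t u, continuous_torusEv_apply α _⟩
  have hΦ : Continuous Φ := by
    refine ContinuousMap.continuous_of_continuous_uncurry _ ?_
    refine continuous_pi fun i => continuous_pi fun j => ?_
    have h1 : Continuous fun u : UMat (MappingTorus α) n =>
        MappingTorus.toFun α ((u : Matrix (Fin n) (Fin n) (MappingTorus α)) i j) :=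
      (MappingTorus.continuous_toFun α).comp
        ((continuous_apply_apply i j).comp continuous_subtype_val)
    exact continuous_eval.comp (h1.prodMap continuous_id)
  have h1 : Φ 1 = 1 := by
    ext t : 1
    exact map_one (torusEv α t)
  have h2 := hΦ.tendsto 1 (Metric.closedBall_mem_nhds _ (by norm_num : (0 : ℝ) < 1 / 16))
  filter_upwards [h2] with u hu t
  rw [Set.mem_preimage, h1, Metric.mem_closedBall, dist_eq_norm] at hu
  exact ((Φ u - 1).norm_coe_le_norm (Set.projIcc (0 : ℝ) 1 zero_le_one t)).trans hu

theorem rotSum_stab {m : ℕ} (f : Fin n ↪ Fin m) {N : ℕ} {u : UMat (MappingTorus α) n}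
    (h : TorusFine α N u) (h' : TorusFine α N (stab f u)) :
    (τ : WeakDual ℂ A) (rotSum α N (stab f u)) = (τ : WeakDual ℂ A) (rotSum α N u) := by
  let _ : CStarAlgebra (Matrix (Fin n) (Fin n) A) := Matrix.cstarAlgebra
  let _ : CStarAlgebra (Matrix (Fin m) (Fin m) A) := Matrix.cstarAlgebra
  have h0 : (0 : ℝ) < N := Nat.cast_pos.2 h.pos
  rw [apply_rotSum, logSum, map_sum, apply_rotSum, logSum, map_sum]
  refine Finset.sum_congr rfl fun k _ => ?_
  have hst : |(k : ℝ) / N - (k + 1) / N| ≤ 1 / N := by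
    rw [← sub_div, sub_add_cancel_left, neg_div, abs_neg, abs_of_nonneg (by positivity)]
  have n1 : ‖star (torusPath α u (k / N)) * torusPath α u ((k + 1) / N) - 1‖ < 1 := by
    rw [norm_star_mul_sub_one (torusPath_mem α u _)]
    exact (h.2 _ _ hst).trans_lt (by norm_num)
  have n2 : ‖star (torusPath α (stab f u) (k / N)) * torusPath α (stab f u) ((k + 1) / N) - 1‖
      < 1 := by
    rw [norm_star_mul_sub_one (torusPath_mem α (stab f u) _)]
    exact (h'.2 _ _ hst).trans_lt (by norm_num)
  have e1 := map_logSeries (E := Matrix (Fin n) (Fin n) A)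
    (traceCLM (Fin n) (τ : WeakDual ℂ A)) n1
  have e2 := map_logSeries (E := Matrix (Fin m) (Fin m) A)
    (traceCLM (Fin m) (τ : WeakDual ℂ A)) n2
  refine e2.trans (Eq.trans ?_ e1.symm)
  refine tsum_congr fun j => ?_
  congr 1
  have hp : ∀ (X : Matrix (Fin n) (Fin n) A) (j : ℕ),
      (corner f X) ^ (j + 1) = corner f (X ^ (j + 1)) := by
    intro X j
    induction j with
    | zero => simp
    | succ j ih => rw [pow_succ, ih, corner_mul, pow_succ X (j + 1)]
  rw [torusPath_stab, torusPath_stab, stabMat_star, ← stabMat_mul, stabMat, add_sub_cancel_left,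
    hp, traceCLM_corner]

/-- For fixed `τ`, the trace of the rotation sum is constant on the path components of `U_n(M_α)`:
it is a homomorphism which vanishes near `1`. -/
theorem rotSum_eq_of_joined (hα : ∀ a, (τ : WeakDual ℂ A) (α a) = (τ : WeakDual ℂ A) a)
    {u v : UMat (MappingTorus α) n} (huv : Joined u v) {N M : ℕ} (h : TorusFine α N u)
    (k : TorusFine α M v) :
    (τ : WeakDual ℂ A) (rotSum α N u) = (τ : WeakDual ℂ A) (rotSum α M v) := by
  choose ν hν using fun u : UMat (MappingTorus α) n => exists_torusFine α u
  let ρ : UMat (MappingTorus α) n →* Multiplicative ℂ := MonoidHom.mk'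
    (fun u => Multiplicative.ofAdd ((τ : WeakDual ℂ A) (rotSum α (ν u) u))) (by
      intro a b
      rw [← ofAdd_add]
      congr 1
      have pa := (hν a).pos
      have pb := (hν b).pos
      have pab := (hν (a * b)).pos
      have fa : TorusFine α (ν a * (ν b * ν (a * b))) a := (hν a).mul (Nat.mul_pos pb pab)
      have fb : TorusFine α (ν a * (ν b * ν (a * b))) b := by
        have := (hν b).mul (Nat.mul_pos pa pab)
        rwa [Nat.mul_left_comm] at this
      have fab : TorusFine α (ν a * (ν b * ν (a * b))) (a * b) := by
        have := (hν (a * b)).mul (Nat.mul_pos pa pb)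
        rwa [mul_comm, mul_assoc] at this
      rw [rotSum_eq α τ (hν (a * b)) fab, rotSum_eq α τ (hν a) fa, rotSum_eq α τ (hν b) fb,
        rotSum_mul α τ fa fb])
  have hopen : IsOpen (ρ.ker : Set (UMat (MappingTorus α) n)) := by
    refine Subgroup.isOpen_of_mem_nhds _ (g := 1) ?_
    filter_upwards [eventually_near_one α (n := n)] with a ha
    exact congrArg Multiplicative.ofAdd (rotSum_near_one α τ hα (hν a).pos ha)
  have hclopen : IsClopen (ρ.ker : Set (UMat (MappingTorus α) n)) :=
    ⟨Subgroup.isClosed_of_isOpen _ hopen, hopen⟩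
  have hj : Joined (1 : UMat (MappingTorus α) n) (u⁻¹ * v) := by
    simpa using huv.map (f := fun x => u⁻¹ * x) (by fun_prop)
  have hmem : u⁻¹ * v ∈ ρ.ker :=
    hclopen.connectedComponent_subset ρ.ker.one_mem (pathComponent_subset_component _ hj)
  have huv' : ρ u = ρ v := by
    rw [MonoidHom.mem_ker, map_mul, map_inv, inv_mul_eq_one] at hmem
    exact hmem
  rw [rotSum_eq α τ h (hν u), rotSum_eq α τ k (hν v)]
  exact Multiplicative.ofAdd.injective huv'

/-- The rotation map, by means of sums of logarithms. -/
theorem exists_rotationHom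
    (hα : ∀ (τ : TracialState A) a, (τ : WeakDual ℂ A) (α a) = (τ : WeakDual ℂ A) a) :
    ∃ R : K1 (MappingTorus α) →+ AffT A, ∀ (n : ℕ) (u : UMat (MappingTorus α) n)
      (τ : TracialState A) (N : ℕ), TorusFine α N u →
      (((R (K1.mk u) : C(TracialState A, ℝ)) τ : ℝ) : ℂ) =
        1 / (2 * Real.pi * Complex.I) * (τ : WeakDual ℂ A) (rotSum α N u) := by
  choose ν hν using fun (n : ℕ) (u : UMat (MappingTorus α) n) => exists_torusFine α u
  let r : ∀ n, UMat (MappingTorus α) n → AffT A := fun n u =>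
    evalAff ((1 / (2 * Real.pi * Complex.I) : ℂ) • rotSum α (ν n u) u)
  have hr : ∀ (n : ℕ) (u : UMat (MappingTorus α) n) (τ : TracialState A) (N : ℕ),
      TorusFine α N u → (((r n u : C(TracialState A, ℝ)) τ : ℝ) : ℂ) =
        1 / (2 * Real.pi * Complex.I) * (τ : WeakDual ℂ A) (rotSum α N u) := by
    intro n u τ N hN
    rw [← rotSum_eq α τ (hν n u) hN, evalAff_apply, map_smul, smul_eq_mul]
    have h1 := re_rotSum α τ (hν n u)
    have h2 : (τ : WeakDual ℂ A) (rotSum α (ν n u) u) =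
        (((τ : WeakDual ℂ A) (rotSum α (ν n u) u)).im : ℂ) * Complex.I := by
      apply Complex.ext <;> simp [h1]
    have h3 : 1 / (2 * Real.pi * Complex.I) * (τ : WeakDual ℂ A) (rotSum α (ν n u) u) =
        ((1 / (2 * Real.pi) * ((τ : WeakDual ℂ A) (rotSum α (ν n u) u)).im : ℝ) : ℂ) := by
      rw [h2]
      push_cast
      have : Complex.I ≠ 0 := Complex.I_ne_zero
      have hpi : (Real.pi : ℂ) ≠ 0 := Complex.ofReal_ne_zero.2 Real.pi_ne_zero
      field_simp
      simp
    rw [h3, Complex.ofReal_re]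
  have hext : ∀ (f g : AffT A), (∀ τ : TracialState A,
      (((f : C(TracialState A, ℝ)) τ : ℝ) : ℂ) = (((g : C(TracialState A, ℝ)) τ : ℝ) : ℂ)) →
      f = g := fun f g h => Subtype.ext (ContinuousMap.ext fun τ => Complex.ofReal_injective (h τ))
  obtain ⟨R, hR⟩ := K1.exists_hom r (by
      intro n a b
      refine hext _ _ fun τ => ?_
      have pa := (hν n a).pos
      have pb := (hν n b).pos
      have pab := (hν n (a * b)).pos
      have fa : TorusFine α (ν n a * (ν n b * ν n (a * b))) a := (hν n a).mul (Nat.mul_pos pb pab)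
      have fb : TorusFine α (ν n a * (ν n b * ν n (a * b))) b := by
        have := (hν n b).mul (Nat.mul_pos pa pab)
        rwa [Nat.mul_left_comm] at this
      have fab : TorusFine α (ν n a * (ν n b * ν n (a * b))) (a * b) := by
        have := (hν n (a * b)).mul (Nat.mul_pos pa pb)
        rwa [mul_comm, mul_assoc] at this
      change _ = (((r n a : C(TracialState A, ℝ)) τ + (r n b : C(TracialState A, ℝ)) τ : ℝ) : ℂ)
      rw [hr n _ τ _ fab, Complex.ofReal_add, hr n _ τ _ fa, hr n _ τ _ fb, rotSum_mul α τ fa fb,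
        mul_add])
    (by
      intro n m h u
      refine hext _ _ fun τ => ?_
      have f1 : TorusFine α (ν n u * ν m (stab (Fin.castLEEmb h) u)) u :=
        (hν n u).mul (hν m _).pos
      have f2 : TorusFine α (ν n u * ν m (stab (Fin.castLEEmb h) u))
          (stab (Fin.castLEEmb h) u) := by
        rw [mul_comm]
        exact (hν m _).mul (hν n u).pos
      rw [hr m _ τ _ f2, hr n _ τ _ f1, rotSum_stab α τ _ f1 f2])
    (by
      intro n u v h
      refine hext _ _ fun τ => ?_
      rw [hr n _ τ _ (hν n u), hr n _ τ _ (hν n v),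
        rotSum_eq_of_joined α τ (hα τ) h (hν n u) (hν n v)])
  refine ⟨R, fun n u τ N hN => ?_⟩
  rw [hR]
  exact hr n u τ N hN

end RotationSum

/-! ### The rotation map as an integral -/

section PiecewiseIntegral

open MeasureTheory

/-- An additive property of intervals holds for all intervals if it holds for those whose interior
does not meet a given finite set. -/
theorem interval_induction {P : ℝ → ℝ → Prop}
    (hadd : ∀ a c b, a < c → c < b → P a c → P c b → P a b) (S : Finset ℝ) : ∀ a b : ℝ, a < b →
    (∀ a' b', a ≤ a' → a' < b' → b' ≤ b → (∀ s ∈ S, s ∉ Set.Ioo a' b') → P a' b') → P a b := by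
  induction S using Finset.induction_on with
  | empty => exact fun a b hab h => h a b le_rfl hab le_rfl (by simp)
  | insert s S _ ih =>
    intro a b hab h
    have key : ∀ a₁ b₁, a ≤ a₁ → a₁ < b₁ → b₁ ≤ b → s ∉ Set.Ioo a₁ b₁ → P a₁ b₁ := by
      intro a₁ b₁ h1 h2 h3 h4
      refine ih a₁ b₁ h2 fun a' b' k1 k2 k3 k4 => h a' b' (h1.trans k1) k2 (k3.trans h3) ?_
      intro r hr
      rcases Finset.mem_insert.1 hr with rfl | hr
      · exact fun hm => h4 ⟨k1.trans_lt hm.1, hm.2.trans_le k3⟩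
      · exact k4 r hr
    by_cases hs : s ∈ Set.Ioo a b
    · exact hadd a s b hs.1 hs.2 (key a s le_rfl hs.1 hs.2.le (by simp))
        (key s b hs.1.le hs.2 le_rfl (by simp))
    · exact key a b le_rfl hab le_rfl hs

variable {A : Type u} [CStarAlgebra A] (α : A ≃⋆ₐ[ℂ] A) {n : ℕ} (τ : TracialState A)

/-- The entrywise derivative of the path of unitaries `u`. -/
noncomputable def torusDeriv (u : UMat (MappingTorus α) n) (t : ℝ) : Matrix (Fin n) (Fin n) A :=
  Matrix.of fun i j => deriv (fun s => torusPath α u s i j) t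

theorem continuous_torusPath (u : UMat (MappingTorus α) n) : Continuous (torusPath α u) :=
  (continuous_torusEv_apply α _).comp continuous_projIcc

theorem logStep_torusPath_eq_integral {u : UMat (MappingTorus α) n} {N : ℕ} (hN : TorusFine α N u)
    {a b : ℝ} (hab : a < b) (hN' : b - a ≤ 1 / N)
    (h : ∀ i j, ContDiffOn ℝ 1 (fun t => torusPath α u t i j) (Set.Icc a b)) :
    IntervalIntegrable (fun t => traceCLM (Fin n) (τ : WeakDual ℂ A)
      (torusDeriv α u t * star (torusPath α u t))) volume a b ∧
    ∫ t in a..b, traceCLM (Fin n) (τ : WeakDual ℂ A)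
      (torusDeriv α u t * star (torusPath α u t)) =
      traceCLM (Fin n) (τ : WeakDual ℂ A)
        (logSeries (star (torusPath α u a) * torusPath α u b - 1)) := by
  have hder : ∀ i j, ∀ t ∈ Set.Ioo a b,
      HasDerivAt (fun s => torusPath α u s i j) (torusDeriv α u t i j) t := by
    intro i j t ht
    exact (((h i j).differentiableOn one_ne_zero).differentiableAt
      (Icc_mem_nhds ht.1 ht.2)).hasDerivAt
  have hi : IntervalIntegrable (fun t => traceCLM (Fin n) (τ : WeakDual ℂ A)
      (torusDeriv α u t * star (torusPath α u t))) volume a b := by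
    let G : ℝ → Matrix (Fin n) (Fin n) A := fun t =>
      Matrix.of fun i j => derivWithin (fun s => torusPath α u s i j) (Set.Icc a b) t
    have hG : ContinuousOn G (Set.Icc a b) := by
      refine continuousOn_pi.2 fun i => continuousOn_pi.2 fun j => ?_
      exact (h i j).continuousOn_derivWithin (uniqueDiffOn_Icc hab) le_rfl
    have hc : ContinuousOn (fun t => traceCLM (Fin n) (τ : WeakDual ℂ A)
        (G t * star (torusPath α u t))) (Set.Icc a b) :=
      (traceCLM (Fin n) (τ : WeakDual ℂ A)).continuous.comp_continuousOn
        (hG.mul (continuous_torusPath α u).star.continuousOn)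
    refine (hc.intervalIntegrable_of_Icc hab.le).congr_uIoo fun t ht => ?_
    rw [Set.uIoo_of_le hab.le] at ht
    have e : G t = torusDeriv α u t := by
      ext i j
      exact derivWithin_of_mem_nhds (Icc_mem_nhds ht.1 ht.2)
    change traceCLM (Fin n) (τ : WeakDual ℂ A) (G t * star (torusPath α u t)) = _
    rw [e]
  refine ⟨hi, ?_⟩
  let _ : CStarAlgebra (Matrix (Fin n) (Fin n) A) := Matrix.cstarAlgebra
  refine logStep_eq_integral (E := Matrix (Fin n) (Fin n) A)
    (traceCLM (Fin n) (τ : WeakDual ℂ A)) (traceCLM_comm τ) (torusPath_mem α u) hab.le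
    (continuous_torusPath α u).continuousOn ?_ ?_ hi
  · intro t ht
    refine (hN.2 a t ?_).trans_lt (by norm_num)
    rw [abs_sub_comm, abs_of_nonneg (by linarith [ht.1])]
    linarith [ht.2]
  · intro t ht
    exact hasDerivAt_pi.2 fun i => hasDerivAt_pi.2 fun j => hder i j t ht

theorem rotSum_eq_integral {u : UMat (MappingTorus α) n} {N : ℕ} (hN : TorusFine α N u)
    (h : ∀ i j, IsPiecewiseC1 fun t => torusPath α u t i j) :
    (τ : WeakDual ℂ A) (rotSum α N u) = ∫ t in (0 : ℝ)..1, traceCLM (Fin n) (τ : WeakDual ℂ A)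
      (torusDeriv α u t * star (torusPath α u t)) := by
  choose S hS using h
  let g : ℝ → ℂ := fun t => traceCLM (Fin n) (τ : WeakDual ℂ A)
    (torusDeriv α u t * star (torusPath α u t))
  let step : ℝ → ℝ → ℂ := fun a b => traceCLM (Fin n) (τ : WeakDual ℂ A)
    (logSeries (star (torusPath α u a) * torusPath α u b - 1))
  have hadd : ∀ a c b : ℝ, a < c → c < b → b - a ≤ 1 / N → step a b = step a c + step c b := by
    intro a c b h1 h2 h3
    let _ : CStarAlgebra (Matrix (Fin n) (Fin n) A) := Matrix.cstarAlgebra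
    refine logStep_add (E := Matrix (Fin n) (Fin n) A)
      (traceCLM (Fin n) (τ : WeakDual ℂ A)) (traceCLM_comm τ) (torusPath_mem α u)
      ((hN.2 _ _ ?_).trans (by norm_num)) ((hN.2 _ _ ?_).trans (by norm_num))
    · rw [abs_sub_comm, abs_of_nonneg (by linarith)]; linarith
    · rw [abs_sub_comm, abs_of_nonneg (by linarith)]; linarith
  have key : ∀ a b : ℝ, a < b → 0 ≤ a → b ≤ 1 → b - a ≤ 1 / N →
      IntervalIntegrable g volume a b ∧ ∫ t in a..b, g t = step a b := by
    intro a b hab h0 h1 hN1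
    have := interval_induction (P := fun a b => b - a ≤ 1 / N →
      IntervalIntegrable g volume a b ∧ ∫ t in a..b, g t = step a b) ?_
      (Finset.univ.biUnion fun i => Finset.univ.biUnion fun j => S i j) a b hab ?_ hN1
    · exact this
    · intro a c b hac hcb h1 h2 h3
      obtain ⟨i1, e1⟩ := h1 (by linarith)
      obtain ⟨i2, e2⟩ := h2 (by linarith)
      refine ⟨i1.trans i2, ?_⟩
      rw [← intervalIntegral.integral_add_adjacent_intervals i1 i2, e1, e2, hadd a c b hac hcb h3]
    · intro a' b' k1 k2 k3 k4 k5
      refine logStep_torusPath_eq_integral α τ hN k2 k5 fun i j => ?_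
      refine hS i j a' b' (h0.trans k1) k2 (k3.trans h1) fun s hs => k4 s ?_
      simp only [Finset.mem_biUnion, Finset.mem_univ, true_and]
      exact ⟨i, j, hs⟩
  have hN0 : (0 : ℝ) < N := Nat.cast_pos.2 hN.pos
  have hk : ∀ k < N, IntervalIntegrable g volume ((k : ℝ) / N) (((k + 1 : ℕ) : ℝ) / N) ∧
      ∫ t in ((k : ℝ) / N)..(((k + 1 : ℕ) : ℝ) / N), g t =
        step ((k : ℝ) / N) (((k + 1 : ℕ) : ℝ) / N) := by
    intro k hk
    have hk' : ((k + 1 : ℕ) : ℝ) ≤ N := by exact_mod_cast hk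
    refine key _ _ ?_ (by positivity) ((div_le_one hN0).2 hk') ?_
    · exact div_lt_div_of_pos_right (by push_cast; linarith) hN0
    · rw [← sub_div]
      refine le_of_eq ?_
      push_cast
      ring
  have hsum := intervalIntegral.sum_integral_adjacent_intervals (μ := volume) (f := g)
    (a := fun k : ℕ => (k : ℝ) / N) (n := N) fun k hk' => (hk k hk').1
  simp only [Nat.cast_zero, zero_div, div_self hN0.ne'] at hsum
  rw [apply_rotSum, logSum, map_sum]
  refine Eq.trans (Finset.sum_congr rfl fun k hk' => ?_) hsum
  rw [(hk k (Finset.mem_range.1 hk')).2, Nat.cast_succ]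

end PiecewiseIntegral

/-! ### Smooth representatives and uniqueness of the rotation map -/

section SmoothRepresentatives

/-- The squaring map of a Banach algebra has a continuously differentiable inverse near `1`. -/
theorem exists_contDiff_sqrt (E : Type*) [NormedRing E] [NormedAlgebra ℝ E] [CompleteSpace E] :
    ∃ (g : E → E) (ε : ℝ), 0 < ε ∧ ∀ s : E, ‖s - 1‖ < ε →
      g (s * s) = s ∧ ContDiffAt ℝ 1 g (s * s) := by
  let f : E → E := fun s => s * s
  have hf : ContDiff ℝ 1 f := contDiff_id.mul contDiff_id
  let f' : E ≃L[ℝ] E := ContinuousLinearEquiv.smulLeft (Units.mk0 (2 : ℝ) two_ne_zero)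
  have hf' : HasFDerivAt f (f' : E →L[ℝ] E) 1 := by
    refine ((hasFDerivAt_id (𝕜 := ℝ) (1 : E)).mul' (hasFDerivAt_id (1 : E))).congr_fderiv ?_
    ext v
    simp [f', two_smul]
  have h1 : f 1 = 1 := mul_one 1
  let e := hf.contDiffAt.toOpenPartialHomeomorph f hf' one_ne_zero
  have hs : ContDiffAt ℝ 1 e.symm (f 1) := hf.contDiffAt.to_localInverse hf' one_ne_zero
  have hev : ∀ᶠ y in nhds (f 1), ContDiffAt ℝ 1 e.symm y := hs.eventually (by simp)
  have hev2 : ∀ᶠ s in nhds (1 : E), s ∈ e.source ∧ ContDiffAt ℝ 1 e.symm (f s) :=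
    Filter.Eventually.and (e.open_source.mem_nhds
      (hf.contDiffAt.mem_toOpenPartialHomeomorph_source hf' one_ne_zero))
      (hf.continuous.continuousAt.eventually hev)
  obtain ⟨ε, hε, h⟩ := Metric.eventually_nhds_iff.1 hev2
  refine ⟨e.symm, ε, hε, fun s hs => ?_⟩
  obtain ⟨k1, k2⟩ := h (by rwa [dist_eq_norm] : dist s 1 < ε)
  exact ⟨e.left_inv k1, k2⟩

variable {A : Type u} [CStarAlgebra A] (α : A ≃⋆ₐ[ℂ] A) {n : ℕ}

/-- The value at `t` as a homomorphism of *-algebras. -/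
noncomputable def torusEvStar (t : unitInterval) :
    Matrix (Fin n) (Fin n) (MappingTorus α) →⋆ₐ[ℂ] Matrix (Fin n) (Fin n) A :=
  { torusEv α t with
    commutes' := fun c => by
      change torusEv α t (algebraMap ℂ _ c) = _
      rw [Algebra.algebraMap_eq_smul_one, torusEv_smul, map_one, Algebra.algebraMap_eq_smul_one]
    map_star' := torusEv_star α t }

/-- Every continuous function with the right values at the end points is a limit of smooth ones. -/
theorem exists_smooth_torusMat_tendsto (F : Matrix (Fin n) (Fin n) (MappingTorus α)) :
    let _ : CStarAlgebra (Matrix (Fin n) (Fin n) A) := Matrix.cstarAlgebra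
    ∃ X : ℕ → Matrix (Fin n) (Fin n) (MappingTorus α), Filter.Tendsto X Filter.atTop (nhds F) ∧
      ∀ m, ∃ x : ℝ → Matrix (Fin n) (Fin n) A, (∀ t : unitInterval, torusEv α t (X m) = x t) ∧
        ContDiff ℝ 1 x := by
  intro _
  let f : C(unitInterval, Matrix (Fin n) (Fin n) A) :=
    ⟨fun t => torusEv α t F, continuous_torusEv_apply α F⟩
  have hα : Continuous α := (NonUnitalStarAlgHom.isometry α α.injective).continuous
  -- a linear term restores the condition at the end points
  let Ψ : C(unitInterval, Matrix (Fin n) (Fin n) A) → C(unitInterval, Matrix (Fin n) (Fin n) A) :=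
    fun p => ⟨fun t => p t + (t : ℝ) • ((p 0).map α - p 1), by fun_prop⟩
  have hΨc : Continuous Ψ := by
    refine ContinuousMap.continuous_of_continuous_uncurry _ ?_
    change Continuous fun z : C(unitInterval, Matrix (Fin n) (Fin n) A) × unitInterval =>
      z.1 z.2 + (z.2 : ℝ) • ((z.1 0).map α - z.1 1)
    refine continuous_eval.add ((continuous_subtype_val.comp continuous_snd).smul ?_)
    have h0 : ∀ t, Continuous fun z : C(unitInterval, Matrix (Fin n) (Fin n) A) × unitInterval =>
        z.1 t := fun t => (continuous_eval_const t).comp continuous_fst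
    exact ((h0 0).matrix_map hα).sub (h0 1)
  have hΨend : ∀ p, (Ψ p 0).map α = Ψ p 1 := by
    intro p
    simp [Ψ]
  have hΨf : Ψ f = f := by
    ext t : 1
    have h : (f 0).map α = f 1 := torusEv_end α F
    simp [Ψ, h]
  let X : ℕ → Matrix (Fin n) (Fin n) (MappingTorus α) := fun m =>
    torusMat α (Ψ (bernsteinApproximation m f)) (hΨend _)
  have hlim : Filter.Tendsto (fun m => Ψ (bernsteinApproximation m f)) Filter.atTop (nhds f) := by
    have := (hΨc.tendsto f).comp (bernsteinApproximation_uniform f)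
    rwa [hΨf] at this
  refine ⟨X, ?_, fun m => ⟨fun t => (∑ k : Fin (m + 1), ((m.choose k : ℝ) * t ^ (k : ℕ) *
    (1 - t) ^ (m - k : ℕ)) • f (bernstein.z k)) +
      t • ((bernsteinApproximation m f 0).map α - bernsteinApproximation m f 1), ?_, ?_⟩⟩
  · refine tendsto_pi_nhds.2 fun i => tendsto_pi_nhds.2 fun j => ?_
    have hind : Topology.IsInducing (MappingTorus.toFun α) := ⟨rfl⟩
    rw [hind.tendsto_nhds_iff]
    have hcomp : Continuous fun p : C(unitInterval, Matrix (Fin n) (Fin n) A) =>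
        (⟨fun M => M i j, by fun_prop⟩ : C(Matrix (Fin n) (Fin n) A, A)).comp p :=
      ContinuousMap.continuous_postcomp _
    exact (hcomp.tendsto f).comp hlim
  · intro t
    change Ψ (bernsteinApproximation m f) t = _
    simp only [Ψ, ContinuousMap.coe_mk]
    rw [bernsteinApproximation.apply]
    simp only [bernstein_apply]
  · fun_prop

/-- Every unitary over the mapping torus is homotopic to a smooth one, the unitary part of a
smooth approximation. -/
theorem exists_joined_piecewiseC1 (u : UMat (MappingTorus α) n) :
    ∃ v : UMat (MappingTorus α) n, Joined u v ∧
      ∀ i j, IsPiecewiseC1 fun t => torusPath α v t i j := by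
  let _ : CStarAlgebra (MappingTorus α) := MappingTorus.cstarAlgebra α
  let _ : CStarAlgebra (Matrix (Fin n) (Fin n) A) := Matrix.cstarAlgebra
  let _ : CStarAlgebra (Matrix (Fin n) (Fin n) (MappingTorus α)) := Matrix.cstarAlgebra
  obtain ⟨g, ε, hε, hg⟩ := exists_contDiff_sqrt (Matrix (Fin n) (Fin n) A)
  obtain ⟨X, hX, hXs⟩ := exists_smooth_torusMat_tendsto α
    (u : Matrix (Fin n) (Fin n) (MappingTorus α))
  have hu : IsUnit (u : Matrix (Fin n) (Fin n) (MappingTorus α)) := ⟨Unitary.toUnits u, rfl⟩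
  have hpol : ContinuousAt (polar : Matrix (Fin n) (Fin n) (MappingTorus α) → _) u :=
    continuousOn_polar.continuousAt (Units.isOpen.mem_nhds hu)
  have hpu : polar (u : Matrix (Fin n) (Fin n) (MappingTorus α)) = u := polar_of_mem u.2
  have ev1 := hX.eventually (Units.isOpen.mem_nhds hu)
  have ev2 := hX.eventually (hpol.eventually (Metric.ball_mem_nhds _ (by norm_num : (0 : ℝ) < 2)))
  have hs : ContinuousAt
      (fun x : Matrix (Fin n) (Fin n) (MappingTorus α) => star (polar x) * x) u :=
    hpol.star.mul continuousAt_id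
  have ev3 := hX.eventually (hs.eventually (Metric.ball_mem_nhds _ hε))
  obtain ⟨m, hm1, hm2, hm3⟩ := (ev1.and (ev2.and ev3)).exists
  obtain ⟨x, hx, hxc⟩ := hXs m
  have hv := polar_mem hm1
  refine ⟨⟨polar (X m), hv⟩, ?_, fun i j => ⟨∅, fun a b h0 hab h1 _ => ?_⟩⟩
  · rw [hpu, dist_eq_norm] at hm2
    exact UMat.joined_of_norm_sub_lt (B := MappingTorus α) hm2
  beta_reduce at hm3
  rw [hpu, (Unitary.mem_iff.1 u.2).1, dist_eq_norm] at hm3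
  -- the positive part `s` is the square root of `x* x`
  set s := star (polar (X m)) * X m with hsdef
  have hs1 : s * s = star (X m) * X m := by
    have e1 : s = invSqrt (star (X m) * X m) * (star (X m) * X m) := by
      rw [hsdef, polar, star_mul, (isSelfAdjoint_invSqrt _).star_eq, mul_assoc]
    rw [e1, ← mul_assoc, invSqrt_mul_mul hm1, one_mul]
  have hs2 : polar (X m) * s = X m := by
    rw [hsdef, ← mul_assoc, (Unitary.mem_iff.1 hv).2, one_mul]
  have hsu : IsUnit s := (IsUnit.star (Unitary.toUnits ⟨polar (X m), hv⟩).isUnit).mul hm1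
  have hst : ∀ t : unitInterval, ‖torusEv α t s - 1‖ < ε := by
    intro t
    have e : torusEv α t s - 1 = torusEvStar α t (s - 1) := by
      rw [map_sub, map_one]; rfl
    rw [e]
    exact (NonUnitalStarAlgHom.norm_apply_le (torusEvStar (n := n) α t) _).trans_lt hm3
  have hform : ∀ t : unitInterval, torusEv α t (polar (X m)) =
      x t * Ring.inverse (g (star (x t) * x t)) := by
    intro t
    have e1 : star (x t) * x t = torusEv α t s * torusEv α t s := by
      rw [← map_mul, hs1, map_mul, torusEv_star, hx]
    rw [e1, (hg _ (hst t)).1, ← hx t]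
    nth_rewrite 2 [← hs2]
    rw [map_mul, mul_assoc, Ring.mul_inverse_cancel _ (hsu.map (torusEv α t)), mul_one]
  have hcd : ContDiffOn ℝ 1 (fun t : ℝ => x t * Ring.inverse (g (star (x t) * x t)))
      (Set.Icc a b) := by
    intro t ht
    let t' : unitInterval := ⟨t, h0.trans ht.1, ht.2.trans h1⟩
    have e1 : star (x t) * x t = torusEv α t' s * torusEv α t' s := by
      rw [← map_mul, hs1, map_mul, torusEv_star, hx]
    have hg' := hg _ (hst t')
    rw [← e1] at hg'
    obtain ⟨w, hw⟩ := hsu.map (torusEv α t')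
    have hinv : ContDiffAt ℝ 1 Ring.inverse (g (star (x t) * x t)) := by
      rw [hg'.1, ← hw]
      exact contDiffAt_ringInverse ℝ w
    have hstar : ContDiff ℝ 1 fun t => star (x t) :=
      (starL' ℝ : Matrix (Fin n) (Fin n) A ≃L[ℝ] _).contDiff.comp hxc
    have hin : ContDiffAt ℝ 1 (fun t => g (star (x t) * x t)) t :=
      hg'.2.comp t (hstar.mul hxc).contDiffAt
    exact (hxc.contDiffAt.mul (hinv.comp t hin)).contDiffWithinAt
  let pr : Matrix (Fin n) (Fin n) A →L[ℝ] A :=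
    { toFun := fun M => M i j
      map_add' := fun _ _ => rfl
      map_smul' := fun _ _ => rfl
      cont := continuous_apply_apply i j }
  refine (pr.contDiff.comp_contDiffOn hcd).congr fun t ht => ?_
  have ht' : t ∈ Set.Icc (0 : ℝ) 1 := ⟨h0.trans ht.1, ht.2.trans h1⟩
  change torusEv α (Set.projIcc (0 : ℝ) 1 zero_le_one t) (polar (X m)) i j = _
  rw [Set.projIcc_of_mem _ ht', hform]
  rfl

end SmoothRepresentatives

section RotationMap

variable {A : Type u} [CStarAlgebra A] {α : A ≃⋆ₐ[ℂ] A}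

/-- Every class in `K₁(M_α)` has a piecewise continuously differentiable representative. -/
theorem IsRotationMap.unique {R R' : K1 (MappingTorus α) →+ AffT A} (h : IsRotationMap α R)
    (h' : IsRotationMap α R') : R = R' := by
  ext x : 1
  induction x using K1.ind with
  | h n u =>
    obtain ⟨v, hv, hd⟩ := exists_joined_piecewiseC1 α u
    rw [K1.mk_eq_of_joined hv]
    refine Subtype.ext (ContinuousMap.ext fun τ => Complex.ofReal_injective ?_)
    exact (h n v hd τ).trans (h' n v hd τ).symm

/-- The rotation map, with its value as a sum of logarithms. -/
theorem exists_isRotationMap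
    (hα : ∀ (τ : TracialState A) a, (τ : WeakDual ℂ A) (α a) = (τ : WeakDual ℂ A) a) :
    ∃ R : K1 (MappingTorus α) →+ AffT A, IsRotationMap α R ∧
      ∀ (n : ℕ) (u : UMat (MappingTorus α) n) (τ : TracialState A) (N : ℕ), TorusFine α N u →
      (((R (K1.mk u) : C(TracialState A, ℝ)) τ : ℝ) : ℂ) =
        1 / (2 * Real.pi * Complex.I) * (τ : WeakDual ℂ A) (rotSum α N u) := by
  obtain ⟨R, hR⟩ := exists_rotationHom α hα
  refine ⟨R, fun n u hu τ => ?_, hR⟩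
  obtain ⟨N, hN⟩ := exists_torusFine α u
  rw [hR n u τ N hN, rotSum_eq_integral α τ hN hu]
  rfl

end RotationMap

/-! ### Classes of projections in `K₀` -/

section KZeroClasses

open scoped Matrix

variable {ι κ σ : Type*} [Fintype ι] [Fintype κ] [Fintype σ] {A : Type u} [CStarAlgebra A]

open Classical in
/-- The class in `K₀(A)` of a projection with arbitrary finite index set. It is `0` on matrices
which are not projections. -/
noncomputable def K0.cls (p : Matrix ι ι A) : K0 A :=
  if hp : IsStarProjection p then
    K0.mk ⟨Fintype.card ι, p.submatrix (Fintype.equivFin ι).symm (Fintype.equivFin ι).symm,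
      submatrix_proj _ hp⟩
  else 0

theorem K0.mk_eq_of_mvN {p q : Proj A} (h : MvN p.p q.p) : K0.mk p = K0.mk q :=
  congrArg Algebra.GrothendieckAddGroup.of (Quotient.sound h)

theorem K0.cls_eq {p : Matrix ι ι A} (hp : IsStarProjection p) {q : Proj A} (h : MvN p q.p) :
    K0.cls p = K0.mk q := by
  rw [K0.cls, dif_pos hp]
  refine K0.mk_eq_of_mvN ?_
  have hp' := (isStarProjection_iff_matrix p).1 hp
  have h2 := submatrix_proj (Fintype.equivFin ι).symm hp
  exact (MvN.reindex hp'.1 hp'.2 (Fintype.equivFin ι).symm).symm.trans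
    ((isStarProjection_iff_matrix _).1 h2).1 q.mul_self h

theorem K0.cls_proj (q : Proj A) : K0.cls q.p = K0.mk q :=
  K0.cls_eq q.isProj ⟨q.p, by rw [q.star_self, q.mul_self], by rw [q.star_self, q.mul_self]⟩

theorem K0.cls_eq_of_mvN {p : Matrix ι ι A} {q : Matrix κ κ A} (hp : IsStarProjection p)
    (hq : IsStarProjection q) (h : MvN p q) : K0.cls p = K0.cls q := by
  have hp' := (isStarProjection_iff_matrix p).1 hp
  have hq' := (isStarProjection_iff_matrix q).1 hq
  have h2 := submatrix_proj (Fintype.equivFin κ).symm hq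
  rw [K0.cls_eq (q := ⟨_, _, h2⟩) hp, K0.cls, dif_pos hq]
  exact h.trans hp'.1 ((isStarProjection_iff_matrix _).1 h2).1
    (MvN.reindex hq'.1 hq'.2 (Fintype.equivFin κ).symm)

theorem K0.cls_fromBlocks {p : Matrix ι ι A} {q : Matrix κ κ A} (hp : IsStarProjection p)
    (hq : IsStarProjection q) : K0.cls (Matrix.fromBlocks p 0 0 q) = K0.cls p + K0.cls q := by
  have hp' := (isStarProjection_iff_matrix p).1 hp
  have hq' := (isStarProjection_iff_matrix q).1 hq
  let P : Proj A := ⟨_, _, submatrix_proj (Fintype.equivFin ι).symm hp⟩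
  let Q : Proj A := ⟨_, _, submatrix_proj (Fintype.equivFin κ).symm hq⟩
  have h1 : K0.cls p = K0.mk P := by rw [K0.cls, dif_pos hp]
  have h2 : K0.cls q = K0.mk Q := by rw [K0.cls, dif_pos hq]
  have h3 : K0.mk P + K0.mk Q = K0.mk (P.add Q) := by
    rw [K0.mk, K0.mk, K0.mk, ProjClass.mk_add, map_add]
  rw [h1, h2, h3]
  refine K0.cls_eq (fromBlocks_proj hp hq) ?_
  have hPQ := fromBlocks_proj P.isProj Q.isProj
  have hPQ' := (isStarProjection_iff_matrix _).1 hPQ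
  have hm := MvN.fromBlocks (MvN.reindex hp'.1 hp'.2 (Fintype.equivFin ι).symm)
    (MvN.reindex hq'.1 hq'.2 (Fintype.equivFin κ).symm)
  exact hm.trans ((isStarProjection_iff_matrix _).1 (fromBlocks_proj hp hq)).1
    (P.add Q).mul_self (MvN.reindex hPQ'.1 hPQ'.2 finSumFinEquiv.symm)

/-- The class of a sum of orthogonal projections. -/
theorem K0.cls_add {p q : Matrix ι ι A} (hp : IsStarProjection p) (hq : IsStarProjection q)
    (h : p * q = 0) : K0.cls (p + q) = K0.cls p + K0.cls q := by
  obtain ⟨p1, p2⟩ := (isStarProjection_iff_matrix p).1 hp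
  obtain ⟨q1, q2⟩ := (isStarProjection_iff_matrix q).1 hq
  have h' : q * p = 0 := by
    have := congrArg Matrix.conjTranspose h
    rwa [Matrix.conjTranspose_mul, p2, q2, Matrix.conjTranspose_zero] at this
  have hpq : IsStarProjection (p + q) := by
    rw [isStarProjection_iff_matrix]
    exact ⟨by simp [add_mul, mul_add, p1, q1, h, h'], by rw [Matrix.conjTranspose_add, p2, q2]⟩
  rw [← K0.cls_fromBlocks hp hq]
  refine K0.cls_eq_of_mvN hpq (fromBlocks_proj hp hq)
    ⟨Matrix.of (Sum.elim (fun i => p i) fun i => q i), ?_, ?_⟩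
  · ext i j
    have e1 : (p * p) i j = p i j := by rw [p1]
    have e2 : (q * q) i j = q i j := by rw [q1]
    rw [Matrix.mul_apply] at e1 e2
    simp only [Matrix.mul_apply, Fintype.sum_sum_type, Matrix.conjTranspose_apply, Matrix.of_apply,
      Sum.elim_inl, Sum.elim_inr, Matrix.add_apply]
    rw [← e1, ← e2]
    congr 1
    · refine Finset.sum_congr rfl fun k _ => ?_
      rw [← Matrix.conjTranspose_apply, p2]
    · refine Finset.sum_congr rfl fun k _ => ?_
      rw [← Matrix.conjTranspose_apply, q2]
  · ext i j
    rcases i with i | i <;> rcases j with j | j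
    · have e : (p * pᴴ) i j = p i j := by rw [p2, p1]
      simpa [Matrix.mul_apply] using e
    · have e : (p * qᴴ) i j = 0 := by rw [q2, h]; rfl
      simpa [Matrix.mul_apply] using e
    · have e : (q * pᴴ) i j = 0 := by rw [p2, h']; rfl
      simpa [Matrix.mul_apply] using e
    · have e : (q * qᴴ) i j = q i j := by rw [q2, q1]
      simpa [Matrix.mul_apply] using e

end KZeroClasses

section NearProjections

open scoped Matrix

/-- Projections of a C*-algebra at distance less than one are conjugate by a unitary: the unitary
part of `q p + (1 - q) (1 - p)`. -/
theorem exists_unitary_mul_eq_mul_of_norm_sub_lt_one {E : Type*} [CStarAlgebra E] {p q : E}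
    (hp : IsStarProjection p) (hq : IsStarProjection q) (h : ‖p - q‖ < 1) :
    ∃ u ∈ unitary E, u * p = q * u := by
  have p1 := hp.isIdempotentElem.eq
  have q1 := hq.isIdempotentElem.eq
  have p2 := hp.isSelfAdjoint.star_eq
  have q2 := hq.isSelfAdjoint.star_eq
  set x : E := q * p + (1 - q) * (1 - p) with hx
  have hw : (2 * q - 1) ∈ unitary E := by
    have e : star (2 * q - 1) = 2 * q - 1 := by
      rw [star_sub, star_mul, q2, star_one, star_ofNat]
      noncomm_ring
    have e2 : (2 * q - 1) * (2 * q - 1) = 4 * (q * q) - 4 * q + 1 := by noncomm_ring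
    rw [Unitary.mem_iff, e, e2, q1, sub_self, zero_add]
    exact ⟨rfl, rfl⟩
  have hx1 : 1 - x = -((2 * q - 1) * (p - q)) := by
    have : (2 * q - 1) * (p - q) = 2 * (q * p) - 2 * (q * q) - p + q := by noncomm_ring
    rw [this, q1, hx]
    noncomm_ring
  have hxu : IsUnit x := by
    have h1 : ‖1 - x‖ < 1 := by
      rw [hx1, norm_neg, CStarRing.norm_mem_unitary_mul _ hw]
      exact h
    have h2 := isUnit_one_sub_of_norm_lt_one h1
    rwa [sub_sub_cancel] at h2
  have hxp : x * p = q * x := by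
    rw [hx]
    have e1 : (q * p + (1 - q) * (1 - p)) * p = q * (p * p) + (1 - q) * (p - p * p) := by
      noncomm_ring
    have e2 : q * (q * p + (1 - q) * (1 - p)) = q * q * p + (q - q * q) * (1 - p) := by
      noncomm_ring
    rw [e1, e2, p1, q1]
    simp
  have hpx : p * star x = star x * q := by
    have := congrArg star hxp
    rwa [star_mul, star_mul, p2, q2] at this
  have hcomm : Commute (star x * x) p := by
    change star x * x * p = p * (star x * x)
    rw [mul_assoc, hxp, ← mul_assoc, ← hpx, mul_assoc]
  refine ⟨polar x, polar_mem hxu, ?_⟩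
  rw [polar, mul_assoc, (Commute.invSqrt hcomm).eq, ← mul_assoc, hxp, mul_assoc]

variable {ι : Type*} [Fintype ι] {A : Type u} [CStarAlgebra A]

/-- The class of a projection is constant along paths. -/
theorem K0.cls_eq_of_path {P : unitInterval → Matrix ι ι A} (hP : Continuous P)
    (hp : ∀ t, IsStarProjection (P t)) : K0.cls (P 0) = K0.cls (P 1) := by
  classical
  let _ : CStarAlgebra (Matrix ι ι A) := Matrix.cstarAlgebra
  have hlc : IsLocallyConstant fun t => K0.cls (P t) := by
    rw [IsLocallyConstant.iff_eventually_eq]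
    intro t
    filter_upwards [hP.continuousAt.eventually (Metric.ball_mem_nhds _ one_pos)] with s hs
    obtain ⟨w, hw, hwp⟩ := exists_unitary_mul_eq_mul_of_norm_sub_lt_one (hp s) (hp t)
      (by rwa [← dist_eq_norm])
    obtain ⟨s1, s2⟩ := (isStarProjection_iff_matrix _).1 (hp s)
    obtain ⟨t1, t2⟩ := (isStarProjection_iff_matrix _).1 (hp t)
    refine K0.cls_eq_of_mvN (hp s) (hp t) ⟨w * P s, ?_, ?_⟩
    · have h1 : wᴴ * w = 1 := (Unitary.mem_iff.1 hw).1
      rw [Matrix.conjTranspose_mul, s2]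
      calc _ = P s * (wᴴ * w) * P s := by simp only [Matrix.mul_assoc]
        _ = P s := by rw [h1, Matrix.mul_one, s1]
    · have h1 : w * wᴴ = 1 := (Unitary.mem_iff.1 hw).2
      rw [Matrix.conjTranspose_mul, s2, hwp]
      calc _ = P t * (w * P s) * wᴴ := by simp only [Matrix.mul_assoc]
        _ = P t * P t * (w * wᴴ) := by rw [hwp]; simp only [Matrix.mul_assoc]
        _ = P t := by rw [h1, Matrix.mul_one, t1]
  exact hlc.apply_eq_of_preconnectedSpace 0 1

end NearProjections

/-! ### Coefficients in complex projections -/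

section ComplexProjections

open scoped Matrix

/-- Projections of complex matrices are classified by their trace. -/
theorem mvN_one_of_isStarProjection {ι : Type*} [Fintype ι] [DecidableEq ι] {f : Matrix ι ι ℂ}
    (hf : IsStarProjection f) : ∃ r : ℕ, f.trace = r ∧ MvN f (1 : Matrix (Fin r) (Fin r) ℂ) := by
  obtain ⟨f1, f2⟩ := (isStarProjection_iff_matrix f).1 hf
  have hH : f.IsHermitian := f2
  set U : Matrix ι ι ℂ := hH.eigenvectorUnitary.1 with hU
  have hUU : star U * U = 1 := (Unitary.mem_iff.1 hH.eigenvectorUnitary.2).1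
  have hUU' : U * star U = 1 := (Unitary.mem_iff.1 hH.eigenvectorUnitary.2).2
  have hfU : f = U * Matrix.diagonal (RCLike.ofReal ∘ hH.eigenvalues) * star U := by
    have := hH.spectral_theorem
    rwa [Unitary.conjStarAlgAut_apply] at this
  set l : ι → ℂ := RCLike.ofReal ∘ hH.eigenvalues with hl
  have hll : ∀ i, l i * l i = l i := by
    have h1 : Matrix.diagonal l = star U * f * U := by
      rw [hfU]
      calc _ = (star U * U) * Matrix.diagonal l * (star U * U) := by
            rw [hUU, Matrix.one_mul, Matrix.mul_one]
        _ = _ := by simp only [Matrix.mul_assoc]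
    have h2 : Matrix.diagonal l * Matrix.diagonal l = Matrix.diagonal l := by
      rw [h1]
      calc _ = star U * f * (U * star U) * f * U := by simp only [Matrix.mul_assoc]
        _ = star U * (f * f) * U := by rw [hUU']; simp only [Matrix.mul_assoc, Matrix.one_mul]
        _ = _ := by rw [f1]
    intro i
    rw [Matrix.diagonal_mul_diagonal] at h2
    simpa using congrFun (congrFun h2 i) i
  have hl1 : ∀ i, l i ≠ 0 → l i = 1 := fun i hi => mul_left_cancel₀ hi (by rw [hll, mul_one])
  let e := Fintype.equivFin {i // l i ≠ 0}
  let v : Matrix (Fin (Fintype.card {i // l i ≠ 0})) ι ℂ :=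
    Matrix.of fun a j => star (U j (e.symm a))
  have hv1 : vᴴ * v = f := by
    rw [hfU]
    ext j k
    have h1 : (vᴴ * v) j k = ∑ x : {i // l i ≠ 0}, U j x * star (U k x) := by
      rw [Matrix.mul_apply, ← e.symm.sum_comp]
      simp [v]
    rw [h1, Matrix.mul_apply]
    simp only [Matrix.mul_diagonal, Matrix.star_apply]
    rw [← Finset.sum_filter_of_ne (s := Finset.univ) (p := fun i => l i ≠ 0)]
    · rw [← Finset.sum_subtype_eq_sum_filter, Finset.subtype_univ]
      refine Finset.sum_congr rfl fun x _ => ?_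
      rw [hl1 x x.2, mul_one]
    · intro i _ h hi
      exact h (by rw [hi]; simp)
  have hv2 : v * vᴴ = 1 := by
    ext a b
    have h1 : (v * vᴴ) a b = (star U * U) (e.symm a) (e.symm b) := by
      simp [Matrix.mul_apply, v]
    rw [h1, hUU, Matrix.one_apply, Matrix.one_apply]
    simp only [Subtype.val_inj, EmbeddingLike.apply_eq_iff_eq]
  refine ⟨_, ?_, v, hv1, hv2⟩
  rw [← hv1, Matrix.trace_mul_comm, hv2, Matrix.trace_one, Fintype.card_fin]

theorem MvN.of_trace_eq {ι κ : Type*} [Fintype ι] [Fintype κ] [DecidableEq ι] [DecidableEq κ]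
    {f : Matrix ι ι ℂ} {g : Matrix κ κ ℂ} (hf : IsStarProjection f) (hg : IsStarProjection g)
    (h : f.trace = g.trace) : MvN f g := by
  obtain ⟨r, hr, h1⟩ := mvN_one_of_isStarProjection hf
  obtain ⟨s, hs, h2⟩ := mvN_one_of_isStarProjection hg
  have hrs : r = s := by
    rw [hr, hs] at h
    exact_mod_cast h
  subst hrs
  exact h1.trans ((isStarProjection_iff_matrix f).1 hf).1 ((isStarProjection_iff_matrix g).1 hg).1
    h2.symm

end ComplexProjections

section Tensor

open scoped Matrix

variable {ι κ μ σ : Type*} [Fintype ι] [Fintype κ] [Fintype μ] [Fintype σ] {A : Type u}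
  [CStarAlgebra A]

/-- The tensor product of a complex matrix and a matrix over `A`. -/
def Matrix.tens (v : Matrix ι κ ℂ) (p : Matrix σ σ A) : Matrix (ι × σ) (κ × σ) A :=
  Matrix.of fun x y => v x.1 y.1 • p x.2 y.2

omit [Fintype ι] [Fintype μ] in
theorem Matrix.tens_mul (v : Matrix ι κ ℂ) (w : Matrix κ μ ℂ) (p q : Matrix σ σ A) :
    Matrix.tens v p * Matrix.tens w q = Matrix.tens (v * w) (p * q) := by
  ext x y
  change _ = (v * w) x.1 y.1 • (p * q) x.2 y.2
  rw [Matrix.mul_apply, Matrix.mul_apply, Matrix.mul_apply, Fintype.sum_prod_type,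
    Finset.sum_smul]
  refine Finset.sum_congr rfl fun i _ => ?_
  rw [Finset.smul_sum]
  exact Finset.sum_congr rfl fun j _ => smul_mul_smul_comm _ _ _ _

omit [Fintype ι] [Fintype κ] [Fintype σ] in
theorem Matrix.tens_conjTranspose (v : Matrix ι κ ℂ) (p : Matrix σ σ A) :
    (Matrix.tens v p)ᴴ = Matrix.tens vᴴ pᴴ := by
  ext x y
  simp [Matrix.tens]

theorem Matrix.tens_proj {f : Matrix ι ι ℂ} {p : Matrix σ σ A} (hf : IsStarProjection f)
    (hp : IsStarProjection p) : IsStarProjection (Matrix.tens f p) := by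
  rw [isStarProjection_iff_matrix] at *
  rw [Matrix.tens_mul, Matrix.tens_conjTranspose, hf.1, hf.2, hp.1, hp.2]
  exact ⟨rfl, rfl⟩

theorem MvN.tens {f : Matrix ι ι ℂ} {g : Matrix κ κ ℂ} (h : MvN f g) {p : Matrix σ σ A}
    (hp : IsStarProjection p) : MvN (Matrix.tens f p) (Matrix.tens g p) := by
  obtain ⟨v, h1, h2⟩ := h
  obtain ⟨p1, p2⟩ := (isStarProjection_iff_matrix p).1 hp
  refine ⟨Matrix.tens v p, ?_, ?_⟩
  · rw [Matrix.tens_conjTranspose, Matrix.tens_mul, h1, p2, p1]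
  · rw [Matrix.tens_conjTranspose, Matrix.tens_mul, h2, p2, p1]

theorem K0.cls_tens_eq [DecidableEq ι] [DecidableEq κ] {f : Matrix ι ι ℂ} {g : Matrix κ κ ℂ}
    (hf : IsStarProjection f) (hg : IsStarProjection g) (h : f.trace = g.trace)
    {p : Matrix σ σ A} (hp : IsStarProjection p) :
    K0.cls (Matrix.tens f p) = K0.cls (Matrix.tens g p) :=
  K0.cls_eq_of_mvN (Matrix.tens_proj hf hp) (Matrix.tens_proj hg hp)
    ((MvN.of_trace_eq hf hg h).tens hp)

theorem K0.cls_tens_eq_add [DecidableEq ι] [DecidableEq κ] {f : Matrix ι ι ℂ} {g : Matrix κ κ ℂ}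
    (hf : IsStarProjection f) (hg : IsStarProjection g) (h : f.trace = g.trace + 1)
    {p : Matrix σ σ A} (hp : IsStarProjection p) :
    K0.cls (Matrix.tens f p) = K0.cls (Matrix.tens g p) + K0.cls p := by
  obtain ⟨p1, p2⟩ := (isStarProjection_iff_matrix p).1 hp
  have h1 : IsStarProjection (1 : Matrix Unit Unit ℂ) := .one _
  have hg1 := fromBlocks_proj hg h1
  rw [K0.cls_tens_eq hf hg1 (by rw [h]; simp [Matrix.trace, Fintype.sum_sum_type]) hp,
    ← K0.cls_fromBlocks (Matrix.tens_proj hg hp) hp]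
  have e : Matrix.fromBlocks (Matrix.tens g p) 0 0 p =
      (Matrix.tens (Matrix.fromBlocks g 0 0 (1 : Matrix Unit Unit ℂ)) p).submatrix
        (Sum.elim (fun x => (Sum.inl x.1, x.2)) fun j => (Sum.inr (), j))
        (Sum.elim (fun x => (Sum.inl x.1, x.2)) fun j => (Sum.inr (), j)) := by
    ext x y
    rcases x with x | x <;> rcases y with y | y <;> simp [Matrix.tens]
  let eq : (κ × σ) ⊕ σ ≃ (κ ⊕ Unit) × σ :=
    ((Equiv.sumCongr (Equiv.refl _) (Equiv.punitProd σ).symm)).trans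
      (Equiv.sumProdDistrib κ Unit σ).symm
  have e2 : Matrix.fromBlocks (Matrix.tens g p) 0 0 p =
      (Matrix.tens (Matrix.fromBlocks g 0 0 (1 : Matrix Unit Unit ℂ)) p).submatrix eq eq := by
    rw [e]
    ext x y
    rcases x with x | x <;> rcases y with y | y <;> rfl
  have hT := Matrix.tens_proj hg1 hp
  obtain ⟨t1, t2⟩ := (isStarProjection_iff_matrix _).1 hT
  refine K0.cls_eq_of_mvN hT (fromBlocks_proj (Matrix.tens_proj hg hp) hp) ?_
  rw [e2]
  exact MvN.reindex t1 t2 eq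

end Tensor

/-! ### Values of the rotation map on Bott classes -/

section RotationOfLoops

open scoped Matrix ComplexOrder

variable {A : Type u} [CStarAlgebra A]

theorem K0.exists_eq_sub (x : K0 A) : ∃ p q : Proj A, x = K0.mk p - K0.mk q := by
  obtain ⟨⟨a, s⟩, h⟩ := (AddLocalization.addMonoidOf (⊤ : AddSubmonoid (ProjClass A))).surj x
  obtain ⟨p, rfl⟩ := Quotient.exists_rep a
  obtain ⟨q, hq⟩ := Quotient.exists_rep s.1
  refine ⟨p, q, eq_sub_of_add_eq ?_⟩
  rw [← hq] at h
  exact h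

variable (α : A ≃⋆ₐ[ℂ] A)

theorem torusPath_loopU {n : ℕ} (p : Matrix (Fin n) (Fin n) A) (hp : IsStarProjection p) {t : ℝ}
    (ht : t ∈ Set.Icc (0 : ℝ) 1) : torusPath α (loopU α p hp) t =
      Complex.exp (2 * Real.pi * Complex.I * t) • p + 1 - p := by
  refine (loopMat_eval α p _).trans ?_
  rw [Set.projIcc_of_mem _ ht]

theorem isPiecewiseC1_loopU {n : ℕ} (p : Matrix (Fin n) (Fin n) A) (hp : IsStarProjection p)
    (i j : Fin n) : IsPiecewiseC1 fun t => torusPath α (loopU α p hp) t i j := by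
  refine ⟨∅, fun a b h0 _ h1 _ => ?_⟩
  have h : ContDiff ℝ 1 fun t : ℝ => Complex.exp (2 * Real.pi * Complex.I * t) • p i j +
      (1 : Matrix (Fin n) (Fin n) A) i j - p i j := by
    have h2 : ContDiff ℝ 1 fun t : ℝ => (2 * Real.pi * Complex.I * t : ℂ) :=
      contDiff_const.mul Complex.ofRealCLM.contDiff
    exact ((h2.cexp.smul contDiff_const).add contDiff_const).sub contDiff_const
  refine h.contDiffOn.congr fun t ht => ?_
  rw [torusPath_loopU α p hp ⟨h0.trans ht.1, ht.2.trans h1⟩]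
  rfl

theorem rotationNumber_loopU {n : ℕ} (p : Matrix (Fin n) (Fin n) A) (hp : IsStarProjection p)
    (τ : TracialState A) :
    rotationNumber α (loopU α p hp) τ = (τ : WeakDual ℂ A) p.trace := by
  obtain ⟨p1, p2⟩ := (isStarProjection_iff_matrix p).1 hp
  have key : ∀ t ∈ Set.uIoo (0 : ℝ) 1, (τ : WeakDual ℂ A)
      (Matrix.trace ((Matrix.of fun i j => deriv (fun s => torusPath α (loopU α p hp) s i j) t) *
      star (torusPath α (loopU α p hp) t))) =
        2 * Real.pi * Complex.I * (τ : WeakDual ℂ A) p.trace := by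
    intro t ht
    rw [Set.uIoo_of_le zero_le_one] at ht
    have hder : ∀ i j, deriv (fun s => torusPath α (loopU α p hp) s i j) t =
        ((2 * Real.pi * Complex.I * Complex.exp (2 * Real.pi * Complex.I * t)) • p) i j := by
      intro i j
      have h1 : HasDerivAt (fun s : ℝ => Complex.exp (2 * Real.pi * Complex.I * s) • p i j +
          (1 : Matrix (Fin n) (Fin n) A) i j - p i j)
          ((2 * Real.pi * Complex.I * Complex.exp (2 * Real.pi * Complex.I * t)) • p i j) t := by
        have h2 : HasDerivAt (fun s : ℝ => Complex.exp (2 * Real.pi * Complex.I * s))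
            (2 * Real.pi * Complex.I * Complex.exp (2 * Real.pi * Complex.I * t)) t := by
          have h3 : HasDerivAt (fun s : ℝ => (2 * Real.pi * Complex.I * s : ℂ))
              (2 * Real.pi * Complex.I) t := by
            simpa using (Complex.ofRealCLM.hasDerivAt (x := t)).const_mul
              (2 * Real.pi * Complex.I : ℂ)
          exact h3.cexp.congr_deriv (mul_comm _ _)
        exact ((h2.smul_const (p i j)).add_const _).sub_const _
      refine (h1.congr_of_eventuallyEq ?_).deriv
      filter_upwards [Ioo_mem_nhds ht.1 ht.2] with s hs
      rw [torusPath_loopU α p hp ⟨hs.1.le, hs.2.le⟩]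
      rfl
    have e1 : (Matrix.of fun i j => deriv (fun s => torusPath α (loopU α p hp) s i j) t) =
        (2 * Real.pi * Complex.I * Complex.exp (2 * Real.pi * Complex.I * t)) • p := by
      ext i j
      exact hder i j
    have e2 : p * star (torusPath α (loopU α p hp) t) =
        star (Complex.exp (2 * Real.pi * Complex.I * t)) • p := by
      rw [torusPath_loopU α p hp ⟨ht.1.le, ht.2.le⟩, Matrix.star_eq_conjTranspose,
        Matrix.conjTranspose_sub, Matrix.conjTranspose_add, Matrix.conjTranspose_smul,
        Matrix.conjTranspose_one, p2, mul_sub, mul_add, mul_one, Matrix.mul_smul, p1]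
      abel
    have hz : Complex.exp (2 * Real.pi * Complex.I * t) *
        star (Complex.exp (2 * Real.pi * Complex.I * t)) = 1 := by
      rw [Complex.star_def, ← Complex.exp_conj, ← Complex.exp_add]
      simp [Complex.conj_ofNat]
    rw [e1, Matrix.smul_mul, e2, smul_smul, mul_assoc, hz, mul_one, Matrix.trace_smul, map_smul,
      smul_eq_mul]
  rw [rotationNumber, intervalIntegral.integral_congr_uIoo key, intervalIntegral.integral_const,
    sub_zero, one_smul, ← mul_assoc, one_div, inv_mul_cancel₀ Complex.two_pi_I_ne_zero, one_mul]

variable {α}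

/-- The rotation map extends the dimension map. -/
theorem IsRotationMap.apply_torusι {R : K1 (MappingTorus α) →+ AffT A} (hR : IsRotationMap α R)
    (x : K0 A) : R (torusι α x) = dimensionMap A x := by
  have key : ∀ p : Proj A, R (torusι α (K0.mk p)) = dimensionMap A (K0.mk p) := by
    intro p
    refine Subtype.ext (ContinuousMap.ext fun τ => ?_)
    have h := hR _ _ (isPiecewiseC1_loopU α p.p p.isProj) τ
    rw [rotationNumber_loopU] at h
    rw [torusι_mk, dimensionMap_mk, ← h, Complex.ofReal_re]
  obtain ⟨p, q, rfl⟩ := K0.exists_eq_sub x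
  rw [map_sub, map_sub, map_sub, key, key]

/-- The rotation map vanishes on constant unitaries. -/
theorem IsRotationMap.apply_const {R : K1 (MappingTorus (1 : A ≃⋆ₐ[ℂ] A)) →+ AffT A}
    (hR : IsRotationMap 1 R) (c : K1 A) :
    R (K1.map (torusConst A) (continuous_torusConst A) c) = 0 := by
  induction c using K1.ind with
  | h n u =>
    refine Subtype.ext (ContinuousMap.ext fun τ => Complex.ofReal_injective ?_)
    rw [K1.map_mk]
    have e : ∀ t, torusPath 1 (UMat.map (torusConst A) n u) t = u := fun t => rfl
    refine (hR n _ (fun i j => ⟨∅, fun a b _ _ _ _ => ?_⟩) τ).trans ?_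
    · simp only [e]
      exact contDiffOn_const
    · simp [rotationNumber, e, show (Matrix.of fun (_ _ : Fin n) => (0 : A)) = 0 from rfl]

end RotationOfLoops

/-! ### Ranks of projections at characters -/

section Characters

open scoped Matrix ComplexOrder

variable {D : Type u} [CStarAlgebra D]

/-- A character as a tracial state. -/
noncomputable def characterState (χ : D →⋆ₐ[ℂ] ℂ) : TracialState D :=
  ⟨({ toLinearMap := (χ : D →ₗ[ℂ] ℂ), cont := map_continuous χ } : D →L[ℂ] ℂ), map_one χ,
    fun a => by
      change 0 ≤ χ (star a * a)
      rw [map_mul, map_star]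
      exact star_mul_self_nonneg _,
    fun a b => by
      change χ (a * b) = χ (b * a)
      rw [map_mul, map_mul, mul_comm]⟩

theorem characterState_apply (χ : D →⋆ₐ[ℂ] ℂ) (a : D) :
    (characterState χ : WeakDual ℂ D) a = χ a := rfl

theorem character_trace_re (χ : D →⋆ₐ[ℂ] ℂ) (e : Proj D) :
    ((χ e.p.trace).re : ℂ) = χ e.p.trace := by
  have h : star (χ e.p.trace) = χ e.p.trace := by
    rw [← map_star, ← Matrix.trace_conjTranspose, e.star_self]
  exact Complex.conj_eq_iff_re.1 h

theorem rotSum_eq_zero_of_character {N : ℕ} {V : UMat (MappingTorus (1 : D ≃⋆ₐ[ℂ] D)) 1}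
    (hN : TorusFine 1 N V) (χ : D →⋆ₐ[ℂ] ℂ) (h : ∀ t, χ (torusEv 1 t V.1 0 0) = 1) :
    (characterState χ : WeakDual ℂ D) (rotSum 1 N V) = 0 := by
  let _ : CStarAlgebra (Matrix (Fin 1) (Fin 1) D) := Matrix.cstarAlgebra
  have h0 : (0 : ℝ) < N := Nat.cast_pos.2 hN.pos
  let ψ : Matrix (Fin 1) (Fin 1) D →+* ℂ :=
    (χ : D →+* ℂ).comp (Matrix.uniqueRingEquiv : Matrix (Fin 1) (Fin 1) D ≃+* D).toRingHom
  have hψ : ∀ M, ψ M = traceCLM (Fin 1) (characterState χ : WeakDual ℂ D) M := by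
    intro M
    rw [traceCLM_apply, Matrix.trace_fin_one]
    rfl
  have hV : ∀ t, ψ (torusPath 1 V t) = 1 := fun t => h _
  have hVs : ∀ t, ψ (star (torusPath 1 V t)) = 1 := by
    intro t
    have h1 := congrArg ψ (Unitary.mem_iff.1 (torusPath_mem 1 V t)).1
    rwa [map_mul, hV, mul_one, map_one] at h1
  rw [apply_rotSum, logSum, map_sum]
  refine Finset.sum_eq_zero fun k _ => ?_
  have hx : ‖star (torusPath 1 V ((k : ℝ) / N)) * torusPath 1 V ((k + 1) / N) - 1‖ < 1 := by
    rw [norm_star_mul_sub_one (torusPath_mem 1 V _)]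
    refine (hN.2 _ _ ?_).trans_lt (by norm_num)
    rw [← sub_div, sub_add_cancel_left, neg_div, abs_neg, abs_of_nonneg (by positivity)]
  refine (map_logSeries (E := Matrix (Fin 1) (Fin 1) D)
    (traceCLM (Fin 1) (characterState χ : WeakDual ℂ D)) hx).trans ?_
  convert tsum_zero with m
  rw [← hψ, map_pow, map_sub, map_mul, hV, hVs, map_one, mul_one, sub_self,
    zero_pow (Nat.succ_ne_zero m), mul_zero]

/-- The difference of two projections over `D` whose Bott class is that of a loop `W` of
unitaries of `D`, up to constants: its rank under a character `χ` is the winding number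
of `χ(W)`, for loops with winding number `0` or `1`. -/
theorem exists_proj_of_loop (W : UMat (MappingTorus (1 : D ≃⋆ₐ[ℂ] D)) 1) :
    ∃ e e' : Proj D, ∀ χ : D →⋆ₐ[ℂ] ℂ,
      ((∀ t, χ (torusEv 1 t W.1 0 0) = circleExp t) → χ e.p.trace = χ e'.p.trace + 1) ∧
      ((∀ t, χ (torusEv 1 t W.1 0 0) = 1) → χ e.p.trace = χ e'.p.trace) := by
  obtain ⟨R, hR, hRs⟩ := exists_isRotationMap (α := (1 : D ≃⋆ₐ[ℂ] D)) fun _ _ => rfl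
  obtain ⟨y, c, hy⟩ := exists_torusι_add_const (K1.mk W)
  obtain ⟨e, e', rfl⟩ := K0.exists_eq_sub y
  refine ⟨e, e', fun χ => ?_⟩
  have hW : ((R (K1.mk W) : C(TracialState D, ℝ)) (characterState χ) : ℂ) =
      χ e.p.trace - χ e'.p.trace := by
    rw [hy, map_add, hR.apply_const, add_zero, hR.apply_torusι, map_sub,
      ← character_trace_re χ e, ← character_trace_re χ e', ← Complex.ofReal_sub]
    congr 1
    exact congrArg₂ (· - ·) (dimensionMap_mk e (characterState χ))
      (dimensionMap_mk e' (characterState χ))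
  have hzero : ∀ V : UMat (MappingTorus (1 : D ≃⋆ₐ[ℂ] D)) 1,
      (∀ t, χ (torusEv 1 t V.1 0 0) = 1) →
      ((R (K1.mk V) : C(TracialState D, ℝ)) (characterState χ) : ℂ) = 0 := by
    intro V hV
    obtain ⟨N, hN⟩ := exists_torusFine 1 V
    rw [hRs _ _ _ _ hN, rotSum_eq_zero_of_character hN χ hV, mul_zero]
  constructor
  · intro h
    have h1 : IsStarProjection (1 : Matrix (Fin 1) (Fin 1) D) := .one _
    let L := loopU (1 : D ≃⋆ₐ[ℂ] D) 1 h1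
    have hL : ∀ t, torusEv 1 t L.1 = circleExp t • (1 : Matrix (Fin 1) (Fin 1) D) := by
      intro t
      refine (loopMat_eval 1 1 t).trans ?_
      rw [add_sub_cancel_right]
      rfl
    have hV := hzero (W * L⁻¹) fun t => by
      have e1 : torusEv 1 t (W * L⁻¹).1 = torusEv 1 t W.1 * star (torusEv 1 t L.1) := by
        rw [← torusEv_star, ← map_mul]; rfl
      have e2 : (torusEv 1 t (W * L⁻¹).1) 0 0 = star (circleExp t) • (torusEv 1 t W.1) 0 0 := by
        rw [e1, hL, star_smul, star_one, Matrix.mul_smul, Matrix.mul_one]; rfl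
      rw [e2, map_smul, h, smul_eq_mul, Complex.star_def, Complex.conj_mul', norm_circleExp]
      simp
    have e3 : K1.mk W = K1.mk (W * L⁻¹) + torusι 1 (K0.mk ⟨1, 1, h1⟩) := by
      rw [torusι_mk, ← K1.mk_mul]
      change K1.mk W = K1.mk (W * L⁻¹ * L)
      rw [inv_mul_cancel_right]
    have e4 : ((R (torusι 1 (K0.mk ⟨1, 1, h1⟩)) : C(TracialState D, ℝ)) (characterState χ) : ℂ)
        = 1 := by
      rw [hR.apply_torusι, dimensionMap_mk, characterState_apply]
      simp
    rw [e3, map_add] at hW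
    change (((R (K1.mk (W * L⁻¹)) : C(TracialState D, ℝ)) (characterState χ) +
      (R (torusι 1 (K0.mk ⟨1, 1, h1⟩)) : C(TracialState D, ℝ)) (characterState χ) : ℝ) : ℂ) = _
      at hW
    rw [Complex.ofReal_add, hV, e4, zero_add] at hW
    rw [hW]; ring
  · intro h
    rw [hzero W h] at hW
    exact (sub_eq_zero.1 hW.symm)

end Characters

/-! ### Bott periodicity: injectivity -/

section HomotopyAlgebra

open scoped Matrix

/-- The homomorphism `(a, b) ↦ a p + b (1 - p)` given by a projection `p`. -/
def projHom {E : Type*} [CStarAlgebra E] {p : E} (hp : IsStarProjection p) :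
    ℂ × ℂ →⋆ₐ[ℂ] E where
  toFun z := z.1 • p + z.2 • (1 - p)
  map_one' := by simp
  map_mul' z w := by
    have p1 := hp.isIdempotentElem.eq
    have h1 : p * (1 - p) = 0 := by rw [mul_sub, p1, mul_one, sub_self]
    have h2 : (1 - p) * p = 0 := by rw [sub_mul, p1, one_mul, sub_self]
    have h3 : (1 - p) * (1 - p) = 1 - p := by rw [mul_sub, h2, mul_one, sub_zero]
    simp [add_mul, mul_add, smul_smul, p1, h1, h2, h3, mul_comm]
  map_zero' := by simp
  map_add' z w := by simp [add_smul]; abel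
  commutes' c := by
    rw [Algebra.algebraMap_eq_smul_one, Algebra.algebraMap_eq_smul_one]
    change (c • (1 : ℂ)) • p + (c • (1 : ℂ)) • (1 - p) = c • (1 : E)
    rw [smul_eq_mul, mul_one, ← smul_add, add_sub_cancel]
  map_star' z := by
    rw [star_add, star_smul, star_smul, star_sub, hp.isSelfAdjoint.star_eq, star_one]
    rfl

theorem projHom_apply {E : Type*} [CStarAlgebra E] {p : E} (hp : IsStarProjection p)
    (z : ℂ × ℂ) : projHom hp z = z.1 • p + z.2 • (1 - p) := rfl

theorem exists_proj_of_unitary_loop {D : Type u} [CStarAlgebra D] (d : C(unitInterval, D))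
    (hd : d 0 = d 1) (hdu : ∀ t, d t ∈ unitary D) :
    ∃ e e' : Proj D, ∀ χ : D →⋆ₐ[ℂ] ℂ,
      ((∀ t, χ (d t) = circleExp t) → χ e.p.trace = χ e'.p.trace + 1) ∧
      ((∀ t, χ (d t) = 1) → χ e.p.trace = χ e'.p.trace) := by
  let w : MappingTorus (1 : D ≃⋆ₐ[ℂ] D) := ⟨d, hd⟩
  have hw1 : star w * w = 1 := MappingTorus.toFun_injective _
    (ContinuousMap.ext fun t => (Unitary.mem_iff.1 (hdu t)).1)
  have hw2 : w * star w = 1 := MappingTorus.toFun_injective _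
    (ContinuousMap.ext fun t => (Unitary.mem_iff.1 (hdu t)).2)
  exact exists_proj_of_loop ⟨Matrix.of fun _ _ => w, by
    rw [Unitary.mem_iff]
    constructor
    · ext i j
      rw [Matrix.mul_apply, Fin.sum_univ_one, Subsingleton.elim i j, Matrix.one_apply_eq]
      exact hw1
    · ext i j
      rw [Matrix.mul_apply, Fin.sum_univ_one, Subsingleton.elim i j, Matrix.one_apply_eq]
      exact hw2⟩

/-- Consider a homotopy, through loops of unitaries of `E`, from the loop
`t ↦ e^{2πit} p + 1 - p` to the same loop for `q`. There are two paths of projections in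
matrix algebras over `E`, whose values at the ends are combinations of `p` and `1 - p`, and
of `q` and `1 - q`, with complex projections as coefficients. The ranks of the coefficients of
`p`, and of those of `q`, differ by one; those of `1 - p` and `1 - q` are equal. -/
theorem exists_proj_paths {E : Type u} [CStarAlgebra E] {p q : E} (hp : IsStarProjection p)
    (hq : IsStarProjection q) (W : unitInterval → unitInterval → E)
    (hW : Continuous fun z : unitInterval × unitInterval => W z.1 z.2)
    (hWu : ∀ s t, W s t ∈ unitary E) (hWl : ∀ s, W s 0 = W s 1)
    (hW0 : ∀ t, W 0 t = projHom hp (circleExp t, 1))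
    (hW1 : ∀ t, W 1 t = projHom hq (circleExp t, 1)) :
    ∃ (D : Type u) (_ : CStarAlgebra D) (ev : unitInterval → D →⋆ₐ[ℂ] E)
      (χ χ' : D →⋆ₐ[ℂ] ℂ × ℂ) (e e' : Proj D),
      (∀ d, Continuous fun s => ev s d) ∧ (∀ d, ev 0 d = projHom hp (χ d)) ∧
      (∀ d, ev 1 d = projHom hq (χ' d)) ∧
      (χ e.p.trace).1 = (χ e'.p.trace).1 + 1 ∧ (χ e.p.trace).2 = (χ e'.p.trace).2 ∧
      (χ' e.p.trace).1 = (χ' e'.p.trace).1 + 1 ∧ (χ' e.p.trace).2 = (χ' e'.p.trace).2 := by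
  let X := C(unitInterval, E) × ((ℂ × ℂ) × (ℂ × ℂ))
  let evX : unitInterval → X →⋆ₐ[ℂ] E := fun s =>
    { toFun := fun x => x.1 s
      map_one' := rfl
      map_mul' := fun _ _ => rfl
      map_zero' := rfl
      map_add' := fun _ _ => rfl
      commutes' := fun _ => rfl
      map_star' := fun _ => rfl }
  let χX : X →⋆ₐ[ℂ] ℂ × ℂ := (StarAlgHom.fst ℂ _ _).comp (StarAlgHom.snd ℂ _ _)
  let χX' : X →⋆ₐ[ℂ] ℂ × ℂ := (StarAlgHom.snd ℂ _ _).comp (StarAlgHom.snd ℂ _ _)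
  -- the algebra of paths in `E` with end points in the spans of `p, 1 - p` and of `q, 1 - q`
  let S : StarSubalgebra ℂ X := StarAlgHom.equalizer ((evX 0).prod (evX 1))
    (((projHom hp).comp χX).prod ((projHom hq).comp χX'))
  have hSmem : ∀ x : X, x ∈ S ↔ x.1 0 = projHom hp x.2.1 ∧ x.1 1 = projHom hq x.2.2 := by
    intro x
    exact ⟨fun h => ⟨congrArg Prod.fst h, congrArg Prod.snd h⟩, fun h => Prod.ext h.1 h.2⟩
  have hSc : IsClosed (S : Set X) := by
    have : (S : Set X) = {x : X | x.1 0 = projHom hp x.2.1 ∧ x.1 1 = projHom hq x.2.2} :=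
      Set.ext hSmem
    rw [this]
    have h0 : ∀ t, Continuous fun x : X => x.1 t := fun t =>
      (continuous_eval_const t).comp continuous_fst
    simp only [projHom_apply]
    exact (isClosed_eq (h0 0) (by fun_prop)).inter (isClosed_eq (h0 1) (by fun_prop))
  have : IsClosed (S : Set X) := hSc
  let hSalg : CStarAlgebra S := inferInstance
  let D := S
  let d : unitInterval → D := fun t =>
    ⟨(⟨fun s => W s t, hW.comp (continuous_id.prodMk continuous_const)⟩,
    ((circleExp t, 1), (circleExp t, 1))), (hSmem _).2 ⟨hW0 t, hW1 t⟩⟩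
  have hd : Continuous d := by
    refine Continuous.subtype_mk (Continuous.prodMk ?_ ?_) _
    · exact ContinuousMap.continuous_of_continuous_uncurry _ (hW.comp continuous_swap)
    · have : Continuous circleExp := by unfold circleExp; fun_prop
      fun_prop
  have hz : ∀ t, star (circleExp t) * circleExp t = 1 := by
    intro t
    rw [Complex.star_def, Complex.conj_mul', norm_circleExp]
    simp
  have hdl : d 0 = d 1 := by
    refine Subtype.ext (Prod.ext (ContinuousMap.ext fun s => hWl s) ?_)
    have : circleExp 0 = circleExp 1 := by
      simp [circleExp, Complex.exp_two_pi_mul_I]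
    simp only [d, this]
  have h1 : star (1 : ℂ) * 1 = 1 := by simp
  have h1' : (1 : ℂ) * star (1 : ℂ) = 1 := by simp
  have hz' : ∀ t, circleExp t * star (circleExp t) = 1 := fun t => by rw [mul_comm, hz]
  have hdu : ∀ t, d t ∈ unitary D := fun t => Unitary.mem_iff.2
    ⟨Subtype.ext (Prod.ext (ContinuousMap.ext fun s => (Unitary.mem_iff.1 (hWu s t)).1)
      (Prod.ext (Prod.ext (hz t) h1) (Prod.ext (hz t) h1))),
    Subtype.ext (Prod.ext (ContinuousMap.ext fun s => (Unitary.mem_iff.1 (hWu s t)).2)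
      (Prod.ext (Prod.ext (hz' t) h1') (Prod.ext (hz' t) h1')))⟩
  obtain ⟨e, e', hee⟩ := exists_proj_of_unitary_loop (D := D) ⟨d, hd⟩ hdl hdu
  let ev : unitInterval → D →⋆ₐ[ℂ] E := fun s => (evX s).comp S.subtype
  let χ : D →⋆ₐ[ℂ] ℂ × ℂ := χX.comp S.subtype
  let χ' : D →⋆ₐ[ℂ] ℂ × ℂ := χX'.comp S.subtype
  refine ⟨D, hSalg, ev, χ, χ', e, e', fun d => ?_, fun d => ((hSmem _).1 d.2).1,
    fun d => ((hSmem _).1 d.2).2, ?_, ?_, ?_, ?_⟩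
  · exact d.1.1.continuous
  · exact (hee ((StarAlgHom.fst ℂ ℂ ℂ).comp χ)).1 fun t => rfl
  · exact (hee ((StarAlgHom.snd ℂ ℂ ℂ).comp χ)).2 fun t => rfl
  · exact (hee ((StarAlgHom.fst ℂ ℂ ℂ).comp χ')).1 fun t => rfl
  · exact (hee ((StarAlgHom.snd ℂ ℂ ℂ).comp χ')).2 fun t => rfl

end HomotopyAlgebra

section BottInjectivity

open scoped Matrix

variable {A : Type u} [CStarAlgebra A]

/-- The block matrix over `A` of the image of a matrix over `D`. -/
def flatMap {D : Type*} [CStarAlgebra D] {ι κ : Type*} [Fintype κ] [DecidableEq κ]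
    (f : D → Matrix κ κ A) (e : Matrix ι ι D) : Matrix (ι × κ) (ι × κ) A :=
  Matrix.comp ι ι κ κ A (e.map f)

theorem flatMap_proj {D : Type*} [CStarAlgebra D] {ι κ : Type*} [Fintype ι] [Fintype κ]
    [DecidableEq κ] (f : D →⋆ₐ[ℂ] Matrix κ κ A) {e : Matrix ι ι D} (he : IsStarProjection e) :
    IsStarProjection (flatMap f e) := by
  classical
  rw [isStarProjection_iff_matrix] at *
  constructor
  · have h : e.map f * e.map f = e.map f := by rw [← Matrix.map_mul, he.1]
    exact (map_mul (Matrix.compRingEquiv ι κ A) (e.map f) (e.map f)).symm.trans (congrArg _ h)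
  · ext x y
    have h : star (f (e y.1 x.1)) = f (e x.1 y.1) := by
      rw [← map_star, ← Matrix.conjTranspose_apply, he.2]
    exact congrFun (congrFun h x.2) y.2

theorem map_character_proj {D : Type*} [CStarAlgebra D] {ι : Type*} [Fintype ι]
    (χ : D →⋆ₐ[ℂ] ℂ) {e : Matrix ι ι D} (he : IsStarProjection e) :
    IsStarProjection (e.map χ) := by
  rw [isStarProjection_iff_matrix] at *
  constructor
  · rw [← Matrix.map_mul, he.1]
  · ext i j
    change star (χ (e j i)) = χ (e i j)
    rw [← map_star, ← Matrix.conjTranspose_apply, he.2]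

/-- If the values of `f` are combinations of `p` and `1 - p`, then the block matrix of a
projection is determined up to equivalence by the ranks of its coefficients. -/
theorem cls_flatMap {D : Type*} [CStarAlgebra D] {k : ℕ} {f : D →⋆ₐ[ℂ] Matrix (Fin k) (Fin k) A}
    {p : Matrix (Fin k) (Fin k) A} (hp : IsStarProjection p) {χ : D →⋆ₐ[ℂ] ℂ × ℂ}
    (hf : ∀ d, f d = (χ d).1 • p + (χ d).2 • (1 - p)) {e e' : Proj D}
    (h1 : (χ e.p.trace).1 = (χ e'.p.trace).1 + 1) (h2 : (χ e.p.trace).2 = (χ e'.p.trace).2) :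
    K0.cls (flatMap f e.p) = K0.cls (flatMap f e'.p) + K0.cls p := by
  let χ₁ : D →⋆ₐ[ℂ] ℂ := (StarAlgHom.fst ℂ ℂ ℂ).comp χ
  let χ₂ : D →⋆ₐ[ℂ] ℂ := (StarAlgHom.snd ℂ ℂ ℂ).comp χ
  have hp' : IsStarProjection (1 - p) := hp.one_sub
  have key : ∀ e : Proj D, K0.cls (flatMap f e.p) =
      K0.cls (Matrix.tens (e.p.map χ₁) p) + K0.cls (Matrix.tens (e.p.map χ₂) (1 - p)) := by
    intro e
    have c1 := map_character_proj χ₁ e.isProj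
    have c2 := map_character_proj χ₂ e.isProj
    rw [← K0.cls_add (Matrix.tens_proj c1 hp) (Matrix.tens_proj c2 hp')]
    · congr 1
      ext x y
      change f (e.p x.1 y.1) x.2 y.2 = _
      rw [hf]
      rfl
    · rw [Matrix.tens_mul, mul_sub, mul_one, hp.isIdempotentElem.eq, sub_self]
      ext x y
      exact smul_zero ((e.p.map χ₁ * e.p.map χ₂) x.1 y.1)
  have htr : ∀ (χ : D →⋆ₐ[ℂ] ℂ) (e : Proj D), (e.p.map χ).trace = χ e.p.trace := by
    intro χ e
    rw [Matrix.trace, Matrix.trace, map_sum]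
    rfl
  rw [key, key, K0.cls_tens_eq_add (map_character_proj χ₁ e.isProj)
    (map_character_proj χ₁ e'.isProj) (by rw [htr, htr]; exact h1) hp,
    K0.cls_tens_eq (map_character_proj χ₂ e.isProj)
    (map_character_proj χ₂ e'.isProj) (by rw [htr, htr]; exact h2) hp']
  abel

/-- Both ends of the paths of projections in `exists_proj_paths` have the same class in `K₀(A)`; the
difference of the two paths is `[p]` at one end and `[q]` at the other. -/
theorem K0.cls_eq_of_joined_loopU {k : ℕ} {p q : Matrix (Fin k) (Fin k) A}
    (hp : IsStarProjection p) (hq : IsStarProjection q)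
    (h : Joined (loopU (1 : A ≃⋆ₐ[ℂ] A) p hp) (loopU 1 q hq)) : K0.cls p = K0.cls q := by
  let _ : CStarAlgebra (Matrix (Fin k) (Fin k) A) := Matrix.cstarAlgebra
  obtain ⟨γ⟩ := h
  have hloop : ∀ {r : Matrix (Fin k) (Fin k) A} (hr : IsStarProjection r) (t : unitInterval),
      torusEv 1 t (loopU (1 : A ≃⋆ₐ[ℂ] A) r hr).1 = projHom hr (circleExp t, 1) := by
    intro r hr t
    refine (loopMat_eval 1 r t).trans ?_
    rw [projHom_apply, one_smul, add_sub_assoc]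
    rfl
  obtain ⟨D, _, ev, χ, χ', e, e', hc, h0, h1, t1, t2, t3, t4⟩ := exists_proj_paths
    (E := Matrix (Fin k) (Fin k) A) hp hq (fun s t => torusEv 1 t (γ s).1) (by
      refine continuous_pi fun i => continuous_pi fun j => ?_
      have h0 : Continuous fun u : UMat (MappingTorus (1 : A ≃⋆ₐ[ℂ] A)) k =>
          MappingTorus.toFun 1
            ((u : Matrix (Fin k) (Fin k) (MappingTorus (1 : A ≃⋆ₐ[ℂ] A))) i j) :=
        (MappingTorus.continuous_toFun 1).comp
          ((continuous_apply_apply i j).comp continuous_subtype_val)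
      have h1 := h0.comp γ.continuous
      exact continuous_eval.comp (h1.prodMap continuous_id))
    (fun s t => by
      have := torusPath_mem 1 (γ s) t
      rwa [torusPath_eq, Set.projIcc_val] at this)
    (fun s => (torusEv_end 1 (γ s).1))
    (fun t => by simp only [γ.source]; exact hloop hp t)
    (fun t => by simp only [γ.target]; exact hloop hq t)
  have hpath : ∀ e : Proj D, K0.cls (flatMap (ev 0) e.p) = K0.cls (flatMap (ev 1) e.p) := by
    intro e
    refine K0.cls_eq_of_path (P := fun s => flatMap (ev s) e.p) ?_ fun s =>
      flatMap_proj (ev s) e.isProj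
    refine continuous_pi fun x => continuous_pi fun y => ?_
    exact (continuous_apply_apply x.2 y.2).comp (hc (e.p x.1 y.1))
  have k0 := cls_flatMap hp (f := ev 0) (χ := χ) h0 t1 t2
  have k1 := cls_flatMap hq (f := ev 1) (χ := χ') h1 t3 t4
  rw [hpath, hpath, k1] at k0
  exact (add_left_cancel k0).symm

theorem K0.cls_corner {n m : ℕ} (f : Fin n ↪ Fin m) (p : Matrix (Fin n) (Fin n) A)
    (hp : IsStarProjection p) : K0.cls (corner f p) = K0.cls p := by
  obtain ⟨p1, p2⟩ := (isStarProjection_iff_matrix p).1 hp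
  refine K0.cls_eq_of_mvN (corner_proj f hp) hp ⟨p * (injMat A f)ᴴ, ?_, ?_⟩
  · rw [Matrix.conjTranspose_mul, Matrix.conjTranspose_conjTranspose, p2, corner]
    calc _ = injMat A f * (p * p) * (injMat A f)ᴴ := by simp only [Matrix.mul_assoc]
      _ = _ := by rw [p1]
  · rw [Matrix.conjTranspose_mul, Matrix.conjTranspose_conjTranspose, p2]
    calc _ = p * ((injMat A f)ᴴ * injMat A f) * p := by simp only [Matrix.mul_assoc]
      _ = _ := by rw [injMat_conjTranspose_mul, Matrix.mul_one, p1]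

/-- The injectivity part of Bott periodicity. -/
theorem torusι_one_injective : Function.Injective (torusι (1 : A ≃⋆ₐ[ℂ] A)) := by
  rw [injective_iff_map_eq_zero]
  intro x hx
  obtain ⟨p, q, rfl⟩ := K0.exists_eq_sub x
  rw [map_sub, sub_eq_zero, torusι_mk, torusι_mk] at hx
  obtain ⟨k, hn, hm, hj⟩ := (K1.mk_eq_iff _ _).1 hx
  rw [stab_loopU, stab_loopU] at hj
  have h := K0.cls_eq_of_joined_loopU _ _ hj
  rw [K0.cls_corner _ _ p.isProj, K0.cls_corner _ _ q.isProj, K0.cls_proj, K0.cls_proj] at h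
  rw [h, sub_self]

end BottInjectivity

/-! ### Contractible loops in topological groups -/

section NullLoops

open unitInterval

variable {G H : Type*} [Group G] [TopologicalSpace G] [IsTopologicalGroup G] [Group H]
  [TopologicalSpace H]

/-- The loop `l` at the identity of a topological group is homotopic to the constant loop,
relative to the end points. -/
def IsNullLoop {G : Type*} [Group G] [TopologicalSpace G] (l : I → G) : Prop :=
  ∃ K : I → I → G, (Continuous fun z : I × I => K z.1 z.2) ∧ (∀ t, K 0 t = l t) ∧
    (∀ t, K 1 t = 1) ∧ ∀ s, K s 0 = 1 ∧ K s 1 = 1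

theorem IsNullLoop.mul {l l' : I → G} (h : IsNullLoop l) (h' : IsNullLoop l') :
    IsNullLoop fun t => l t * l' t := by
  obtain ⟨K, h1, h2, h3, h4⟩ := h
  obtain ⟨K', k1, k2, k3, k4⟩ := h'
  refine ⟨fun s t => K s t * K' s t, h1.mul k1, fun t => by simp only [h2, k2],
    fun t => by simp only [h3, k3, mul_one], fun s => ?_⟩
  beta_reduce
  rw [(h4 s).1, (h4 s).2, (k4 s).1, (k4 s).2, mul_one]
  exact ⟨rfl, rfl⟩

theorem IsNullLoop.inv {l : I → G} (h : IsNullLoop l) : IsNullLoop fun t => (l t)⁻¹ := by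
  obtain ⟨K, h1, h2, h3, h4⟩ := h
  refine ⟨fun s t => (K s t)⁻¹, h1.inv, fun t => by simp only [h2],
    fun t => by simp only [h3, inv_one], fun s => ?_⟩
  beta_reduce
  rw [(h4 s).1, (h4 s).2, inv_one]
  exact ⟨rfl, rfl⟩

omit [IsTopologicalGroup G] in
theorem IsNullLoop.map {l : I → G} (h : IsNullLoop l) (φ : G →* H) (hφ : Continuous φ) :
    IsNullLoop fun t => φ (l t) := by
  obtain ⟨K, h1, h2, h3, h4⟩ := h
  refine ⟨fun s t => φ (K s t), hφ.comp h1, fun t => by simp only [h2],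
    fun t => by simp only [h3, map_one], fun s => ?_⟩
  beta_reduce
  rw [(h4 s).1, (h4 s).2, map_one]
  exact ⟨rfl, rfl⟩

/-- The commutator of a loop with an element joined to the identity is homotopic to a constant. -/
theorem isNullLoop_commutator {l : I → G} (hl : Continuous l) (h0 : l 0 = 1) (h1 : l 1 = 1) {w : G}
    (hw : Joined w 1) : IsNullLoop fun t => w * l t * w⁻¹ * (l t)⁻¹ := by
  obtain ⟨γ⟩ := hw
  refine ⟨fun s t => γ s * l t * (γ s)⁻¹ * (l t)⁻¹, by fun_prop, fun t => by simp only [γ.source],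
    fun t => by simp, fun s => ?_⟩
  beta_reduce
  rw [h0, h1]
  simp

end NullLoops

/-! ### Unitaries over mapping tori as twisted paths -/

section TwistedPaths

open unitInterval

variable {A : Type u} [CStarAlgebra A] (α : A ≃⋆ₐ[ℂ] A) {n m : ℕ}

/-- The value at `t` of a unitary over the mapping torus. -/
noncomputable def UMat.ev (t : I) : UMat (MappingTorus α) n →* UMat A n :=
  UMat.map (torusEval α t) n

/-- The action of an automorphism on unitary matrices. -/
noncomputable def UMat.aut : UMat A n →* UMat A n := UMat.map (α : A →⋆ₐ[ℂ] A) n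

theorem UMat.coe_aut (x : UMat A n) :
    (UMat.aut α x : Matrix (Fin n) (Fin n) A) = x.1.map α := rfl

theorem UMat.continuous_aut : Continuous (UMat.aut α : UMat A n →* UMat A n) :=
  UMat.continuous_map _ (NonUnitalStarAlgHom.isometry α α.injective).continuous n

theorem UMat.ev_stab (f : Fin n ↪ Fin m) (t : I) (u : UMat (MappingTorus α) n) :
    UMat.ev α t (stab f u) = stab f (UMat.ev α t u) := UMat.map_stab _ f u

theorem UMat.aut_stab (f : Fin n ↪ Fin m) (x : UMat A n) :
    UMat.aut α (stab f x) = stab f (UMat.aut α x) := UMat.map_stab _ f x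

theorem UMat.ev_one (u : UMat (MappingTorus α) n) : UMat.ev α 1 u = UMat.aut α (UMat.ev α 0 u) :=
  Subtype.ext (torusEv_end α u.1).symm

variable {α} in
theorem UMat.ev_ext {u v : UMat (MappingTorus α) n} (h : ∀ t, UMat.ev α t u = UMat.ev α t v) :
    u = v :=
  Subtype.ext (torusEv_ext α fun t => congrArg Subtype.val (h t))

theorem UMat.continuous_ev :
    Continuous fun z : UMat (MappingTorus α) n × I => UMat.ev α z.2 z.1 := by
  refine Continuous.subtype_mk (continuous_pi fun i => continuous_pi fun j => ?_) _
  have h0 : Continuous fun u : UMat (MappingTorus α) n =>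
      MappingTorus.toFun α ((u : Matrix (Fin n) (Fin n) (MappingTorus α)) i j) :=
    (MappingTorus.continuous_toFun α).comp
      ((continuous_apply_apply i j).comp continuous_subtype_val)
  exact continuous_eval.comp (h0.prodMap continuous_id)

/-- The unitary over the mapping torus given by a path from `x` to `α(x)`. -/
noncomputable def UMat.ofPath (f : C(I, UMat A n)) (h : UMat.aut α (f 0) = f 1) :
    UMat (MappingTorus α) n :=
  ⟨torusMat α ⟨fun t => (f t).1, by fun_prop⟩ (congrArg Subtype.val h), by
    rw [Unitary.mem_iff]
    constructor <;> refine torusEv_ext α fun t => ?_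
    · refine (map_mul _ _ _).trans (Eq.trans ?_ (map_one _).symm)
      rw [torusEv_star]
      exact (Unitary.mem_iff.1 (f t).2).1
    · refine (map_mul _ _ _).trans (Eq.trans ?_ (map_one _).symm)
      rw [torusEv_star]
      exact (Unitary.mem_iff.1 (f t).2).2⟩

theorem UMat.ev_ofPath (f : C(I, UMat A n)) (h : UMat.aut α (f 0) = f 1) (t : I) :
    UMat.ev α t (UMat.ofPath α f h) = f t := rfl

variable {α}

theorem UMat.joined_of_homotopy {K : I → I → UMat A n} (hK : Continuous fun z : I × I => K z.1 z.2)
    (h : ∀ s, UMat.aut α (K s 0) = K s 1) {u v : UMat (MappingTorus α) n}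
    (hu : ∀ t, UMat.ev α t u = K 0 t) (hv : ∀ t, UMat.ev α t v = K 1 t) : Joined u v := by
  refine ⟨⟨⟨fun s => UMat.ofPath α ⟨K s, hK.comp (continuous_const.prodMk continuous_id)⟩ (h s),
    ?_⟩, UMat.ev_ext fun t => (hu t).symm, UMat.ev_ext fun t => (hv t).symm⟩⟩
  refine Continuous.subtype_mk (continuous_pi fun i => continuous_pi fun j => ?_) _
  rw [MappingTorus.continuous_iff]
  refine ContinuousMap.continuous_of_continuous_uncurry _ ?_
  have h0 : Continuous fun x : UMat A n => (x : Matrix (Fin n) (Fin n) A) i j :=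
    (continuous_apply_apply i j).comp continuous_subtype_val
  exact h0.comp hK

/-- The unitary over the mapping torus given by a contractible loop is homotopic to `1`. -/
theorem UMat.joined_one_of_isNullLoop {u : UMat (MappingTorus α) n}
    (h : IsNullLoop fun t => UMat.ev α t u) : Joined u 1 := by
  obtain ⟨K, h1, h2, h3, h4⟩ := h
  refine UMat.joined_of_homotopy h1 (fun s => ?_) (fun t => (h2 t).symm) fun t => ?_
  · rw [(h4 s).1, (h4 s).2, map_one]
  · rw [h3, map_one]

/-- A homotopy of the value at `0` extends to a homotopy of unitaries over the mapping torus. -/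
theorem UMat.exists_ev_zero_eq {y : UMat A n} (hy : Joined y 1) :
    ∃ P : UMat (MappingTorus α) n, Joined P 1 ∧ UMat.ev α 0 P = y := by
  obtain ⟨e⟩ := hy
  have ha := UMat.continuous_aut α (n := n)
  let K : I → I → UMat A n := fun s t => e (max s t) * UMat.aut α (e (max s (σ t)))
  have hK : Continuous fun z : I × I => K z.1 z.2 := by
    refine (e.continuous.comp (by fun_prop)).mul (ha.comp (e.continuous.comp ?_))
    fun_prop
  have hend : ∀ s, UMat.aut α (K s 0) = K s 1 := by
    intro s
    have h1 : max s (1 : I) = 1 := max_eq_right s.2.2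
    simp [K, h1]
  refine ⟨UMat.ofPath α ⟨K 0, hK.comp (continuous_const.prodMk continuous_id)⟩ (hend 0),
    UMat.joined_of_homotopy hK hend (fun t => rfl) fun t => ?_, ?_⟩
  · have h1 : ∀ t : I, max 1 t = 1 := fun t => max_eq_left t.2.2
    simp [K, h1]
  · change K 0 0 = y
    simp [K]

/-- A class in `K₁(M_α)` has a representative whose value at `0` is, up to enlarging matrices,
a given representative of its image in `K₁(A)`. -/
theorem UMat.exists_rep {x : UMat A n} {u : UMat (MappingTorus α) m}
    (h : K1.mk x = torusQ α (K1.mk u)) : ∃ (k : ℕ) (hn : n ≤ k) (u' : UMat (MappingTorus α) k),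
      K1.mk u' = K1.mk u ∧ UMat.ev α 0 u' = stab (Fin.castLEEmb hn) x := by
  obtain ⟨k, hn, hm, hj⟩ := (K1.mk_eq_iff x (UMat.ev α 0 u)).1 h
  have hj' := hj.map (f := fun y => y * (stab (Fin.castLEEmb hm) (UMat.ev α 0 u))⁻¹) (by fun_prop)
  rw [mul_inv_cancel] at hj'
  obtain ⟨P, hP, hP0⟩ := UMat.exists_ev_zero_eq (α := α) hj'
  refine ⟨k, hn, P * stab (Fin.castLEEmb hm) u, ?_, ?_⟩
  · rw [K1.mk_mul, K1.mk_eq_of_joined hP, K1.mk_one, zero_add, K1.mk_stab]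
  · rw [map_mul, hP0, UMat.ev_stab, inv_mul_cancel_right]

/-- The loop `l` in `U_n(A)` is contractible in `U_k(A)` for some `k`. -/
def IsStablyNull (l : I → UMat A n) : Prop :=
  ∃ (k : ℕ) (h : n ≤ k), IsNullLoop fun t => stab (Fin.castLEEmb h) (l t)

theorem IsStablyNull.exists_ge {l : I → UMat A n} (h : IsStablyNull l) :
    ∃ k, ∀ m, k ≤ m → ∃ h : n ≤ m, IsNullLoop fun t => stab (Fin.castLEEmb h) (l t) := by
  obtain ⟨k, hk, hl⟩ := h
  refine ⟨k, fun m hm => ⟨hk.trans hm, ?_⟩⟩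
  have := hl.map (stab (Fin.castLEEmb hm)) (continuous_stab _)
  simp only [stab_trans] at this
  exact this

theorem IsStablyNull.mul {l l' : I → UMat A n} (h : IsStablyNull l) (h' : IsStablyNull l') :
    IsStablyNull fun t => l t * l' t := by
  obtain ⟨k, hk⟩ := h.exists_ge
  obtain ⟨k', hk'⟩ := h'.exists_ge
  obtain ⟨h1, h2⟩ := hk _ (le_max_left k k')
  obtain ⟨h3, h4⟩ := hk' _ (le_max_right k k')
  refine ⟨max k k', h1, ?_⟩
  simp only [map_mul]
  exact h2.mul h4

theorem IsStablyNull.inv {l : I → UMat A n} (h : IsStablyNull l) :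
    IsStablyNull fun t => (l t)⁻¹ := by
  obtain ⟨k, hk, hl⟩ := h
  refine ⟨k, hk, ?_⟩
  simp only [map_inv]
  exact hl.inv

theorem IsStablyNull.aut {l : I → UMat A n} (h : IsStablyNull l) :
    IsStablyNull fun t => UMat.aut α (l t) := by
  obtain ⟨k, hk, hl⟩ := h
  refine ⟨k, hk, ?_⟩
  simp only [← UMat.aut_stab]
  exact hl.map (UMat.aut α) (UMat.continuous_aut α)

theorem IsNullLoop.isStablyNull {l : I → UMat A n} (h : IsNullLoop l) : IsStablyNull l :=
  ⟨n, le_rfl, h.map _ (continuous_stab _)⟩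

theorem IsStablyNull.of_stab {hnm : n ≤ m} {l : I → UMat A n}
    (h : IsStablyNull fun t => stab (Fin.castLEEmb hnm) (l t)) : IsStablyNull l := by
  obtain ⟨k, hk, hl⟩ := h
  refine ⟨k, hnm.trans hk, ?_⟩
  simp only [stab_trans] at hl
  exact hl

theorem IsStablyNull.mk_eq_zero {u : UMat (MappingTorus α) n}
    (h : IsStablyNull fun t => UMat.ev α t u) : K1.mk u = 0 := by
  obtain ⟨k, hk, hl⟩ := h
  simp only [← UMat.ev_stab] at hl
  rw [← K1.mk_stab (Fin.castLEEmb hk) u, K1.mk_eq_of_joined (UMat.joined_one_of_isNullLoop hl),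
    K1.mk_one]

end TwistedPaths

/-! ### Approximately inner automorphisms -/

section ApproximatelyInner

open unitInterval

variable {A : Type u} [CStarAlgebra A] {α : A ≃⋆ₐ[ℂ] A} {n : ℕ}

/-- The unitary part of the segment from `l` to `1` is a homotopy. -/
theorem isNullLoop_of_norm_sub_lt {l : I → UMat A n} (hl : Continuous l) (h0 : l 0 = 1)
    (h1 : l 1 = 1) :
    let _ : CStarAlgebra (Matrix (Fin n) (Fin n) A) := Matrix.cstarAlgebra
    (∀ t, ‖(l t - 1 : Matrix (Fin n) (Fin n) A)‖ < 1) → IsNullLoop l := by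
  intro _ h
  let S : I → I → Matrix (Fin n) (Fin n) A := fun s t => 1 + ((σ s : ℝ)) • ((l t).1 - 1)
  have hS : ∀ s t, IsUnit (S s t) := by
    intro s t
    have h2 : ‖-(((σ s : ℝ)) • ((l t).1 - 1))‖ < 1 := by
      rw [norm_neg, norm_smul, Real.norm_of_nonneg (σ s).2.1]
      exact (mul_le_of_le_one_left (norm_nonneg _) (σ s).2.2).trans_lt (h t)
    have h3 := isUnit_one_sub_of_norm_lt_one h2
    rwa [sub_neg_eq_add] at h3
  have hSc : Continuous fun z : I × I => S z.1 z.2 := by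
    have : Continuous fun z : I × I => (l z.2).1 :=
      continuous_subtype_val.comp (hl.comp continuous_snd)
    fun_prop
  refine ⟨fun s t => polarU (S s t) (hS s t), ?_, fun t => ?_, fun t => ?_, fun s => ?_⟩
  · exact Continuous.subtype_mk (continuousOn_polar.comp_continuous hSc fun z => hS z.1 z.2) _
  · refine Subtype.ext ?_
    have e : S 0 t = (l t).1 := by simp [S]
    change polar (S 0 t) = _
    rw [e, polar_of_mem (l t).2]
  · refine Subtype.ext ?_
    have e : S 1 t = 1 := by simp [S]
    change polar (S 1 t) = 1
    rw [e, polar_of_mem (one_mem _)]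
  · have e0 : S s 0 = 1 := by simp [S, h0]
    have e1 : S s 1 = 1 := by simp [S, h1]
    refine ⟨Subtype.ext ?_, Subtype.ext ?_⟩
    · change polar (S s 0) = 1
      rw [e0, polar_of_mem (one_mem _)]
    · change polar (S s 1) = 1
      rw [e1, polar_of_mem (one_mem _)]

theorem norm_map_aut_le (α : A ≃⋆ₐ[ℂ] A) (M : Matrix (Fin n) (Fin n) A) :
    let _ : CStarAlgebra (Matrix (Fin n) (Fin n) A) := Matrix.cstarAlgebra
    ‖(M.map α : Matrix (Fin n) (Fin n) A)‖ ≤ ‖M‖ := by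
  intro _
  let φ : Matrix (Fin n) (Fin n) A →⋆ₐ[ℂ] Matrix (Fin n) (Fin n) A :=
    { (α : A →ₐ[ℂ] A).mapMatrix with
      map_star' := fun M => by
        ext i j
        exact map_star α (M j i) }
  exact NonUnitalStarAlgHom.norm_apply_le φ M

/-- On a compact set of unitary matrices, an approximately inner automorphism is close to an
inner one. -/
theorem exists_norm_aut_sub_conj_lt (hα : α ∈ approxInn A) {K : Set (UMat A n)} (hK : IsCompact K) :
    let _ : CStarAlgebra (Matrix (Fin n) (Fin n) A) := Matrix.cstarAlgebra
    ∃ w : UMat A n, ∀ x ∈ K,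
      ‖((UMat.aut α x).1 - (w * x * w⁻¹).1 : Matrix (Fin n) (Fin n) A)‖ < 1 := by
  classical
  intro _
  obtain ⟨T, hTK, hT, hcov⟩ := hK.finite_cover_balls (e := 1 / 3) (by norm_num)
  obtain ⟨δ, hδ, hball⟩ := (Metric.mem_nhds_iff (α := Fin n → Fin n → A) (x := 0)).1
    (Metric.ball_mem_nhds (0 : Matrix (Fin n) (Fin n) A) (by norm_num : (0 : ℝ) < 1 / 3))
  obtain ⟨w, hw⟩ := hα (hT.toFinset.biUnion fun x => Finset.univ.image fun ij : Fin n × Fin n =>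
    x.1 ij.1 ij.2) δ hδ
  let W : UMat A n := ⟨Matrix.diagonal fun _ => (w : A), by
    rw [Unitary.mem_iff, Matrix.star_eq_conjTranspose, Matrix.diagonal_conjTranspose,
      Matrix.diagonal_mul_diagonal, Matrix.diagonal_mul_diagonal, ← Matrix.diagonal_one]
    simp⟩
  refine ⟨W, fun x hx => ?_⟩
  obtain ⟨y, hyT, hxy⟩ := Set.mem_iUnion₂.1 (hcov hx)
  have h1 : ‖(x.1 - y.1 : Matrix (Fin n) (Fin n) A)‖ < 1 / 3 := by
    rw [← dist_eq_norm]; exact hxy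
  have h2 : ‖((UMat.aut α y).1 - (W * y * W⁻¹).1 : Matrix (Fin n) (Fin n) A)‖ < 1 / 3 := by
    rw [← mem_ball_zero_iff]
    refine hball ?_
    refine (dist_pi_lt_iff hδ).2 fun i => (dist_pi_lt_iff hδ).2 fun j => ?_
    rw [dist_eq_norm]
    have e : ((UMat.aut α y).1 - (W * y * W⁻¹).1 : Matrix (Fin n) (Fin n) A) i j =
        α (y.1 i j) - w * y.1 i j * star (w : A) := by
      change α (y.1 i j) - (Matrix.diagonal (fun _ => (w : A)) * y.1 *
        star (Matrix.diagonal fun _ => (w : A)) : Matrix (Fin n) (Fin n) A) i j = _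
      rw [Matrix.star_eq_conjTranspose, Matrix.diagonal_conjTranspose, Matrix.mul_diagonal,
        Matrix.diagonal_mul]
      rfl
    change ‖((UMat.aut α y).1 - (W * y * W⁻¹).1 : Matrix (Fin n) (Fin n) A) i j - 0‖ < δ
    rw [sub_zero, e]
    refine hw _ (Finset.mem_biUnion.2 ⟨y, hT.mem_toFinset.2 hyT, ?_⟩)
    exact Finset.mem_image.2 ⟨(i, j), Finset.mem_univ _, rfl⟩
  have h3 : ‖((UMat.aut α x).1 - (UMat.aut α y).1 : Matrix (Fin n) (Fin n) A)‖ < 1 / 3 := by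
    rw [UMat.coe_aut, UMat.coe_aut, ← Matrix.map_sub _ (map_sub _)]
    exact (norm_map_aut_le α _).trans_lt h1
  have h4 : ‖((W * y * W⁻¹).1 - (W * x * W⁻¹).1 : Matrix (Fin n) (Fin n) A)‖ < 1 / 3 := by
    have e : ((W * y * W⁻¹).1 - (W * x * W⁻¹).1 : Matrix (Fin n) (Fin n) A) =
        W.1 * (y.1 - x.1) * (W⁻¹).1 := by
      rw [mul_sub, sub_mul]; rfl
    rw [e, CStarRing.norm_mul_mem_unitary _ (W⁻¹).2, CStarRing.norm_mem_unitary_mul _ W.2,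
      norm_sub_rev]
    exact h1
  have e : ((UMat.aut α x).1 - (W * x * W⁻¹).1 : Matrix (Fin n) (Fin n) A) =
      ((UMat.aut α x).1 - (UMat.aut α y).1) + ((UMat.aut α y).1 - (W * y * W⁻¹).1) +
      ((W * y * W⁻¹).1 - (W * x * W⁻¹).1) := by abel
  rw [e]
  refine (norm_add₃_le).trans_lt ?_
  linarith

/-- `w ⊕ w⁻¹` is homotopic to `1`. -/
theorem joined_stab_mul_stab_inv (w : UMat A n) :
    Joined (stab (Fin.castLEEmb (Nat.le_add_right n n)) w * stab (Fin.natAddEmb n) w⁻¹) 1 := by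
  have h := joined_stab_of_disjoint (Fin.castLEEmb (Nat.le_add_right n n)) (Fin.natAddEmb n) (by
    intro i j h
    have h1 := congrArg Fin.val h
    have := i.2
    simp only [Fin.natAddEmb_apply, Fin.val_natAdd, Fin.castLEEmb_apply, Fin.val_castLE] at h1
    omega) w⁻¹
  have h2 := h.symm.map (f := fun x => stab (Fin.castLEEmb (Nat.le_add_right n n)) w * x)
    (by fun_prop)
  rwa [← map_mul, mul_inv_cancel, map_one] at h2

theorem stab_conj (w x : UMat A n) : stab (Fin.castLEEmb (Nat.le_add_right n n)) (w * x * w⁻¹) =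
    (stab (Fin.castLEEmb (Nat.le_add_right n n)) w * stab (Fin.natAddEmb n) w⁻¹) *
      stab (Fin.castLEEmb (Nat.le_add_right n n)) x *
      (stab (Fin.castLEEmb (Nat.le_add_right n n)) w * stab (Fin.natAddEmb n) w⁻¹)⁻¹ := by
  have h := stab_comm_of_disjoint (Fin.castLEEmb (Nat.le_add_right n n)) (Fin.natAddEmb n) (by
    intro i j h
    have h1 := congrArg Fin.val h
    have := i.2
    simp only [Fin.natAddEmb_apply, Fin.val_natAdd, Fin.castLEEmb_apply, Fin.val_castLE] at h1
    omega) x w⁻¹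
  rw [mul_assoc (stab _ w), ← h, map_mul, map_mul, map_inv]
  group

/-- An approximately inner automorphism acts trivially on homotopy classes of loops in
`U_∞(A)`. -/
theorem isStablyNull_aut_mul_inv (hα : α ∈ approxInn A) {c : I → UMat A n} (hc : Continuous c)
    (h0 : c 0 = 1) (h1 : c 1 = 1) : IsStablyNull fun t => UMat.aut α (c t) * (c t)⁻¹ := by
  let _ : CStarAlgebra (Matrix (Fin n) (Fin n) A) := Matrix.cstarAlgebra
  obtain ⟨w, hw⟩ := exists_norm_aut_sub_conj_lt hα (isCompact_range hc)
  have ha := UMat.continuous_aut α (n := n)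
  have k1 : IsNullLoop fun t => UMat.aut α (c t) * (w * c t * w⁻¹)⁻¹ := by
    refine isNullLoop_of_norm_sub_lt ((ha.comp hc).mul (by fun_prop)) (by simp [h0]) (by simp [h1])
      fun t => ?_
    have e : ((UMat.aut α (c t) * (w * c t * w⁻¹)⁻¹).1 - 1 : Matrix (Fin n) (Fin n) A) =
        ((UMat.aut α (c t)).1 - (w * c t * w⁻¹).1) * ((w * c t * w⁻¹)⁻¹).1 := by
      rw [sub_mul]
      congr 1
      exact (congrArg Subtype.val (mul_inv_cancel (w * c t * w⁻¹))).symm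
    change ‖((UMat.aut α (c t) * (w * c t * w⁻¹)⁻¹).1 - 1 : Matrix (Fin n) (Fin n) A)‖ < 1
    rw [e, CStarRing.norm_mul_mem_unitary _ ((w * c t * w⁻¹)⁻¹).2]
    exact hw _ ⟨t, rfl⟩
  have k2 : IsStablyNull fun t => w * c t * w⁻¹ * (c t)⁻¹ := by
    refine ⟨n + n, Nat.le_add_right n n, ?_⟩
    have hs := continuous_stab (B := A) (Fin.castLEEmb (Nat.le_add_right n n))
    have := isNullLoop_commutator (hs.comp hc) (by simp [h0]) (by simp [h1])
      (joined_stab_mul_stab_inv w)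
    convert this using 2 with t
    rw [map_mul, stab_conj, map_inv (stab (Fin.castLEEmb (Nat.le_add_right n n))) (c t)]
    rfl
  convert k1.isStablyNull.mul k2 using 2 with t
  group

/-- Every unitary is homotopic, after enlarging matrices, to its image under an approximately
inner automorphism. -/
theorem exists_joined_aut (hα : α ∈ approxInn A) (x : UMat A n) :
    ∃ (k : ℕ) (h : n ≤ k), Joined (stab (Fin.castLEEmb h) x)
      (UMat.aut α (stab (Fin.castLEEmb h) x)) := by
  let _ : CStarAlgebra (Matrix (Fin n) (Fin n) A) := Matrix.cstarAlgebra
  obtain ⟨w, hw⟩ := exists_norm_aut_sub_conj_lt hα (isCompact_singleton (x := x))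
  have h1 : Joined (w * x * w⁻¹) (UMat.aut α x) :=
    UMat.joined_of_norm_sub_lt ((hw x rfl).trans (by norm_num))
  refine ⟨n + n, Nat.le_add_right n n, ?_⟩
  have h2 := h1.map (continuous_stab (B := A) (Fin.castLEEmb (Nat.le_add_right n n)))
  rw [UMat.aut_stab]
  refine Joined.trans ?_ h2
  have h3 := (joined_stab_mul_stab_inv w).symm.map (f := fun y => y *
    stab (Fin.castLEEmb (Nat.le_add_right n n)) x * y⁻¹) (by fun_prop)
  rw [one_mul, inv_one, mul_one, ← stab_conj] at h3
  exact h3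

/-- If `α` is approximately inner, a loop which represents zero in `K₁(M_α)` is contractible. -/
theorem isStablyNull_of_mk_eq_zero (hα : α ∈ approxInn A) {u : UMat (MappingTorus α) n}
    (h0 : UMat.ev α 0 u = 1) (hu : K1.mk u = 0) : IsStablyNull fun t => UMat.ev α t u := by
  rw [← K1.mk_one (n := n)] at hu
  obtain ⟨k, hn, _, ⟨γ⟩⟩ := (K1.mk_eq_iff _ _).1 hu
  let G : I → I → UMat A k := fun s t => UMat.ev α t (γ s)
  have hG : Continuous fun z : I × I => G z.1 z.2 :=
    (UMat.continuous_ev α).comp (γ.continuous.prodMap continuous_id)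
  have hGc : ∀ {f g : I × I → I}, Continuous f → Continuous g → Continuous fun z => G (f z) (g z) :=
    fun hf hg => hG.comp (hf.prodMk hg)
  have hc : Continuous fun s => G s 0 := hG.comp (continuous_id.prodMk continuous_const)
  have G0 : ∀ t, G 0 t = stab (Fin.castLEEmb hn) (UMat.ev α t u) := by
    intro t
    simp only [G, γ.source, UMat.ev_stab]
  have G1 : ∀ t, G 1 t = 1 := by
    intro t
    simp only [G, γ.target, map_one]
  have Ge : ∀ s, G s 1 = UMat.aut α (G s 0) := fun s => UMat.ev_one α _
  have G00 : G 0 0 = 1 := by rw [G0, h0, map_one]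
  -- the values at `0` of the homotopy form the loop `c`
  have hm := isStablyNull_aut_mul_inv hα hc G00 (G1 0)
  have ha := UMat.continuous_aut α (n := k)
  have key : IsNullLoop fun t => G 0 t * (UMat.aut α (G t 0) * (G t 0)⁻¹) := by
    refine ⟨fun s t => G s t * (G s 0)⁻¹ * (UMat.aut α (G (s * t) 0) * (G (s * t) 0)⁻¹)⁻¹ *
      (UMat.aut α (G t 0) * (G t 0)⁻¹), ?_, fun t => ?_, fun t => ?_, fun s => ⟨?_, ?_⟩⟩
    · have c1 := hGc (f := fun z => z.1) (g := fun z => z.2) (by fun_prop) (by fun_prop)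
      have c2 := hGc (f := fun z => z.1) (g := fun _ => 0) (by fun_prop) (by fun_prop)
      have c3 := hGc (f := fun z => z.1 * z.2) (g := fun _ => 0) (by fun_prop) (by fun_prop)
      have c4 := hGc (f := fun z => z.2) (g := fun _ => 0) (by fun_prop) (by fun_prop)
      exact ((c1.mul c2.inv).mul ((ha.comp c3).mul c3.inv).inv).mul ((ha.comp c4).mul c4.inv)
    · simp [G00]
    · simp [G1]
    · simp [G00]
    · beta_reduce
      rw [Ge, mul_one, G1]
      simp
  refine IsStablyNull.of_stab (hnm := hn) ?_
  convert key.isStablyNull.mul hm.inv using 2 with t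
  rw [G0]
  group

end ApproximatelyInner

/-! ### The extension given by the mapping torus -/

section TorusExtension

open unitInterval

variable {A : Type u} [CStarAlgebra A] {α : A ≃⋆ₐ[ℂ] A} {n m : ℕ}

theorem TracialState.apply_approxInn (hα : α ∈ approxInn A) (τ : TracialState A) (a : A) :
    (τ : WeakDual ℂ A) (α a) = (τ : WeakDual ℂ A) a := by
  have hcl : IsClosed {x : A | (τ : WeakDual ℂ A) x = (τ : WeakDual ℂ A) a} :=
    isClosed_eq (map_continuous (τ : WeakDual ℂ A)) continuous_const
  have hmem : α a ∈ closure {x : A | (τ : WeakDual ℂ A) x = (τ : WeakDual ℂ A) a} := by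
    refine Metric.mem_closure_iff.2 fun ε hε => ?_
    obtain ⟨u, hu⟩ := hα {a} ε hε
    refine ⟨u * a * star (u : A), ?_, ?_⟩
    · change (τ : WeakDual ℂ A) (u * a * star (u : A)) = (τ : WeakDual ℂ A) a
      rw [τ.2.2.2, ← mul_assoc, (Unitary.mem_iff.1 u.2).1, one_mul]
    · rw [dist_eq_norm]
      exact hu a (Finset.mem_singleton_self a)
  rwa [hcl.closure_eq] at hmem

theorem torusQ_mk (u : UMat (MappingTorus α) n) :
    torusQ α (K1.mk u) = K1.mk (UMat.ev α 0 u) := rfl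

theorem UMat.ev_loopU (p : Matrix (Fin n) (Fin n) A) (hp : IsStarProjection p) (t : I) :
    UMat.ev α t (loopU α p hp) = UMat.ev 1 t (loopU 1 p hp) :=
  Subtype.ext ((loopMat_eval α p t).trans (loopMat_eval 1 p t).symm)

theorem UMat.ev_zero_loopU (p : Matrix (Fin n) (Fin n) A) (hp : IsStarProjection p) :
    UMat.ev α 0 (loopU α p hp) = 1 := by
  refine Subtype.ext ((loopMat_eval α p 0).trans ?_)
  simp

/-- The Bott class of `x ∈ K₀(A)` is represented, in all mapping tori, by the same loop. -/
theorem exists_loop_torusι (x : K0 A) : ∃ (m : ℕ) (L : I → UMat A m), L 0 = 1 ∧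
    ∀ α : A ≃⋆ₐ[ℂ] A, ∃ u : UMat (MappingTorus α) m, K1.mk u = torusι α x ∧
      ∀ t, UMat.ev α t u = L t := by
  obtain ⟨p, q, rfl⟩ := K0.exists_eq_sub x
  refine ⟨p.n + q.n, fun t => stab (Fin.castAddEmb q.n) (UMat.ev 1 t (loopU 1 p.p p.isProj)) *
    (stab (Fin.natAddEmb p.n) (UMat.ev 1 t (loopU 1 q.p q.isProj)))⁻¹, ?_, fun α => ?_⟩
  · simp only [UMat.ev_zero_loopU, map_one, inv_one, mul_one]
  · refine ⟨stab (Fin.castAddEmb q.n) (loopU α p.p p.isProj) *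
      (stab (Fin.natAddEmb p.n) (loopU α q.p q.isProj))⁻¹, ?_, fun t => ?_⟩
    · rw [map_sub, torusι_mk, torusι_mk, eq_sub_iff_add_eq, ← K1.mk_stab (Fin.natAddEmb p.n)
        (loopU α q.p q.isProj), ← K1.mk_mul, inv_mul_cancel_right, K1.mk_stab]
    · rw [map_mul, map_inv, UMat.ev_stab, UMat.ev_stab, UMat.ev_loopU (α := α) p.p,
        UMat.ev_loopU (α := α) q.p]

theorem torusQ_torusι (x : K0 A) : torusQ α (torusι α x) = 0 := by
  obtain ⟨m, L, hL0, hL⟩ := exists_loop_torusι x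
  obtain ⟨u, hu, hut⟩ := hL α
  rw [← hu, torusQ_mk, hut, hL0, K1.mk_one]

/-- A Bott loop which is trivial in `K₁(M_α)` is contractible, hence also trivial in
`K₁(C(S¹, A))`. -/
theorem torusι_injective (hα : α ∈ approxInn A) : Function.Injective (torusι α) := by
  rw [injective_iff_map_eq_zero]
  intro x hx
  obtain ⟨m, L, hL0, hL⟩ := exists_loop_torusι x
  obtain ⟨u, hu, hut⟩ := hL α
  obtain ⟨v, hv, hvt⟩ := hL 1
  have h1 := isStablyNull_of_mk_eq_zero hα ((hut 0).trans hL0) (hu.trans hx)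
  refine torusι_one_injective ?_
  rw [map_zero, ← hv]
  refine IsStablyNull.mk_eq_zero ?_
  simpa only [hut, hvt] using h1

theorem exists_torusι_one_eq {x : K1 (MappingTorus (1 : A ≃⋆ₐ[ℂ] A))} (hx : torusQ 1 x = 0) :
    ∃ y, torusι 1 y = x := by
  obtain ⟨y, c, rfl⟩ := exists_torusι_add_const x
  have hc : torusQ 1 (K1.map (torusConst A) (continuous_torusConst A) c) = c := by
    induction c using K1.ind with
    | h n u => rfl
  rw [map_add, torusQ_torusι, zero_add, hc] at hx
  exact ⟨y, by rw [hx, map_zero, add_zero]⟩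

theorem exists_torusι_eq {x : K1 (MappingTorus α)} (hx : torusQ α x = 0) :
    ∃ y, torusι α y = x := by
  induction x using K1.ind with
  | h n u =>
    obtain ⟨k, _, u', hu', h0⟩ := UMat.exists_rep (x := (1 : UMat A n)) (u := u)
      (by rw [K1.mk_one, hx])
    rw [map_one] at h0
    have hc : Continuous fun t => UMat.ev α t u' :=
      (UMat.continuous_ev α).comp (continuous_const.prodMk continuous_id)
    have h1 : UMat.ev α 1 u' = 1 := by rw [UMat.ev_one, h0, map_one]
    -- the same loop over the untwisted mapping torus
    let v : UMat (MappingTorus (1 : A ≃⋆ₐ[ℂ] A)) k := UMat.ofPath 1 ⟨_, hc⟩ (by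
      change UMat.aut 1 (UMat.ev α 0 u') = UMat.ev α 1 u'
      rw [h0, h1, map_one])
    have hv : ∀ t, UMat.ev 1 t v = UMat.ev α t u' := fun t => rfl
    obtain ⟨y, hy⟩ := exists_torusι_one_eq (x := K1.mk v) (by
      rw [torusQ_mk, hv, h0, K1.mk_one])
    obtain ⟨m, L, hL0, hL⟩ := exists_loop_torusι y
    obtain ⟨a, ha, hat⟩ := hL α
    obtain ⟨b, hb, hbt⟩ := hL 1
    have key : ∀ {γ : A ≃⋆ₐ[ℂ] A} (r : UMat (MappingTorus γ) k) (s : UMat (MappingTorus γ) m),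
        K1.mk (stab (Fin.castAddEmb m) r * (stab (Fin.natAddEmb k) s)⁻¹) =
          K1.mk r - K1.mk s := by
      intro γ r s
      rw [eq_sub_iff_add_eq, ← K1.mk_stab (Fin.natAddEmb k) s, ← K1.mk_mul, inv_mul_cancel_right,
        K1.mk_stab]
    have hn := isStablyNull_of_mk_eq_zero (one_mem (approxInn A))
      (u := stab (Fin.castAddEmb m) v * (stab (Fin.natAddEmb k) b)⁻¹)
      (by simp only [map_mul, map_inv, UMat.ev_stab, hv, hbt, h0, hL0, map_one, inv_one, mul_one])
      (by rw [key, hb, hy, sub_self])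
    have hz : K1.mk (stab (Fin.castAddEmb m) u' * (stab (Fin.natAddEmb k) a)⁻¹) = 0 := by
      refine IsStablyNull.mk_eq_zero ?_
      simpa only [map_mul, map_inv, UMat.ev_stab, hv, hbt, hat] using hn
    rw [key, ha, sub_eq_zero, hu'] at hz
    exact ⟨y, hz.symm⟩

/-- A homotopy from a unitary `x` to `α(x)` is a unitary over the mapping torus. -/
theorem torusQ_surjective (hα : α ∈ approxInn A) : Function.Surjective (torusQ α) := by
  intro c
  induction c using K1.ind with
  | h n x =>
    obtain ⟨k, hk, ⟨γ⟩⟩ := exists_joined_aut hα x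
    refine ⟨K1.mk (UMat.ofPath α γ.toContinuousMap ?_), ?_⟩
    · exact (congrArg _ γ.source).trans γ.target.symm
    · rw [torusQ_mk, UMat.ev_ofPath, ← K1.mk_stab (Fin.castLEEmb hk) x]
      exact congrArg K1.mk γ.source

/-- The extension of `K₁(A)` by `K₀(A)` given by the mapping torus. -/
theorem isOrderExt_of_isRotationMap (hα : α ∈ approxInn A) {R : K1 (MappingTorus α) →+ AffT A}
    (hR : IsRotationMap α R) : IsOrderExt (dimensionMap A) (torusι α) (torusQ α) R where
  injective := torusι_injective hα
  exact x := ⟨exists_torusι_eq, by rintro ⟨a, rfl⟩; exact torusQ_torusι a⟩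
  surjective := torusQ_surjective hα
  comp := hR.apply_torusι

end TorusExtension

/-! ### Composition of twisted paths -/

section Glue

open unitInterval

variable {A : Type u} [CStarAlgebra A] {α β : A ≃⋆ₐ[ℂ] A} {n m : ℕ}

/-- The unitary `w` over `M_{αβ}` is composed of the unitaries `v` over `M_β` and `u` over `M_α`
with the same value `x` at `0`: as a path from `x` to `α(β(x))`, it is homotopic to the path `u`
from `x` to `α(x)`, followed by the path `α(v)` from `α(x)` to `α(β(x))`. The pointwise product
avoids the reparametrization. -/
def IsGlued (v : UMat (MappingTorus β) n) (u : UMat (MappingTorus α) n)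
    (w : UMat (MappingTorus (α * β)) n) : Prop :=
  UMat.ev β 0 v = UMat.ev α 0 u ∧ ∀ t, UMat.ev (α * β) t w =
    UMat.aut α (UMat.ev β t v * (UMat.ev β 0 v)⁻¹) * UMat.ev α t u

theorem UMat.aut_mul (x : UMat A n) : UMat.aut (α * β) x = UMat.aut α (UMat.aut β x) := rfl

theorem exists_isGlued {v : UMat (MappingTorus β) n} {u : UMat (MappingTorus α) n}
    (h : UMat.ev β 0 v = UMat.ev α 0 u) : ∃ w, IsGlued v u w := by
  have hu : Continuous fun t => UMat.ev α t u :=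
    (UMat.continuous_ev α).comp (continuous_const.prodMk continuous_id)
  have hv : Continuous fun t => UMat.ev β t v :=
    (UMat.continuous_ev β).comp (continuous_const.prodMk continuous_id)
  refine ⟨UMat.ofPath (α * β) ⟨fun t => UMat.aut α (UMat.ev β t v * (UMat.ev β 0 v)⁻¹) *
    UMat.ev α t u, ((UMat.continuous_aut α).comp (hv.mul continuous_const)).mul hu⟩ ?_, h,
    fun t => rfl⟩
  change UMat.aut (α * β) (UMat.aut α (UMat.ev β 0 v * (UMat.ev β 0 v)⁻¹) * UMat.ev α 0 u) =
    UMat.aut α (UMat.ev β 1 v * (UMat.ev β 0 v)⁻¹) * UMat.ev α 1 u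
  rw [mul_inv_cancel, map_one, one_mul, UMat.ev_one, UMat.ev_one, UMat.aut_mul, ← h, ← map_mul,
    inv_mul_cancel_right]

theorem IsGlued.stab {v : UMat (MappingTorus β) n} {u : UMat (MappingTorus α) n}
    {w : UMat (MappingTorus (α * β)) n} (h : IsGlued v u w) (f : Fin n ↪ Fin m) :
    IsGlued (stab f v) (stab f u) (stab f w) := by
  refine ⟨?_, fun t => ?_⟩
  · rw [UMat.ev_stab, UMat.ev_stab, h.1]
  · rw [UMat.ev_stab, UMat.ev_stab, UMat.ev_stab, UMat.ev_stab, h.2, map_mul, ← UMat.aut_stab,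
      map_mul, map_inv]

theorem IsGlued.mul {v v' : UMat (MappingTorus β) n} {u u' : UMat (MappingTorus α) n}
    {w w' : UMat (MappingTorus (α * β)) n} (h : IsGlued v u w) (h' : IsGlued v' u' w')
    (h1 : ∀ t, Commute (UMat.ev β t v') (UMat.ev β 0 v))
    (h2 : ∀ t, Commute (UMat.aut α (UMat.ev β t v')) (UMat.ev α t u))
    (h3 : ∀ t, Commute (UMat.aut α (UMat.ev β 0 v')) (UMat.ev α t u)) :
    IsGlued (v * v') (u * u') (w * w') := by
  refine ⟨by rw [map_mul, map_mul, h.1, h'.1], fun t => ?_⟩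
  rw [map_mul (UMat.ev (α * β) t), h.2, h'.2, map_mul (UMat.ev β t), map_mul (UMat.ev β 0),
    map_mul (UMat.ev α t)]
  have e1 : UMat.ev β t v * UMat.ev β t v' * (UMat.ev β 0 v * UMat.ev β 0 v')⁻¹ =
      UMat.ev β t v * (UMat.ev β 0 v)⁻¹ * (UMat.ev β t v' * (UMat.ev β 0 v')⁻¹) := by
    have c1 := (h1 t).inv_right.eq
    have c2 := (h1 0).inv_inv.eq
    rw [mul_inv_rev, c2, mul_assoc, ← mul_assoc (UMat.ev β t v'), c1]
    simp only [mul_assoc]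
  have c3 : Commute (UMat.aut α (UMat.ev β t v' * (UMat.ev β 0 v')⁻¹)) (UMat.ev α t u) := by
    rw [map_mul, map_inv]
    exact (h2 t).mul_left (h3 t).inv_left
  rw [e1, map_mul (UMat.aut α) (_ * _), mul_assoc, mul_assoc, ← mul_assoc (UMat.ev α t u),
    ← c3.eq]
  simp only [mul_assoc]

theorem castAddEmb_ne_natAddEmb (i : Fin n) (j : Fin m) :
    Fin.castAddEmb m i ≠ Fin.natAddEmb n j := by
  intro h
  have h1 := congrArg Fin.val h
  have := i.2
  simp only [Fin.natAddEmb_apply, Fin.val_natAdd, Fin.castAddEmb_apply, Fin.val_castAdd] at h1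
  omega

theorem IsGlued.add {v : UMat (MappingTorus β) n} {u : UMat (MappingTorus α) n}
    {w : UMat (MappingTorus (α * β)) n} (h : IsGlued v u w) {v' : UMat (MappingTorus β) m}
    {u' : UMat (MappingTorus α) m} {w' : UMat (MappingTorus (α * β)) m} (h' : IsGlued v' u' w') :
    IsGlued (_root_.stab (Fin.castAddEmb m) v * _root_.stab (Fin.natAddEmb n) v')
      (_root_.stab (Fin.castAddEmb m) u * _root_.stab (Fin.natAddEmb n) u')
      (_root_.stab (Fin.castAddEmb m) w * _root_.stab (Fin.natAddEmb n) w') := by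
  refine (h.stab _).mul (h'.stab _) (fun t => ?_) (fun t => ?_) fun t => ?_ <;>
    simp only [UMat.ev_stab, UMat.aut_stab] <;>
    exact (stab_comm_of_disjoint _ _ castAddEmb_ne_natAddEmb _ _).symm

theorem K1.exists_joined_one {B : Type u} [Ring B] [StarRing B] [TopologicalSpace B]
    [IsTopologicalRing B] [ContinuousStar B] {u : UMat B n} (h : K1.mk u = 0) :
    ∃ k, ∀ m, k ≤ m → ∃ h : n ≤ m, Joined (stab (Fin.castLEEmb h) u) 1 := by
  rw [← K1.mk_one (n := n)] at h
  obtain ⟨k, hn, _, hj⟩ := (K1.mk_eq_iff _ _).1 h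
  refine ⟨k, fun m hm => ⟨hn.trans hm, ?_⟩⟩
  have := hj.map (continuous_stab (B := B) (Fin.castLEEmb hm))
  rw [stab_trans, map_one, map_one] at this
  exact this

/-- A unitary composed of unitaries with trivial classes has a trivial class. The homotopies of
`v` and `u` to `1` have different values at `0`; their quotient is a loop `D`, which `β` does not
change up to homotopy. -/
theorem IsGlued.mk_eq_zero (hβ : β ∈ approxInn A) {v : UMat (MappingTorus β) n}
    {u : UMat (MappingTorus α) n} {w : UMat (MappingTorus (α * β)) n} (h : IsGlued v u w)
    (hv : K1.mk v = 0) (hu : K1.mk u = 0) : K1.mk w = 0 := by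
  obtain ⟨k, hk⟩ := K1.exists_joined_one hv
  obtain ⟨k', hk'⟩ := K1.exists_joined_one hu
  obtain ⟨h1, ⟨γ⟩⟩ := hk _ (le_max_left k k')
  obtain ⟨h2, ⟨δ⟩⟩ := hk' _ (le_max_right k k')
  obtain ⟨hs0, hs⟩ := h.stab (Fin.castLEEmb h1)
  let V : I → I → UMat A (max k k') := fun s t => UMat.ev β t (γ s)
  let U : I → I → UMat A (max k k') := fun s t => UMat.ev α t (δ s)
  have hVc : ∀ {f g : I × I → I}, Continuous f → Continuous g → Continuous fun z => V (f z) (g z) :=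
    fun hf hg => (UMat.continuous_ev β).comp ((γ.continuous.comp hf).prodMk hg)
  have hUc : ∀ {f g : I × I → I}, Continuous f → Continuous g → Continuous fun z => U (f z) (g z) :=
    fun hf hg => (UMat.continuous_ev α).comp ((δ.continuous.comp hf).prodMk hg)
  have V0 : ∀ t, V 0 t = UMat.ev β t (_root_.stab (Fin.castLEEmb h1) v) := fun t => by
    simp only [V, γ.source]
  have U0 : ∀ t, U 0 t = UMat.ev α t (_root_.stab (Fin.castLEEmb h1) u) := fun t => by
    simp only [U, δ.source]
  have V1 : ∀ t, V 1 t = 1 := fun t => by simp only [V, γ.target, map_one]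
  have U1 : ∀ t, U 1 t = 1 := fun t => by simp only [U, δ.target, map_one]
  have Ve : ∀ s, V s 1 = UMat.aut β (V s 0) := fun s => UMat.ev_one β _
  have Ue : ∀ s, U s 1 = UMat.aut α (U s 0) := fun s => UMat.ev_one α _
  let D : I → UMat A (max k k') := fun s => (U s 0)⁻¹ * V s 0
  have hDc : Continuous D := by
    have c1 : Continuous fun s => U s 0 :=
      (UMat.continuous_ev α).comp (δ.continuous.prodMk continuous_const)
    have c2 : Continuous fun s => V s 0 :=
      (UMat.continuous_ev β).comp (γ.continuous.prodMk continuous_const)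
    exact c1.inv.mul c2
  have D0 : D 0 = 1 := by
    simp only [D]
    rw [U0, V0, hs0, inv_mul_cancel]
  have D1 : D 1 = 1 := by
    simp only [D]
    rw [U1, V1, inv_one, one_mul]
  have hb := UMat.continuous_aut β (n := max k k')
  have ha := UMat.continuous_aut α (n := max k k')
  let M : I → UMat A (max k k') := fun s => (UMat.aut α (UMat.aut β (D s) * (D s)⁻¹))⁻¹
  have hMc : Continuous M := (ha.comp ((hb.comp hDc).mul hDc.inv)).inv
  have hM : IsStablyNull M := (isStablyNull_aut_mul_inv hβ hDc D0 D1).aut.inv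
  have M0 : M 0 = 1 := by simp [M, D0]
  have M1 : M 1 = 1 := by simp [M, D1]
  let w' : UMat (MappingTorus (α * β)) (max k k') := UMat.ofPath (α * β) ⟨M, hMc⟩ (by
    change UMat.aut (α * β) (M 0) = M 1
    rw [M0, M1, map_one])
  have hj : Joined (_root_.stab (Fin.castLEEmb h1) w) w' := by
    refine UMat.joined_of_homotopy (K := fun s t =>
      UMat.aut α (V s t * (V s 0)⁻¹) * U s t * M (s * t)) ?_ (fun s => ?_) (fun t => ?_)
      fun t => ?_
    · have c1 := hVc (f := fun z => z.1) (g := fun z => z.2) (by fun_prop) (by fun_prop)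
      have c2 := hVc (f := fun z => z.1) (g := fun _ => 0) (by fun_prop) (by fun_prop)
      have c3 := hUc (f := fun z => z.1) (g := fun z => z.2) (by fun_prop) (by fun_prop)
      exact ((ha.comp (c1.mul c2.inv)).mul c3).mul (hMc.comp (by fun_prop))
    · rw [mul_zero, mul_one, M0, mul_one, mul_inv_cancel, map_one, one_mul, Ve, Ue, UMat.aut_mul]
      simp only [M, D, map_mul, map_inv]
      group
    · rw [hs, ← V0, ← V0, ← U0, zero_mul, M0, mul_one]
    · simp only [V1, U1, one_mul, inv_one, map_one]
      rfl
  rw [← K1.mk_stab (Fin.castLEEmb h1) w, K1.mk_eq_of_joined hj]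
  exact IsStablyNull.mk_eq_zero hM

end Glue

/-! ### The rotation map of a composite -/

section RotationOfGlued

open unitInterval

variable {A : Type u} [CStarAlgebra A] {α β : A ≃⋆ₐ[ℂ] A} {n : ℕ}

/-- The path `w` is the product of `α(v)`, a constant and `u`, and `τ` is invariant under `α`. -/
theorem rotSum_isGlued (hα : α ∈ approxInn A) {v : UMat (MappingTorus β) n}
    {u : UMat (MappingTorus α) n} {w : UMat (MappingTorus (α * β)) n} (h : IsGlued v u w)
    (τ : TracialState A) {N : ℕ} (hv : TorusFine β N v) (hu : TorusFine α N u) :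
    (τ : WeakDual ℂ A) (rotSum (α * β) N w) =
      (τ : WeakDual ℂ A) (rotSum α N u) + (τ : WeakDual ℂ A) (rotSum β N v) := by
  let _ : CStarAlgebra (Matrix (Fin n) (Fin n) A) := Matrix.cstarAlgebra
  have h0 : (0 : ℝ) < N := Nat.cast_pos.2 hv.pos
  let φ := traceCLM (Fin n) (τ : WeakDual ℂ A)
  let P : ℝ → Matrix (Fin n) (Fin n) A := fun t => (torusPath β v t).map α
  let C : ℝ → Matrix (Fin n) (Fin n) A := fun _ => (UMat.aut α (UMat.ev β 0 v)⁻¹).1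
  have hP : ∀ t, P t ∈ unitary (Matrix (Fin n) (Fin n) A) := fun t =>
    (UMat.aut α (UMat.ev β (Set.projIcc (0 : ℝ) 1 zero_le_one t) v)).2
  have hC : ∀ t, C t ∈ unitary (Matrix (Fin n) (Fin n) A) := fun _ =>
    (UMat.aut α (UMat.ev β 0 v)⁻¹).2
  have hw : torusPath (α * β) w = fun t => P t * C t * torusPath α u t := by
    funext t
    refine (congrArg Subtype.val (h.2 (Set.projIcc (0 : ℝ) 1 zero_le_one t))).trans ?_
    rw [map_mul]
    rfl
  have fP : IsFine N P := ⟨hv.pos, fun s t hst => by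
    have e : P s - P t = (torusPath β v s - torusPath β v t).map α :=
      (Matrix.map_sub _ (map_sub α) _ _).symm
    rw [e]
    exact (norm_map_aut_le α _).trans (hv.2 s t hst)⟩
  have fC : IsFine N C := ⟨hv.pos, fun s t _ => by
    rw [sub_self, norm_zero]; norm_num⟩
  have fPC : IsFine N fun t => P t * C t := ⟨hv.pos, fun s t hst => by
    have e : P s * C s - P t * C t = (P s - P t) * C s := (sub_mul _ _ _).symm
    rw [e, CStarRing.norm_mul_mem_unitary _ (hC s)]
    exact fP.2 s t hst⟩
  have c0 : φ (logSum N C) = 0 := by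
    rw [map_logSum]
    refine Finset.sum_eq_zero fun k _ => ?_
    exact logStep_self φ hC ((k : ℝ) / N)
  have cP : φ (logSum N P) = φ (logSum N (torusPath β v)) := by
    rw [logSum, logSum, map_sum, map_sum]
    refine Finset.sum_congr rfl fun k _ => ?_
    have hst : |(k : ℝ) / N - (k + 1) / N| ≤ 1 / N := by
      rw [← sub_div, sub_add_cancel_left, neg_div, abs_neg, abs_of_nonneg (by positivity)]
    have e : star (P (k / N)) * P ((k + 1) / N) - 1 =
        (star (torusPath β v (k / N)) * torusPath β v ((k + 1) / N) - 1).map α := by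
      rw [Matrix.map_sub _ (map_sub α), Matrix.map_mul, Matrix.map_one _ (map_zero α) (map_one α)]
      congr 2
      ext i j
      exact (map_star α _).symm
    have h1 : ‖star (torusPath β v (k / N)) * torusPath β v ((k + 1) / N) - 1‖ < 1 := by
      rw [norm_star_mul_sub_one (torusPath_mem β v _)]
      exact (hv.2 _ _ hst).trans_lt (by norm_num)
    rw [e]
    exact trace_logSeries_map α τ (τ.apply_approxInn hα) _ h1 ((norm_map_aut_le α _).trans_lt h1)
  rw [apply_rotSum, apply_rotSum, apply_rotSum, hw]
  have e1 := map_logSum_mul_path φ (traceCLM_comm τ) (fun t => mul_mem (hP t) (hC t))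
    (torusPath_mem α u) fPC hu
  have e2 := map_logSum_mul_path φ (traceCLM_comm τ) hP hC fP fC
  refine e1.trans ?_
  rw [e2, c0, cP, add_zero, add_comm]

theorem IsRotationMap.apply_isGlued (hα : α ∈ approxInn A) (hβ : β ∈ approxInn A)
    {Rα : K1 (MappingTorus α) →+ AffT A} {Rβ : K1 (MappingTorus β) →+ AffT A}
    {R : K1 (MappingTorus (α * β)) →+ AffT A} (hRα : IsRotationMap α Rα)
    (hRβ : IsRotationMap β Rβ) (hR : IsRotationMap (α * β) R) {v : UMat (MappingTorus β) n}
    {u : UMat (MappingTorus α) n} {w : UMat (MappingTorus (α * β)) n} (h : IsGlued v u w) :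
    R (K1.mk w) = Rα (K1.mk u) + Rβ (K1.mk v) := by
  obtain ⟨Sα, hSα, kα⟩ := exists_isRotationMap (α := α) fun τ => τ.apply_approxInn hα
  obtain ⟨Sβ, hSβ, kβ⟩ := exists_isRotationMap (α := β) fun τ => τ.apply_approxInn hβ
  obtain ⟨S, hS, k⟩ := exists_isRotationMap (α := α * β) fun τ => τ.apply_approxInn
    (mul_mem hα hβ)
  rw [hRα.unique hSα, hRβ.unique hSβ, hR.unique hS]
  obtain ⟨N₁, h1⟩ := exists_torusFine α u
  obtain ⟨N₂, h2⟩ := exists_torusFine β v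
  obtain ⟨N₃, h3⟩ := exists_torusFine (α * β) w
  have f1 : TorusFine α (N₁ * (N₂ * N₃)) u := h1.mul (Nat.mul_pos h2.pos h3.pos)
  have f2 : TorusFine β (N₁ * (N₂ * N₃)) v := by
    rw [mul_left_comm]
    exact h2.mul (Nat.mul_pos h1.pos h3.pos)
  have f3 : TorusFine (α * β) (N₁ * (N₂ * N₃)) w := by
    rw [← mul_assoc, mul_comm]
    exact h3.mul (Nat.mul_pos h1.pos h2.pos)
  refine Subtype.ext (ContinuousMap.ext fun τ => Complex.ofReal_injective ?_)
  refine (k _ _ τ _ f3).trans ?_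
  rw [rotSum_isGlued hα h τ f2 f1, mul_add, ← kα _ _ τ _ f1, ← kβ _ _ τ _ f2, ← Complex.ofReal_add]
  rfl

end RotationOfGlued

/-! ### The sum of two extensions -/

section SumOfTori

open unitInterval

variable {A : Type u} [CStarAlgebra A] {α β : A ≃⋆ₐ[ℂ] A}

variable (α) in
/-- The classes `([v], [u], [w])` of unitaries such that `w` is composed of `v` and `u`. -/
def gluedTriples (hβ : β ∈ approxInn A) : AddSubgroup
    (K1 (MappingTorus β) × K1 (MappingTorus α) × K1 (MappingTorus (α * β))) where
  carrier := {z | ∃ (n : ℕ) (v : UMat (MappingTorus β) n) (u : UMat (MappingTorus α) n)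
    (w : UMat (MappingTorus (α * β)) n), IsGlued v u w ∧ z = (K1.mk v, K1.mk u, K1.mk w)}
  zero_mem' := ⟨0, 1, 1, 1, ⟨by simp, by simp⟩, by simp only [K1.mk_one]; rfl⟩
  add_mem' := by
    rintro _ _ ⟨n, v, u, w, h, rfl⟩ ⟨n', v', u', w', h', rfl⟩
    refine ⟨_, _, _, _, h.add h', ?_⟩
    simp only [K1.mk_mul, K1.mk_stab]
    rfl
  neg_mem' := by
    rintro _ ⟨n, v, u, w, h, rfl⟩
    obtain ⟨w', h'⟩ := exists_isGlued (v := v⁻¹) (u := u⁻¹) (by rw [map_inv, map_inv, h.1])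
    have hinv : ∀ {γ : A ≃⋆ₐ[ℂ] A} (x : UMat (MappingTorus γ) n), K1.mk x⁻¹ = -K1.mk x := by
      intro γ x
      rw [eq_neg_iff_add_eq_zero, ← K1.mk_mul, inv_mul_cancel, K1.mk_one]
    have h0 := (h.add h').mk_eq_zero hβ (by simp only [K1.mk_mul, K1.mk_stab, hinv, add_neg_cancel])
      (by simp only [K1.mk_mul, K1.mk_stab, hinv, add_neg_cancel])
    simp only [K1.mk_mul, K1.mk_stab] at h0
    refine ⟨n, v⁻¹, u⁻¹, w', h', ?_⟩
    rw [hinv, hinv, ← neg_eq_of_add_eq_zero_right h0]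
    rfl

/-- Gluing a loop `L` to the constant path gives `α(L)`, which is homotopic to `L`. -/
theorem mem_gluedTriples_left (hβ : β ∈ approxInn A) (hα : α ∈ approxInn A) (x : K0 A) :
    (torusι β x, 0, torusι (α * β) x) ∈ gluedTriples α hβ := by
  obtain ⟨m, L, hL0, hL⟩ := exists_loop_torusι x
  obtain ⟨v, hv, hvt⟩ := hL β
  obtain ⟨w, hw, hwt⟩ := hL (α * β)
  obtain ⟨w', h⟩ := exists_isGlued (v := v) (u := (1 : UMat (MappingTorus α) m))
    (by rw [hvt, hL0, map_one])
  refine ⟨m, v, 1, w', h, ?_⟩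
  have hLc : Continuous L := by
    have := (UMat.continuous_ev β).comp (continuous_const.prodMk continuous_id :
      Continuous fun t : I => (v, t))
    exact this.congr hvt
  have hL1 : L 1 = 1 := by rw [← hvt, UMat.ev_one, hvt, hL0, map_one]
  -- `α(L)` and `L` have the same class
  have h0 : K1.mk (w' * w⁻¹) = 0 := by
    refine IsStablyNull.mk_eq_zero ?_
    convert isStablyNull_aut_mul_inv hα hLc hL0 hL1 using 2 with t
    rw [map_mul, map_inv, h.2, hwt, hvt, hvt, hL0, inv_one, mul_one, map_one, mul_one]
  have h1 : K1.mk w' = K1.mk w := by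
    have e : w' = w' * w⁻¹ * w := (inv_mul_cancel_right _ _).symm
    rw [e, K1.mk_mul, h0, zero_add]
  rw [hv, K1.mk_one, h1, hw]

theorem mem_gluedTriples_right (hβ : β ∈ approxInn A) (x : K0 A) :
    (0, torusι α x, torusι (α * β) x) ∈ gluedTriples α hβ := by
  obtain ⟨m, L, hL0, hL⟩ := exists_loop_torusι x
  obtain ⟨u, hu, hut⟩ := hL α
  obtain ⟨w, hw, hwt⟩ := hL (α * β)
  refine ⟨m, 1, u, w, ⟨by rw [hut, hL0, map_one], fun t => ?_⟩, by rw [hu, hw, K1.mk_one]⟩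
  rw [hwt, hut, map_one, map_one, inv_one, mul_one, map_one, one_mul]

/-- The orderextension of `αβ` is the sum of those of `α` and `β`: both are quotients of the
group of triples `([v], [u], [w])` where `w` is composed of `v` and `u`. -/
theorem torusOrderExt_mul_iso (hα : α ∈ approxInn A) (hβ : β ∈ approxInn A)
    {Rα : K1 (MappingTorus α) →+ AffT A} {Rβ : K1 (MappingTorus β) →+ AffT A}
    {R : K1 (MappingTorus (α * β)) →+ AffT A} (hRα : IsRotationMap α Rα)
    (hRβ : IsRotationMap β Rβ) (hR : IsRotationMap (α * β) R) :
    OrderExt.Iso (OrderExt.sum (torusOrderExt α Rα (isOrderExt_of_isRotationMap hα hRα))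
      (torusOrderExt β Rβ (isOrderExt_of_isRotationMap hβ hRβ)))
      (torusOrderExt (α * β) R (isOrderExt_of_isRotationMap (mul_mem hα hβ) hR)) := by
  set X := torusOrderExt α Rα (isOrderExt_of_isRotationMap hα hRα) with hX
  set Y := torusOrderExt β Rβ (isOrderExt_of_isRotationMap hβ hRβ) with hY
  let F : gluedTriples α hβ →+ OrderExt.pullback X Y :=
    { toFun := fun z => ⟨(z.1.2.1, z.1.1), by
        obtain ⟨⟨_, _, _⟩, n, v, u, w, h, e⟩ := z
        cases e
        exact congrArg K1.mk h.1.symm⟩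
      map_zero' := rfl
      map_add' := fun _ _ => rfl }
  let g : gluedTriples α hβ →+ K1 (MappingTorus (α * β)) :=
    { toFun := fun z => z.1.2.2
      map_zero' := rfl
      map_add' := fun _ _ => rfl }
  have hF : Function.Surjective F := by
    rintro ⟨⟨b, a⟩, hab⟩
    change K1 (MappingTorus α) at b
    change K1 (MappingTorus β) at a
    induction b using K1.ind with
    | h n u =>
      induction a using K1.ind with
      | h m v =>
        obtain ⟨k, hk, u', hu', hu0⟩ := UMat.exists_rep (x := UMat.ev β 0 v) (u := u) hab.symm
        obtain ⟨w, hw⟩ := exists_isGlued (v := stab (Fin.castLEEmb hk) v) (u := u')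
          (by rw [hu0, UMat.ev_stab])
        refine ⟨⟨(K1.mk v, K1.mk u, K1.mk w), k, _, u', w, hw, ?_⟩, rfl⟩
        rw [K1.mk_stab, hu']
  refine OrderExt.iso_of_cover (X := OrderExt.sum X Y) (T := gluedTriples α hβ)
    ((OrderExt.pairHom X Y).comp F) g ((OrderExt.pairHom_surjective X Y).comp hF) ?_ ?_ ?_ ?_
  · rintro ⟨⟨a, b, c⟩, hz⟩ h0
    -- here `(a, b) = (-ι x, ι x)`; correcting by the two triples of `x` leaves `(0, 0, c)`
    obtain ⟨x, hx1, hx2⟩ := (OrderExt.pairHom_eq_zero X Y).1 h0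
    change torusι α x = b at hx1
    change -torusι β x = a at hx2
    have h1 := sub_mem (add_mem hz (mem_gluedTriples_left (α := α) hβ hα x))
      (mem_gluedTriples_right (α := α) hβ x)
    obtain ⟨n, v, u, w, h, e⟩ := h1
    have e1 : a + torusι β x - 0 = K1.mk v := congrArg (fun z => z.1) e
    have e2 : b + 0 - torusι α x = K1.mk u := congrArg (fun z => z.2.1) e
    have e3 : c + torusι (α * β) x - torusι (α * β) x = K1.mk w := congrArg (fun z => z.2.2) e
    change c = 0
    rw [add_sub_cancel_right] at e3
    rw [e3]
    refine h.mk_eq_zero hβ ?_ ?_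
    · rw [← e1, ← hx2, neg_add_cancel, sub_zero]
    · rw [← e2, hx1, add_zero, sub_self]
  · rintro ⟨⟨a, b, c⟩, n, v, u, w, h, e⟩
    cases e
    exact (IsRotationMap.apply_isGlued hα hβ hRα hRβ hR h).symm
  · intro x
    exact ⟨⟨_, mem_gluedTriples_right hβ x⟩, rfl, rfl⟩
  · rintro ⟨⟨a, b, c⟩, n, v, u, w, h, e⟩
    cases e
    change K1.mk (UMat.ev (α * β) 0 w) = K1.mk (UMat.ev α 0 u)
    rw [h.2, mul_inv_cancel, map_one, one_mul]

end SumOfTori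

theorem lemma2p3 {A : Type*} [CStarAlgebra A] [IsSimpleRing A] :
    (∀ α : approxInn A, ∃! R : K1 (MappingTorus (α : A ≃⋆ₐ[ℂ] A)) →+ AffT A,
      IsRotationMap (α : A ≃⋆ₐ[ℂ] A) R) ∧
    ∃ η : approxInn A →* Multiplicative (OExt (K1 A) (dimensionMap A)),
      ∀ (α : approxInn A) (R : K1 (MappingTorus (α : A ≃⋆ₐ[ℂ] A)) →+ AffT A),
        IsRotationMap (α : A ≃⋆ₐ[ℂ] A) R →
        ∃ h : IsOrderExt (dimensionMap A) (torusι (α : A ≃⋆ₐ[ℂ] A)) (torusQ (α : A ≃⋆ₐ[ℂ] A)) R,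
          η α = Multiplicative.ofAdd (OExt.mk (torusOrderExt (α : A ≃⋆ₐ[ℂ] A) R h)) := by
  have hex : ∀ α : approxInn A, ∃ R : K1 (MappingTorus (α : A ≃⋆ₐ[ℂ] A)) →+ AffT A,
      IsRotationMap (α : A ≃⋆ₐ[ℂ] A) R := fun α =>
    (exists_isRotationMap fun τ => τ.apply_approxInn α.2).imp fun _ h => h.1
  refine ⟨fun α => ?_, ?_⟩
  · obtain ⟨R, hR⟩ := hex α
    exact ⟨R, hR, fun R' hR' => hR'.unique hR⟩
  · choose R hR using hex
    refine ⟨MonoidHom.mk' (fun α => Multiplicative.ofAdd (OExt.mk (torusOrderExt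
      (α : A ≃⋆ₐ[ℂ] A) (R α) (isOrderExt_of_isRotationMap α.2 (hR α))))) fun α β => ?_,
      fun α R' hR' => ⟨isOrderExt_of_isRotationMap α.2 hR', ?_⟩⟩
    · exact congrArg Multiplicative.ofAdd
        (Quotient.sound (torusOrderExt_mul_iso α.2 β.2 (hR α) (hR β) (hR (α * β)))).symm
    · obtain rfl := hR'.unique (hR α)
      rfl
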